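/- Let $G$ be a connected simple graph on $\{0,\dots,n-1\}$, given by its adjacency matrix. A set $S$ is a \emph{robust MIS} of $G$ if it is a maximal independent set of every connected spanning subgraph of $G$. A subgraph is biconnected if it has at least three vertices, is connected, and stays connected after the removal of any single vertex; a biconnected component is a maximal biconnected subgraph. \textbf{The ABC-tree.} Its nodes are the pendant vertices ($\mathcal P$), the articulation points ($\mathcal A$), the bridges ($\mathcal B$) and the biconnected components ($\mathcal C$) of $G$; its edges join each $a\in\mathcal A$ to each $X\in\mathcal C$ containing $a$, and each $v\in\mathcal A\cup\mathcal P$ to each $Y\in\mathcal B$ containing $v$. Root it at some $R\in\mathcal C$. The attachment vertex $v(x)$ of $x\in\mathcal A\cup\mathcal P$ is $x$; that of a node $x\ne R$ in $\mathcal B\cup\mathcal C$ is the vertex underlying the parent of $x$. A labelling $L$ assigns to each node a subset of $\{PI,PO,PE\}$; a vertex of $G$ that is an articulation point carries the labels of its node, and other vertices carry none. \textbf{isSatisfiable}$(x,\mathit{flag})$, for $x\in\mathcal C$ and $\mathit{flag}\in\{\mathtt{in},\mathtt{out},\mathtt{none}\}$ (with $x\neq R$ unless $\mathit{flag}=\mathtt{none}$).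 Let $E^{PO}$ be the set of edges of $x$ both of whose endpoints carry $PO$, and let $X=x\setminus E^{PO}$. Return false if $X$ is not bipartite. Otherwise take one Boolean variable $x_i$ per connected component $X_i$ of $X$, give each vertex $v$ of $X_i$ a literal $\ell(v)\in\{x_i,\neg x_i\}$ such that neighbours in $X$ get different literals, and return whether the conjunction of the following clauses is satisfiable: $\ell(v)$ for each $v$ in $x$ whose label set is $\{PI\}$; $\neg\ell(v)$ for each $v$ in $x$ whose label set is $\{PO\}$ or $\{PE\}$; $\neg\ell(u)\vee\neg\ell(v)$ for each $\{u,v\}\in E^{PO}$; and $\ell(v(x))$ if $\mathit{flag}=\mathtt{in}$, $\neg\ell(v(x))$ if $\mathit{flag}=\mathtt{out}$. \textbf{The decision algorithm} labels all nodes $x\neq R$ bottom-up, as follows. \begin{itemize} \item $x\in\mathcal P$: $L(x)=\{PI,PE\}$. \item $x\in\mathcal A$: $L(x)$ contains $PI$ iff all children have $PI$. If every child has $PO$ or $PE$, it contains $PO$ when some child has $PO$, and $PE$ when none has. It contains nothing else. \item $x\in\mathcal B$ with child $c$: $PO\in L(x)$ iff $PI\in L(c)$; $PI\in L(x)$ iff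 $PE\in L(c)$ or $PO\in L(c)$; $PE\in L(x)$ iff $PO\in L(c)$ and $PI\notin L(c)$. \item $x\in\mathcal C$: $PI\in L(x)$ iff isSatisfiable$(x,\mathtt{in})$; $PO\in L(x)$ iff isSatisfiable$(x,\mathtt{out})$ (the parent of $x$ having no label in both calls); $PE\in L(x)$ iff $PO\notin L(x)$ and isSatisfiable$(x,\mathtt{out})$ holds when the parent of $x$ is temporarily labelled $\{PO\}$. \end{itemize} It rejects if some node other than $R$ gets no label; otherwise it accepts iff isSatisfiable$(R,\mathtt{none})$. \textbf{Lemma.} Time is counted on a unit-cost random access machine with words of $O(\log n)$ bits, and graphs, trees and membership relations are stored as matrices. \begin{enumerate} \item Some program builds the ABC-tree of every connected graph $G$ in $O(n^2)$ steps. \item Some program implements isSatisfiable: given $G$, its ABC-tree rooted at any $R\in\mathcal C$, any labelling $L$, and any admissible $x$ and $\mathit{flag}$, it returns the value of isSatisfiable$(x,\mathit{flag})$ in $O(n^2)$ steps and leaves the stored tree and labelling intact. \item Some program implements the decision algorithm on a given ABC-tree rooted at any $R\in\mathcal C$ in $O(n^3)$ steps: it returns the verdict of the algorithm and, if this is "accept",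 the final labelling. \item Some program decides, for every connected graph $G$, whether $G$ admits a robust MIS, in $O(n^3)$ steps; if $G$ has a biconnected component, the program does so by outputting the ABC-tree rooted at some $R\in\mathcal C$ and the verdict and (if it accepts) the final labelling of the decision algorithm. \end{enumerate} The constants in the $O$'s and in the word length do not depend on $G$, $R$, $L$, $x$, $\mathit{flag}$, nor on the numbering of the nodes. -/

import Mathlib

/-!
Robust maximal independent sets, the ABC-tree of a connected graph, the labelling algorithm, and a
word random access machine with a step count.
-/

namespace RMIS

/-! ### Graph notions -/

section Graph

variable {V : Type}

/-- `S` is a maximal independent set of `G`. -/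
def IsMIS (G : SimpleGraph V) (S : Set V) : Prop :=
  Maximal (fun T => G.IsIndepSet T) S

/-- `S` is a robust MIS of `G`: an MIS of every connected spanning subgraph of `G`. -/
def IsRobustMIS (G : SimpleGraph V) (S : Set V) : Prop :=
  ∀ H : SimpleGraph V, H ≤ G → H.Connected → IsMIS H S

/-- A vertex of degree one. -/
def IsPendant (G : SimpleGraph V) (v : V) : Prop :=
  (G.neighborSet v).ncard = 1

/-- A vertex whose removal disconnects the graph (the empty graph is not disconnected). -/
def IsArticulation (G : SimpleGraph V) (v : V) : Prop :=
  ¬ (G.induce {v}ᶜ).Preconnected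

/-- An edge whose removal disconnects the graph. -/
def IsBridgeEdge (G : SimpleGraph V) (e : Sym2 V) : Prop :=
  e ∈ G.edgeSet ∧ G.IsBridge e

/-- A subgraph with at least three vertices that is connected and stays connected after the removal
of any single vertex. -/
def IsBiconnected {G : SimpleGraph V} (H : G.Subgraph) : Prop :=
  3 ≤ H.verts.ncard ∧ H.Connected ∧ ∀ v ∈ H.verts, (H.deleteVerts {v}).Connected

/-- A maximal biconnected subgraph. -/
def IsBiconnectedComponent {G : SimpleGraph V} (H : G.Subgraph) : Prop :=
  Maximal (fun K : G.Subgraph => IsBiconnected K) H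

/-! ### The ABC-tree -/

/-- The nodes of the ABC-tree: pendant vertices (P), articulation points (A), bridges (B) and
biconnected components (C). -/
inductive Node (G : SimpleGraph V) : Type
  | pendant (v : V) (h : IsPendant G v) : Node G
  | artic (v : V) (h : IsArticulation G v) : Node G
  | bridge (e : Sym2 V) (h : IsBridgeEdge G e) : Node G
  | comp (H : G.Subgraph) (h : IsBiconnectedComponent H) : Node G

/-- The vertices of `G` underlying a node. -/
def Node.verts {G : SimpleGraph V} : Node G → Set V
  | .pendant v _ => {v}
  | .artic v _ => {v}
  | .bridge e _ => {v | v ∈ e}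
  | .comp H _ => H.verts

/-- A numbering of the four types of nodes. -/
def Node.kind {G : SimpleGraph V} : Node G → ℕ
  | .pendant _ _ => 0
  | .artic _ _ => 1
  | .bridge _ _ => 2
  | .comp _ _ => 3

/-- The pairs (articulation point, component containing it) and (articulation point or pendant
vertex, bridge containing it). -/
def Node.Incident {G : SimpleGraph V} : Node G → Node G → Prop
  | .artic a _, .comp H _ => a ∈ H.verts
  | .artic a _, .bridge e _ => a ∈ e
  | .pendant v _, .bridge e _ => v ∈ e
  | _, _ => False

/-- The ABC-tree of `G`. -/
def abcTree (G : SimpleGraph V) : SimpleGraph (Node G) :=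
  SimpleGraph.fromRel Node.Incident

/-- The node is a biconnected component. -/
def Node.IsComp {G : SimpleGraph V} (x : Node G) : Prop :=
  ∃ H h, x = Node.comp H h

/-- In the ABC-tree rooted at `R`, the node `p` is the parent of `x`: the neighbour of `x` that is
one hop closer to `R`. -/
def IsParent {G : SimpleGraph V} (R p x : Node G) : Prop :=
  (abcTree G).Adj x p ∧ (abcTree G).dist R x = (abcTree G).dist R p + 1

/-- In the ABC-tree rooted at `R`, the vertex `v` is the attachment vertex of the node `x`: the
vertex `x` itself if `x` is a vertex node, the vertex underlying the parent of `x` otherwise. (The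
root, which has no parent, has no attachment vertex.) -/
def IsAttachment {G : SimpleGraph V} (R : Node G) (v : V) : Node G → Prop
  | .pendant u _ => v = u
  | .artic u _ => v = u
  | .bridge e h => ∃ p, IsParent R p (.bridge e h) ∧ v ∈ p.verts
  | .comp H h => ∃ p, IsParent R p (.comp H h) ∧ v ∈ p.verts

/-! ### The procedure `isSatisfiable` -/

/-- The labels "possibly in", "possibly out", "possibly external". -/
inductive Label : Type
  | PI | PO | PE

/-- The flag of `isSatisfiable`, which forces the status of the attachment vertex. -/
inductive Flag : Type
  | none | inside | outside

/-- A labelling of the nodes of the ABC-tree. -/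
abbrev Labelling (G : SimpleGraph V) : Type := Node G → Set Label

/-- The labels that a vertex carries: those of its articulation node, if there is one. -/
def vertexLabels {G : SimpleGraph V} (L : Labelling G) (v : V) : Set Label :=
  {l | ∃ h : IsArticulation G v, l ∈ L (.artic v h)}

/-- The edges of the component `H` both of whose endpoints carry the label PO. -/
def poGraph {G : SimpleGraph V} (L : Labelling G) (H : G.Subgraph) : SimpleGraph H.verts where
  Adj u v := H.coe.Adj u v ∧ Label.PO ∈ vertexLabels L u.1 ∧ Label.PO ∈ vertexLabels L v.1
  symm := ⟨fun _ _ h => ⟨h.1.symm, h.2.2, h.2.1⟩⟩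
  loopless := ⟨fun _ h => h.1.ne rfl⟩

/-- The component `H` without the edges both of whose endpoints carry the label PO. -/
def cutGraph {G : SimpleGraph V} (L : Labelling G) (H : G.Subgraph) : SimpleGraph H.verts :=
  H.coe \ poGraph L H

/-- A literal: `(i, true)` is the variable `i`, `(i, false)` is its negation. -/
abbrev Literal (ι : Type) : Type := ι × Bool

/-- The negation of a literal. -/
def Literal.neg {ι : Type} (l : Literal ι) : Literal ι := (l.1, !l.2)

/-- A set of clauses (disjunctions of literals) has a satisfying assignment. -/
def SatisfiableFormula {ι : Type} (F : Set (List (Literal ι))) : Prop :=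
  ∃ τ : ι → Bool, ∀ c ∈ F, ∃ l ∈ c, τ l.1 = l.2

/-- The literal of a vertex of `X`, given a proper 2-colouring of `X`: there is one variable for
each connected component of `X`, and the colour decides between this variable and its negation. -/
def vertexLiteral {W : Type} {X : SimpleGraph W} (col : X.Coloring Bool) (v : W) :
    Literal X.ConnectedComponent :=
  (X.connectedComponentMk v, col v)

/-- The clauses of the 2-SAT formula of a component `H` with attachment vertices `att` (one vertex,
or none at the root). -/
def formula {G : SimpleGraph V} (L : Labelling G) (H : G.Subgraph) (att : Set V) (flag : Flag)
    (col : (cutGraph L H).Coloring Bool) :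
    Set (List (Literal (cutGraph L H).ConnectedComponent)) :=
  {c | ∃ v : H.verts, vertexLabels L v.1 = {Label.PI} ∧ c = [vertexLiteral col v]} ∪
  {c | ∃ v : H.verts, (vertexLabels L v.1 = {Label.PO} ∨ vertexLabels L v.1 = {Label.PE}) ∧
      c = [(vertexLiteral col v).neg]} ∪
  {c | ∃ u v : H.verts, (poGraph L H).Adj u v ∧
      c = [(vertexLiteral col u).neg, (vertexLiteral col v).neg]} ∪
  {c | ∃ v : H.verts, flag = Flag.inside ∧ v.1 ∈ att ∧ c = [vertexLiteral col v]} ∪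
  {c | ∃ v : H.verts, flag = Flag.outside ∧ v.1 ∈ att ∧ c = [(vertexLiteral col v).neg]}

/-- The value returned by `isSatisfiable(x, flag)` in the ABC-tree rooted at `R` with current
labelling `L`: false if `cutGraph` is not bipartite, and otherwise whether the 2-SAT formula is
satisfiable. (Which of the proper 2-colourings is used does not matter, as they differ by the
names of the variables and their negations.) -/
def isSatisfiable {G : SimpleGraph V} (R : Node G) (L : Labelling G) (x : Node G) (flag : Flag) :
    Prop :=
  ∃ H h, x = Node.comp H h ∧
    ∃ col : (cutGraph L H).Coloring Bool,
      SatisfiableFormula (formula L H {v | IsAttachment R v x} flag col)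

/-! ### The decision algorithm -/

open Classical in
/-- The labelling `L` in which the labels of the parent of `x` have been replaced by `S`. -/
noncomputable def setParent {G : SimpleGraph V} (R : Node G) (L : Labelling G) (x : Node G)
    (S : Set Label) : Labelling G :=
  fun z => if IsParent R z x then S else L z

/-- The three tests by which a biconnected component gets its labels. While `x` is being labelled,
its parent has no label yet; for the third test it gets an artificial label PO. -/
def compLabels {G : SimpleGraph V} (R : Node G) (L : Labelling G) (x : Node G) : Set Label :=
  {l | (l = Label.PI ∧ isSatisfiable R (setParent R L x ∅) x .inside) ∨
       (l = Label.PO ∧ isSatisfiable R (setParent R L x ∅) x .outside) ∨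
       (l = Label.PE ∧ ¬ isSatisfiable R (setParent R L x ∅) x .outside ∧
          isSatisfiable R (setParent R L x {Label.PO}) x .outside)}

/-- `LabelNode(x)` for an articulation point. -/
def articLabels {G : SimpleGraph V} (R : Node G) (L : Labelling G) (x : Node G) : Set Label :=
  {l | (l = Label.PI ∧ ∀ c, IsParent R x c → Label.PI ∈ L c) ∨
       (l = Label.PO ∧ (∀ c, IsParent R x c → Label.PO ∈ L c ∨ Label.PE ∈ L c) ∧
          ∃ c, IsParent R x c ∧ Label.PO ∈ L c) ∨
       (l = Label.PE ∧ (∀ c, IsParent R x c → Label.PO ∈ L c ∨ Label.PE ∈ L c) ∧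
          ¬ ∃ c, IsParent R x c ∧ Label.PO ∈ L c)}

/-- `LabelNode(x)` for a bridge; such a node has exactly one child `c`. -/
def bridgeLabels {G : SimpleGraph V} (R : Node G) (L : Labelling G) (x : Node G) : Set Label :=
  {l | ∃ c, IsParent R x c ∧
      ((l = Label.PO ∧ Label.PI ∈ L c) ∨
       (l = Label.PI ∧ (Label.PE ∈ L c ∨ Label.PO ∈ L c)) ∨
       (l = Label.PE ∧ Label.PO ∈ L c ∧ Label.PI ∉ L c))}

/-- The labels computed by `LabelNode(x)` from the labels of the children of `x`. -/
def labelNode {G : SimpleGraph V} (R : Node G) (L : Labelling G) (x : Node G) : Set Label :=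
  match x with
  | .pendant _ _ => {Label.PI, Label.PE}
  | .artic _ _ => articLabels R L x
  | .bridge _ _ => bridgeLabels R L x
  | .comp _ _ => compLabels R L x

/-- `L` is the labelling that `LabelNode` produces bottom-up in the ABC-tree rooted at `R`; the root
gets no label. -/
def IsRunLabelling {G : SimpleGraph V} (R : Node G) (L : Labelling G) : Prop :=
  L R = ∅ ∧ ∀ x, x ≠ R → L x = labelNode R L x

/-- The decision algorithm on the ABC-tree rooted at `R` accepts, with final labelling `L`: no node
other than the root ends up without a label, and the final test at the root succeeds. -/
def AcceptsWith {G : SimpleGraph V} (R : Node G) (L : Labelling G) : Prop :=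
  IsRunLabelling R L ∧ (∀ x, x ≠ R → L x ≠ ∅) ∧ isSatisfiable R L R .none

end Graph

/-! ### The word random access machine

Programs are structured; they use a fixed finite set of registers (`var i`) and of arrays
(`get a e` is cell number `e` of array `a`). All values, including addresses, are words, that is,
natural numbers of at most `W`; an operation whose operands or result are not words blocks. Each
operation, memory access and test costs one step. -/

/-- The operations on words. -/
inductive Op : Type
  | add | sub | mul | div | mod | lt | eq

/-- The value of an operation (subtraction is truncated, division by zero gives zero, and
comparisons give `0` or `1`). -/
def Op.eval : Op → ℕ → ℕ → ℕ
  | .add, a, b => a + b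
  | .sub, a, b => a - b
  | .mul, a, b => a * b
  | .div, a, b => a / b
  | .mod, a, b => a % b
  | .lt, a, b => if a < b then 1 else 0
  | .eq, a, b => if a = b then 1 else 0

/-- Expressions. -/
inductive Expr : Type
  | lit (k : ℕ) : Expr
  | var (i : ℕ) : Expr
  | get (a : ℕ) (e : Expr) : Expr
  | op (o : Op) (e₁ e₂ : Expr) : Expr

/-- The number of operations and memory accesses in an expression. -/
def Expr.cost : Expr → ℕ
  | .lit _ => 1
  | .var _ => 1
  | .get _ e => e.cost + 1
  | .op _ e₁ e₂ => e₁.cost + e₂.cost + 1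

/-- The memory. -/
structure State : Type where
  var : ℕ → ℕ
  arr : ℕ → ℕ → ℕ

/-- `v`, provided that it is a word. -/
def word (W v : ℕ) : Option ℕ := if v ≤ W then some v else none

/-- The value of an expression, if all intermediate values are words. -/
def Expr.eval (W : ℕ) (s : State) : Expr → Option ℕ
  | .lit k => word W k
  | .var i => word W (s.var i)
  | .get a e => (e.eval W s).bind fun i => word W (s.arr a i)
  | .op o e₁ e₂ => (e₁.eval W s).bind fun a => (e₂.eval W s).bind fun b => word W (o.eval a b)

/-- Programs. -/
inductive Prog : Type
  | skip : Prog
  | assign (i : ℕ) (e : Expr) : Prog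
  | store (a : ℕ) (idx e : Expr) : Prog
  | seq (p q : Prog) : Prog
  | ite (b : Expr) (p q : Prog) : Prog
  | while (b : Expr) (p : Prog) : Prog

/-- `Exec W p s t s'`: on a machine with words up to `W`, the program `p` started in state `s` halts
after exactly `t` steps in state `s'`. -/
inductive Exec (W : ℕ) : Prog → State → ℕ → State → Prop
  | skip (s : State) : Exec W .skip s 1 s
  | assign (i : ℕ) (e : Expr) (s : State) (v : ℕ) (hv : e.eval W s = some v) :
      Exec W (.assign i e) s (e.cost + 1) { s with var := Function.update s.var i v }
  | store (a : ℕ) (idx e : Expr) (s : State) (j v : ℕ) (hj : idx.eval W s = some j)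
      (hv : e.eval W s = some v) :
      Exec W (.store a idx e) s (idx.cost + e.cost + 1)
        { s with arr := Function.update s.arr a (Function.update (s.arr a) j v) }
  | seq (p q : Prog) (s s' s'' : State) (t t' : ℕ) (hp : Exec W p s t s')
      (hq : Exec W q s' t' s'') : Exec W (.seq p q) s (t + t') s''
  | ite_true (b : Expr) (p q : Prog) (s s' : State) (v t : ℕ) (hb : b.eval W s = some v)
      (hv : v ≠ 0) (hp : Exec W p s t s') : Exec W (.ite b p q) s (b.cost + 1 + t) s'
  | ite_false (b : Expr) (p q : Prog) (s s' : State) (t : ℕ) (hb : b.eval W s = some 0)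
      (hq : Exec W q s t s') : Exec W (.ite b p q) s (b.cost + 1 + t) s'
  | while_true (b : Expr) (p : Prog) (s s' s'' : State) (v t t' : ℕ) (hb : b.eval W s = some v)
      (hv : v ≠ 0) (hp : Exec W p s t s') (hw : Exec W (.while b p) s' t' s'') :
      Exec W (.while b p) s (b.cost + 1 + t + t') s''
  | while_false (b : Expr) (p : Prog) (s : State) (hb : b.eval W s = some 0) :
      Exec W (.while b p) s (b.cost + 1) s

/-- On a machine with words up to `W`, the program `p` started in state `s` halts within `T` steps
in a state with the property `post`. -/
def HaltsWithin (W T : ℕ) (p : Prog) (s : State) (post : State → Prop) : Prop :=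
  ∃ t s', t ≤ T ∧ Exec W p s t s' ∧ post s'

/-- The largest word for inputs of size `n`: words have `O(log n)` bits. -/
def maxWord (c n : ℕ) : ℕ := (n + 2) ^ c

/-! ### Memory layout

The predicates restrict only the cells that they mention; all other cells may hold anything. -/

/-- The number `1` or `0` that encodes a truth value. -/
noncomputable def bit (p : Prop) : ℕ := open Classical in if p then 1 else 0

/-- Register 0 holds the number of vertices, array 0 the adjacency matrix. -/
def HoldsGraph {n : ℕ} (G : SimpleGraph (Fin n)) (s : State) : Prop :=
  s.var 0 = n ∧ ∀ i j : Fin n, s.arr 0 (i * n + j) = bit (G.Adj i j)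

/-- The memory holds the graph `G` and its ABC-tree, whose nodes are numbered by `ν`: register 1
holds the number of nodes, array 1 their types, array 2 the matrix of which vertices underlie which
nodes, and array 3 the adjacency matrix of the tree. -/
def HoldsTree {n N : ℕ} (G : SimpleGraph (Fin n)) (ν : Fin N ≃ Node G) (s : State) : Prop :=
  HoldsGraph G s ∧
  s.var 1 = N ∧
  (∀ i : Fin N, s.arr 1 i = (ν i).kind) ∧
  (∀ (i : Fin N) (v : Fin n), s.arr 2 (i * n + v) = bit (v ∈ (ν i).verts)) ∧
  (∀ i j : Fin N, s.arr 3 (i * N + j) = bit ((abcTree G).Adj (ν i) (ν j)))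

/-- In addition, register 2 holds the root and array 4 the parents of the other nodes. -/
def HoldsRootedTree {n N : ℕ} (G : SimpleGraph (Fin n)) (ν : Fin N ≃ Node G) (R : Node G)
    (s : State) : Prop :=
  HoldsTree G ν s ∧
  s.var 2 = ν.symm R ∧
  ∀ i j : Fin N, IsParent R (ν j) (ν i) → s.arr 4 i = j

/-- Array 5 holds a labelling, three bits per node. -/
def HoldsLabels {n N : ℕ} {G : SimpleGraph (Fin n)} (ν : Fin N ≃ Node G) (L : Labelling G)
    (s : State) : Prop :=
  ∀ i : Fin N,
    s.arr 5 (3 * i) = bit (Label.PI ∈ L (ν i)) ∧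
    s.arr 5 (3 * i + 1) = bit (Label.PO ∈ L (ν i)) ∧
    s.arr 5 (3 * i + 2) = bit (Label.PE ∈ L (ν i))

/-- Registers 3 and 4 hold the two arguments of `isSatisfiable`. -/
def HoldsCall {n N : ℕ} {G : SimpleGraph (Fin n)} (ν : Fin N ≃ Node G) (x : Node G) (flag : Flag)
    (s : State) : Prop :=
  s.var 3 = ν.symm x ∧
  s.var 4 = match flag with
    | .none => 0
    | .inside => 1
    | .outside => 2

/-- Register 5 holds a returned truth value. -/
def Returns (p : Prop) (s : State) : Prop :=
  s.var 5 = bit p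

/-- The output of the decision algorithm on the ABC-tree rooted at `R`: its verdict and, if it
accepts, the final labelling. -/
def HoldsVerdict {n N : ℕ} {G : SimpleGraph (Fin n)} (ν : Fin N ≃ Node G) (R : Node G)
    (s : State) : Prop :=
  Returns (∃ L, AcceptsWith R L) s ∧ ∀ L, AcceptsWith R L → HoldsLabels ν L s

end RMIS

namespace RMIS

/-! ### Program notation -/

/-! The graph theory rests on one description of the blocks (bridges and biconnected components)
that a program can produce and a proof can use. In a `BlockCert` every vertex has a class and every
class an apex that precedes its members in a search order; a class together with its apex is a
block. Climbing from apex to apex until a given block is entered is a retraction onto that block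
(`BlockCert.retr`), and an edge outside the block joins two vertices with the same image. This
yields the components, bridges and articulation points, the fact that the ABC-tree is a tree, and
the criterion `BlockCert.isRobustMIS_iff`: `S` is a robust MIS iff it is independent and every
vertex outside `S` has a block in which all of its neighbours belong to `S`. `BlockFacts` collects
these consequences.

By the criterion, the labels of a node describe the possible status of its attachment vertex: in
`S`; outside and taken care of by a block at or below the node; outside and still waiting for
another block. A robust MIS has its status listed at every node (`BlockFacts.covers`), hence the
algorithm accepts. Conversely, after acceptance the solutions of the block formulas are glued from
the root downwards (`BlockFacts.robust_of_accepts`). For both directions the 2-SAT formula is first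
rewritten as constraints on a vertex set (`BlockFacts.isSatisfiable_iff`). Without components the
graph is a tree, and every MIS is robust.

The tree is built in quadratic time by inserting the vertices in search order. The cycles closed by
a new vertex are merged by two climbing walks that stop where they meet; each step marks a new
class, lowers the future apex or ends the walk, so one vertex costs O(n) (`mergeWalk_spec`,
`mergeVertex_spec`). Satisfiability is decided without building an implication graph: the two
possible values of an undecided vertex are propagated in lockstep until one propagation ends without
conflict. If that takes `i` steps, the cost is O(n i) and `i` values are fixed for good; two
conflicts refute all solutions (`round_spec`, `solve_spec`). The ABC-tree has at most 4n nodes, and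
each takes at most three such tests, which gives the cubic bound.

For the machine, code without loops is executed symbolically (`hw_run`), loops are treated by
invariants with a potential that pays for the time (`runs_while`, `runs_for`), and everything that a
program does not write is preserved for syntactic reasons (`Exec.frame`). -/

instance (n : ℕ) : OfNat Expr n := ⟨Expr.lit n⟩
instance : Add Expr := ⟨Expr.op .add⟩
instance : Sub Expr := ⟨Expr.op .sub⟩
instance : Mul Expr := ⟨Expr.op .mul⟩
instance : Div Expr := ⟨Expr.op .div⟩
instance : Mod Expr := ⟨Expr.op .mod⟩

prefix:max "♯" => Expr.var
infixl:90 " ↗ " => Expr.get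
infix:50 " =! " => Expr.op Op.eq
infix:50 " <! " => Expr.op Op.lt
infix:45 " ≔ " => Prog.assign
infixr:40 " ;; " => Prog.seq

/-- Update of a register. -/
def State.setVar (s : State) (i v : ℕ) : State :=
  { s with var := Function.update s.var i v }

/-- Update of an array cell. -/
def State.setArr (s : State) (a j v : ℕ) : State :=
  { s with arr := Function.update s.arr a (Function.update (s.arr a) j v) }

@[simp] theorem State.setVar_var (s : State) (i v j : ℕ) :
    (s.setVar i v).var j = if j = i then v else s.var j := by
  simp [State.setVar, Function.update_apply]

@[simp] theorem State.setVar_arr (s : State) (i v : ℕ) : (s.setVar i v).arr = s.arr := rfl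

@[simp] theorem State.setArr_var (s : State) (a j v : ℕ) : (s.setArr a j v).var = s.var := rfl

@[simp] theorem State.setArr_arr (s : State) (a j v b : ℕ) :
    (s.setArr a j v).arr b = if b = a then Function.update (s.arr a) j v else s.arr b := by
  simp only [State.setArr, Function.update_apply]

/-- The value of an expression on unbounded words. -/
@[simp] def Expr.val (s : State) : Expr → ℕ
  | .lit k => k
  | .var i => s.var i
  | .get a e => s.arr a (e.val s)
  | .op o e₁ e₂ => o.eval (e₁.val s) (e₂.val s)

/-- All values read by the expression are at most `M`. -/
@[simp] def Expr.Bdd (M : ℕ) (s : State) : Expr → Prop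
  | .lit k => k ≤ M
  | .var i => s.var i ≤ M
  | .get a e => e.Bdd M s ∧ s.arr a (e.val s) ≤ M
  | .op _ e₁ e₂ => e₁.Bdd M s ∧ e₂.Bdd M s

attribute [simp] Expr.cost Op.eval

section Instances
variable (s : State) (M n : ℕ) (a b : Expr)
@[simp] theorem Expr.val_ofNat : (OfNat.ofNat n : Expr).val s = n := rfl
@[simp] theorem Expr.val_add : (a + b).val s = a.val s + b.val s := rfl
@[simp] theorem Expr.val_sub : (a - b).val s = a.val s - b.val s := rfl
@[simp] theorem Expr.val_mul : (a * b).val s = a.val s * b.val s := rfl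
@[simp] theorem Expr.val_div : (a / b).val s = a.val s / b.val s := rfl
@[simp] theorem Expr.val_mod : (a % b).val s = a.val s % b.val s := rfl
@[simp] theorem Expr.bdd_ofNat : (OfNat.ofNat n : Expr).Bdd M s ↔ n ≤ M := Iff.rfl
@[simp] theorem Expr.bdd_add : (a + b).Bdd M s ↔ a.Bdd M s ∧ b.Bdd M s := Iff.rfl
@[simp] theorem Expr.bdd_sub : (a - b).Bdd M s ↔ a.Bdd M s ∧ b.Bdd M s := Iff.rfl
@[simp] theorem Expr.bdd_mul : (a * b).Bdd M s ↔ a.Bdd M s ∧ b.Bdd M s := Iff.rfl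
@[simp] theorem Expr.bdd_div : (a / b).Bdd M s ↔ a.Bdd M s ∧ b.Bdd M s := Iff.rfl
@[simp] theorem Expr.bdd_mod : (a % b).Bdd M s ↔ a.Bdd M s ∧ b.Bdd M s := Iff.rfl
end Instances

/-- Words up to `W` suffice to evaluate short expressions whose leaves are at most `M`. -/
structure Big (W M : ℕ) : Prop where
  -- A generous bound: it covers all literals of the programs, and `2 ≤ M` is needed for sums.
  two : 32 ≤ M
  pow : M ^ 64 ≤ W

/-- An expression of cost `k` over leaves of size at most `M` has a value of at most `M ^ k`. With
`k ≤ 64` no intermediate result exceeds `W`, so the word length never has to be considered again;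
only the leaves are bounded later. -/
theorem Expr.eval_eq {W M : ℕ} (hB : Big W M) {s : State} :
    ∀ e : Expr, e.Bdd M s → e.cost ≤ 64 →
      e.eval W s = some (e.val s) ∧ e.val s ≤ M ^ e.cost ∧ 1 ≤ e.cost := by
  have hM1 : 1 ≤ M := by have := hB.two; omega
  have hw : ∀ v k, v ≤ M ^ k → k ≤ 64 → word W v = some v := by
    intro v k hv hk
    have : v ≤ W := hv.trans ((Nat.pow_le_pow_right hM1 hk).trans hB.pow)
    simp [word, this]
  intro e
  induction e with
  | lit k =>
    intro h _
    have : k ≤ M ^ 1 := by simpa using h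
    exact ⟨hw _ 1 this (by norm_num), this, le_rfl⟩
  | var i =>
    intro h _
    have : s.var i ≤ M ^ 1 := by simpa using h
    exact ⟨hw _ 1 this (by norm_num), this, le_rfl⟩
  | get a e ih =>
    intro h hc
    obtain ⟨h1, h2, h3⟩ := ih h.1 (by simp at hc; omega)
    have hle : s.arr a (e.val s) ≤ M ^ 1 := by simpa using h.2
    refine ⟨?_, ?_, by simp⟩
    · simp only [Expr.eval, h1, Option.bind_some, Expr.val]
      exact hw _ 1 hle (by norm_num)
    · exact hle.trans (Nat.pow_le_pow_right hM1 (by simp))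
  | op o e₁ e₂ ih₁ ih₂ =>
    intro h hc
    simp only [Expr.cost] at hc
    obtain ⟨a1, a2, a3⟩ := ih₁ h.1 (by omega)
    obtain ⟨b1, b2, b3⟩ := ih₂ h.2 (by omega)
    have hle : o.eval (e₁.val s) (e₂.val s) ≤ M ^ (e₁.cost + e₂.cost + 1) := by
      have hA : M ^ e₁.cost ≤ M ^ (e₁.cost + e₂.cost + 1) :=
        Nat.pow_le_pow_right hM1 (by omega)
      have h1 : 1 ≤ M ^ (e₁.cost + e₂.cost + 1) := Nat.one_le_pow _ _ hM1
      cases o with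
      | add =>
        have hB' : M ^ e₂.cost ≤ M ^ (e₁.cost + e₂.cost) := Nat.pow_le_pow_right hM1 (by omega)
        have hA' : M ^ e₁.cost ≤ M ^ (e₁.cost + e₂.cost) := Nat.pow_le_pow_right hM1 (by omega)
        -- The cost of the addition itself provides one spare factor `M ≥ 2`, enough for the sum of
        -- two bounded values.
        have : M ^ (e₁.cost + e₂.cost + 1) = M ^ (e₁.cost + e₂.cost) * M := pow_succ _ _
        have h2 := Nat.mul_le_mul_left (M ^ (e₁.cost + e₂.cost)) (show 2 ≤ M by
          have := hB.two; omega)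
        simp only [Op.eval]; omega
      | sub => simp only [Op.eval]; omega
      | mul =>
        simp only [Op.eval]
        calc e₁.val s * e₂.val s ≤ M ^ e₁.cost * M ^ e₂.cost := Nat.mul_le_mul a2 b2
          _ = M ^ (e₁.cost + e₂.cost) := (pow_add _ _ _).symm
          _ ≤ _ := Nat.pow_le_pow_right hM1 (by omega)
      | div => exact (Nat.div_le_self _ _).trans (a2.trans hA)
      | mod => exact (Nat.mod_le _ _).trans (a2.trans hA)
      | lt => simp only [Op.eval]; split_ifs <;> omega
      | eq => simp only [Op.eval]; split_ifs <;> omega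
    refine ⟨?_, hle, by simp⟩
    simp only [Expr.eval, a1, b1, Option.bind_some, Expr.val]
    exact hw _ _ hle hc

/-! ### Modified registers and arrays -/

/-- The registers that a program may modify. -/
def Prog.wvars : Prog → List ℕ
  | .skip => []
  | .assign i _ => [i]
  | .store _ _ _ => []
  | .seq p q => p.wvars ++ q.wvars
  | .ite _ p q => p.wvars ++ q.wvars
  | .while _ p => p.wvars

/-- The arrays that a program may modify. -/
def Prog.warrs : Prog → List ℕ
  | .skip => []
  | .assign _ _ => []
  | .store a _ _ => [a]
  | .seq p q => p.warrs ++ q.warrs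
  | .ite _ p q => p.warrs ++ q.warrs
  | .while _ p => p.warrs

/-- The states agree outside of what `p` may modify. -/
structure Frame (p : Prog) (s s' : State) : Prop where
  var : ∀ i, i ∉ p.wvars → s'.var i = s.var i
  arr : ∀ a, a ∉ p.warrs → s'.arr a = s.arr a

theorem Frame.refl (p : Prog) (s : State) : Frame p s s := ⟨fun _ _ => rfl, fun _ _ => rfl⟩

theorem Frame.trans {p : Prog} {s s' s'' : State} (h : Frame p s s') (h' : Frame p s' s'') :
    Frame p s s'' :=
  ⟨fun i hi => (h'.var i hi).trans (h.var i hi), fun i hi => (h'.arr i hi).trans (h.arr i hi)⟩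

theorem Frame.mono {p q : Prog} {s s' : State} (h : Frame p s s')
    (h1 : ∀ i ∈ p.wvars, i ∈ q.wvars) (h2 : ∀ i ∈ p.warrs, i ∈ q.warrs) : Frame q s s' :=
  ⟨fun i hi => h.var i fun h' => hi (h1 i h'), fun i hi => h.arr i fun h' => hi (h2 i h')⟩

/-- Because the written registers and arrays are computable lists, preservation of a concrete cell
is later a closed decidable statement, discharged by `of_decide_eq_true rfl`. -/
theorem Exec.frame {W : ℕ} {p : Prog} {s s' : State} {t : ℕ} (h : Exec W p s t s') :
    Frame p s s' := by
  induction h with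
  | skip s => exact Frame.refl _ _
  | assign i e s v hv =>
    refine ⟨fun j hj => ?_, fun _ _ => rfl⟩
    have : j ≠ i := by simpa [Prog.wvars] using hj
    simp [Function.update_of_ne this]
  | store a idx e s j v hj hv =>
    refine ⟨fun _ _ => rfl, fun b hb => ?_⟩
    have : b ≠ a := by simpa [Prog.warrs] using hb
    simp [Function.update_of_ne this]
  | seq p q s s' s'' t t' hp hq ihp ihq =>
    exact (ihp.mono (by simp +contextual [Prog.wvars]) (by simp +contextual [Prog.warrs])).trans
      (ihq.mono (by simp +contextual [Prog.wvars]) (by simp +contextual [Prog.warrs]))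
  | ite_true b p q s s' v t hb hv hp ihp =>
    exact ihp.mono (by simp +contextual [Prog.wvars]) (by simp +contextual [Prog.warrs])
  | ite_false b p q s s' t hb hq ihq =>
    exact ihq.mono (by simp +contextual [Prog.wvars]) (by simp +contextual [Prog.warrs])
  | while_true b p s s' s'' v t t' hb hv hp hw ihp ihw =>
    exact (Frame.mono (q := .while b p) ihp (by simp [Prog.wvars]) (by simp [Prog.warrs])).trans ihw
  | while_false b p s hb => exact Frame.refl _ _

/-! ### Total correctness with time -/

/-- `p` started in `s` halts, after `t` steps in a state `s'` with `Q t s'`. -/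
def Runs (W : ℕ) (p : Prog) (s : State) (Q : ℕ → State → Prop) : Prop :=
  ∃ t s', Exec W p s t s' ∧ Q t s'

theorem HaltsWithin.runs {W T : ℕ} {p : Prog} {s : State} {post : State → Prop}
    (h : HaltsWithin W T p s post) : Runs W p s fun t s' => t ≤ T ∧ Frame p s s' ∧ post s' := by
  obtain ⟨t, s', ht, he, hp⟩ := h
  exact ⟨t, s', he, ht, he.frame, hp⟩

theorem Runs.halts {W T : ℕ} {p : Prog} {s : State} {post : State → Prop}
    {Q : ℕ → State → Prop} (h : Runs W p s Q) (hQ : ∀ t s', Frame p s s' → Q t s' → t ≤ T ∧ post s') :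
    HaltsWithin W T p s post := by
  obtain ⟨t, s', he, hq⟩ := h
  exact ⟨t, s', (hQ t s' he.frame hq).1, he, (hQ t s' he.frame hq).2⟩

theorem Runs.mono {W : ℕ} {p : Prog} {s : State} {Q Q' : ℕ → State → Prop}
    (h : Runs W p s Q) (hQ : ∀ t s', Frame p s s' → Q t s' → Q' t s') : Runs W p s Q' := by
  obtain ⟨t, s', he, hq⟩ := h
  exact ⟨t, s', he, hQ t s' he.frame hq⟩

theorem HaltsWithin.mono {W T T' : ℕ} {p : Prog} {s : State} {post post' : State → Prop}
    (h : HaltsWithin W T p s post) (hT : T ≤ T') (hp : ∀ s', Frame p s s' → post s' → post' s') :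
    HaltsWithin W T' p s post' := by
  obtain ⟨t, s', ht, he, hq⟩ := h
  exact ⟨t, s', ht.trans hT, he, hp s' he.frame hq⟩

theorem runs_seq {W : ℕ} {p q : Prog} {s : State} {Q Q' : ℕ → State → Prop}
    (hp : Runs W p s Q)
    (hq : ∀ t s', Frame p s s' → Q t s' → Runs W q s' fun t' s'' => Q' (t + t') s'') :
    Runs W (.seq p q) s Q' := by
  obtain ⟨t, s', he, h⟩ := hp
  obtain ⟨t', s'', he', h'⟩ := hq t s' he.frame h
  exact ⟨t + t', s'', .seq p q s s' s'' t t' he he', h'⟩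

theorem hw_seq {W T T₁ T₂ : ℕ} {p q : Prog} {s : State} {post : State → Prop} (mid : State → Prop)
    (hp : HaltsWithin W T₁ p s mid)
    (hq : ∀ s', Frame p s s' → mid s' → HaltsWithin W T₂ q s' post) (hT : T₁ + T₂ ≤ T) :
    HaltsWithin W T (.seq p q) s post := by
  obtain ⟨t, s', ht, he, h⟩ := hp
  obtain ⟨t', s'', ht', he', h'⟩ := hq s' he.frame h
  exact ⟨t + t', s'', by omega, .seq p q s s' s'' t t' he he', h'⟩

theorem runs_ite {W M : ℕ} (hB : Big W M) {b : Expr} {p q : Prog} {s : State}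
    {Q : ℕ → State → Prop} (hb : b.Bdd M s) (hc : b.cost ≤ 64)
    (hp : b.val s ≠ 0 → Runs W p s fun t s' => Q (b.cost + 1 + t) s')
    (hq : b.val s = 0 → Runs W q s fun t s' => Q (b.cost + 1 + t) s') :
    Runs W (.ite b p q) s Q := by
  have he := (Expr.eval_eq hB b hb hc).1
  by_cases h : b.val s = 0
  · obtain ⟨t, s', hx, h'⟩ := hq h
    exact ⟨_, s', .ite_false b p q s s' t (h ▸ he) hx, h'⟩
  · obtain ⟨t, s', hx, h'⟩ := hp h
    exact ⟨_, s', .ite_true b p q s s' _ t he h hx, h'⟩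

theorem hw_ite {W M T T' : ℕ} (hB : Big W M) {b : Expr} {p q : Prog} {s : State}
    {post : State → Prop} (hb : b.Bdd M s) (hc : b.cost ≤ 64)
    (hp : b.val s ≠ 0 → HaltsWithin W T' p s post)
    (hq : b.val s = 0 → HaltsWithin W T' q s post) (hT : b.cost + 1 + T' ≤ T) :
    HaltsWithin W T (.ite b p q) s post := by
  refine Runs.halts (runs_ite hB (Q := fun t s' => t ≤ T ∧ post s') hb hc (fun h => ?_)
    (fun h => ?_)) fun _ _ _ h => h
  · exact (hp h).runs.mono fun t s' _ h => ⟨by omega, h.2.2⟩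
  · exact (hq h).runs.mono fun t s' _ h => ⟨by omega, h.2.2⟩

/-! ### Programs without loops -/

/-- The effect of a program without loops. -/
@[simp] def Prog.run : Prog → State → State
  | .skip, s => s
  | .assign i e, s => s.setVar i (e.val s)
  | .store a i e, s => s.setArr a (i.val s) (e.val s)
  | .seq p q, s => q.run (p.run s)
  | .ite b p q, s => if b.val s = 0 then q.run s else p.run s
  | .while _ _, s => s

/-- All values read during a run of a program without loops are at most `M`. -/
@[simp] def Prog.Safe (M : ℕ) : Prog → State → Prop
  | .skip, _ => True
  | .assign _ e, s => e.Bdd M s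
  | .store _ i e, s => i.Bdd M s ∧ e.Bdd M s
  | .seq p q, s => p.Safe M s ∧ q.Safe M (p.run s)
  | .ite b p q, s => b.Bdd M s ∧ (b.val s = 0 → q.Safe M s) ∧ (b.val s ≠ 0 → p.Safe M s)
  | .while _ _, _ => False

/-- An upper bound for the running time of a program without loops. -/
def Prog.tmax : Prog → ℕ
  | .skip => 1
  | .assign _ e => e.cost + 1
  | .store _ i e => i.cost + e.cost + 1
  | .seq p q => p.tmax + q.tmax
  | .ite b p q => b.cost + 1 + max p.tmax q.tmax
  | .while _ _ => 0

/-- All expressions are short. -/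
def Prog.small : Prog → Bool
  | .skip => true
  | .assign _ e => e.cost ≤ 64
  | .store _ i e => i.cost ≤ 64 && e.cost ≤ 64
  | .seq p q => p.small && q.small
  | .ite b p q => b.cost ≤ 64 && p.small && q.small
  | .while _ _ => false

/-- This turns the verification of code without loops into simplification of the final state
`Prog.run`, an arithmetic check of `Prog.Safe`, and the evaluation of `Prog.tmax`. -/
theorem exec_run {W M : ℕ} (hB : Big W M) :
    ∀ (p : Prog) (s : State), p.small = true → p.Safe M s →
      ∃ t, t ≤ p.tmax ∧ Exec W p s t (p.run s) := by
  intro p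
  induction p with
  | skip => exact fun s _ _ => ⟨1, le_rfl, .skip s⟩
  | assign i e =>
    intro s hs h
    exact ⟨_, le_rfl, .assign i e s _ (Expr.eval_eq hB e h (by simpa [Prog.small] using hs)).1⟩
  | store a i e =>
    intro s hs h
    simp only [Prog.small, Bool.and_eq_true, decide_eq_true_eq] at hs
    exact ⟨_, le_rfl, .store a i e s _ _ (Expr.eval_eq hB i h.1 hs.1).1
      (Expr.eval_eq hB e h.2 hs.2).1⟩
  | seq p q ihp ihq =>
    intro s hs h
    simp only [Prog.small, Bool.and_eq_true] at hs
    obtain ⟨t, ht, hx⟩ := ihp s hs.1 h.1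
    obtain ⟨t', ht', hx'⟩ := ihq _ hs.2 h.2
    exact ⟨t + t', by simp only [Prog.tmax]; omega, .seq _ _ _ _ _ _ _ hx hx'⟩
  | ite b p q ihp ihq =>
    intro s hs h
    simp only [Prog.small, Bool.and_eq_true, decide_eq_true_eq] at hs
    have he := (Expr.eval_eq hB b h.1 hs.1.1).1
    by_cases h0 : b.val s = 0
    · obtain ⟨t, ht, hx⟩ := ihq s hs.2 (h.2.1 h0)
      refine ⟨b.cost + 1 + t, by simp only [Prog.tmax]; omega, ?_⟩
      simp only [Prog.run, h0, if_true]
      exact .ite_false b p q s _ t (h0 ▸ he) hx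
    · obtain ⟨t, ht, hx⟩ := ihp s hs.1.2 (h.2.2 h0)
      refine ⟨b.cost + 1 + t, by simp only [Prog.tmax]; omega, ?_⟩
      simp only [Prog.run, h0, if_false]
      exact .ite_true b p q s _ _ t he h0 hx
  | _ b p => intro s hs; simp [Prog.small] at hs

theorem hw_run {W M T : ℕ} (hB : Big W M) {p : Prog} {s : State} {post : State → Prop}
    (hs : p.small = true) (hT : p.tmax ≤ T) (h : p.Safe M s) (hp : post (p.run s)) :
    HaltsWithin W T p s post := by
  obtain ⟨t, ht, hx⟩ := exec_run hB p s hs h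
  exact ⟨t, _, ht.trans hT, hx, hp⟩

theorem runs_run {W M : ℕ} (hB : Big W M) {p : Prog} {s : State} {Q : ℕ → State → Prop}
    (hs : p.small = true) (h : p.Safe M s) (hp : ∀ t, t ≤ p.tmax → Q t (p.run s)) :
    Runs W p s Q := by
  obtain ⟨t, ht, hx⟩ := exec_run hB p s hs h
  exact ⟨t, _, hx, hp t ht⟩

/-! ### Loops -/

/-- Amortised analysis: the potential pays for every iteration including its test. As an iteration
takes positive time, the same potential proves termination. The surplus `b.cost + 1` is the last,
failing test. -/
theorem runs_while {W M : ℕ} (hB : Big W M) {b : Expr} {p : Prog} {s₀ : State}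
    (hc : b.cost ≤ 64) (Inv : State → Prop) (φ : State → ℕ) (h0 : Inv s₀)
    (hb : ∀ s, Frame (.while b p) s₀ s → Inv s → b.Bdd M s)
    (hstep : ∀ s, Frame (.while b p) s₀ s → Inv s → b.val s ≠ 0 →
      Runs W p s fun t s' => Inv s' ∧ t + (b.cost + 1) + φ s' ≤ φ s) :
    Runs W (.while b p) s₀ fun t s' =>
      Inv s' ∧ b.val s' = 0 ∧ t + φ s' ≤ φ s₀ + (b.cost + 1) := by
  have key : ∀ m s, φ s ≤ m → Frame (.while b p) s₀ s → Inv s →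
      Runs W (.while b p) s fun t s' =>
        Inv s' ∧ b.val s' = 0 ∧ t + φ s' ≤ φ s + (b.cost + 1) := by
    intro m
    induction m with
    | zero =>
      intro s hm hf hi
      have he := (Expr.eval_eq hB b (hb s hf hi) hc).1
      by_cases h : b.val s = 0
      · exact ⟨_, s, .while_false b p s (h ▸ he), hi, h, by omega⟩
      · obtain ⟨t, s', hx, hi', ht⟩ := hstep s hf hi h
        omega
    | succ m ih =>
      intro s hm hf hi
      have he := (Expr.eval_eq hB b (hb s hf hi) hc).1
      by_cases h : b.val s = 0
      · exact ⟨_, s, .while_false b p s (h ▸ he), hi, h, by omega⟩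
      · obtain ⟨t, s', hx, hi', ht⟩ := hstep s hf hi h
        have hf' : Frame (.while b p) s s' :=
          hx.frame.mono (by simp [Prog.wvars]) (by simp [Prog.warrs])
        obtain ⟨t', s'', hx', hi'', h'', ht'⟩ := ih s' (by omega) (hf.trans hf') hi'
        exact ⟨_, s'', .while_true b p s s' s'' _ t t' he h hx hx', hi'', h'', by omega⟩
  exact key _ _ le_rfl (Frame.refl _ _) h0

/-- `for i = 0, …, (register r) - 1 do p`. -/
def Prog.for (i r : ℕ) (p : Prog) : Prog :=
  i ≔ 0 ;; .while (♯i <! ♯r) (p ;; i ≔ ♯i + 1)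

/-- The 8 per iteration are 4 steps for the test and 4 for the increment; the 6 are 2 for the
initialisation and 4 for the final test. An iteration may exceed `Tb` by what it takes from `φ`. -/
theorem runs_for {W M : ℕ} (hB : Big W M) {i r K : ℕ} {p : Prog} {s : State} (hi : i ∉ p.wvars)
    (hr : r ∉ p.wvars) (hir : r ≠ i) (hK : s.var r = K) (hKM : K ≤ M)
    (Inv : ℕ → State → Prop) (φ : State → ℕ) (Tb : ℕ)
    (h0 : Inv 0 (s.setVar i 0))
    (hstep : ∀ k s', k < K → Frame (.for i r p) s s' → s'.var i = k → Inv k s' →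
      Runs W p s' fun t s'' => Inv (k + 1) (s''.setVar i (k + 1)) ∧
        t + φ (s''.setVar i (k + 1)) ≤ Tb + φ s') :
    Runs W (.for i r p) s fun t s' => Inv K s' ∧ s'.var i = K ∧
      t + φ s' ≤ K * (Tb + 8) + 6 + φ (s.setVar i 0) := by
  have hM : 32 ≤ M := hB.two
  refine runs_seq (Q := fun t s' => t ≤ 2 ∧ s' = s.setVar i 0)
    (runs_run hB rfl (by simp) (fun t ht => ⟨ht, rfl⟩)) ?_
  rintro t₀ s₁ hf₁ ⟨ht₀, rfl⟩
  have hwv : ∀ j, j ∉ (Prog.for i r p).wvars ↔ j ≠ i ∧ j ∉ p.wvars := by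
    intro j; simp only [Prog.for, Prog.wvars, List.mem_append, List.mem_singleton]; tauto
  have hrw : r ∉ (Prog.for i r p).wvars := (hwv r).2 ⟨hir, hr⟩
  have hf0 : Frame (.for i r p) s (s.setVar i 0) :=
    hf₁.mono (by simp [Prog.wvars, Prog.for]) (by simp [Prog.warrs])
  refine (runs_while hB (b := ♯i <! ♯r) (M := M) (by simp)
    (fun s' => Frame (.for i r p) s s' ∧ s'.var i ≤ K ∧ Inv (s'.var i) s')
    (fun s' => (K - s'.var i) * (Tb + 8) + φ s')
    ⟨hf0, by simp, by simpa using h0⟩ ?_ ?_).mono ?_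
  · rintro s' - ⟨hf, hle, -⟩
    have := hf.var r hrw
    simp only [Expr.Bdd]; omega
  · rintro s' - ⟨hf, hle, hI⟩ hlt
    have hrK : s'.var r = K := (hf.var r hrw).trans hK
    have hlt' : s'.var i < K := by
      by_contra hcon
      simp [hrK, hcon] at hlt
    refine runs_seq (hstep _ s' hlt' hf rfl hI) ?_
    rintro t s'' hf' ⟨hI', ht⟩
    have hieq : s''.var i = s'.var i := hf'.var i hi
    refine runs_run hB rfl (by simp [hieq]; omega) fun t' ht' => ?_
    have hrun : (Prog.assign i (♯i + 1)).run s'' = s''.setVar i (s'.var i + 1) := by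
      simp [hieq]
    rw [hrun]
    have hv : (s''.setVar i (s'.var i + 1)).var i = s'.var i + 1 := by simp
    have ht'' : t' ≤ 4 := ht'
    refine ⟨⟨hf.trans ?_, by rw [hv]; omega, by rw [hv]; exact hI'⟩, ?_⟩
    · constructor
      · intro j hj
        have := (hwv j).1 hj
        simp [this.1, hf'.var j this.2]
      · intro a ha
        exact hf'.arr a (by simpa [Prog.for, Prog.warrs] using ha)
    · rw [hv]
      have : (K - s'.var i) = (K - (s'.var i + 1)) + 1 := by omega
      rw [this, Nat.add_mul]
      simp only [Expr.cost]; omega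
  · rintro t s' - ⟨⟨hf, hle, hI⟩, h0', ht⟩
    have hrK : s'.var r = K := (hf.var r hrw).trans hK
    have hiK : s'.var i = K := by
      by_contra hcon
      have : s'.var i < K := by omega
      simp [hrK, this] at h0'
    refine ⟨by rwa [hiK] at hI, hiK, ?_⟩
    simp only [State.setVar_var, if_true, hiK, Expr.cost, Nat.sub_self, Nat.sub_zero,
      Nat.zero_mul] at ht
    omega

theorem hw_for {W M : ℕ} (hB : Big W M) {i r K T : ℕ} {p : Prog} {s : State}
    {post : State → Prop} (hi : i ∉ p.wvars)
    (hr : r ∉ p.wvars) (hir : r ≠ i) (hK : s.var r = K) (hKM : K ≤ M)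
    (Inv : ℕ → State → Prop) (Tb : ℕ)
    (h0 : Inv 0 (s.setVar i 0))
    (hstep : ∀ k s', k < K → Frame (.for i r p) s s' → s'.var i = k → Inv k s' →
      HaltsWithin W Tb p s' fun s'' => Inv (k + 1) (s''.setVar i (k + 1)))
    (hpost : ∀ s', Frame (.for i r p) s s' → s'.var i = K → Inv K s' → post s')
    (hT : K * (Tb + 8) + 6 ≤ T) :
    HaltsWithin W T (.for i r p) s post := by
  refine (runs_for hB hi hr hir hK hKM Inv (fun _ => 0) Tb h0 ?_).halts ?_
  · intro k s' hk hf hv hI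
    exact (hstep k s' hk hf hv hI).runs.mono fun t s'' _ h => ⟨h.2.2, by omega⟩
  · rintro t s' hf ⟨hI, hv, ht⟩
    exact ⟨by omega, hpost s' hf hv hI⟩

end RMIS

namespace RMIS

/-! ### Blocks of a graph -/

section Blocks

variable {V : Type} {G : SimpleGraph V}

/-- `x` and `y` are joined by a path of `G` inside `s`. -/
def ConnIn (G : SimpleGraph V) (s : Set V) : V → V → Prop :=
  Relation.ReflTransGen fun a b => G.Adj a b ∧ a ∈ s ∧ b ∈ s

theorem ConnIn.symm {s : Set V} {x y : V} (h : ConnIn G s x y) : ConnIn G s y x := by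
  induction h with
  | refl => exact .refl
  | tail _ h ih => exact .head ⟨h.1.symm, h.2.2, h.2.1⟩ ih

theorem ConnIn.trans {s : Set V} {x y z : V} (h : ConnIn G s x y) (h' : ConnIn G s y z) :
    ConnIn G s x z := Relation.ReflTransGen.trans h h'

theorem reflTransGen_mono {r p : V → V → Prop} (hrp : ∀ a b, r a b → p a b) {x y : V}
    (h : Relation.ReflTransGen r x y) : Relation.ReflTransGen p x y :=
  Relation.ReflTransGen.mono hrp _ _ h

theorem ConnIn.single {s : Set V} {x y : V} (h : G.Adj x y) (hx : x ∈ s) (hy : y ∈ s) :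
    ConnIn G s x y := Relation.ReflTransGen.single ⟨h, hx, hy⟩

theorem reachable_induce_iff {s : Set V} (x y : s) :
    (G.induce s).Reachable x y ↔ ConnIn G s x y := by
  rw [SimpleGraph.reachable_iff_reflTransGen]
  constructor
  · intro h
    induction h with
    | refl => exact .refl
    | @tail b c _ h ih => exact ih.trans (ConnIn.single h b.2 c.2)
  · intro h
    obtain ⟨y, hy⟩ := y
    change ConnIn G s x y at h
    induction h with
    | refl => exact .refl
    | @tail b c _ h ih => exact (ih h.2.1).tail (by exact h.1)

theorem subgraph_reachable_iff (K : G.Subgraph) (x y : K.verts) :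
    K.coe.Reachable x y ↔ Relation.ReflTransGen K.Adj x y := by
  rw [SimpleGraph.reachable_iff_reflTransGen]
  constructor
  · intro h
    induction h with
    | refl => exact .refl
    | tail _ h ih => exact ih.tail h
  · intro h
    obtain ⟨y, hy⟩ := y
    change Relation.ReflTransGen K.Adj x y at h
    induction h with
    | refl => exact .refl
    | @tail b c _ h ih => exact (ih h.fst_mem).tail (by exact h)

theorem subgraph_connected_iff (K : G.Subgraph) :
    K.Connected ↔
      K.verts.Nonempty ∧ ∀ x ∈ K.verts, ∀ y ∈ K.verts, Relation.ReflTransGen K.Adj x y := by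
  rw [SimpleGraph.Subgraph.connected_iff, SimpleGraph.Subgraph.preconnected_iff, and_comm]
  refine and_congr_right fun _ => ⟨fun h x hx y hy => ?_, fun h x y => ?_⟩
  · exact (subgraph_reachable_iff K ⟨x, hx⟩ ⟨y, hy⟩).1 (h _ _)
  · exact (subgraph_reachable_iff K x y).2 (h _ x.2 _ y.2)

/-- No third vertex separates `x` from `y`. -/
def Unsep (G : SimpleGraph V) (x y : V) : Prop := ∀ v, v ≠ x → v ≠ y → ConnIn G {v}ᶜ x y

theorem Unsep.refl (x : V) : Unsep G x x := fun _ _ _ => .refl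

theorem Unsep.symm {x y : V} (h : Unsep G x y) : Unsep G y x := fun v h1 h2 => (h v h2 h1).symm

theorem unsep_of_adj {x y : V} (h : G.Adj x y) : Unsep G x y :=
  fun _ h1 h2 => ConnIn.single h h1.symm h2.symm

/-- Blocks of `G` given by a rooted class structure: `cl x` is the name of the block in which `x` is
not the apex, `ap c` is the apex of the block named `c`. -/
structure BlockCert (G : SimpleGraph V) (r : V) (pos : V → ℕ) (cl ap : V → V) : Prop where
  pos_inj : Function.Injective pos
  root : ∀ x, cl x = r ↔ x = r
  cl_cl : ∀ x, cl (cl x) = cl x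
  ap_lt : ∀ x, x ≠ r → pos (ap (cl x)) < pos x
  clique : ∀ x y, x ≠ r → cl y = cl x → Unsep G x y
  clique_ap : ∀ x, x ≠ r → Unsep G x (ap (cl x))
  edge : ∀ x y, G.Adj x y → pos y < pos x → cl y = cl x ∨ y = ap (cl x)

/-- The vertices of the block named `c`. -/
def blk (cl ap : V → V) (c : V) : Set V := {x | cl x = c ∨ x = ap c}

/-- `c` is the name of a block. -/
def IsBlk (r : V) (cl : V → V) (c : V) : Prop := cl c = c ∧ c ≠ r

namespace BlockCert

variable {r : V} {pos : V → ℕ} {cl ap : V → V} (h : BlockCert G r pos cl ap)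
include h

/-- Passing to the apex of the class lowers the position as long as the vertex is not `r`, so the
climb ends at `r`. -/
theorem pos_root (x : V) : pos r ≤ pos x := by
  induction hn : pos x using Nat.strong_induction_on generalizing x with
  | _ n ih =>
    subst hn
    by_cases hx : x = r
    · rw [hx]
    · exact (ih _ (h.ap_lt x hx) _ rfl).trans (h.ap_lt x hx).le

theorem isBlk_cl {x : V} (hx : x ≠ r) : IsBlk r cl (cl x) :=
  ⟨h.cl_cl x, fun h' => hx ((h.root x).1 h')⟩

theorem ne_root_of_cl {c x : V} (hc : IsBlk r cl c) (hx : cl x = c) : x ≠ r := by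
  rintro rfl
  exact hc.2 (hx ▸ (h.root x).2 rfl)

theorem pos_ap_lt {c x : V} (hc : IsBlk r cl c) (hx : cl x = c) : pos (ap c) < pos x := by
  have := h.ap_lt x (h.ne_root_of_cl hc hx)
  rwa [hx] at this

theorem ap_ne {c : V} (hc : IsBlk r cl c) : ap c ≠ c := fun h' => by
  have := h.pos_ap_lt hc hc.1
  rw [h'] at this; omega

omit h in
theorem ap_mem (cl ap : V → V) (c : V) : ap c ∈ blk cl ap c := Or.inr rfl

omit h in
theorem self_mem {c : V} (hc : IsBlk r cl c) : c ∈ blk cl ap c := Or.inl hc.1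

theorem blk_unsep {c x y : V} (hc : IsBlk r cl c) (hx : x ∈ blk cl ap c) (hy : y ∈ blk cl ap c) :
    Unsep G x y := by
  rcases hx with hx | hx <;> rcases hy with hy | hy
  · exact h.clique x y (h.ne_root_of_cl hc hx) (hy.trans hx.symm)
  · subst hy hx; exact h.clique_ap x (h.ne_root_of_cl hc rfl)
  · subst hx hy; exact (h.clique_ap y (h.ne_root_of_cl hc rfl)).symm
  · subst hx; subst hy; exact Unsep.refl _

/-- The block is that of the later end, which cannot be the root; `edge` places the earlier end in
its class or at its apex. -/
theorem exists_blk_of_adj {x y : V} (hxy : G.Adj x y) :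
    ∃ c, IsBlk r cl c ∧ x ∈ blk cl ap c ∧ y ∈ blk cl ap c := by
  wlog hlt : pos y < pos x generalizing x y
  · have hne : pos x ≠ pos y := fun h' => hxy.ne (h.pos_inj h')
    obtain ⟨c, hc, h1, h2⟩ := this hxy.symm (by omega)
    exact ⟨c, hc, h2, h1⟩
  have hx : x ≠ r := by
    rintro rfl
    have := h.pos_root y; omega
  exact ⟨cl x, h.isBlk_cl hx, Or.inl rfl, h.edge x y hxy hlt⟩

open Classical in
/-- The retraction onto the block named `c`. -/
noncomputable def retr (h : BlockCert G r pos cl ap) (c x : V) : V :=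
  if cl x = c then x else if _ : x = r then ap c else retr h c (ap (cl x))
termination_by pos x
decreasing_by exact h.ap_lt x ‹_›

theorem retr_of_cl {c x : V} (hx : cl x = c) : h.retr c x = x := by
  rw [retr, if_pos hx]

theorem retr_root {c : V} (hc : IsBlk r cl c) : h.retr c r = ap c := by
  rw [retr, if_neg, dif_pos rfl]
  intro h'
  exact h.ne_root_of_cl hc h' rfl

theorem retr_step {c x : V} (hx : x ≠ r) (hc : cl x ≠ c) :
    h.retr c x = h.retr c (ap (cl x)) := by
  rw [retr, if_neg hc, dif_neg hx]

/-- Positions only fall during the climb, whereas all members of the class `c` come after `ap c`.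
The climb therefore misses the class and ends at `r`, which is sent to the apex. -/
theorem retr_of_pos_le {c x : V} (hc : IsBlk r cl c) (hx : pos x ≤ pos (ap c)) :
    h.retr c x = ap c := by
  induction hn : pos x using Nat.strong_induction_on generalizing x with
  | _ n ih =>
    subst hn
    by_cases hr : x = r
    · rw [hr, h.retr_root hc]
    · have hne : cl x ≠ c := fun h' => by have := h.pos_ap_lt hc h'; omega
      rw [h.retr_step hr hne]
      have := h.ap_lt x hr
      exact ih _ this (by omega) rfl

theorem retr_of_mem {c x : V} (hc : IsBlk r cl c) (hx : x ∈ blk cl ap c) : h.retr c x = x := by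
  rcases hx with hx | rfl
  · exact h.retr_of_cl hx
  · exact h.retr_of_pos_le hc le_rfl

theorem retr_mem {c : V} (hc : IsBlk r cl c) (x : V) : h.retr c x ∈ blk cl ap c := by
  induction hn : pos x using Nat.strong_induction_on generalizing x with
  | _ n ih =>
    subst hn
    by_cases h1 : cl x = c
    · rw [h.retr_of_cl h1]; exact Or.inl h1
    by_cases hr : x = r
    · rw [hr, h.retr_root hc]; exact ap_mem cl ap c
    · rw [h.retr_step hr h1]
      exact ih _ (h.ap_lt x hr) _ rfl

theorem retr_blk {c c' x : V} (hc' : IsBlk r cl c') (hne : c' ≠ c) (hx : x ∈ blk cl ap c') :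
    h.retr c x = h.retr c (ap c') := by
  rcases hx with hx | rfl
  · rw [h.retr_step (h.ne_root_of_cl hc' hx) (by rwa [hx]), hx]
  · rfl

theorem retr_eq_of_mem {c c' x y : V} (hc' : IsBlk r cl c') (hne : c' ≠ c)
    (hx : x ∈ blk cl ap c') (hy : y ∈ blk cl ap c') : h.retr c x = h.retr c y :=
  (h.retr_blk hc' hne hx).trans (h.retr_blk hc' hne hy).symm

/-- An edge lies in some block. If that block is not `c`, all its vertices have the image of its
apex, because the climb from any of them passes through it. -/
theorem retr_adj {x y : V} (c : V) (hxy : G.Adj x y) :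
    (x ∈ blk cl ap c ∧ y ∈ blk cl ap c) ∨ h.retr c x = h.retr c y := by
  obtain ⟨c', hc', hx, hy⟩ := h.exists_blk_of_adj hxy
  by_cases hne : c' = c
  · subst hne; exact Or.inl ⟨hx, hy⟩
  · exact Or.inr (h.retr_eq_of_mem hc' hne hx hy)

/-- The position of a vertex relative to a block can only change at that position. -/
theorem retr_stable {c z x y : V} (hc : IsBlk r cl c) (hz : h.retr c x = z)
    (hxy : ConnIn G {z}ᶜ x y) : h.retr c y = z := by
  induction hxy with
  | refl => exact hz
  | @tail a b _ hab ih =>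
    rcases h.retr_adj c hab.1 with ⟨h1, h2⟩ | h'
    · rw [h.retr_of_mem hc h1] at ih
      exact absurd ih hab.2.1
    · rw [← h', ih]

/-- The retraction onto `c` fixes the two common vertices but collapses every other block to a
point. -/
theorem blk_eq_of_two {c c' x y : V} (hc : IsBlk r cl c) (hc' : IsBlk r cl c') (hxy : x ≠ y)
    (hx : x ∈ blk cl ap c) (hx' : x ∈ blk cl ap c') (hy : y ∈ blk cl ap c)
    (hy' : y ∈ blk cl ap c') : c = c' := by
  by_contra hne
  have := h.retr_eq_of_mem hc' (Ne.symm hne) hx' hy'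
  rw [h.retr_of_mem hc hx, h.retr_of_mem hc hy] at this
  exact hxy this

/-- A path of `G` that avoids `v` is retracted to the block. The image moves only along edges inside
the block, whose ends are vertices of the path, so it avoids `v` as well. -/
theorem connIn_blk {c v x y : V} (hc : IsBlk r cl c) (hx : x ∈ blk cl ap c)
    (hy : y ∈ blk cl ap c) (hvx : v ≠ x) (hvy : v ≠ y) :
    ConnIn G (blk cl ap c \ {v}) x y := by
  have key : ∀ y', ConnIn G {v}ᶜ x y' →
      h.retr c y' ≠ v ∧ ConnIn G (blk cl ap c \ {v}) x (h.retr c y') := by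
    intro y' hy'
    induction hy' with
    | refl => rw [h.retr_of_mem hc hx]; exact ⟨hvx.symm, .refl⟩
    | @tail a b _ hab ih =>
      rcases h.retr_adj c hab.1 with ⟨h1, h2⟩ | h'
      · rw [h.retr_of_mem hc h1] at ih
        rw [h.retr_of_mem hc h2]
        exact ⟨hab.2.2, ih.2.trans (ConnIn.single hab.1 ⟨h1, hab.2.1⟩ ⟨h2, hab.2.2⟩)⟩
      · rwa [← h']
  have := (key y (h.blk_unsep hc hx hy v hvx hvy)).2
  rwa [h.retr_of_mem hc hy] at this

omit h in
theorem exists_third {c x y : V} (hc : 3 ≤ (blk cl ap c).ncard) :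
    ∃ z ∈ blk cl ap c, z ≠ x ∧ z ≠ y := by
  by_contra hcon
  push Not at hcon
  have hsub : blk cl ap c ⊆ {x, y} := fun z hz => by
    by_cases hzx : z = x
    · exact Or.inl hzx
    · exact Or.inr (hcon z hz hzx)
  have := (Set.ncard_le_ncard hsub (Set.toFinite _)).trans (Set.ncard_insert_le x {y})
  simp at this; omega

theorem isBiconnected_blk {c : V} (hc : IsBlk r cl c) (h3 : 3 ≤ (blk cl ap c).ncard) :
    IsBiconnected ((⊤ : G.Subgraph).induce (blk cl ap c)) := by
  have hadj : ∀ v x y, ConnIn G (blk cl ap c \ {v}) x y → Relation.ReflTransGen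
      (((⊤ : G.Subgraph).induce (blk cl ap c)).deleteVerts {v}).Adj x y := by
    intro v x y hxy
    refine reflTransGen_mono (fun a b hab => ?_) hxy
    exact ⟨hab.2.1, hab.2.2, hab.2.1.1, hab.2.2.1, hab.1⟩
  refine ⟨h3, (subgraph_connected_iff _).2 ⟨⟨c, self_mem hc⟩, fun x hx y hy => ?_⟩,
    fun v hv => (subgraph_connected_iff _).2 ⟨?_, fun x hx y hy => ?_⟩⟩
  -- The connectedness of the whole block is inherited from the block without some third vertex.
  · obtain ⟨v, hv, hvx, hvy⟩ := exists_third (x := x) (y := y) h3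
    refine reflTransGen_mono (fun a b hab => ?_)
      (hadj v x y (h.connIn_blk hc hx hy hvx hvy))
    exact (SimpleGraph.Subgraph.deleteVerts_adj.1 hab).2.2.2.2
  · obtain ⟨x, hx, hxv, -⟩ := exists_third (x := v) (y := v) h3
    exact ⟨x, by simpa using ⟨hx, hxv⟩⟩
  · simp only [SimpleGraph.Subgraph.induce_verts] at hx hy
    exact hadj v x y (h.connIn_blk hc hx.1 hy.1 (Ne.symm hx.2) (Ne.symm hy.2))

/-- Take the block of an edge of `K`, and suppose that a vertex of `K` lies outside of it, with
image `z`. Since `K` stays connected without `z`, all of `K` except perhaps `z` has image `z`. The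
ends of the edge are their own images, so both equal `z`, which is absurd. -/
theorem verts_subset_of_isBiconnected {K : G.Subgraph} (hK : IsBiconnected K) :
    ∃ c, IsBlk r cl c ∧ K.verts ⊆ blk cl ap c := by
  obtain ⟨h3, hconn, hdel⟩ := hK
  rw [subgraph_connected_iff] at hconn
  have hfin : K.verts.Finite := Set.finite_of_ncard_pos (by omega)
  obtain ⟨x, y, hx, hy, hxy⟩ := (Set.one_lt_ncard_iff hfin).1 (by omega)
  obtain ⟨u, w, huw⟩ : ∃ u w, K.Adj u w := by
    rcases Relation.ReflTransGen.cases_head (hconn.2 x hx y hy) with h' | ⟨w, h', -⟩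
    · exact absurd h' hxy
    · exact ⟨x, w, h'⟩
  obtain ⟨c, hc, huc, hwc⟩ := h.exists_blk_of_adj huw.adj_sub
  refine ⟨c, hc, fun v hv => ?_⟩
  by_contra hvc
  set z := h.retr c v with hz
  have hzv : z ≠ v := fun h' => hvc (h' ▸ h.retr_mem hc v)
  have key : ∀ t ∈ K.verts, t ≠ z → h.retr c t = z := by
    intro t ht htz
    refine h.retr_stable hc hz.symm ?_
    -- If `z` is not in `K`, then paths in `K` avoid it without any deletion.
    by_cases hzK : z ∈ K.verts
    · have := ((subgraph_connected_iff _).1 (hdel z hzK)).2 v (by simpa using ⟨hv, hzv.symm⟩) t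
        (by simpa using ⟨ht, htz⟩)
      refine reflTransGen_mono (fun a b hab => ?_) this
      rw [SimpleGraph.Subgraph.deleteVerts_adj] at hab
      exact ⟨hab.2.2.2.2.adj_sub, hab.2.1, hab.2.2.2.1⟩
    · refine reflTransGen_mono (fun a b hab => ?_) (hconn.2 v hv t ht)
      exact ⟨hab.adj_sub, fun h' => hzK (h' ▸ hab.fst_mem), fun h' => hzK (h' ▸ hab.snd_mem)⟩
  have hu : u = z := by
    by_contra hne
    exact hne ((h.retr_of_mem hc huc).symm.trans (key u huw.fst_mem hne))
  have hw : w = z := by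
    by_contra hne
    exact hne ((h.retr_of_mem hc hwc).symm.trans (key w huw.snd_mem hne))
  exact huw.ne (hu.trans hw.symm)

/-- Large blocks are biconnected, every biconnected subgraph lies in one block, and distinct blocks
share at most one vertex. Hence the maximal biconnected subgraphs are the large blocks with all
their edges. -/
theorem isBiconnectedComponent_iff [Finite V] (K : G.Subgraph) :
    IsBiconnectedComponent K ↔ ∃ c, IsBlk r cl c ∧ 3 ≤ (blk cl ap c).ncard ∧
      K = (⊤ : G.Subgraph).induce (blk cl ap c) := by
  have hle : ∀ (K : G.Subgraph) c, K.verts ⊆ blk cl ap c →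
      K ≤ (⊤ : G.Subgraph).induce (blk cl ap c) := fun K c hs =>
    ⟨hs, fun a b hab => ⟨hs hab.fst_mem, hs hab.snd_mem, hab.adj_sub⟩⟩
  constructor
  · intro hK
    obtain ⟨c, hc, hs⟩ := h.verts_subset_of_isBiconnected hK.1
    have h3 : 3 ≤ (blk cl ap c).ncard := hK.1.1.trans (Set.ncard_le_ncard hs (Set.toFinite _))
    exact ⟨c, hc, h3, le_antisymm (hle K c hs) (hK.2 (h.isBiconnected_blk hc h3) (hle K c hs))⟩
  · rintro ⟨c, hc, h3, rfl⟩
    refine ⟨h.isBiconnected_blk hc h3, fun K hK hcK => ?_⟩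
    obtain ⟨c', hc', hs⟩ := h.verts_subset_of_isBiconnected hK
    have hsub : blk cl ap c ⊆ blk cl ap c' := hcK.1.trans hs
    have : c = c' := h.blk_eq_of_two hc hc' (h.ap_ne hc).symm (self_mem hc) (hsub (self_mem hc))
      (ap_mem cl ap c) (hsub (ap_mem cl ap c))
    subst this
    exact hle K c hs

/-- If `v` lies in one block only, a path through `v` enters and leaves it within this block and can
be rerouted around `v`. If `v` lies in two blocks, the retraction onto one of them sends the rest of
the other to `v`, and this value cannot change along paths avoiding `v`. -/
theorem isArticulation_iff (hG : G.Connected) (v : V) :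
    IsArticulation G v ↔ ∃ c c', c ≠ c' ∧ IsBlk r cl c ∧ IsBlk r cl c' ∧
      v ∈ blk cl ap c ∧ v ∈ blk cl ap c' := by
  constructor
  · intro hv
    by_contra hcon
    push Not at hcon
    refine hv fun x y => (reachable_induce_iff x y).2 ?_
    have hpath := (SimpleGraph.reachable_iff_reflTransGen _ _).1 (hG.preconnected x.1 y.1)
    -- When the path stands at `v`, the neighbour through which it came is remembered as the start
    -- of the detour.
    have key : ∀ y, Relation.ReflTransGen G.Adj x.1 y →
        (y ≠ v → ConnIn G {v}ᶜ x.1 y) ∧ (y = v → ∃ a, G.Adj a v ∧ ConnIn G {v}ᶜ x.1 a) := by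
      intro y hy
      induction hy with
      | refl => exact ⟨fun _ => .refl, fun h' => absurd h' x.2⟩
      | @tail a b _ hab ih =>
        by_cases ha : a = v
        · subst ha
          obtain ⟨a', ha', hc'⟩ := ih.2 rfl
          refine ⟨fun hb => hc'.trans ?_, fun hb => absurd hb hab.ne'⟩
          obtain ⟨c, hc, h1, h2⟩ := h.exists_blk_of_adj ha'
          obtain ⟨d, hd, h3, h4⟩ := h.exists_blk_of_adj hab
          have : c = d := by
            by_contra hne
            exact hcon c d hne hc hd h2 h3
          subst this
          exact h.blk_unsep hc h1 h4 a ha'.ne' hb.symm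
        · exact ⟨fun hb => (ih.1 ha).trans (ConnIn.single hab ha hb), fun hb => ⟨a, hb ▸ hab, ih.1 ha⟩⟩
    exact (key y hpath).1 y.2
  · rintro ⟨c, c', hne, hc, hc', hv, hv'⟩ hpre
    have other : ∀ c, IsBlk r cl c → ∃ x ∈ blk cl ap c, x ≠ v := by
      intro c hc
      by_cases hcv : c = v
      · exact ⟨ap c, ap_mem cl ap c, hcv ▸ h.ap_ne hc⟩
      · exact ⟨c, self_mem hc, hcv⟩
    obtain ⟨x, hx, hxv⟩ := other c hc
    obtain ⟨y, hy, hyv⟩ := other c' hc'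
    have h1 : h.retr c y = v := by
      rw [h.retr_eq_of_mem hc' hne.symm hy hv', h.retr_of_mem hc hv]
    have h2 := (reachable_induce_iff ⟨y, hyv⟩ ⟨x, hxv⟩).1 (hpre _ _)
    have h3 := h.retr_stable hc h1 h2
    rw [h.retr_of_mem hc hx] at h3
    exact hxv h3

/-- A path from `c` to its apex retracts to a path inside the two-point block, which must use the
edge between the two points. -/
theorem adj_of_blk_pair (hG : G.Connected) {c : V} (hc : IsBlk r cl c) (h3 : ¬ 3 ≤ (blk cl ap c).ncard) [Finite V] :
    blk cl ap c = {c, ap c} ∧ G.Adj c (ap c) := by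
  have hsub : ({c, ap c} : Set V) ⊆ blk cl ap c := by
    rintro x (rfl | rfl)
    · exact self_mem hc
    · exact ap_mem cl ap c
  have hcard : ({c, ap c} : Set V).ncard = 2 := Set.ncard_pair (h.ap_ne hc).symm
  have heq : blk cl ap c = {c, ap c} :=
    (Set.eq_of_subset_of_ncard_le hsub (by omega) (Set.toFinite _)).symm
  refine ⟨heq, ?_⟩
  by_contra hna
  have hpath : Relation.ReflTransGen (fun a b => G.Adj a b ∧ a ∈ blk cl ap c ∧ b ∈ blk cl ap c)
      c (ap c) := by
    have key : ∀ y, Relation.ReflTransGen G.Adj c y →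
        ConnIn G (blk cl ap c) c (h.retr c y) := by
      intro y hy
      induction hy with
      | refl => rw [h.retr_of_cl hc.1]; exact .refl
      | @tail a b _ hab ih =>
        rcases h.retr_adj c hab with ⟨h1, h2⟩ | h'
        · rw [h.retr_of_mem hc h1] at ih
          rw [h.retr_of_mem hc h2]
          exact ih.trans (ConnIn.single hab h1 h2)
        · rwa [← h']
    have := key (ap c) ((SimpleGraph.reachable_iff_reflTransGen _ _).1 (hG.preconnected c (ap c)))
    rwa [h.retr_of_mem hc (ap_mem cl ap c)] at this
  rcases Relation.ReflTransGen.cases_head hpath with h' | ⟨w, ⟨ha, -, hw⟩, -⟩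
  · exact h.ap_ne hc h'.symm
  · rw [heq] at hw
    rcases hw with rfl | rfl
    · exact ha.ne rfl
    · exact hna ha

/-- A third vertex `z` of the block of an edge gives a detour: to `z` avoiding one end, then onwards
avoiding the other. Conversely, once the edge of a two-point block is deleted, the retraction keeps
the value `c` along all paths from `c`. -/
theorem isBridgeEdge_iff [Finite V] (hG : G.Connected) (e : Sym2 V) :
    IsBridgeEdge G e ↔ ∃ c, IsBlk r cl c ∧ ¬ 3 ≤ (blk cl ap c).ncard ∧ e = s(c, ap c) := by
  constructor
  · rintro ⟨he, hbr⟩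
    induction e with | _ u w =>
    rw [SimpleGraph.mem_edgeSet] at he
    obtain ⟨c, hc, hu, hw⟩ := h.exists_blk_of_adj he
    have h3 : ¬ 3 ≤ (blk cl ap c).ncard := by
      intro h3
      obtain ⟨z, hz, hzu, hzw⟩ := exists_third (x := u) (y := w) h3
      rw [SimpleGraph.isBridge_iff, SimpleGraph.reachable_iff_reflTransGen] at hbr
      refine hbr (Relation.ReflTransGen.trans (b := z) ?_ ?_)
      · refine reflTransGen_mono (fun a b hab => ?_) (h.blk_unsep hc hu hz w he.ne' hzw.symm)
        have h1 : a ≠ w := hab.2.1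
        have h2 : b ≠ w := hab.2.2
        simp [hab.1, h1, h2]
      · refine reflTransGen_mono (fun a b hab => ?_) (h.blk_unsep hc hz hw u hzu.symm he.ne)
        have h1 : a ≠ u := hab.2.1
        have h2 : b ≠ u := hab.2.2
        simp [hab.1, h1, h2]
    have heq := (h.adj_of_blk_pair hG hc h3).1
    refine ⟨c, hc, h3, ?_⟩
    rw [heq] at hu hw
    have := he.ne
    rcases hu with rfl | rfl <;> rcases hw with rfl | rfl
    · exact absurd rfl this
    · rfl
    · exact Sym2.eq_swap
    · exact absurd rfl this
  · rintro ⟨c, hc, h3, rfl⟩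
    obtain ⟨heq, hadj⟩ := h.adj_of_blk_pair hG hc h3
    refine ⟨hadj, ?_⟩
    rw [SimpleGraph.isBridge_iff, SimpleGraph.reachable_iff_reflTransGen]
    intro hp
    have key : ∀ y, Relation.ReflTransGen (G.deleteEdges {s(c, ap c)}).Adj c y →
        h.retr c y = c := by
      intro y hy
      induction hy with
      | refl => exact h.retr_of_cl hc.1
      | @tail a b _ hab ih =>
        rw [SimpleGraph.deleteEdges_adj] at hab
        rcases h.retr_adj c hab.1 with ⟨h1, h2⟩ | h'
        · exfalso
          rw [h.retr_of_mem hc h1] at ih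
          subst ih
          rw [heq] at h2
          rcases h2 with rfl | rfl
          · exact hab.1.ne rfl
          · exact hab.2 rfl
        · rw [← h', ih]
    have := key _ hp
    rw [h.retr_of_mem hc (ap_mem cl ap c)] at this
    exact h.ap_ne hc this

/-- In a larger block the only neighbour of `v` would separate it from a third vertex. -/
theorem isPendant_blk [Finite V] {v c : V} (hv : IsPendant G v) (hc : IsBlk r cl c)
    (hvc : v ∈ blk cl ap c) : ¬ 3 ≤ (blk cl ap c).ncard := by
  intro h3
  obtain ⟨w, hw⟩ := Set.ncard_eq_one.1 hv
  obtain ⟨z, hz, hzv, hzw⟩ := exists_third (x := v) (y := w) h3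
  have hvw : w ≠ v := by
    have : w ∈ G.neighborSet v := hw ▸ rfl
    exact (show G.Adj v w from this).ne'
  rcases Relation.ReflTransGen.cases_head (h.blk_unsep hc hvc hz w hvw hzw.symm) with h' | ⟨t, h', -⟩
  · exact hzv h'.symm
  · have : t ∈ G.neighborSet v := h'.1
    rw [hw] at this
    exact h'.2.2 this

/-- A second neighbour of `v` does not fit into a block of two vertices, so the edge to it lies in
another block. -/
theorem pendant_or_two_blks [Finite V] (hG : G.Connected) {c v : V} (hc : IsBlk r cl c)
    (h3 : ¬ 3 ≤ (blk cl ap c).ncard) (hv : v ∈ blk cl ap c) :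
    IsPendant G v ∨ IsArticulation G v := by
  obtain ⟨heq, hadj⟩ := h.adj_of_blk_pair hG hc h3
  by_cases hp : IsPendant G v
  · exact Or.inl hp
  refine Or.inr ?_
  obtain ⟨w, hw, hvw⟩ : ∃ w ∈ blk cl ap c, G.Adj v w := by
    have hv' := hv
    rw [heq] at hv'
    rcases hv' with rfl | rfl
    · exact ⟨_, ap_mem cl ap v, hadj⟩
    · exact ⟨_, self_mem hc, hadj.symm⟩
  obtain ⟨u, hu, huw⟩ : ∃ u ∈ G.neighborSet v, u ≠ w := by
    by_contra hcon
    push Not at hcon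
    exact hp (Set.ncard_eq_one.2 ⟨w, Set.eq_singleton_iff_unique_mem.2 ⟨hvw, hcon⟩⟩)
  obtain ⟨d, hd, hvd, hud⟩ := h.exists_blk_of_adj (show G.Adj v u from hu)
  refine (h.isArticulation_iff hG v).2 ⟨c, d, ?_, hc, hd, hv, hvd⟩
  rintro rfl
  rw [heq] at hv hw hud
  have h1 := hvw.ne
  have h2 := (show G.Adj v u from hu).ne
  simp only [Set.mem_insert_iff, Set.mem_singleton_iff] at hv hw hud
  rcases hv with rfl | rfl <;> rcases hw with rfl | rfl <;> rcases hud with rfl | rfl <;>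
    first | exact h1 rfl | exact h2 rfl | exact huw rfl

omit h in
theorem isMIS_iff (H : SimpleGraph V) (S : Set V) :
    IsMIS H S ↔ H.IsIndepSet S ∧ ∀ v, v ∉ S → ∃ w ∈ S, H.Adj v w := by
  constructor
  · intro hS
    refine ⟨hS.1, fun v hv => ?_⟩
    by_contra hcon
    push Not at hcon
    have hind : H.IsIndepSet (insert v S) := by
      refine Set.pairwise_insert.2
        ⟨hS.1, fun w hw _ => ⟨hcon w hw, fun h' => hcon w hw h'.symm⟩⟩
    exact hv (hS.2 hind (Set.subset_insert v S) (Set.mem_insert v S))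
  · rintro ⟨hS, hdom⟩
    refine ⟨hS, fun T hT hST v hv => ?_⟩
    by_contra hvS
    obtain ⟨w, hw, hvw⟩ := hdom v hvS
    exact hT hv (hST hw) hvw.ne hvw

/-- A connected spanning subgraph cannot remove all edges that `v` has in a block, but in each block
it may keep just one of them. So an adversary can undominate `v` exactly when every block at `v`
offers a neighbour outside of `S`. -/
theorem isRobustMIS_iff (hG : G.Connected) (S : Set V) :
    IsRobustMIS G S ↔ G.IsIndepSet S ∧ ∀ v, v ∉ S → ∃ c, IsBlk r cl c ∧ v ∈ blk cl ap c ∧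
      ∀ w ∈ blk cl ap c, G.Adj v w → w ∈ S := by
  constructor
  · intro hS
    refine ⟨(hS G le_rfl hG).1, fun v hv => ?_⟩
    by_contra hcon
    push Not at hcon
    -- The adversary's subgraph: `v` loses all its edges to `S`, so it is undominated. It remains to
    -- see that the subgraph is connected.
    set H : SimpleGraph V := G.deleteEdges {e | ∃ w ∈ S, e = s(v, w)} with hH
    have hadj : ∀ a b, G.Adj a b → a ≠ v → b ≠ v → H.Adj a b := by
      intro a b hab ha hb
      rw [hH, SimpleGraph.deleteEdges_adj]
      refine ⟨hab, ?_⟩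
      rintro ⟨w, -, he⟩
      rw [Sym2.eq_iff] at he
      rcases he with ⟨h1, -⟩ | ⟨-, h1⟩
      · exact ha h1
      · exact hb h1
    have hadj' : ∀ w, G.Adj v w → w ∉ S → H.Adj v w := by
      intro w hw hwS
      rw [hH, SimpleGraph.deleteEdges_adj]
      refine ⟨hw, ?_⟩
      rintro ⟨w', hw', he⟩
      rw [Sym2.congr_right] at he
      exact hwS (he ▸ hw')
    have hreach : ∀ w, H.Reachable v w := by
      intro w
      by_cases hwv : w = v
      · rw [hwv]
      have hpath := (SimpleGraph.reachable_iff_reflTransGen _ _).1 (hG.preconnected v w)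
      induction hpath with
      | refl => exact .rfl
      | @tail a b _ hab ih =>
        by_cases hav : a = v
        · subst hav
          -- A deleted edge from `v` to `b` is bypassed inside its block, via a neighbour `u`
          -- outside of `S` and a path from `u` to `b` that avoids `v`.
          obtain ⟨c, hc, h1, h2⟩ := h.exists_blk_of_adj hab
          obtain ⟨u, hu, hau, huS⟩ := hcon c hc h1
          refine (hadj' u hau huS).reachable.trans ?_
          rw [SimpleGraph.reachable_iff_reflTransGen]
          exact reflTransGen_mono (fun x y hxy => hadj x y hxy.1 hxy.2.1 hxy.2.2)
            (h.blk_unsep hc hu h2 a hau.ne (Ne.symm hwv))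
        · exact (ih hav).trans (hadj a b hab hav hwv).reachable
    have hconn : H.Connected := by
      rw [SimpleGraph.connected_iff_exists_forall_reachable]
      exact ⟨v, hreach⟩
    obtain ⟨w, hw, hvw⟩ := ((isMIS_iff H S).1
      (hS H (SimpleGraph.deleteEdges_le _) hconn)).2 v hv
    rw [hH, SimpleGraph.deleteEdges_adj] at hvw
    exact hvw.2 ⟨w, hw, rfl⟩
  · rintro ⟨hS, hdom⟩ H hH hconn
    refine (isMIS_iff H S).2 ⟨fun a ha b hb hab hadj => hS ha hb hab (hH hadj), fun v hv => ?_⟩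
    obtain ⟨c, hc, hvc, hw⟩ := hdom v hv
    by_contra hcon
    push Not at hcon
    -- If `v` has no neighbour in `S` left, it has no edge of this block left. Then the retraction
    -- sends all that `v` reaches to `v`, including the other vertices of the block.
    have key : ∀ y, Relation.ReflTransGen H.Adj v y → h.retr c y = v := by
      intro y hy
      induction hy with
      | refl => exact h.retr_of_mem hc hvc
      | @tail a b _ hab ih =>
        rcases h.retr_adj c (hH hab) with ⟨h1, h2⟩ | h'
        · rw [h.retr_of_mem hc h1] at ih
          subst ih
          exact absurd hab (hcon b (hw b h2 (hH hab)))
        · rw [← h', ih]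
    have key' : ∀ y ∈ blk cl ap c, y = v := fun y hy => by
      rw [← key y ((SimpleGraph.reachable_iff_reflTransGen _ _).1 (hconn.preconnected v y)),
        h.retr_of_mem hc hy]
    exact h.ap_ne hc ((key' _ (ap_mem cl ap c)).trans (key' c (self_mem hc)).symm)

end BlockCert

end Blocks

end RMIS

/-! ### The nodes of the ABC-tree and its tree structure -/

namespace RMIS

section Nodes

variable {V : Type} {G : SimpleGraph V}

/-- The node is a bridge or a biconnected component. -/
def Node.IsBlock : Node G → Prop
  | .pendant _ _ => False
  | .artic _ _ => False
  | .bridge _ _ => True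
  | .comp _ _ => True

/-- The node is the articulation point or pendant vertex `v`. -/
def Node.IsVertex (v : V) : Node G → Prop
  | .pendant u _ => v = u
  | .artic u _ => v = u
  | .bridge _ _ => False
  | .comp _ _ => False

theorem Node.block_or_vertex (x : Node G) : x.IsBlock ∨ ∃ v, x.IsVertex v := by
  cases x with
  | pendant v _ => exact Or.inr ⟨v, rfl⟩
  | artic v _ => exact Or.inr ⟨v, rfl⟩
  | bridge _ _ => exact Or.inl trivial
  | comp _ _ => exact Or.inl trivial

theorem Node.IsVertex.not_block {x : Node G} {v : V} (h : x.IsVertex v) : ¬ x.IsBlock := by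
  cases x <;> simp_all [Node.IsVertex, Node.IsBlock]

theorem Node.IsVertex.verts {x : Node G} {v : V} (h : x.IsVertex v) : x.verts = {v} := by
  cases x <;> simp_all [Node.IsVertex, Node.verts]

/-- The facts about the blocks of a connected graph on which the algorithms rely. -/
structure BlockFacts (G : SimpleGraph V) : Prop where
  edge : ∀ u w, G.Adj u w → ∃ X : Node G, X.IsBlock ∧ u ∈ X.verts ∧ w ∈ X.verts
  artic : ∀ (X Y : Node G) v, X.IsBlock → Y.IsBlock → X ≠ Y → v ∈ X.verts → v ∈ Y.verts →
    IsArticulation G v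
  tree_adj : ∀ x y : Node G, (abcTree G).Adj x y ↔
    (∃ v, x.IsVertex v ∧ y.IsBlock ∧ v ∈ y.verts) ∨ (∃ v, y.IsVertex v ∧ x.IsBlock ∧ v ∈ x.verts)
  acyclic : (abcTree G).IsAcyclic
  preconnected : (abcTree G).Preconnected
  robust : ∀ S : Set V, IsRobustMIS G S ↔ G.IsIndepSet S ∧ ∀ v, v ∉ S →
    ∃ X : Node G, X.IsBlock ∧ v ∈ X.verts ∧ ∀ w ∈ X.verts, G.Adj v w → w ∈ S
  bridge_vert : ∀ e (_ : IsBridgeEdge G e) v, v ∈ e → IsPendant G v ∨ IsArticulation G v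
  not_both : ∀ v, IsPendant G v → ¬ IsArticulation G v
  comp_adj : ∀ (H : G.Subgraph), IsBiconnectedComponent H → ∀ u w,
    H.Adj u w ↔ u ∈ H.verts ∧ w ∈ H.verts ∧ G.Adj u w
  finite : Finite (Node G)
  card_le : Nat.card (Node G) ≤ 4 * Nat.card V

namespace BlockCert

variable {r : V} {pos : V → ℕ} {cl ap : V → V} (h : BlockCert G r pos cl ap)
include h

open Classical in
/-- The node of type `k` given by the vertex or block name `v`. -/
noncomputable def nodeOf [Finite V] (h : BlockCert G r pos cl ap) (hG : G.Connected) (k : Fin 4)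
    (v : V) : Option (Node G) :=
  match k with
  | 0 => if hv : IsPendant G v then some (.pendant v hv) else none
  | 1 => if hv : IsArticulation G v then some (.artic v hv) else none
  | 2 => if hv : IsBlk r cl v ∧ ¬ 3 ≤ (blk cl ap v).ncard then
      some (.bridge s(v, ap v) ((h.isBridgeEdge_iff hG _).2 ⟨v, hv.1, hv.2, rfl⟩)) else none
  | 3 => if hv : IsBlk r cl v ∧ 3 ≤ (blk cl ap v).ncard then
      some (.comp _ ((h.isBiconnectedComponent_iff _).2 ⟨v, hv.1, hv.2, rfl⟩)) else none

variable [Finite V] (hG : G.Connected)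
include hG

theorem nodeOf_surj (x : Node G) : ∃ k v, h.nodeOf hG k v = some x := by
  cases x with
  | pendant v hv => exact ⟨0, v, by simp [nodeOf, hv]⟩
  | artic v hv => exact ⟨1, v, by simp [nodeOf, hv]⟩
  | bridge e he =>
    obtain ⟨c, hc, h3, rfl⟩ := (h.isBridgeEdge_iff hG e).1 he
    exact ⟨2, c, by rw [nodeOf, dif_pos ⟨hc, h3⟩]⟩
  | comp H hH =>
    obtain ⟨c, hc, h3, rfl⟩ := (h.isBiconnectedComponent_iff H).1 hH
    exact ⟨3, c, by rw [nodeOf, dif_pos ⟨hc, h3⟩]⟩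

theorem nodeOf_spec {k : Fin 4} {v : V} {x : Node G} (hx : h.nodeOf hG k v = some x) :
    x.kind = k ∧ ((k = 0 ∧ IsPendant G v ∧ x.IsVertex v) ∨
      (k = 1 ∧ IsArticulation G v ∧ x.IsVertex v) ∨
      (k = 2 ∧ IsBlk r cl v ∧ ¬ 3 ≤ (blk cl ap v).ncard ∧ x.IsBlock ∧ x.verts = blk cl ap v) ∨
      (k = 3 ∧ IsBlk r cl v ∧ 3 ≤ (blk cl ap v).ncard ∧ x.IsBlock ∧ x.verts = blk cl ap v)) := by
  have hbr : ∀ c, IsBlk r cl c → ¬ 3 ≤ (blk cl ap c).ncard →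
      {w | w ∈ s(c, ap c)} = blk cl ap c := by
    intro c hc h3
    rw [(h.adj_of_blk_pair hG hc h3).1]
    ext w; simp
  match k with
  | 0 =>
    simp only [nodeOf] at hx; split_ifs at hx with hv
    cases hx
    exact ⟨rfl, Or.inl ⟨rfl, hv, rfl⟩⟩
  | 1 =>
    simp only [nodeOf] at hx; split_ifs at hx with hv
    cases hx
    exact ⟨rfl, Or.inr (Or.inl ⟨rfl, hv, rfl⟩)⟩
  | 2 =>
    simp only [nodeOf] at hx; split_ifs at hx with hv
    cases hx
    exact ⟨rfl, Or.inr (Or.inr (Or.inl ⟨rfl, hv.1, hv.2, trivial, hbr v hv.1 hv.2⟩))⟩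
  | 3 =>
    simp only [nodeOf] at hx; split_ifs at hx with hv
    cases hx
    exact ⟨rfl, Or.inr (Or.inr (Or.inr ⟨rfl, hv.1, hv.2, trivial, rfl⟩))⟩

/-- The pair of type and vertex (or block name) is a faithful code of the node: a block determines
its name because distinct blocks share at most one vertex. These codes also give the bound on the
number of nodes. -/
theorem nodeOf_inj {k k' : Fin 4} {v v' : V} {x : Node G} (hx : h.nodeOf hG k v = some x)
    (hx' : h.nodeOf hG k' v' = some x) : k = k' ∧ v = v' := by
  obtain ⟨hk, h1⟩ := h.nodeOf_spec hG hx
  obtain ⟨hk', h2⟩ := h.nodeOf_spec hG hx'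
  have hkk : k = k' := Fin.ext (hk.symm.trans hk')
  refine ⟨hkk, ?_⟩
  subst hkk
  have hvt : x.IsVertex v → x.IsVertex v' → v = v' := fun a b => by
    have := a.verts.symm.trans b.verts
    simpa using this
  have hbl : IsBlk r cl v → IsBlk r cl v' → x.verts = blk cl ap v → x.verts = blk cl ap v' →
      v = v' := fun a b c d => by
    have he := c.symm.trans d
    exact h.blk_eq_of_two a b (h.ap_ne a).symm (self_mem a) (he ▸ self_mem a) (ap_mem cl ap v)
      (he ▸ ap_mem cl ap v)
  rcases h1 with h1 | h1 | h1 | h1 <;> rcases h2 with h2 | h2 | h2 | h2 <;>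
    first
    | exact hvt h1.2.2 h2.2.2
    | exact hbl h1.2.1 h2.2.1 h1.2.2.2.2 h2.2.2.2.2
    | exact absurd (h1.1.symm.trans h2.1) (by decide)

theorem exists_blk_of_isBlock {x : Node G} (hx : x.IsBlock) :
    ∃ c, IsBlk r cl c ∧ x.verts = blk cl ap c := by
  obtain ⟨k, v, hk⟩ := h.nodeOf_surj hG x
  rcases (h.nodeOf_spec hG hk).2 with h1 | h1 | h1 | h1
  · exact absurd hx h1.2.2.not_block
  · exact absurd hx h1.2.2.not_block
  · exact ⟨v, h1.2.1, h1.2.2.2.2⟩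
  · exact ⟨v, h1.2.1, h1.2.2.2.2⟩

theorem exists_node_of_isBlk {c : V} (hc : IsBlk r cl c) :
    ∃ x : Node G, x.IsBlock ∧ x.verts = blk cl ap c := by
  by_cases h3 : 3 ≤ (blk cl ap c).ncard
  · exact ⟨.comp _ ((h.isBiconnectedComponent_iff _).2 ⟨c, hc, h3, rfl⟩), trivial, rfl⟩
  · refine ⟨.bridge s(c, ap c) ((h.isBridgeEdge_iff hG _).2 ⟨c, hc, h3, rfl⟩), trivial, ?_⟩
    refine Eq.trans ?_ (h.adj_of_blk_pair hG hc h3).1.symm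
    ext w; simp [Node.verts]

/-- Equal vertex sets have equal names, and the size decides whether the name denotes a bridge or a
component. -/
theorem isBlock_inj {x y : Node G} (hx : x.IsBlock) (hy : y.IsBlock) (he : x.verts = y.verts) :
    x = y := by
  obtain ⟨k, v, hk⟩ := h.nodeOf_surj hG x
  obtain ⟨k', v', hk'⟩ := h.nodeOf_surj hG y
  have hkk : k = k' ∧ v = v' := by
    have key : IsBlk r cl v → IsBlk r cl v' → x.verts = blk cl ap v → y.verts = blk cl ap v' →
        v = v' := fun a b c d => by
      have he' := c.symm.trans (he.trans d)
      exact h.blk_eq_of_two a b (h.ap_ne a).symm (self_mem a) (he' ▸ self_mem a)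
        (ap_mem cl ap v) (he' ▸ ap_mem cl ap v)
    rcases (h.nodeOf_spec hG hk).2 with h1 | h1 | h1 | h1
    · exact absurd hx h1.2.2.not_block
    · exact absurd hx h1.2.2.not_block
    all_goals
      rcases (h.nodeOf_spec hG hk').2 with h2 | h2 | h2 | h2
      · exact absurd hy h2.2.2.not_block
      · exact absurd hy h2.2.2.not_block
      all_goals
        have hv := key h1.2.1 h2.2.1 h1.2.2.2.2 h2.2.2.2.2
        subst hv
        first
        | exact ⟨h1.1.trans h2.1.symm, rfl⟩
        | exact absurd h1.2.2.1 h2.2.2.1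
        | exact absurd h2.2.2.1 h1.2.2.1
  rw [hkk.1, hkk.2, hk'] at hk
  exact (Option.some.inj hk).symm

/-- Two blocks at a pendant vertex would both contain its only neighbour, hence coincide. -/
theorem not_pendant_artic (v : V) (hp : IsPendant G v) : ¬ IsArticulation G v := by
  intro ha
  obtain ⟨c, c', hne, hc, hc', hv, hv'⟩ := (h.isArticulation_iff hG v).1 ha
  obtain ⟨w, hw⟩ := Set.ncard_eq_one.1 hp
  have key : ∀ c, IsBlk r cl c → v ∈ blk cl ap c → w ∈ blk cl ap c ∧ v ≠ w := by
    intro c hc hv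
    obtain ⟨heq, hadj⟩ := h.adj_of_blk_pair hG hc (h.isPendant_blk hp hc hv)
    have hv' := hv
    rw [heq] at hv'
    rcases hv' with rfl | rfl
    · have : ap v ∈ G.neighborSet v := hadj
      rw [hw] at this
      obtain rfl : ap v = w := this
      exact ⟨ap_mem cl ap v, hadj.ne⟩
    · have : c ∈ G.neighborSet (ap c) := hadj.symm
      rw [hw] at this
      obtain rfl : c = w := this
      exact ⟨self_mem hc, hadj.ne'⟩
  exact hne (h.blk_eq_of_two hc hc' (key c hc hv).2 hv hv' (key c hc hv).1 (key c' hc' hv').1)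

omit hG in
-- Pendant vertices lie in no component, so the two kinds of tree edges merge into the single
-- relation "a vertex node lies in a block".
theorem tree_adj (x y : Node G) : (abcTree G).Adj x y ↔
    (∃ v, x.IsVertex v ∧ y.IsBlock ∧ v ∈ y.verts) ∨
      (∃ v, y.IsVertex v ∧ x.IsBlock ∧ v ∈ x.verts) := by
  have hpc : ∀ v (H : G.Subgraph), IsPendant G v → IsBiconnectedComponent H → v ∉ H.verts := by
    intro v H hv hH hvH
    obtain ⟨c, hc, h3, rfl⟩ := (h.isBiconnectedComponent_iff H).1 hH
    exact h.isPendant_blk hv hc hvH h3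
  have key : ∀ x y : Node G, Node.Incident x y ↔ ∃ v, x.IsVertex v ∧ y.IsBlock ∧ v ∈ y.verts := by
    intro x y
    cases x <;> cases y <;>
      simp only [Node.Incident, Node.IsVertex, Node.IsBlock, Node.verts, false_iff, not_exists,
        false_and, and_false, not_false_iff, implies_true, exists_eq_left, true_and,
        Set.mem_ofPred_eq]
    exact hpc _ _ ‹_› ‹_›
  rw [abcTree, SimpleGraph.fromRel_adj, key, key]
  constructor
  · exact fun h => h.2
  · intro h
    refine ⟨?_, h⟩
    rintro rfl
    rcases h with ⟨v, h1, h2, -⟩ | ⟨v, h1, h2, -⟩ <;> exact h1.not_block h2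

theorem isVertex_inj {x y : Node G} {v : V} (hx : x.IsVertex v) (hy : y.IsVertex v) : x = y := by
  cases x <;> cases y <;> simp only [Node.IsVertex] at hx hy
  · subst hx; subst hy; rfl
  · subst hx; subst hy; exact absurd ‹_› (h.not_pendant_artic hG _ ‹_›)
  · subst hx; subst hy; exact absurd ‹_› (h.not_pendant_artic hG _ ‹_›)
  · subst hx; subst hy; rfl

/-- Every tree edge between a vertex `a` and a block `X` is a bridge of the tree: without it, any
node reached from `a` differs from `X` and all its vertices retract to `a` in `X`. Coming back to
`X` would use another vertex node of `X`, whose image is not `a`. -/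
theorem acyclic : (abcTree G).IsAcyclic := by
  rw [SimpleGraph.isAcyclic_iff_forall_adj_isBridge]
  have key : ∀ (A X : Node G) a, A.IsVertex a → X.IsBlock → a ∈ X.verts →
      (abcTree G).IsBridge s(A, X) := by
    intro A X a hA hX ha
    obtain ⟨c, hc, hXc⟩ := h.exists_blk_of_isBlock hG hX
    rw [hXc] at ha
    rw [SimpleGraph.isBridge_iff, SimpleGraph.reachable_iff_reflTransGen]
    intro hp
    have key : ∀ Y, Relation.ReflTransGen ((abcTree G).deleteEdges {s(A, X)}).Adj A Y →
        Y ≠ X ∧ ∀ v ∈ Y.verts, h.retr c v = a := by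
      intro Y hY
      induction hY with
      | refl =>
        refine ⟨fun h' => hA.not_block (h' ▸ hX), fun v hv => ?_⟩
        rw [hA.verts] at hv
        obtain rfl : v = a := hv
        exact h.retr_of_mem hc ha
      | @tail Y Z _ hYZ ih =>
        rw [SimpleGraph.deleteEdges_adj, h.tree_adj] at hYZ
        obtain ⟨hYZ, hne⟩ := hYZ
        rcases hYZ with ⟨v, hv, hZ, hvZ⟩ | ⟨v, hv, hY, hvY⟩
        · have hra := ih.2 v (by rw [hv.verts]; rfl)
          have hZX : Z ≠ X := by
            rintro rfl
            rw [hXc] at hvZ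
            rw [h.retr_of_mem hc hvZ] at hra
            subst hra
            exact hne (by rw [h.isVertex_inj hG hv hA]; rfl)
          refine ⟨hZX, fun w hw => ?_⟩
          obtain ⟨d, hd, hZd⟩ := h.exists_blk_of_isBlock hG hZ
          rw [hZd] at hw hvZ
          have hdc : d ≠ c := by
            rintro rfl
            exact hZX (h.isBlock_inj hG hZ hX (hZd.trans hXc.symm))
          rw [h.retr_eq_of_mem hd hdc hw hvZ, hra]
        · refine ⟨fun h' => hv.not_block (h' ▸ hX), fun w hw => ?_⟩
          rw [hv.verts] at hw
          obtain rfl : w = v := hw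
          exact ih.2 _ hvY
    exact (key X hp).1 rfl
  intro x y hxy
  rcases (h.tree_adj x y).1 hxy with ⟨v, h1, h2, h3⟩ | ⟨v, h1, h2, h3⟩
  · exact key x y v h1 h2 h3
  · rw [Sym2.eq_swap]; exact key y x v h1 h2 h3

/-- Blocks with a common vertex are equal or joined through an articulation point. A walk of `G`
leads from block to block with common vertices. -/
theorem preconnected : (abcTree G).Preconnected := by
  have share : ∀ (X Y : Node G) v, X.IsBlock → Y.IsBlock → v ∈ X.verts → v ∈ Y.verts →
      (abcTree G).Reachable X Y := by
    intro X Y v hX hY hv hv'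
    by_cases hXY : X = Y
    · rw [hXY]
    obtain ⟨c, hc, hXc⟩ := h.exists_blk_of_isBlock hG hX
    obtain ⟨d, hd, hYd⟩ := h.exists_blk_of_isBlock hG hY
    have ha : IsArticulation G v := by
      refine (h.isArticulation_iff hG v).2 ⟨c, d, ?_, hc, hd, hXc ▸ hv, hYd ▸ hv'⟩
      rintro rfl
      exact hXY (h.isBlock_inj hG hX hY (hXc.trans hYd.symm))
    have h1 : (abcTree G).Adj X (.artic v ha) := (h.tree_adj _ _).2 (Or.inr ⟨v, rfl, hX, hv⟩)
    have h2 : (abcTree G).Adj (.artic v ha) Y := (h.tree_adj _ _).2 (Or.inl ⟨v, rfl, hY, hv'⟩)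
    exact h1.reachable.trans h2.reachable
  have walk : ∀ u w, Relation.ReflTransGen G.Adj u w → ∀ X Y : Node G, X.IsBlock → Y.IsBlock →
      u ∈ X.verts → w ∈ Y.verts → (abcTree G).Reachable X Y := by
    intro u w huw
    induction huw with
    | refl => exact fun X Y hX hY h1 h2 => share X Y u hX hY h1 h2
    | @tail a b _ hab ih =>
      intro X Y hX hY h1 h2
      obtain ⟨c, hc, hac, hbc⟩ := h.exists_blk_of_adj hab
      obtain ⟨Z, hZ, hZc⟩ := h.exists_node_of_isBlk hG hc
      exact (ih X Z hX hZ h1 (hZc ▸ hac)).trans (share Z Y b hZ hY (hZc ▸ hbc) h2)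
  have toBlock : ∀ X : Node G, ∃ Y : Node G, Y.IsBlock ∧ (∃ v, v ∈ Y.verts) ∧
      (abcTree G).Reachable X Y := by
    intro X
    rcases X.block_or_vertex with hX | ⟨v, hv⟩
    · obtain ⟨c, hc, hXc⟩ := h.exists_blk_of_isBlock hG hX
      exact ⟨X, hX, ⟨c, hXc ▸ self_mem hc⟩, .rfl⟩
    · obtain ⟨u, huv⟩ : ∃ u, G.Adj v u := by
        cases X with
        | pendant u hu =>
          obtain rfl : v = u := hv
          obtain ⟨w, hw⟩ := Set.ncard_eq_one.1 hu
          exact ⟨w, show w ∈ G.neighborSet v by rw [hw]; rfl⟩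
        | artic u hu =>
          obtain rfl : v = u := hv
          obtain ⟨c, c', -, hc, -, hvc, -⟩ := (h.isArticulation_iff hG v).1 hu
          have : ∃ w, w ≠ v := by
            by_cases hcv : c = v
            · exact ⟨ap c, hcv ▸ h.ap_ne hc⟩
            · exact ⟨c, hcv⟩
          obtain ⟨w, hw⟩ := this
          rcases Relation.ReflTransGen.cases_head
            ((SimpleGraph.reachable_iff_reflTransGen _ _).1 (hG.preconnected v w)) with h' | ⟨t, h', -⟩
          · exact absurd h'.symm hw
          · exact ⟨t, h'⟩
        | bridge => exact absurd hv id
        | comp => exact absurd hv id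
      obtain ⟨c, hc, hvc, -⟩ := h.exists_blk_of_adj huv
      obtain ⟨Z, hZ, hZc⟩ := h.exists_node_of_isBlk hG hc
      exact ⟨Z, hZ, ⟨v, hZc ▸ hvc⟩,
        ((h.tree_adj _ _).2 (Or.inl ⟨v, hv, hZ, hZc ▸ hvc⟩)).reachable⟩
  intro X Y
  obtain ⟨X', hX', ⟨u, hu⟩, h1⟩ := toBlock X
  obtain ⟨Y', hY', ⟨w, hw⟩, h2⟩ := toBlock Y
  exact (h1.trans (walk u w ((SimpleGraph.reachable_iff_reflTransGen _ _).1
    (hG.preconnected u w)) X' Y' hX' hY' hu hw)).trans h2.symm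

theorem facts : BlockFacts G := by
  choose fk fv hf using h.nodeOf_surj hG
  -- The codes take values in `Fin 4 × V`, which proves finiteness and the bound of four nodes per
  -- vertex.
  have hinj : Function.Injective fun x => (fk x, fv x) := by
    intro x y hxy
    simp only [Prod.mk.injEq] at hxy
    have h1 := hf x
    rw [hxy.1, hxy.2, hf y] at h1
    exact (Option.some.inj h1).symm
  refine ⟨fun u w huw => ?_, fun X Y v hX hY hne hv hv' => ?_, h.tree_adj, h.acyclic hG,
    h.preconnected hG, fun S => ?_, fun e he v hv => ?_, h.not_pendant_artic hG,
    fun H hH u w => ?_, Finite.of_injective _ hinj, ?_⟩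
  · obtain ⟨c, hc, hu, hw⟩ := h.exists_blk_of_adj huw
    obtain ⟨Z, hZ, hZc⟩ := h.exists_node_of_isBlk hG hc
    exact ⟨Z, hZ, hZc ▸ hu, hZc ▸ hw⟩
  · obtain ⟨c, hc, hXc⟩ := h.exists_blk_of_isBlock hG hX
    obtain ⟨d, hd, hYd⟩ := h.exists_blk_of_isBlock hG hY
    refine (h.isArticulation_iff hG v).2 ⟨c, d, ?_, hc, hd, hXc ▸ hv, hYd ▸ hv'⟩
    rintro rfl
    exact hne (h.isBlock_inj hG hX hY (hXc.trans hYd.symm))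
  · rw [h.isRobustMIS_iff hG]
    refine and_congr_right fun _ => forall₂_congr fun v hv => ⟨?_, ?_⟩
    · rintro ⟨c, hc, h1, h2⟩
      obtain ⟨Z, hZ, hZc⟩ := h.exists_node_of_isBlk hG hc
      exact ⟨Z, hZ, hZc ▸ h1, hZc ▸ h2⟩
    · rintro ⟨X, hX, h1, h2⟩
      obtain ⟨c, hc, hXc⟩ := h.exists_blk_of_isBlock hG hX
      exact ⟨c, hc, hXc ▸ h1, hXc ▸ h2⟩
  · obtain ⟨c, hc, h3, rfl⟩ := (h.isBridgeEdge_iff hG e).1 he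
    refine h.pendant_or_two_blks hG hc h3 ?_
    rw [(h.adj_of_blk_pair hG hc h3).1]
    simpa using hv
  · obtain ⟨c, hc, h3, rfl⟩ := (h.isBiconnectedComponent_iff H).1 hH
    simp
  · have := Nat.card_le_card_of_injective _ hinj
    simpa [Nat.card_prod] using this

end BlockCert

end Nodes

end RMIS

namespace RMIS

/-! ### Rooted trees -/

section RootedTree

variable {α : Type} {T : SimpleGraph α}

/-- In an acyclic graph, two ways to choose a neighbour closer to the root agree. -/
theorem descending_unique (hT : T.IsAcyclic) {R : α} {f f' : α → ℕ} {q q' : α → α}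
    (hq : ∀ x, x ≠ R → T.Adj x (q x) ∧ f (q x) < f x)
    (hq' : ∀ x, x ≠ R → T.Adj x (q' x) ∧ f' (q' x) < f' x) {x : α} (hx : x ≠ R) : q x = q' x := by
  -- Iterating the choice gives a path to `R`, since the measure falls; its second vertex is the
  -- choice at `x`. Paths in an acyclic graph are unique.
  have key : ∀ (f : α → ℕ) (q : α → α), (∀ x, x ≠ R → T.Adj x (q x) ∧ f (q x) < f x) →
      ∀ n x, f x = n → ∃ p : T.Walk x R, p.IsPath ∧ (∀ y ∈ p.support, f y ≤ f x) ∧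
        (x ≠ R → p.snd = q x) := by
    intro f q hq n
    induction n using Nat.strong_induction_on with
    | _ n ih =>
      intro x hn
      by_cases hx : x = R
      · subst hx
        exact ⟨.nil, SimpleGraph.Walk.IsPath.nil, by simp, fun h => absurd rfl h⟩
      · obtain ⟨hadj, hlt⟩ := hq x hx
        obtain ⟨p, hp, hs, -⟩ := ih _ (hn ▸ hlt) (q x) rfl
        refine ⟨.cons hadj p, ?_, ?_, fun _ => by simp⟩
        · rw [SimpleGraph.Walk.cons_isPath_iff]
          refine ⟨hp, fun h => ?_⟩
          have := hs x h
          omega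
        · intro y hy
          rw [SimpleGraph.Walk.support_cons, List.mem_cons] at hy
          rcases hy with rfl | hy
          · exact le_rfl
          · exact (hs y hy).trans hlt.le
  obtain ⟨p, hp, -, h1⟩ := key f q hq _ x rfl
  obtain ⟨p', hp', -, h1'⟩ := key f' q' hq' _ x rfl
  have : p = p' := congrArg Subtype.val ((hT.subsingleton_path x R).elim ⟨p, hp⟩ ⟨p', hp'⟩)
  rw [← h1 hx, ← h1' hx, this]

theorem exists_topdown {β : Type} (R : α) (par : α → α) (f : α → ℕ)
    (hf : ∀ x, x ≠ R → f (par x) < f x) (g₀ : β) (g : α → β → β) :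
    ∃ sol : α → β, sol R = g₀ ∧ ∀ x, x ≠ R → sol x = g x (sol (par x)) := by
  classical
  let F : (x : α) → ((y : α) → f y < f x → β) → β := fun x ih =>
    if hx : x = R then g₀ else g x (ih (par x) (hf x hx))
  let wf := (measure f).wf
  refine ⟨wf.fix F, ?_, fun x hx => ?_⟩
  · rw [wf.fix_eq]; simp only [F, dif_pos rfl]
  · rw [wf.fix_eq]; simp only [F, dif_neg hx]

end RootedTree

section Parents

variable {V : Type} {G : SimpleGraph V} (F : BlockFacts G) {R : Node G}
include F

theorem BlockFacts.exists_parent {x : Node G} (hx : x ≠ R) : ∃ p, IsParent R p x := by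
  obtain ⟨w, hw⟩ := (F.preconnected x R).exists_walk_length_eq_dist
  cases w with
  | nil => exact absurd rfl hx
  | @cons _ p _ hadj w =>
    refine ⟨p, hadj, ?_⟩
    have h1 : (abcTree G).dist p R ≤ w.length := SimpleGraph.dist_le w
    rw [SimpleGraph.Walk.length_cons] at hw
    rcases F.acyclic.dist_eq_dist_add_one_of_adj_of_reachable R hadj (F.preconnected R x) with h | h
    · exact h
    · rw [SimpleGraph.dist_comm, SimpleGraph.dist_comm (u := R) (v := x)] at h
      omega

omit F in
theorem IsParent.ne_root {p x : Node G} (h : IsParent R p x) : x ≠ R := by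
  rintro rfl
  have := h.2
  simp at this

/-- The parent is defined by distances, while a program knows the predecessors of a search. Both are
neighbours that lower some measure, so they agree, whether or not the search computes distances. -/
theorem BlockFacts.parent_eq {f : Node G → ℕ} {q : Node G → Node G}
    (hq : ∀ x, x ≠ R → (abcTree G).Adj x (q x) ∧ f (q x) < f x) {p x : Node G}
    (h : IsParent R p x) : p = q x := by
  classical
  choose! pa hpa using fun x (hx : x ≠ R) => F.exists_parent hx
  have := descending_unique F.acyclic (R := R) (f := (abcTree G).dist R)
    (q := fun y => if y = x then p else pa y) (f' := f) (q' := q) (fun y hy => ?_) hq h.ne_root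
  · simpa using this
  · by_cases hyx : y = x
    · subst hyx
      simp only [if_true]
      exact ⟨h.1, by have := h.2; omega⟩
    · simp only [hyx, if_false]
      exact ⟨(hpa y hy).1, by have := (hpa y hy).2; omega⟩

theorem BlockFacts.isParent_iff {f : Node G → ℕ} {q : Node G → Node G}
    (hq : ∀ x, x ≠ R → (abcTree G).Adj x (q x) ∧ f (q x) < f x) {p x : Node G} :
    IsParent R p x ↔ x ≠ R ∧ p = q x := by
  refine ⟨fun h => ⟨h.ne_root, F.parent_eq hq h⟩, ?_⟩
  rintro ⟨hx, rfl⟩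
  obtain ⟨p, hp⟩ := F.exists_parent hx
  rwa [← F.parent_eq hq hp]

theorem BlockFacts.parent_unique {p p' x : Node G} (h : IsParent R p x) (h' : IsParent R p' x) :
    p = p' := by
  choose! pa hpa using fun x (hx : x ≠ R) => F.exists_parent hx
  have hq : ∀ x, x ≠ R → (abcTree G).Adj x (pa x) ∧ (abcTree G).dist R (pa x) <
      (abcTree G).dist R x := fun y hy => ⟨(hpa y hy).1, by have := (hpa y hy).2; omega⟩
  rw [F.parent_eq hq h, F.parent_eq hq h']

theorem BlockFacts.adj_parent {x y : Node G} (h : (abcTree G).Adj x y) :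
    IsParent R x y ∨ IsParent R y x := by
  rcases F.acyclic.dist_eq_dist_add_one_of_adj_of_reachable R h (F.preconnected R x) with h' | h'
  · exact Or.inr ⟨h, h'⟩
  · exact Or.inl ⟨h.symm, h'⟩

/-- The tree is finite, so distances from the root are bounded by some `B`, and `B` minus the
distance falls from a node to its children. -/
theorem BlockFacts.bottom_up {P : Node G → Prop}
    (ih : ∀ x, (∀ c, IsParent R x c → P c) → P x) (x : Node G) : P x := by
  have := F.finite
  obtain ⟨B, hB⟩ := (Set.finite_range ((abcTree G).dist R)).bddAbove
  have key : ∀ n x, B - (abcTree G).dist R x = n → P x := by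
    intro n
    induction n using Nat.strong_induction_on with
    | _ n IH =>
      intro x hx
      refine ih x fun c hc => IH _ ?_ c rfl
      have h1 := hB ⟨c, rfl⟩
      have h2 := hc.2
      omega
  exact key _ x rfl

omit F in
theorem Node.IsComp.isBlock {x : Node G} (h : x.IsComp) : x.IsBlock := by
  obtain ⟨H, hH, rfl⟩ := h; trivial

omit F in
theorem Node.IsVertex.eq {x : Node G} {u v : V} (h : x.IsVertex u) (h' : x.IsVertex v) : u = v := by
  have := h.verts.symm.trans h'.verts
  simpa using this

/-- The parent of a block is an articulation point in it. -/
theorem BlockFacts.parent_block (hR : R.IsBlock) {p X : Node G} (h : IsParent R p X)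
    (hX : X.IsBlock) : ∃ a ha, p = .artic a ha ∧ a ∈ X.verts := by
  rcases (F.tree_adj X p).1 h.1 with ⟨v, h1, -, -⟩ | ⟨a, h1, -, h2⟩
  · exact absurd hX h1.not_block
  -- The root is a block, so the vertex node `p` has a block above it besides `X` below it. Lying in
  -- two blocks makes it an articulation point.
  have hpR : p ≠ R := fun h' => h1.not_block (h' ▸ hR)
  obtain ⟨Z, hZ⟩ := F.exists_parent hpR
  have hZX : Z ≠ X := by
    rintro rfl
    have := h.2; have := hZ.2; omega
  obtain ⟨hZb, haZ⟩ : Z.IsBlock ∧ a ∈ Z.verts := by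
    rcases (F.tree_adj p Z).1 hZ.1 with ⟨v, h3, h4, h5⟩ | ⟨v, -, h3, -⟩
    · exact ⟨h4, h1.eq h3 ▸ h5⟩
    · exact absurd h3 h1.not_block
  have ha := F.artic Z X a hZb hX hZX haZ h2
  cases p with
  | pendant u hu =>
    obtain rfl : a = u := h1
    exact absurd ha (F.not_both a hu)
  | artic u hu =>
    obtain rfl : a = u := h1
    exact ⟨a, ha, rfl, h2⟩
  | bridge => exact absurd h1 id
  | comp => exact absurd h1 id

theorem BlockFacts.parent_vertex {p x : Node G} {v : V} (hx : x.IsVertex v) (h : IsParent R p x) :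
    p.IsBlock ∧ v ∈ p.verts := by
  rcases (F.tree_adj x p).1 h.1 with ⟨u, h3, h4, h5⟩ | ⟨u, -, h3, -⟩
  · exact ⟨h4, hx.eq h3 ▸ h5⟩
  · exact absurd h3 hx.not_block

theorem BlockFacts.child_block {c X : Node G} (h : IsParent R X c) (hX : X.IsBlock) :
    ∃ v, c.IsVertex v ∧ v ∈ X.verts := by
  rcases (F.tree_adj c X).1 h.1 with ⟨u, h3, h4, h5⟩ | ⟨u, h3, -, -⟩
  · exact ⟨u, h3, h5⟩
  · exact absurd hX h3.not_block

omit F in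
theorem isAttachment_block {X : Node G} {v : V} (hX : X.IsBlock) :
    IsAttachment R v X ↔ ∃ p, IsParent R p X ∧ v ∈ p.verts := by
  cases X with
  | pendant => exact absurd hX id
  | artic => exact absurd hX id
  | bridge => exact Iff.rfl
  | comp => exact Iff.rfl

theorem BlockFacts.attachment_eq {X : Node G} (hX : X.IsBlock) {a : V} {ha : IsArticulation G a}
    (h : IsParent R (.artic a ha) X) : {v | IsAttachment R v X} = {a} := by
  ext v
  change IsAttachment R v X ↔ v = a
  rw [isAttachment_block hX]
  constructor
  · rintro ⟨p, hp, hv⟩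
    rw [F.parent_unique hp h] at hv
    exact hv
  · rintro rfl
    exact ⟨_, h, rfl⟩

/-- A vertex of a block is its attachment vertex, or its node is a child of the block. -/
theorem BlockFacts.artic_cases {X : Node G} (hX : X.IsBlock) {v : V} (hv : v ∈ X.verts)
    (ha : IsArticulation G v) : IsParent R (.artic v ha) X ∨ IsParent R X (.artic v ha) :=
  F.adj_parent ((F.tree_adj _ _).2 (Or.inl ⟨v, rfl, hX, hv⟩))

end Parents

/-! ### Solutions of the formula of a component -/

section LocalSolutions

variable {V : Type} {G : SimpleGraph V}

/-- `T` is a choice of vertices of the component with vertex set `X` that obeys the formula. -/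
structure LocalSol (G : SimpleGraph V) (lab : V → Set Label) (X att : Set V) (flag : Flag)
    (T : Set V) : Prop where
  xor : ∀ u ∈ X, ∀ w ∈ X, G.Adj u w → Label.PO ∉ lab u → (u ∈ T ↔ w ∉ T)
  nand : ∀ u ∈ X, ∀ w ∈ X, G.Adj u w → Label.PO ∈ lab u → Label.PO ∈ lab w → ¬ (u ∈ T ∧ w ∈ T)
  pin : ∀ v ∈ X, lab v = {Label.PI} → v ∈ T
  pout : ∀ v ∈ X, lab v = {Label.PO} ∨ lab v = {Label.PE} → v ∉ T
  fin : flag = .inside → ∀ v ∈ X, v ∈ att → v ∈ T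
  fout : flag = .outside → ∀ v ∈ X, v ∈ att → v ∉ T

theorem LocalSol.congr {lab lab' : V → Set Label} {X att T : Set V} {flag : Flag}
    (h : LocalSol G lab X att flag T) (he : ∀ v ∈ X, lab v = lab' v) :
    LocalSol G lab' X att flag T := by
  refine ⟨fun u hu w hw => ?_, fun u hu w hw => ?_, fun u hu => ?_, fun u hu => ?_, h.fin, h.fout⟩
  · rw [← he u hu]; exact h.xor u hu w hw
  · rw [← he u hu, ← he w hw]; exact h.nand u hu w hw
  · rw [← he u hu]; exact h.pin u hu
  · rw [← he u hu]; exact h.pout u hu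

/-- A 2-colouring of the cut component together with one truth value per connected part is the same
as a set `T` of vertices of which each remaining edge contains exactly one end. This removes
colourings, variables and clauses from all later arguments. -/
theorem BlockFacts.isSatisfiable_iff (F : BlockFacts G) (R : Node G) (L : Labelling G)
    (H : G.Subgraph) (h : IsBiconnectedComponent H) (flag : Flag) :
    isSatisfiable R L (.comp H h) flag ↔
      ∃ T, LocalSol G (vertexLabels L) H.verts {v | IsAttachment R v (.comp H h)} flag T := by
  classical
  set att := {v | IsAttachment R v (.comp H h)} with hatt
  have hadj : ∀ u w, H.Adj u w ↔ u ∈ H.verts ∧ w ∈ H.verts ∧ G.Adj u w := F.comp_adj H h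
  constructor
  · rintro ⟨H', h', he, col, τ, hτ⟩
    cases he
    rw [← hatt] at hτ
    -- The vertices whose literals are true.
    let T : Set V := {v | ∃ hv : v ∈ H.verts, τ ((cutGraph L H).connectedComponentMk ⟨v, hv⟩) =
      col ⟨v, hv⟩}
    have hT : ∀ v (hv : v ∈ H.verts), v ∈ T ↔
        τ ((cutGraph L H).connectedComponentMk ⟨v, hv⟩) = col ⟨v, hv⟩ :=
      fun v hv => ⟨fun ⟨_, h⟩ => h, fun h => ⟨hv, h⟩⟩
    have hneg : ∀ a b : Bool, a = !b ↔ ¬ a = b := by decide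
    refine ⟨T, fun u hu w hw huw hPO => ?_, fun u hu w hw huw h1 h2 => ?_, fun v hv hl => ?_,
      fun v hv hl => ?_, fun hf v hv ha => ?_, fun hf v hv ha => ?_⟩
    · have hc : (cutGraph L H).Adj ⟨u, hu⟩ ⟨w, hw⟩ :=
        ⟨(hadj u w).2 ⟨hu, hw, huw⟩, fun h => hPO h.2.1⟩
      have h1 := col.valid hc
      have h2 : (cutGraph L H).connectedComponentMk ⟨u, hu⟩ =
        (cutGraph L H).connectedComponentMk ⟨w, hw⟩ :=
        SimpleGraph.ConnectedComponent.sound hc.reachable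
      rw [hT u hu, hT w hw, h2]
      revert h1
      generalize col ⟨u, hu⟩ = a, col ⟨w, hw⟩ = b
      generalize τ _ = c
      revert a b c; decide
    · obtain ⟨l, hl, hl'⟩ := hτ _ (Or.inl (Or.inl (Or.inr ⟨⟨u, hu⟩, ⟨w, hw⟩,
        ⟨(hadj u w).2 ⟨hu, hw, huw⟩, h1, h2⟩, rfl⟩)))
      rw [hT u hu, hT w hw]
      simp only [List.mem_cons, List.not_mem_nil, or_false] at hl
      rcases hl with rfl | rfl
      · exact fun h => (hneg _ _).1 hl' h.1
      · exact fun h => (hneg _ _).1 hl' h.2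
    · obtain ⟨l, hl, hl'⟩ := hτ _ (Or.inl (Or.inl (Or.inl (Or.inl ⟨⟨v, hv⟩, hl, rfl⟩))))
      rw [List.mem_singleton] at hl; subst hl
      exact (hT v hv).2 hl'
    · obtain ⟨l, hl, hl'⟩ := hτ _ (Or.inl (Or.inl (Or.inl (Or.inr ⟨⟨v, hv⟩, hl, rfl⟩))))
      rw [List.mem_singleton] at hl; subst hl
      rw [hT v hv]
      exact (hneg _ _).1 hl'
    · obtain ⟨l, hl, hl'⟩ := hτ _ (Or.inl (Or.inr ⟨⟨v, hv⟩, hf, ha, rfl⟩))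
      rw [List.mem_singleton] at hl; subst hl
      exact (hT v hv).2 hl'
    · obtain ⟨l, hl, hl'⟩ := hτ _ (Or.inr ⟨⟨v, hv⟩, hf, ha, rfl⟩)
      rw [List.mem_singleton] at hl; subst hl
      rw [hT v hv]
      exact (hneg _ _).1 hl'
  · rintro ⟨T, hT⟩
    -- Membership in `T` itself serves as colouring; then the assignment that makes all variables
    -- true satisfies the formula.
    let col : (cutGraph L H).Coloring Bool := SimpleGraph.Coloring.mk
      (fun v => decide (v.1 ∈ T)) (by
        intro u w huw
        have h1 := (hadj u w).1 huw.1
        have h2 : u.1 ∈ T ↔ w.1 ∉ T := by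
          by_cases hu : Label.PO ∈ vertexLabels L u.1
          · have hw : Label.PO ∉ vertexLabels L w.1 := fun hw => huw.2 ⟨huw.1, hu, hw⟩
            have := hT.xor w w.2 u u.2 h1.2.2.symm hw
            tauto
          · exact hT.xor u u.2 w w.2 h1.2.2 hu
        intro h3
        rw [decide_eq_decide] at h3
        tauto)
    have hcol : ∀ v, (true = col v) ↔ v.1 ∈ T := fun v => by
      change true = decide (v.1 ∈ T) ↔ _
      rw [eq_comm, decide_eq_true_iff]
    have hncol : ∀ v, (true = !col v) ↔ v.1 ∉ T := fun v => by
      rw [← hcol v]; cases col v <;> simp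
    refine ⟨H, h, rfl, col, fun _ => true, ?_⟩
    rintro c ((((⟨v, hl, rfl⟩ | ⟨v, hl, rfl⟩) | ⟨u, v, huv, rfl⟩) | ⟨v, hf, ha, rfl⟩) |
      ⟨v, hf, ha, rfl⟩)
    · exact ⟨_, List.mem_singleton_self _, (hcol v).2 (hT.pin v v.2 hl)⟩
    · exact ⟨_, List.mem_singleton_self _, (hncol v).2 (hT.pout v v.2 hl)⟩
    · by_cases hu : u.1 ∈ T
      · have hv : v.1 ∉ T := fun hv => hT.nand u u.2 v v.2 ((hadj u v).1 huv.1).2.2 huv.2.1 huv.2.2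
          ⟨hu, hv⟩
        exact ⟨(vertexLiteral col v).neg, by simp, (hncol v).2 hv⟩
      · exact ⟨(vertexLiteral col u).neg, by simp, (hncol u).2 hu⟩
    · exact ⟨_, List.mem_singleton_self _, (hcol v).2 (hT.fin hf v v.2 ha)⟩
    · exact ⟨_, List.mem_singleton_self _, (hncol v).2 (hT.fout hf v v.2 ha)⟩

end LocalSolutions

end RMIS

/-! ### Necessity: a graph with a robust MIS is accepted -/

namespace RMIS

section Correctness

variable {V : Type} {G : SimpleGraph V}

theorem vertexLabels_artic (L : Labelling G) {v : V} (hv : IsArticulation G v) :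
    vertexLabels L v = L (.artic v hv) := by
  ext l; exact ⟨fun ⟨_, h⟩ => h, fun h => ⟨hv, h⟩⟩

theorem vertexLabels_of_not (L : Labelling G) {v : V} (hv : ¬ IsArticulation G v) :
    vertexLabels L v = ∅ := by
  ext l; exact ⟨fun ⟨h, _⟩ => hv h, fun h => absurd h (by simp)⟩

/-- All neighbours of `v` in the block `Y` are in `S`. -/
def SatBy (S : Set V) (Y : Node G) (v : V) : Prop :=
  Y.IsBlock ∧ v ∈ Y.verts ∧ ∀ w ∈ Y.verts, G.Adj v w → w ∈ S

theorem BlockFacts.setParent_labels (F : BlockFacts G) {R : Node G} (L : Labelling G) {X : Node G}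
    {a : V} {ha : IsArticulation G a} (hp : IsParent R (.artic a ha) X) (Z : Set Label) (u : V) :
    (u = a → vertexLabels (setParent R L X Z) u = Z) ∧
      (u ≠ a → vertexLabels (setParent R L X Z) u = vertexLabels L u) := by
  constructor
  · rintro rfl
    rw [vertexLabels_artic _ ha]
    simp [setParent, hp]
  · intro hu
    by_cases hua : IsArticulation G u
    · rw [vertexLabels_artic _ hua, vertexLabels_artic _ hua, setParent, if_neg]
      intro hp'
      have := F.parent_unique hp hp'
      cases this
      exact hu rfl
    · rw [vertexLabels_of_not _ hua, vertexLabels_of_not _ hua]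

/-- For an independent set the "exactly one end" condition only asks that a vertex outside of `S`
without PO has all its neighbours in the block in `S`. -/
theorem localSol_of_indep {S X att : Set V} {lab : V → Set Label} {flag : Flag}
    (hind : G.IsIndepSet S)
    (h1 : ∀ u ∈ X, u ∈ S → lab u ≠ {Label.PO} ∧ lab u ≠ {Label.PE})
    (h2 : ∀ u ∈ X, u ∉ S → lab u ≠ {Label.PI})
    (h3 : ∀ u ∈ X, u ∉ S → Label.PO ∉ lab u → ∀ w ∈ X, G.Adj u w → w ∈ S)
    (h4 : flag = .inside → ∀ v ∈ X, v ∈ att → v ∈ S)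
    (h5 : flag = .outside → ∀ v ∈ X, v ∈ att → v ∉ S) : LocalSol G lab X att flag S := by
  refine ⟨fun u hu w hw huw hPO => ?_, fun u _ w _ huw _ _ h => hind h.1 h.2 huw.ne huw,
    fun v hv hl => ?_, fun v hv hl hvS => ?_, h4, h5⟩
  · constructor
    · exact fun huS hwS => hind huS hwS huw.ne huw
    · intro hwS
      by_contra huS
      exact hwS (h3 u hu huS hPO w hw huw)
  · by_contra hvS
    exact h2 v hv hvS hl
  · rcases hl with hl | hl
    · exact (h1 v hv hvS).1 hl
    · exact (h1 v hv hvS).2 hl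

/-- The labels of `x` cover the status of its attachment vertex `v` with respect to `S`. -/
structure Covers (R : Node G) (L : Labelling G) (S : Set V) (x : Node G) (v : V) : Prop where
  inn : v ∈ S → Label.PI ∈ L x
  out : v ∉ S → Label.PO ∈ L x ∨ Label.PE ∈ L x
  sat : v ∉ S → (∃ Y, (Y = x ∨ IsParent R x Y) ∧ SatBy S Y v) → Label.PO ∈ L x

variable (F : BlockFacts G) {R : Node G} {L : Labelling G}
include F

/-- A vertex outside of `S` is satisfied by some block. If this is a block below its node, the
vertex carries PO by `Covers.sat`; so without PO the block must be `X` itself. A vertex that is no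
articulation point lies in no other block. -/
theorem BlockFacts.covers_vertices {S : Set V} {X : Node G} (hX : X.IsBlock)
    (hS : IsRobustMIS G S)
    (hcov : ∀ c, IsParent R X c → ∀ v, IsAttachment R v c → Covers R L S c v) {u : V}
    (hu : u ∈ X.verts) (hua : ∀ ha : IsArticulation G u, ¬ IsParent R (.artic u ha) X) :
    (u ∈ S → vertexLabels L u ≠ {Label.PO} ∧ vertexLabels L u ≠ {Label.PE}) ∧
    (u ∉ S → vertexLabels L u ≠ {Label.PI}) ∧
    (u ∉ S → Label.PO ∉ vertexLabels L u → ∀ w ∈ X.verts, G.Adj u w → w ∈ S) := by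
  by_cases ha : IsArticulation G u
  · have hc := (F.artic_cases (R := R) hX hu ha).resolve_left (hua ha)
    have hcv := hcov _ hc u rfl
    rw [vertexLabels_artic L ha]
    refine ⟨fun h => ⟨fun h' => ?_, fun h' => ?_⟩, fun h h' => ?_, fun h hPO => ?_⟩
    · have := hcv.inn h; rw [h'] at this; cases this
    · have := hcv.inn h; rw [h'] at this; cases this
    · have := hcv.out h; rw [h'] at this; rcases this with h | h <;> cases h
    · obtain ⟨Y, hY, huY, hw⟩ := ((F.robust S).1 hS).2 u h
      by_cases hYX : Y = X
      · exact hYX ▸ hw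
      · exfalso
        refine hPO (hcv.sat h ⟨Y, Or.inr ?_, hY, huY, hw⟩)
        rcases F.artic_cases (R := R) hY huY ha with h' | h'
        · exact h'
        · exact absurd (F.parent_unique h' hc) hYX
  · rw [vertexLabels_of_not L ha]
    refine ⟨fun _ => ⟨fun h => ?_, fun h => ?_⟩, fun _ h => ?_, fun h _ => ?_⟩
    · exact absurd h.symm (Set.singleton_ne_empty _)
    · exact absurd h.symm (Set.singleton_ne_empty _)
    · exact absurd h.symm (Set.singleton_ne_empty _)
    · obtain ⟨Y, hY, huY, hw⟩ := ((F.robust S).1 hS).2 u h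
      by_cases hYX : Y = X
      · exact hYX ▸ hw
      · exact absurd (F.artic Y X u hY hX hYX huY hu) ha

theorem BlockFacts.covers_comp {S : Set V} {H : G.Subgraph} {hH : IsBiconnectedComponent H}
    (hR : R.IsBlock) (hX : Node.comp H hH ≠ R) (hS : IsRobustMIS G S)
    (hL : L (.comp H hH) = compLabels R L (.comp H hH))
    (hcov : ∀ c, IsParent R (.comp H hH) c → ∀ v, IsAttachment R v c → Covers R L S c v) {v : V}
    (hv : IsAttachment R v (.comp H hH)) : Covers R L S (.comp H hH) v := by
  obtain ⟨p, hp⟩ := F.exists_parent hX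
  obtain ⟨a, ha, rfl, haX⟩ := F.parent_block hR hp trivial
  have hatt := F.attachment_eq (X := .comp H hH) trivial hp
  obtain rfl : v = a := by
    have : v ∈ {v | IsAttachment R v (Node.comp H hH)} := hv
    rwa [hatt] at this
  have hind := ((F.robust S).1 hS).1
  have hlab := F.setParent_labels L hp
  have hver : ∀ u ∈ H.verts, u ≠ v → _ := fun u (hu : u ∈ (Node.comp H hH).verts) (huv : u ≠ v) =>
    F.covers_vertices (R := R) (L := L) (X := .comp H hH) trivial hS hcov hu fun ha' hp' => by
      have := F.parent_unique hp hp'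
      cases this
      exact huv rfl
  -- `Z` is what the parent carries during the call. With `Z = {PO}` the component need not satisfy
  -- its attachment vertex, so `S` passes the test whenever `v` is outside of it.
  have test : ∀ (Z : Set Label) (flag : Flag), (Z = ∅ ∨ (Z = {Label.PO} ∧ v ∉ S)) →
      (v ∉ S → Label.PO ∉ Z → ∀ w ∈ H.verts, G.Adj v w → w ∈ S) →
      (flag = .inside → v ∈ S) → (flag = .outside → v ∉ S) →
      isSatisfiable R (setParent R L (.comp H hH) Z) (.comp H hH) flag := by
    intro Z flag hZ h3 h4 h5
    rw [F.isSatisfiable_iff R _ H hH flag, hatt]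
    refine ⟨S, localSol_of_indep hind (fun u hu huS => ?_) (fun u hu huS => ?_)
      (fun u hu huS hPO => ?_) ?_ ?_⟩
    · by_cases huv : u = v
      · rw [(hlab Z u).1 huv]
        subst huv
        rcases hZ with rfl | ⟨-, h⟩
        · exact ⟨fun h => Set.singleton_ne_empty _ h.symm, fun h => Set.singleton_ne_empty _ h.symm⟩
        · exact absurd huS h
      · rw [(hlab Z u).2 huv]
        exact (hver u hu huv).1 huS
    · by_cases huv : u = v
      · rw [(hlab Z u).1 huv]
        rcases hZ with rfl | ⟨rfl, -⟩
        · exact fun h => Set.singleton_ne_empty _ h.symm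
        · simp
      · rw [(hlab Z u).2 huv]
        exact (hver u hu huv).2.1 huS
    · by_cases huv : u = v
      · subst huv
        rw [(hlab Z u).1 rfl] at hPO
        exact h3 huS hPO
      · rw [(hlab Z u).2 huv] at hPO
        exact (hver u hu huv).2.2 huS hPO
    · rintro hf u - (rfl : u = v); exact h4 hf
    · rintro hf u - (rfl : u = v); exact h5 hf
  have hPO : v ∉ S → (∀ w ∈ H.verts, G.Adj v w → w ∈ S) → Label.PO ∈ L (.comp H hH) := by
    intro h1 h2
    rw [hL]
    exact Or.inr (Or.inl ⟨rfl, test ∅ .outside (Or.inl rfl) (fun _ _ => h2) (by simp)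
      (fun _ => h1)⟩)
  refine ⟨fun h => ?_, fun h => ?_, fun h ⟨Y, hY, hYs⟩ => ?_⟩
  · rw [hL]
    exact Or.inl ⟨rfl, test ∅ .inside (Or.inl rfl) (fun h' => absurd h h') (fun _ => h) (by simp)⟩
  · by_cases hPO' : Label.PO ∈ L (.comp H hH)
    · exact Or.inl hPO'
    · refine Or.inr ?_
      rw [hL] at hPO' ⊢
      refine Or.inr (Or.inr ⟨rfl, fun h' => hPO' (Or.inr (Or.inl ⟨rfl, h'⟩)), ?_⟩)
      exact test {Label.PO} .outside (Or.inr ⟨rfl, h⟩) (fun _ h' => absurd rfl h') (by simp)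
        (fun _ => h)
  · rcases hY with rfl | hY
    · exact hPO h hYs.2.2
    · obtain ⟨w, hw, -⟩ := F.child_block hY trivial
      exact absurd hYs.1 hw.not_block

/-- Induction from the leaves. The set `S` itself witnesses every test that has to succeed, and the
third field of `Covers` forces PO rather than PE as soon as a block at or below the node satisfies
the vertex. -/
theorem BlockFacts.covers (hR : R.IsBlock) {S : Set V} (hS : IsRobustMIS G S)
    (hL : IsRunLabelling R L) (x : Node G) :
    x ≠ R → ∀ v, IsAttachment R v x → Covers R L S x v := by
  obtain ⟨hind, hdom⟩ := (F.robust S).1 hS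
  refine F.bottom_up (R := R) (P := fun x => x ≠ R → ∀ v, IsAttachment R v x → Covers R L S x v)
    (fun x ih hx v hv => ?_) x
  have hLx := hL.2 x hx
  cases x with
  | pendant u hu =>
    change L _ = {Label.PI, Label.PE} at hLx
    refine ⟨fun _ => by simp [hLx], fun _ => by simp [hLx], fun _ ⟨Y, hY, hYs⟩ => ?_⟩
    -- No block hangs below a pendant vertex, because parents of blocks are articulation points.
    exfalso
    rcases hY with rfl | hY
    · exact hYs.1
    · obtain ⟨p, hp⟩ := F.exists_parent hx
      obtain ⟨h1, h2⟩ := F.parent_vertex (x := .pendant u hu) (v := u) rfl hp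
      obtain ⟨a, ha, h3, -⟩ := F.parent_block hR hY hYs.1
      cases h3
  | artic u hu =>
    change L _ = articLabels R L _ at hLx
    obtain rfl : v = u := hv
    have hch : ∀ c, IsParent R (.artic v hu) c → Covers R L S c v := by
      intro c hc
      have hcb : c.IsBlock := by
        rcases (F.tree_adj c _).1 hc.1 with ⟨w, -, h3, -⟩ | ⟨w, -, h3, -⟩
        · exact absurd h3 id
        · exact h3
      exact ih c hc hc.ne_root v ((isAttachment_block hcb).2 ⟨_, hc, rfl⟩)
    refine ⟨fun h => ?_, fun h => ?_, fun h ⟨Y, hY, hYs⟩ => ?_⟩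
    · rw [hLx]; exact Or.inl ⟨rfl, fun c hc => (hch c hc).inn h⟩
    · rw [hLx]
      by_cases hex : ∃ c, IsParent R (.artic v hu) c ∧ Label.PO ∈ L c
      · exact Or.inl (Or.inr (Or.inl ⟨rfl, fun c hc => (hch c hc).out h, hex⟩))
      · exact Or.inr (Or.inr (Or.inr ⟨rfl, fun c hc => (hch c hc).out h, hex⟩))
    · rcases hY with rfl | hY
      · exact absurd hYs.1 id
      · rw [hLx]
        exact Or.inr (Or.inl ⟨rfl, fun c hc => (hch c hc).out h, Y, hY,
          (hch Y hY).sat h ⟨Y, Or.inl rfl, hYs⟩⟩)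
  | comp H hH =>
    exact F.covers_comp hR hx hS hLx (fun c hc v hv => ih c hc hc.ne_root v hv) hv
  | bridge e he =>
    change L _ = bridgeLabels R L _ at hLx
    obtain ⟨p, hp⟩ := F.exists_parent hx
    obtain ⟨a, ha, rfl, haX⟩ := F.parent_block hR hp trivial
    obtain rfl : v = a := by
      have : v ∈ {v | IsAttachment R v (Node.bridge e he)} := hv
      rwa [F.attachment_eq (X := .bridge e he) trivial hp] at this
    obtain ⟨c, rfl⟩ : ∃ c, e = s(v, c) := haX
    have hvc : G.Adj v c := he.1
    have haX : v ∈ (Node.bridge s(v, c) he).verts := by simp [Node.verts]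
    obtain ⟨C, hC, hCv⟩ : ∃ C : Node G, C.IsVertex c ∧ c ∈ (Node.bridge s(v, c) he).verts := by
      have hce : c ∈ s(v, c) := by simp
      rcases F.bridge_vert _ he c hce with h | h
      · exact ⟨.pendant c h, rfl, hce⟩
      · exact ⟨.artic c h, rfl, hce⟩
    have hCX : IsParent R (.bridge s(v, c) he) C := by
      rcases F.adj_parent (R := R) ((F.tree_adj C (.bridge s(v, c) he)).2
        (Or.inl ⟨c, hC, trivial, hCv⟩)) with h | h
      · have := F.parent_unique hp h
        subst this
        exact absurd (hC : c = v) hvc.ne'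
      · exact h
    have hcov : Covers R L S C c := by
      refine ih C hCX hCX.ne_root c ?_
      cases C with
      | pendant => exact hC
      | artic => exact hC
      | bridge => exact absurd hC id
      | comp => exact absurd hC id
    have hsat : v ∉ S → c ∈ S → Label.PO ∈ L (.bridge s(v, c) he) := by
      intro _ h
      rw [hLx]
      exact ⟨C, hCX, Or.inl ⟨rfl, hcov.inn h⟩⟩
    refine ⟨fun h => ?_, fun h => ?_, fun h ⟨Y, hY, hYs⟩ => ?_⟩
    · rw [hLx]
      exact ⟨C, hCX, Or.inr (Or.inl ⟨rfl, (hcov.out fun h' => hind h h' hvc.ne hvc).symm⟩)⟩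
    · by_cases hc : c ∈ S
      · exact Or.inl (hsat h hc)
      -- With both ends outside of `S` the bridge does not satisfy `c`, so a block below `c` does.
      -- Hence the child has PO, and the bridge gets PO or PE depending on whether the child also
      -- has PI.
      · obtain ⟨Y, hY, hcY, hw⟩ := hdom c hc
        have hYX : Y ≠ .bridge s(v, c) he := by
          rintro rfl
          exact h (hw v haX hvc.symm)
        have hca := F.artic Y (.bridge s(v, c) he) c hY trivial hYX hcY hCv
        have hPO : Label.PO ∈ L C := by
          refine hcov.sat hc ⟨Y, Or.inr ?_, hY, hcY, hw⟩
          rcases F.adj_parent (R := R) ((F.tree_adj C Y).2 (Or.inl ⟨c, hC, hY, hcY⟩)) with h | h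
          · exact h
          · exact absurd (F.parent_unique h hCX) hYX
        rw [hLx]
        by_cases hPI : Label.PI ∈ L C
        · exact Or.inl ⟨C, hCX, Or.inl ⟨rfl, hPI⟩⟩
        · exact Or.inr ⟨C, hCX, Or.inr (Or.inr ⟨rfl, hPO, hPI⟩)⟩
    · rcases hY with rfl | hY
      · exact hsat h (hYs.2.2 c hCv hvc)
      · obtain ⟨w, hw, -⟩ := F.child_block hY trivial
        exact absurd hYs.1 hw.not_block

theorem BlockFacts.exists_attachment (hR : R.IsBlock) {x : Node G} (hx : x ≠ R) :
    ∃ v, IsAttachment R v x := by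
  rcases x.block_or_vertex with h | ⟨v, h⟩
  · obtain ⟨p, hp⟩ := F.exists_parent hx
    obtain ⟨a, ha, rfl, haX⟩ := F.parent_block hR hp h
    exact ⟨a, (isAttachment_block h).2 ⟨_, hp, rfl⟩⟩
  · cases x with
    | pendant => exact ⟨v, h⟩
    | artic => exact ⟨v, h⟩
    | bridge => exact absurd h id
    | comp => exact absurd h id

/-- The algorithm accepts graphs with a robust MIS. -/
theorem BlockFacts.accepts_of_robust (hR : R.IsComp) {S : Set V} (hS : IsRobustMIS G S)
    (hL : IsRunLabelling R L) : AcceptsWith R L := by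
  have hcov := F.covers hR.isBlock hS hL
  refine ⟨hL, fun x hx he => ?_, ?_⟩
  · obtain ⟨v, hv⟩ := F.exists_attachment hR.isBlock hx
    have hc := hcov x hx v hv
    by_cases hvS : v ∈ S
    · have := hc.inn hvS; rw [he] at this; exact this
    · have := hc.out hvS; rw [he] at this; exact this.elim id id
  · obtain ⟨H, hH, rfl⟩ := hR
    rw [F.isSatisfiable_iff _ L H hH]
    have hver : ∀ u ∈ H.verts, _ := fun u (hu : u ∈ (Node.comp H hH).verts) =>
      F.covers_vertices (R := .comp H hH) (L := L) (X := .comp H hH) trivial hS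
        (fun c hc v hv => hcov c hc.ne_root v hv) hu fun ha' hp' => hp'.ne_root rfl
    exact ⟨S, localSol_of_indep ((F.robust S).1 hS).1 (fun u hu => (hver u hu).1)
      (fun u hu => (hver u hu).2.1) (fun u hu => (hver u hu).2.2) (by simp) (by simp)⟩

end Correctness

end RMIS

/-! ### Sufficiency: acceptance yields a robust MIS -/

namespace RMIS

section Construction

variable {V : Type} {G : SimpleGraph V}

/-- `T` is an admissible choice of vertices in the block `X` with attachment vertices `att`. -/
structure BlockSol (L : Labelling G) (X : Node G) (att T : Set V) : Prop where
  indep : ∀ u ∈ X.verts, ∀ w ∈ X.verts, G.Adj u w → ¬ (u ∈ T ∧ w ∈ T)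
  sat : ∀ u ∈ X.verts, u ∉ att → u ∉ T → Label.PO ∉ vertexLabels L u →
    ∀ w ∈ X.verts, G.Adj u w → w ∈ T
  pin : ∀ u ∈ X.verts, u ∉ att → ∀ ha : IsArticulation G u, u ∈ T → Label.PI ∈ L (.artic u ha)
  pout : ∀ u ∈ X.verts, u ∉ att → ∀ ha : IsArticulation G u, u ∉ T →
    Label.PO ∈ L (.artic u ha) ∨ Label.PE ∈ L (.artic u ha)
  att_sat : ∀ a ∈ att, a ∉ T → Label.PO ∈ L X → ∀ w ∈ X.verts, G.Adj a w → w ∈ T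

/-- The formula has unit clauses only for singleton label sets. This suffices because an
articulation point never carries both PO and PE: a nonempty set other than the excluded singletons
contains the label that the chosen status needs. -/
theorem set_label_cases {s : Set Label} (hs : s ≠ ∅) (hex : ¬ (Label.PO ∈ s ∧ Label.PE ∈ s)) :
    (s ≠ {Label.PI} → Label.PO ∈ s ∨ Label.PE ∈ s) ∧
      (s ≠ {Label.PO} → s ≠ {Label.PE} → Label.PI ∈ s) := by
  constructor
  · intro h
    by_contra hcon
    push Not at hcon
    refine h (Set.eq_singleton_iff_nonempty_unique_mem.2
      ⟨Set.nonempty_iff_ne_empty.2 hs, fun l hl => ?_⟩)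
    cases l with
    | PI => rfl
    | PO => exact absurd hl hcon.1
    | PE => exact absurd hl hcon.2
  · intro h1 h2
    by_contra hPI
    by_cases hPO : Label.PO ∈ s
    · refine h1 (Set.eq_singleton_iff_unique_mem.2 ⟨hPO, fun l hl => ?_⟩)
      cases l with
      | PI => exact absurd hl hPI
      | PO => rfl
      | PE => exact absurd ⟨hPO, hl⟩ hex
    · refine h2 (Set.eq_singleton_iff_nonempty_unique_mem.2
        ⟨Set.nonempty_iff_ne_empty.2 hs, fun l hl => ?_⟩)
      cases l with
      | PI => exact absurd hl hPI
      | PO => exact absurd hl hPO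
      | PE => rfl

variable (F : BlockFacts G) {R : Node G} {L : Labelling G}

theorem artic_labels_excl (hL : IsRunLabelling R L) {v : V} (ha : IsArticulation G v)
    (hR : R.IsBlock) : ¬ (Label.PO ∈ L (.artic v ha) ∧ Label.PE ∈ L (.artic v ha)) := by
  have hx : Node.artic v ha ≠ R := by rintro rfl; exact hR
  rw [hL.2 _ hx]
  rintro ⟨h1, h2⟩
  rcases h1 with ⟨h, -⟩ | ⟨-, -, h1⟩ | ⟨h, -⟩
  · cases h
  · rcases h2 with ⟨h, -⟩ | ⟨h, -⟩ | ⟨-, -, h2⟩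
    · cases h
    · cases h
    · exact h2 h1
  · cases h

/-- The attachment vertex may have been labelled differently during the test, so labels are compared
only away from it. If the component has PO, `hatt` says that the attachment vertex was tested
without PO, hence is satisfied within the component. -/
theorem LocalSol.blockSol {H : G.Subgraph} {hH : IsBiconnectedComponent H} {att T : Set V}
    {lab : V → Set Label} {flag : Flag} (hR : R.IsBlock) (hL : IsRunLabelling R L)
    (hne : ∀ x, x ≠ R → L x ≠ ∅)
    (hT : LocalSol G lab H.verts att flag T)
    (hlab : ∀ u ∈ H.verts, u ∉ att → lab u = vertexLabels L u)
    (hatt : ∀ a ∈ att, a ∉ T → Label.PO ∈ L (.comp H hH) → Label.PO ∉ lab a)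
    (hattH : att ⊆ H.verts) : BlockSol L (.comp H hH) att T := by
  have hlab' : ∀ u ∈ H.verts, u ∉ att → ∀ ha : IsArticulation G u, lab u = L (.artic u ha) :=
    fun u hu hua ha => (hlab u hu hua).trans (vertexLabels_artic L ha)
  have hneR : ∀ u (ha : IsArticulation G u), Node.artic u ha ≠ R := by
    rintro u ha rfl; exact hR
  refine ⟨fun u hu w hw huw h => ?_, fun u hu hua huT hPO w hw huw => ?_,
    fun u hu hua ha huT => ?_, fun u hu hua ha huT => ?_, fun a haa haT hPO w hw haw => ?_⟩
  · by_cases h1 : Label.PO ∈ lab u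
    · by_cases h2 : Label.PO ∈ lab w
      · exact hT.nand u hu w hw huw h1 h2 h
      · exact (hT.xor w hw u hu huw.symm h2).1 h.2 h.1
    · exact (hT.xor u hu w hw huw h1).1 h.1 h.2
  · rw [← hlab u hu hua] at hPO
    by_contra hwT
    exact huT ((hT.xor u hu w hw huw hPO).2 hwT)
  · refine (set_label_cases (hne _ (hneR u ha)) (artic_labels_excl hL ha hR)).2 ?_ ?_
    · intro h'
      exact hT.pout u hu (Or.inl ((hlab' u hu hua ha).trans h')) huT
    · intro h'
      exact hT.pout u hu (Or.inr ((hlab' u hu hua ha).trans h')) huT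
  · refine (set_label_cases (hne _ (hneR u ha)) (artic_labels_excl hL ha hR)).1 ?_
    intro h'
    exact huT (hT.pin u hu ((hlab' u hu hua ha).trans h'))
  · by_contra hwT
    exact haT ((hT.xor a (hattH haa) w hw haw (hatt a haa haT hPO)).2 hwT)

include F

/-- Each label was granted because some test succeeded, and the solution found by that test is used.
If PO is present, its solution must be taken, as only this one satisfies the attachment vertex. -/
theorem BlockFacts.exists_blockSol_comp (hR : R.IsBlock) (hL : AcceptsWith R L) {H : G.Subgraph}
    {hH : IsBiconnectedComponent H} {a : V} {ha : IsArticulation G a}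
    (hp : IsParent R (.artic a ha) (.comp H hH)) (b : Prop)
    (hb : b → Label.PI ∈ L (.comp H hH))
    (hnb : ¬ b → Label.PO ∈ L (.comp H hH) ∨ Label.PE ∈ L (.comp H hH)) :
    ∃ T, BlockSol L (.comp H hH) {a} T ∧ (a ∈ T ↔ b) := by
  obtain ⟨hrun, hne, -⟩ := hL
  have hLx : L (.comp H hH) = compLabels R L (.comp H hH) := hrun.2 _ hp.ne_root
  have hlab := F.setParent_labels L hp
  have hatt := F.attachment_eq (X := .comp H hH) trivial hp
  have haX : a ∈ H.verts := by
    obtain ⟨a', ha', h1, h2⟩ := F.parent_block hR hp trivial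
    cases h1; exact h2
  have conv : ∀ (Z : Set Label) (flag : Flag) T,
      LocalSol G (vertexLabels (setParent R L (.comp H hH) Z)) H.verts {a} flag T →
      (a ∉ T → Label.PO ∈ L (.comp H hH) → Label.PO ∉ Z) →
      BlockSol L (.comp H hH) {a} T := by
    intro Z flag T hT hZ
    refine hT.blockSol hR hrun hne (fun u _ hu => (hlab Z u).2 hu) ?_ (by simpa using haX)
    rintro a' (rfl : a' = a) h1 h2
    rw [(hlab Z a').1 rfl]
    exact hZ h1 h2
  by_cases hb' : b
  · have hPI := hb hb'
    rw [hLx] at hPI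
    rcases hPI with ⟨-, hs⟩ | ⟨h, -⟩ | ⟨h, -⟩
    · rw [F.isSatisfiable_iff R _ H hH, hatt] at hs
      obtain ⟨T, hT⟩ := hs
      exact ⟨T, conv ∅ _ T hT (fun _ _ => by simp), fun _ => hb', fun _ => hT.fin rfl a haX rfl⟩
    · cases h
    · cases h
  · have key : Label.PO ∈ L (.comp H hH) → ∃ T, BlockSol L (.comp H hH) {a} T ∧ (a ∈ T ↔ b) := by
      intro hPO
      rw [hLx] at hPO
      rcases hPO with ⟨h, -⟩ | ⟨-, hs⟩ | ⟨h, -⟩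
      · cases h
      · rw [F.isSatisfiable_iff R _ H hH, hatt] at hs
        obtain ⟨T, hT⟩ := hs
        exact ⟨T, conv ∅ _ T hT (fun _ _ => by simp),
          fun h => absurd h (hT.fout rfl a haX rfl), fun h => absurd h hb'⟩
      · cases h
    by_cases hPO : Label.PO ∈ L (.comp H hH)
    · exact key hPO
    · have hPE := (hnb hb').resolve_left hPO
      have hPE' := hPE
      rw [hLx] at hPE'
      rcases hPE' with ⟨h, -⟩ | ⟨h, -⟩ | ⟨-, -, hs⟩
      · cases h
      · cases h
      · rw [F.isSatisfiable_iff R _ H hH, hatt] at hs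
        obtain ⟨T, hT⟩ := hs
        exact ⟨T, conv _ _ T hT (fun _ h => absurd h hPO),
          fun h => absurd h (hT.fout rfl a haX rfl), fun h => absurd h hb'⟩

/-- With attachment vertex `a` and other end `c`, the labels PI, PO and PE are realised by `{a}`,
`{c}` and `∅`. In the last case `c` carries PO and is satisfied from below. -/
theorem BlockFacts.exists_blockSol_bridge (hR : R.IsBlock) (hL : AcceptsWith R L) {e : Sym2 V}
    {he : IsBridgeEdge G e} {a : V} {ha : IsArticulation G a}
    (hp : IsParent R (.artic a ha) (.bridge e he)) (b : Prop)
    (hb : b → Label.PI ∈ L (.bridge e he))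
    (hnb : ¬ b → Label.PO ∈ L (.bridge e he) ∨ Label.PE ∈ L (.bridge e he)) :
    ∃ T, BlockSol L (.bridge e he) {a} T ∧ (a ∈ T ↔ b) := by
  obtain ⟨hrun, hne, -⟩ := hL
  have hLx : L (.bridge e he) = bridgeLabels R L (.bridge e he) := hrun.2 _ hp.ne_root
  obtain ⟨c, rfl⟩ : ∃ c, e = s(a, c) := by
    obtain ⟨a', ha', h1, h2⟩ := F.parent_block hR hp trivial
    cases h1; exact h2
  have hac : G.Adj a c := he.1
  have hver : ∀ u ∈ (Node.bridge s(a, c) he).verts, u = a ∨ u = c := fun u hu => by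
    simpa [Node.verts] using hu
  have hchild : ∀ C, IsParent R (.bridge s(a, c) he) C → C.IsVertex c := by
    intro C hC
    obtain ⟨v, hv, hvX⟩ := F.child_block hC trivial
    rcases hver v hvX with rfl | rfl
    · cases C with
      | pendant u hu =>
        obtain rfl : v = u := hv
        exact absurd ha (F.not_both v hu)
      | artic u hu =>
        obtain rfl : v = u := hv
        have := hp.2; have := hC.2; omega
      | bridge => exact absurd hv id
      | comp => exact absurd hv id
    · exact hv
  have hart : ∀ (C : Node G) (hca : IsArticulation G c), C.IsVertex c → C = .artic c hca := by
    intro C hca hC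
    cases C with
    | pendant u hu =>
      obtain rfl : c = u := hC
      exact absurd hca (F.not_both c hu)
    | artic u hu => obtain rfl : c = u := hC; rfl
    | bridge => exact absurd hC id
    | comp => exact absurd hC id
  by_cases hb' : b
  · have hPI := hb hb'
    rw [hLx] at hPI
    obtain ⟨C, hC, ⟨h, -⟩ | ⟨-, h⟩ | ⟨h, -⟩⟩ := hPI
    · cases h
    rotate_left
    · cases h
    refine ⟨{a}, ⟨fun u hu w hw huw h' => huw.ne (h'.1.trans h'.2.symm), ?_, ?_, ?_, ?_⟩,
      fun _ => hb', fun _ => rfl⟩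
    · intro u hu hua _ _ w hw huw
      rcases hver u hu with rfl | rfl
      · exact absurd rfl hua
      · rcases hver w hw with rfl | rfl
        · rfl
        · exact absurd rfl huw.ne
    · intro u hu hua ha' huT; exact absurd huT hua
    · intro u hu hua ha' huT
      rcases hver u hu with rfl | rfl
      · exact absurd rfl hua
      · rw [← hart C ha' (hchild C hC)]; exact h.symm
    · rintro a' (rfl : a' = a) h; exact absurd rfl h
  · by_cases hPO : Label.PO ∈ L (.bridge s(a, c) he)
    · have hPO' := hPO
      rw [hLx] at hPO'
      obtain ⟨C, hC, ⟨-, h⟩ | ⟨h, -⟩ | ⟨h, -⟩⟩ := hPO'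
      rotate_left
      · cases h
      · cases h
      refine ⟨{c}, ⟨fun u hu w hw huw h' => huw.ne (h'.1.trans h'.2.symm), ?_, ?_, ?_, ?_⟩,
        fun h => absurd h hac.ne, fun h => absurd h hb'⟩
      · intro u hu hua huT
        rcases hver u hu with rfl | rfl
        · exact absurd rfl hua
        · exact absurd rfl huT
      · intro u hu hua ha' huT
        obtain rfl : u = c := huT
        rw [← hart C ha' (hchild C hC)]; exact h
      · intro u hu hua ha' huT
        rcases hver u hu with rfl | rfl
        · exact absurd rfl hua
        · exact absurd rfl huT
      · rintro a' (rfl : a' = a) - - w hw huw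
        rcases hver w hw with rfl | rfl
        · exact absurd rfl huw.ne
        · rfl
    · have hPE := (hnb hb').resolve_left hPO
      rw [hLx] at hPE
      obtain ⟨C, hC, ⟨h, -⟩ | ⟨h, -⟩ | ⟨-, h, -⟩⟩ := hPE
      · cases h
      · cases h
      refine ⟨∅, ⟨fun u hu w hw huw h' => h'.1, ?_, ?_, ?_, ?_⟩,
        fun h => absurd h id, fun h => absurd h hb'⟩
      · intro u hu hua _ hPOu
        exfalso
        rcases hver u hu with rfl | rfl
        · exact hua rfl
        · have hCv := hchild C hC
          cases C with
          | pendant v hv =>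
            have := hrun.2 _ hC.ne_root
            rw [this] at h
            rcases h with h | h <;> cases h
          | artic v hv =>
            obtain rfl : u = v := hCv
            exact hPOu ⟨hv, h⟩
          | bridge => exact hCv
          | comp => exact hCv
      · intro u hu hua ha' huT; exact absurd huT id
      · intro u hu hua ha' huT
        rcases hver u hu with rfl | rfl
        · exact absurd rfl hua
        · rw [← hart C ha' (hchild C hC)]; exact Or.inl h
      · intro a' _ _ h; exact absurd h hPO

/-- If the algorithm accepts, then there is a robust MIS. -/
theorem BlockFacts.robust_of_accepts (hconn : G.Connected) (hR : R.IsComp)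
    (hL : AcceptsWith R L) : ∃ S, IsRobustMIS G S := by
  classical
  have hRb := hR.isBlock
  obtain ⟨hrun, hne, hsatR⟩ := hL
  choose! pa hpa using fun x (hx : x ≠ R) => F.exists_parent hx
  obtain ⟨T₀, hT₀⟩ : ∃ T, BlockSol L R ∅ T := by
    obtain ⟨H, hH, rfl⟩ := hR
    rw [F.isSatisfiable_iff _ L H hH] at hsatR
    obtain ⟨T, hT⟩ := hsatR
    have hatt : {v | IsAttachment (Node.comp H hH) v (Node.comp H hH)} = ∅ := by
      ext v
      simp only [Set.mem_empty_iff_false, iff_false]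
      rintro ⟨p, hp, -⟩
      exact hp.ne_root rfl
    rw [hatt] at hT
    exact ⟨T, hT.blockSol hRb hrun hne (fun _ _ _ => rfl) (fun _ h => absurd h id) (by simp)⟩
  -- Solutions are chosen from the root downwards. A vertex node passes on the set of its parent, so
  -- a block sees the choice of its grandparent and has to agree with it at the attachment vertex.
  obtain ⟨sol, hsolR, hsol⟩ := exists_topdown (β := Set V) R pa ((abcTree G).dist R)
    (fun x hx => by have := (hpa x hx).2; omega) T₀
    (fun X T => if X.IsBlock then Classical.epsilon fun T' => ∃ a ∈ (pa X).verts,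
      BlockSol L X {a} T' ∧ (a ∈ T' ↔ a ∈ T) else T)
  -- every block gets an admissible choice, consistent with that of its grandparent
  have main : ∀ X, (X = R ∨ ∀ a ha, IsParent R (.artic a ha) X →
      X.IsBlock → BlockSol L X {a} (sol X) ∧
        ∀ Z, IsParent R Z (.artic a ha) → (a ∈ sol X ↔ a ∈ sol Z)) := by
    have step : ∀ n X, (abcTree G).dist R X = n → (X = R ∨ ∀ a ha, IsParent R (.artic a ha) X →
      X.IsBlock → BlockSol L X {a} (sol X) ∧
        ∀ Z, IsParent R Z (.artic a ha) → (a ∈ sol X ↔ a ∈ sol Z)) := by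
      intro n
      induction n using Nat.strong_induction_on with
      | _ n ih =>
        intro X hn
        by_cases hXR : X = R
        · exact Or.inl hXR
        refine Or.inr fun a ha hp hX => ?_
        have haR : Node.artic a ha ≠ R := by rintro rfl; exact hRb
        obtain ⟨Z, hZ⟩ := F.exists_parent haR
        obtain ⟨hZb, haZ⟩ := F.parent_vertex (x := .artic a ha) (v := a) rfl hZ
        have hpX : pa X = .artic a ha := F.parent_unique (hpa X hXR) hp
        have hpA : pa (.artic a ha) = Z := F.parent_unique (hpa _ haR) hZ
        have hsolA : sol (.artic a ha) = sol Z := by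
          rw [hsol _ haR, hpA, if_neg (fun h : (Node.artic a ha).IsBlock => h)]
        have hsolX := hsol X hXR
        rw [if_pos hX, hpX, hsolA] at hsolX
        have hZsol : ∃ att, a ∉ att ∧ BlockSol L Z att (sol Z) := by
          by_cases hZR : Z = R
          · subst hZR
            exact ⟨∅, by simp, hsolR ▸ hT₀⟩
          · obtain ⟨p, hp'⟩ := F.exists_parent hZR
            obtain ⟨a', ha', rfl, haZ'⟩ := F.parent_block hRb hp' hZb
            have := (((ih _ (by have := hp.2; have := hZ.2; omega) Z rfl).resolve_left hZR) a' ha'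
              hp' hZb).1
            refine ⟨{a'}, ?_, this⟩
            rintro (rfl : a = a')
            have := hp'.2; have := hZ.2; omega
        obtain ⟨att, haatt, hZs⟩ := hZsol
        have hLA := hrun.2 _ haR
        change _ = articLabels R L _ at hLA
        have hPI : a ∈ sol Z → Label.PI ∈ L X := by
          intro h
          have := hZs.pin a haZ haatt ha h
          rw [hLA] at this
          rcases this with ⟨-, h⟩ | ⟨h, -⟩ | ⟨h, -⟩
          · exact h X hp
          · cases h
          · cases h
        have hPOE : a ∉ sol Z → Label.PO ∈ L X ∨ Label.PE ∈ L X := by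
          intro h
          have := hZs.pout a haZ haatt ha h
          rw [hLA] at this
          rcases this with (⟨h, -⟩ | ⟨-, h, -⟩ | ⟨h, -⟩) | (⟨h, -⟩ | ⟨h, -⟩ | ⟨-, h, -⟩)
          · cases h
          · exact h X hp
          · cases h
          · cases h
          · cases h
          · exact h X hp
        have hex : ∃ T', ∃ a' ∈ (Node.artic a ha).verts,
            BlockSol L X {a'} T' ∧ (a' ∈ T' ↔ a' ∈ sol Z) := by
          have : ∃ T, BlockSol L X {a} T ∧ (a ∈ T ↔ a ∈ sol Z) := by
            cases X with
            | pendant => exact absurd hX id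
            | artic => exact absurd hX id
            | bridge e he => exact F.exists_blockSol_bridge hRb ⟨hrun, hne, hsatR⟩ hp _ hPI hPOE
            | comp H hH => exact F.exists_blockSol_comp hRb ⟨hrun, hne, hsatR⟩ hp _ hPI hPOE
          obtain ⟨T, h1, h2⟩ := this
          exact ⟨T, a, rfl, h1, h2⟩
        have hspec := Classical.epsilon_spec hex
        rw [← hsolX] at hspec
        obtain ⟨a', (rfl : a' = a), h1, h2⟩ := hspec
        exact ⟨h1, fun Z' hZ' => by rw [F.parent_unique hZ' hZ]; exact h2⟩
    exact fun X => step _ X rfl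
  have hblock : ∀ X : Node G, X.IsBlock → ∃ att, BlockSol L X att (sol X) ∧
      ∀ a ∈ att, ∃ ha, IsParent R (.artic a ha) X := by
    intro X hX
    by_cases hXR : X = R
    · subst hXR
      exact ⟨∅, hsolR ▸ hT₀, fun a h => absurd h id⟩
    · obtain ⟨p, hp⟩ := F.exists_parent hXR
      obtain ⟨a, ha, rfl, -⟩ := F.parent_block hRb hp hX
      refine ⟨{a}, ((main X).resolve_left hXR a ha hp hX).1, ?_⟩
      rintro a' (rfl : a' = a)
      exact ⟨ha, hp⟩
  have hchild : ∀ X a ha, IsParent R (.artic a ha) X → X.IsBlock → ∀ Z,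
      IsParent R Z (.artic a ha) → (a ∈ sol X ↔ a ∈ sol Z) := fun X a ha hp hX =>
    ((main X).resolve_left hp.ne_root a ha hp hX).2
  have hcons : ∀ X Y : Node G, X.IsBlock → Y.IsBlock → ∀ v, v ∈ X.verts → v ∈ Y.verts →
      v ∈ sol X → v ∈ sol Y := by
    intro X Y hX hY v hvX hvY hv
    by_cases hXY : X = Y
    · exact hXY ▸ hv
    have ha := F.artic X Y v hX hY hXY hvX hvY
    obtain ⟨Z, hZ⟩ := F.exists_parent (R := R) (x := .artic v ha) (by rintro rfl; exact hRb)
    have key : ∀ X : Node G, X.IsBlock → v ∈ X.verts → (v ∈ sol X ↔ v ∈ sol Z) := by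
      intro X hX hvX
      rcases F.artic_cases (R := R) hX hvX ha with h | h
      · exact hchild X v ha h hX Z hZ
      · rw [F.parent_unique h hZ]
    exact (key Y hY hvY).2 ((key X hX hvX).1 hv)
  refine ⟨{v | ∃ X : Node G, X.IsBlock ∧ v ∈ X.verts ∧ v ∈ sol X}, (F.robust _).2 ⟨?_, ?_⟩⟩
  · rintro u ⟨X, hX, huX, hu⟩ w ⟨Y, hY, hwY, hw⟩ - huw
    obtain ⟨Z, hZ, huZ, hwZ⟩ := F.edge u w huw
    obtain ⟨att, hs, -⟩ := hblock Z hZ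
    exact hs.indep u huZ w hwZ huw ⟨hcons X Z hX hZ u huX huZ hu, hcons Y Z hY hZ w hwY hwZ hw⟩
  · intro v hv
    have hvs : ∀ X : Node G, X.IsBlock → v ∈ X.verts → v ∉ sol X :=
      fun X hX hvX h => hv ⟨X, hX, hvX, h⟩
    -- The block of `v` in which `v` is not the attachment vertex: the one above `v` for an
    -- articulation point, any block otherwise.
    obtain ⟨X, hX, hvX, hup⟩ : ∃ X : Node G, X.IsBlock ∧ v ∈ X.verts ∧
        ∀ ha, ¬ IsParent R (.artic v ha) X := by
      by_cases ha : IsArticulation G v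
      · obtain ⟨X, hX⟩ := F.exists_parent (R := R) (x := .artic v ha) (by rintro rfl; exact hRb)
        obtain ⟨h1, h2⟩ := F.parent_vertex (x := .artic v ha) (v := v) rfl hX
        refine ⟨X, h1, h2, fun ha' h' => ?_⟩
        have := h'.2; have := hX.2; omega
      · obtain ⟨H, hH, rfl⟩ := hR
        have h1 : 1 < H.verts.ncard := by have := hH.1.1; omega
        obtain ⟨w, -, hwv⟩ := Set.exists_ne_of_one_lt_ncard h1 v
        rcases Relation.ReflTransGen.cases_head
            ((SimpleGraph.reachable_iff_reflTransGen _ _).1 (hconn.preconnected v w)) with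
          h' | ⟨t, h', -⟩
        · exact absurd h'.symm hwv
        · obtain ⟨X, hX, hvX, -⟩ := F.edge v t h'
          exact ⟨X, hX, hvX, fun ha' => absurd ha' ha⟩
    obtain ⟨att, hs, hatt⟩ := hblock X hX
    have hva : v ∉ att := fun h => by
      obtain ⟨ha, hp⟩ := hatt v h
      exact hup ha hp
    -- A vertex with PO is satisfied by a child block that has PO; without PO the block chosen above
    -- satisfies it.
    by_cases hPO : Label.PO ∈ vertexLabels L v
    · obtain ⟨ha, hPO⟩ := hPO
      rw [hrun.2 (.artic v ha) (by rintro rfl; exact hRb)] at hPO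
      rcases hPO with ⟨h, -⟩ | ⟨-, -, Y, hY, hYPO⟩ | ⟨h, -⟩
      · cases h
      rotate_left
      · cases h
      obtain ⟨hYb, hvY⟩ : Y.IsBlock ∧ v ∈ Y.verts := by
        rcases (F.tree_adj Y _).1 hY.1 with ⟨w, -, h3, -⟩ | ⟨w, h2, h3, h4⟩
        · exact absurd h3 id
        · obtain rfl : w = v := h2
          exact ⟨h3, h4⟩
      have hYs := ((main Y).resolve_left hY.ne_root v ha hY hYb).1
      refine ⟨Y, hYb, hvY, fun w hw hvw => ⟨Y, hYb, hw, ?_⟩⟩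
      exact hYs.att_sat v rfl (hvs Y hYb hvY) hYPO w hw hvw
    · exact ⟨X, hX, hvX, fun w hw hvw => ⟨X, hX, hw, hs.sat v hvX hva (hvs X hX hvX) hPO w hw hvw⟩⟩

/-- A connected graph without biconnected components has a robust MIS. -/
theorem BlockFacts.robust_of_no_comp [Finite V] (hno : ¬ ∃ x : Node G, x.IsComp) :
    ∃ S, IsRobustMIS G S := by
  -- Any maximal independent set works: the edge that dominates `v` is a bridge, hence an entire
  -- block at `v`.
  obtain ⟨S, -, hS⟩ := (Set.toFinite {S : Set V | G.IsIndepSet S}).exists_le_maximal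
    (show (∅ : Set V) ∈ {S : Set V | G.IsIndepSet S} from Set.pairwise_empty _)
  have hmis := (BlockCert.isMIS_iff G S).1 hS
  refine ⟨S, (F.robust S).2 ⟨hmis.1, fun v hv => ?_⟩⟩
  obtain ⟨w, hw, hvw⟩ := hmis.2 v hv
  obtain ⟨X, hX, hvX, hwX⟩ := F.edge v w hvw
  refine ⟨X, hX, hvX, fun u hu hvu => ?_⟩
  cases X with
  | pendant => exact absurd hX id
  | artic => exact absurd hX id
  | comp H hH => exact absurd ⟨_, H, hH, rfl⟩ hno
  | bridge e he =>
    have h1 : e = s(v, w) := (Sym2.mem_and_mem_iff hvw.ne).1 ⟨hvX, hwX⟩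
    have h2 : u = v ∨ u = w := by
      have : u ∈ e := hu
      rw [h1] at this
      simpa using this
    rcases h2 with rfl | rfl
    · exact absurd rfl hvu.ne
    · exact hw

end Construction

end RMIS

/-! ### Truth values as words -/

namespace RMIS

theorem bit_true {p : Prop} (h : p) : bit p = 1 := by simp [bit, h]

theorem bit_false {p : Prop} (h : ¬ p) : bit p = 0 := by simp [bit, h]

@[simp] theorem bit_eq_one_iff {p : Prop} : bit p = 1 ↔ p := by
  by_cases h : p <;> simp [bit, h]

@[simp] theorem bit_eq_zero_iff {p : Prop} : bit p = 0 ↔ ¬ p := by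
  by_cases h : p <;> simp [bit, h]

theorem bit_le_one (p : Prop) : bit p ≤ 1 := by
  by_cases h : p <;> simp [bit, h]

theorem bit_congr {p q : Prop} (h : p ↔ q) : bit p = bit q := by rw [propext h]

/-! ### Graph search -/

/-- The state of a graph search from `r`: `O` lists the `tail` vertices found so far, `P` is the
inverse of `O`, `Q` holds the predecessors and `S` marks the found vertices. -/
structure SearchInv (m r : ℕ) (A : ℕ → ℕ → Prop) (tail : ℕ) (O P Q S : ℕ → ℕ) : Prop where
  pos : 1 ≤ tail
  le : tail ≤ m
  ord : ∀ k, k < tail → O k < m ∧ P (O k) = k ∧ S (O k) = 1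
  seen : ∀ i, i < m → S i = 0 ∨ (S i = 1 ∧ P i < tail ∧ O (P i) = i)
  root : r < m ∧ S r = 1 ∧ P r = 0 ∧ Q r < m
  par : ∀ i, i < m → S i = 1 → i ≠ r → Q i < m ∧ A (Q i) i ∧ P (Q i) < P i ∧ S (Q i) = 1

theorem SearchInv.init {m r : ℕ} {A : ℕ → ℕ → Prop} {O P Q S : ℕ → ℕ} (hr : r < m)
    (hS : ∀ i, i < m → S i = 0) :
    SearchInv m r A 1 (Function.update O 0 r) (Function.update P r 0) (Function.update Q r r)
      (Function.update S r 1) := by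
  refine ⟨le_rfl, by omega, fun k hk => ?_, fun i hi => ?_, by simp [hr], fun i hi h1 h2 => ?_⟩
  · obtain rfl : k = 0 := by omega
    simp [hr]
  · by_cases h : i = r
    · subst h; simp
    · simp [Function.update_of_ne h, hS i hi]
  · rw [Function.update_of_ne h2, hS i hi] at h1
    omega

theorem SearchInv.push {m r : ℕ} {A : ℕ → ℕ → Prop} {tail : ℕ} {O P Q S : ℕ → ℕ}
    (h : SearchInv m r A tail O P Q S) {u w : ℕ} (hw : w < m) (hSw : S w = 0) (hu : u < m)
    (hSu : S u = 1) (hA : A u w) :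
    SearchInv m r A (tail + 1) (Function.update O tail w) (Function.update P w tail)
      (Function.update Q w u) (Function.update S w 1) := by
  have hne : ∀ i, S i = 1 → i ≠ w := by rintro i hi rfl; omega
  -- The queue so far is an injective list of vertices different from `w`, so there is room for one
  -- more.
  have hlt : tail < m := by
    by_contra hcon
    have hcard : (Finset.range tail).card ≤ ((Finset.range m).erase w).card := by
      refine Finset.card_le_card_of_injOn O (fun k hk => ?_) fun k hk l hl hkl => ?_
      · have := h.ord k (by simpa using hk)
        simp [hne _ this.2.2, this.1]
      · have h1 := h.ord k (by simpa using hk)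
        have h2 := h.ord l (by simpa using hl)
        rw [← h1.2.1, ← h2.2.1, hkl]
    rw [Finset.card_erase_of_mem (by simpa using hw)] at hcard
    simp at hcard
    omega
  refine ⟨by omega, by omega, fun k hk => ?_, fun i hi => ?_, ?_, fun i hi h1 h2 => ?_⟩
  · by_cases hkt : k = tail
    · subst hkt; simp [hw]
    · have h1 := h.ord k (by omega)
      have h2 := hne _ h1.2.2
      simp [Function.update_of_ne hkt, Function.update_of_ne h2, h1]
  · by_cases hiw : i = w
    · subst hiw; simp
    · rw [Function.update_of_ne hiw, Function.update_of_ne hiw]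
      rcases h.seen i hi with h1 | ⟨h1, h2, h3⟩
      · exact Or.inl h1
      · refine Or.inr ⟨h1, by omega, ?_⟩
        rw [Function.update_of_ne (by omega), h3]
  · have h1 := hne _ h.root.2.1
    simp [Function.update_of_ne h1, h.root]
  · have huw := hne u hSu
    by_cases hiw : i = w
    · subst hiw
      rcases h.seen u hu with h3 | ⟨-, h3, -⟩
      · omega
      · simp [hu, hA, Function.update_of_ne huw, hSu, h3]
    · rw [Function.update_of_ne hiw] at h1
      have h3 := h.par i hi h1 h2
      have h4 := hne _ h3.2.2.2
      simp [Function.update_of_ne hiw, Function.update_of_ne h4, h3]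

/-- Scan the row of the vertex in register 11. -/
def searchRow (adj nR : ℕ) : Prog :=
  .for 12 nR (.ite ((adj ↗ (♯11 * ♯nR + ♯12)) * (1 - (12 ↗ ♯12)))
    (.store 12 ♯12 1 ;; .store 13 ♯12 ♯11 ;; .store 11 ♯12 ♯13 ;; .store 10 ♯13 ♯12 ;;
      13 ≔ ♯13 + 1) .skip)

/-- Search the graph with adjacency matrix `adj`, whose number of vertices is in register `nR`, from
the vertex in register `rR`. The order of the vertices is written to array 10, their positions to
array 11, their predecessors to array 13. -/
def search (adj nR rR : ℕ) : Prog :=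
  .for 10 nR (.store 12 ♯10 0) ;;
  (.store 12 ♯rR 1 ;; .store 13 ♯rR ♯rR ;; .store 11 ♯rR 0 ;; .store 10 0 ♯rR ;; 13 ≔ 1) ;;
  .for 10 nR (11 ≔ 10 ↗ ♯10 ;; searchRow adj nR)

section Search

variable {W M adj nR rR m r : ℕ} {A : ℕ → ℕ → Prop}

theorem searchRow_spec (hB : Big W M) (hadj : adj < 10) (hnR : nR < 10) (hm : m ≤ M) {s : State}
    (hn : s.var nR = m) (hA : ∀ i j, i < m → j < m → s.arr adj (i * m + j) = bit (A i j))
    {u : ℕ} (hu : s.var 11 = u)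
    (hI : SearchInv m r A (s.var 13) (s.arr 10) (s.arr 11) (s.arr 13) (s.arr 12))
    (hum : u < m) (hSu : s.arr 12 u = 1) :
    HaltsWithin W (m * 60 + 6) (searchRow adj nR) s fun s' =>
      SearchInv m r A (s'.var 13) (s'.arr 10) (s'.arr 11) (s'.arr 13) (s'.arr 12) ∧
      s.var 13 ≤ s'.var 13 ∧ (∀ h, h < s.var 13 → s'.arr 10 h = s.arr 10 h) ∧
      (∀ i, s.arr 12 i = 1 → s'.arr 12 i = 1) ∧ ∀ w, w < m → A u w → s'.arr 12 w = 1 := by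
  have hM := hB.two
  refine hw_for hB (K := m) (of_decide_eq_true rfl) (by simp [Prog.wvars]; omega) (by omega) hn hm
    (fun j s' =>
      SearchInv m r A (s'.var 13) (s'.arr 10) (s'.arr 11) (s'.arr 13) (s'.arr 12) ∧
      s.var 13 ≤ s'.var 13 ∧ (∀ h, h < s.var 13 → s'.arr 10 h = s.arr 10 h) ∧
      (∀ i, s.arr 12 i = 1 → s'.arr 12 i = 1) ∧ ∀ w, w < j → A u w → s'.arr 12 w = 1) 52
    ?_ ?_ (fun s' _ _ h => h) (by omega)
  · simpa using hI
  · rintro j s' hj hf hvj ⟨hI', h1, h2, h3, h4⟩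
    have e1 : s'.var nR = m := by
      rw [hf.var nR (by simp [Prog.for, Prog.wvars]; omega), hn]
    have e2 : s'.var 11 = u := by rw [hf.var 11 (of_decide_eq_true rfl), hu]
    have e3 : s'.arr adj = s.arr adj := hf.arr adj (by simp [Prog.for, Prog.warrs]; omega)
    have e4 : s'.arr adj (u * m + j) = bit (A u j) := by rw [e3, hA u j hum hj]
    have hS01 : s'.arr 12 j ≤ 1 := by rcases hI'.seen j hj with h | h <;> omega
    have hb := bit_le_one (A u j)
    have ht := hI'.le
    have d1 : adj ≠ 10 := by omega
    have d2 : adj ≠ 11 := by omega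
    have d3 : adj ≠ 12 := by omega
    have d4 : adj ≠ 13 := by omega
    refine hw_run hB rfl (of_decide_eq_true rfl) ?_ ?_
    · simp [e1, e2, e4, hvj]; omega
    · by_cases hpush : A u j ∧ s'.arr 12 j = 0
      · have hb1 := bit_true hpush.1
        have := hI'.push hj hpush.2 hum (h3 u hSu) hpush.1
        simp [e1, e2, e4, hvj, hb1, hpush.2]
        refine ⟨this, by omega, fun h hh => ?_, fun i hi => ?_, fun w hw hAw => ?_⟩
        · rw [Function.update_of_ne (by omega)]; exact h2 h hh
        · by_cases hij : i = j
          · subst hij; simp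
          · rw [Function.update_of_ne hij]; exact h3 i hi
        · by_cases hij : w = j
          · subst hij; simp
          · rw [Function.update_of_ne hij]; exact h4 w (by omega) hAw
      · have hz : bit (A u j) * (1 - s'.arr 12 j) = 0 := by
          by_cases hAj : A u j
          · have : s'.arr 12 j ≠ 0 := fun h => hpush ⟨hAj, h⟩
            have : s'.arr 12 j = 1 := by omega
            simp [this]
          · simp [bit_false hAj]
        simp [e1, e2, e4, hvj, hz]
        refine ⟨hI', h1, h2, h3, fun w hw hAw => ?_⟩
        by_cases hij : w = j
        · subst hij
          by_contra hne
          exact hpush ⟨hAw, by omega⟩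
        · exact h4 w (by omega) hAw

/-- The result of a graph search. -/
structure SearchPost (m r : ℕ) (A : ℕ → ℕ → Prop) (O P Q : ℕ → ℕ) : Prop where
  ord : ∀ k, k < m → O k < m ∧ P (O k) = k
  pos : ∀ i, i < m → P i < m ∧ O (P i) = i
  root : r < m ∧ P r = 0 ∧ Q r < m
  par : ∀ i, i < m → i ≠ r → Q i < m ∧ A (Q i) i ∧ P (Q i) < P i

/-- Connectedness enters as the induction principle "a set that contains `r` and is closed under `A`
is everything", so that the same program serves for the graph and for its tree. Each of the `m` rows
is scanned once. -/
theorem search_spec (hB : Big W M) (hadj : adj < 10) (hnR : nR < 10) (hrR : rR < 10) (hm : m ≤ M)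
    {s : State} (hn : s.var nR = m) (hr : s.var rR = r) (hrm : r < m)
    (hA : ∀ i j, i < m → j < m → s.arr adj (i * m + j) = bit (A i j))
    (hconn : ∀ C : ℕ → Prop, C r → (∀ i j, i < m → j < m → C i → A i j → C j) → ∀ i, i < m → C i) :
    HaltsWithin W (200 * m ^ 2) (search adj nR rR) s fun s' =>
      SearchPost m r A (s'.arr 10) (s'.arr 11) (s'.arr 13) := by
  have hM := hB.two
  have hm1 : 1 ≤ m := by omega
  refine hw_seq (T₁ := m * 11 + 6) (T₂ := 30 + (m * (m * 60 + 17) + 6)) (fun s' => ∀ i, i < m → s'.arr 12 i = 0)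
    (hw_for hB (K := m) (of_decide_eq_true rfl) (by simp [Prog.wvars]) (by omega) hn hm
    (fun j s' => ∀ i, i < j → s'.arr 12 i = 0) 3 (by simp) ?_ (fun s' _ _ h => h) (by omega)) ?_
    (by nlinarith)
  · intro j s' hj hf hv hI
    refine hw_run hB rfl (of_decide_eq_true rfl) (by simp [hv]; omega) ?_
    intro i hi
    simp only [Prog.run, Expr.val, hv]
    by_cases h : i = j
    · subst h; simp
    · simp [Function.update_of_ne h, hI i (by omega)]
  · intro s₁ hf₁ h0
    have e1 : s₁.var nR = m := by
      rw [hf₁.var nR (by simp [Prog.for, Prog.wvars]; omega), hn]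
    have e2 : s₁.var rR = r := by
      rw [hf₁.var rR (by simp [Prog.for, Prog.wvars]; omega), hr]
    have e3 : s₁.arr adj = s.arr adj := hf₁.arr adj (by simp [Prog.for, Prog.warrs]; omega)
    have d : rR ≠ 13 := by omega
    refine hw_seq (T₁ := 30) (T₂ := m * (m * 60 + 17) + 6) (fun s' =>
      SearchInv m r A (s'.var 13) (s'.arr 10) (s'.arr 11) (s'.arr 13) (s'.arr 12) ∧
      s'.arr 10 0 = r) (hw_run hB rfl (of_decide_eq_true rfl) (by simp [e2]; omega) ?_) ?_
      le_rfl
    · simp [e2]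
      exact SearchInv.init hrm h0
    · rintro s₂ hf₂ ⟨hI₂, hr0⟩
      have e1' : s₂.var nR = m := by
        rw [hf₂.var nR (by simp [Prog.wvars]; omega), e1]
      have e3' : s₂.arr adj = s.arr adj := by
        rw [hf₂.arr adj (by simp [Prog.warrs]; omega), e3]
      refine hw_for hB (K := m) (of_decide_eq_true rfl)
        (by simp [Prog.wvars, searchRow, Prog.for]; omega) (by omega) e1' hm
        (fun k s' => SearchInv m r A (s'.var 13) (s'.arr 10) (s'.arr 11) (s'.arr 13) (s'.arr 12) ∧
          k ≤ s'.var 13 ∧ ∀ h, h < k → ∀ w, w < m → A (s'.arr 10 h) w → s'.arr 12 w = 1)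
        (m * 60 + 9) ?_ ?_ ?_ (by nlinarith)
      · simpa using hI₂
      · rintro k s' hk hf hv ⟨hI, hkt, hcl⟩
        -- The queue is never empty too early: if all found vertices were processed, they would be
        -- closed under adjacency, so all `m` vertices would have been found, contradicting `k < m`.
        have hlt : k < s'.var 13 := by
          by_contra hcon
          have hke : k = s'.var 13 := by omega
          have hall := hconn (fun i => i < m ∧ s'.arr 12 i = 1) ⟨hrm, hI.root.2.1⟩ (by
            rintro i j hi hj ⟨-, hs⟩ hij
            refine ⟨hj, ?_⟩
            rcases hI.seen i hi with h | ⟨-, h2, h3⟩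
            · omega
            · exact hcl (s'.arr 11 i) (by omega) j hj (by rw [h3]; exact hij))
          have hcard : (Finset.range m).card ≤ (Finset.range (s'.var 13)).card := by
            refine Finset.card_le_card_of_injOn (s'.arr 11) (fun i hi => ?_) fun i hi j hj hij => ?_
            · have h1 := hall i (by simpa using hi)
              rcases hI.seen i h1.1 with h | ⟨-, h2, -⟩
              · omega
              · simpa using h2
            · have h1 := hall i (by simpa using hi)
              have h2 := hall j (by simpa using hj)
              rcases hI.seen i h1.1 with h | ⟨-, -, h3⟩
              · omega
              rcases hI.seen j h2.1 with h | ⟨-, -, h4⟩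
              · omega
              rw [← h3, ← h4, hij]
          simp at hcard
          omega
        have ho := hI.ord k hlt
        have g1 : s'.var nR = m := by
          rw [hf.var nR (by simp [Prog.for, Prog.wvars, searchRow]; omega), e1']
        have g3 : s'.arr adj = s.arr adj := by
          rw [hf.arr adj (by simp [Prog.for, Prog.warrs, searchRow]; omega), e3']
        refine hw_seq (T₁ := 3) (T₂ := m * 60 + 6) (fun s'' => s'' = s'.setVar 11 (s'.arr 10 k))
          (hw_run hB rfl (of_decide_eq_true rfl) (by simp [hv]; omega) (by simp [hv])) ?_ (by omega)
        rintro _ - rfl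
        have d : nR ≠ 11 := by omega
        refine (searchRow_spec (r := r) (A := A) hB hadj hnR hm (by simp [d, g1])
          (by simp only [State.setVar_arr, g3]; exact hA) (u := s'.arr 10 k) (by simp)
          (by simpa using hI) ho.1 (by simpa using ho.2.2)).mono le_rfl ?_
        rintro s'' - ⟨hI'', h1, h2, h3, h4⟩
        simp at h1 h2 h3 h4
        refine ⟨by simpa using hI'', by simp; omega, ?_⟩
        simp only [State.setVar_arr]
        intro h hh w hw hAw
        rw [h2 h (by omega)] at hAw
        by_cases hhk : h = k
        · subst hhk; exact h4 w hw hAw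
        · exact h3 w (hcl h (by omega) w hw hAw)
      · rintro s' - - ⟨hI, hkt, -⟩
        have htm : s'.var 13 = m := le_antisymm hI.le hkt
        have hall : ∀ i, i < m → s'.arr 12 i = 1 ∧ s'.arr 11 i < m ∧ s'.arr 10 (s'.arr 11 i) = i := by
          intro i hi
          rcases hI.seen i hi with h | h
          · exfalso
            have hcard : (Finset.range m).card ≤ ((Finset.range m).erase i).card := by
              refine Finset.card_le_card_of_injOn (s'.arr 10) (fun k hk => ?_)
                fun k hk l hl hkl => ?_
              · have := hI.ord k (by simpa [htm] using hk)
                have hne : s'.arr 10 k ≠ i := by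
                  intro h'
                  rw [h'] at this; omega
                simp [hne, this.1]
              · have h1 := hI.ord k (by simpa [htm] using hk)
                have h2 := hI.ord l (by simpa [htm] using hl)
                rw [← h1.2.1, ← h2.2.1, hkl]
            rw [Finset.card_erase_of_mem (by simpa using hi)] at hcard
            simp at hcard
            omega
          · exact ⟨h.1, by omega, h.2.2⟩
        refine ⟨fun k hk => ?_, fun i hi => (hall i hi).2, ⟨hrm, hI.root.2.2⟩, fun i hi hir => ?_⟩
        · have := hI.ord k (by omega)
          exact ⟨this.1, this.2.1⟩
        · have := hI.par i hi (hall i hi).1 hir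
          exact ⟨this.1, this.2.1, this.2.2.1⟩

end Search

end RMIS

namespace RMIS

/-! ### Merging blocks -/

section Merge

variable {V : Type} {G : SimpleGraph V} {r : V} {pos : V → ℕ} {cl ap : V → V}

/-- No vertex separates two other vertices of `K`. -/
def UnsepSet (G : SimpleGraph V) (K : Set V) : Prop := ∀ a ∈ K, ∀ b ∈ K, Unsep G a b

/-- Deleting one vertex spares `p` or `q`, and the connection runs through the spared one. -/
theorem UnsepSet.union {K K' : Set V} (h : UnsepSet G K) (h' : UnsepSet G K') {p q : V}
    (hpq : p ≠ q) (hp : p ∈ K) (hp' : p ∈ K') (hq : q ∈ K) (hq' : q ∈ K') :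
    UnsepSet G (K ∪ K') := by
  have key : ∀ a ∈ K, ∀ b ∈ K', Unsep G a b := by
    intro a ha b hb v hva hvb
    by_cases hvp : v = p
    · have hvq : v ≠ q := hvp ▸ hpq
      exact (h a ha q hq v hva hvq).trans (h' q hq' b hb v hvq hvb)
    · exact (h a ha p hp v hva hvp).trans (h' p hp' b hb v hvp hvb)
  rintro a (ha | ha) b (hb | hb)
  · exact h a ha b hb
  · exact key a ha b hb
  · exact (key b hb a ha).symm
  · exact h' a ha b hb

theorem UnsepSet.mono {K K' : Set V} (h : UnsepSet G K) (hs : K' ⊆ K) : UnsepSet G K' :=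
  fun a ha b hb => h a (hs ha) b (hs hb)

theorem unsepSet_triple {a b c : V} (hab : Unsep G a b) (hac : Unsep G a c) (hbc : Unsep G b c) :
    UnsepSet G {a, b, c} := by
  rintro x (rfl | rfl | rfl) y (rfl | rfl | rfl) <;>
    first | exact Unsep.refl _ | assumption | exact Unsep.symm ‹_›

/-- The block structure for the edges among the first `k` vertices and the edges of the tree. -/
structure MergeInv (G : SimpleGraph V) (r : V) (pos : V → ℕ) (k : ℕ) (cl ap : V → V) : Prop where
  root : ∀ x, cl x = r ↔ x = r
  cl_cl : ∀ x, cl (cl x) = cl x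
  ap_lt : ∀ x, x ≠ r → pos (ap (cl x)) < pos x
  clique : ∀ x y, x ≠ r → cl y = cl x → Unsep G x y
  clique_ap : ∀ x, x ≠ r → Unsep G x (ap (cl x))
  edge : ∀ x y, G.Adj x y → pos y < pos x → pos x < k → cl y = cl x ∨ y = ap (cl x)
  fresh : ∀ x, k ≤ pos x → cl x = x
  name : ∀ x, pos x < k → pos (cl x) < k

/-- The climb from `x` to the root only visits vertices earlier than `s`, and no step of it depends
on `s`. -/
theorem MergeInv.chain {k : ℕ} (h : MergeInv G r pos k cl ap) {s x : V} (hx : pos x < pos s) :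
    ConnIn G {s}ᶜ x r := by
  induction hn : pos x using Nat.strong_induction_on generalizing x with
  | _ n ih =>
    subst hn
    by_cases hr : x = r
    · rw [hr]; exact .refl
    · have h1 := h.ap_lt x hr
      refine (h.clique_ap x hr s ?_ ?_).trans (ih _ h1 (h1.trans hx) rfl)
      · rintro rfl; omega
      · rintro rfl; omega

theorem MergeInv.low {k : ℕ} (h : MergeInv G r pos k cl ap) {s x y : V} (hx : pos x < pos s)
    (hy : pos y < pos s) : ConnIn G {s}ᶜ x y := (h.chain hx).trans (h.chain hy).symm

/-- The state of a walk that closes the cycles through `v`: the classes in `K` belong to the block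
of `v`, and so do `x` and `z`. -/
structure WalkInv (G : SimpleGraph V) (pos : V → ℕ) (r v : V) (cl ap : V → V) (K : Set V)
    (z x : V) : Prop where
  cliq : UnsepSet G ({v, z, x} ∪ {y | cl y ∈ K})
  root : r ∉ K
  name : ∀ c ∈ K, pos c < pos v
  zpos : pos z < pos v
  xpos : pos x < pos v
  ap_cov : ∀ c ∈ K, ap c = z ∨ ap c = x ∨ cl (ap c) ∈ K
  ap_low : ∀ c ∈ K, pos z ≤ pos (ap c) ∨ pos x ≤ pos (ap c)

theorem WalkInv.swap {v z x : V} {K : Set V} (h : WalkInv G pos r v cl ap K z x) :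
    WalkInv G pos r v cl ap K x z := by
  refine ⟨?_, h.root, h.name, h.xpos, h.zpos, fun c hc => ?_, fun c hc => ?_⟩
  · refine h.cliq.mono (Set.union_subset_union_left _ ?_)
    rintro y (rfl | rfl | rfl) <;> simp
  · have := h.ap_cov c hc; tauto
  · have := h.ap_low c hc; tauto

/-- The later walker climbs over its block. The vertices `x`, `z` and the new apex are pairwise
inseparable; this triple shares `x` and `z` with the set collected so far, and the block of `x`
shares `x` and its apex with the result, so all of it fuses. -/
theorem WalkInv.step {k : ℕ} (hM : MergeInv G r pos k cl ap) {v z x : V} (hv : pos v = k)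
    {K : Set V} (h : WalkInv G pos r v cl ap K z x) (hlt : pos z < pos x) (hr : x ≠ r) :
    WalkInv G pos r v cl ap (insert (cl x) K) z (ap (cl x)) := by
  have hne : x ≠ z := by rintro rfl; omega
  have hap := hM.ap_lt x hr
  have hxx' : x ≠ ap (cl x) := by intro h'; rw [← h'] at hap; omega
  have hclr : ∀ y, cl y = cl x → y ≠ r := fun y hy hyr => by
    rw [(hM.root y).2 hyr] at hy
    exact hr ((hM.root x).1 hy.symm)
  have hxz : Unsep G x z := h.cliq x (by simp) z (by simp)
  have htri : UnsepSet G {x, z, ap (cl x)} := by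
    refine unsepSet_triple hxz (hM.clique_ap x hr) fun s hs hs' => ?_
    -- Only the deletion of `x` is delicate; then `z` and the apex are both earlier than `x` and
    -- hence joined through the root.
    by_cases hsx : s = x
    · subst hsx; exact hM.low hlt hap
    · exact (hxz.symm s hs hsx).trans (hM.clique_ap x hr s hsx hs')
  have hB : UnsepSet G {y | cl y = cl x ∨ y = ap (cl x)} := by
    rintro a (ha | rfl) b (hb | rfl)
    · exact hM.clique a b (hclr a ha) (hb.trans ha.symm)
    · have := hM.clique_ap a (hclr a ha); rwa [ha] at this
    · have := (hM.clique_ap b (hclr b hb)).symm; rwa [hb] at this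
    · exact Unsep.refl _
  have h1 := h.cliq.union htri hne (by simp) (by simp) (by simp) (by simp)
  have h2 := h1.union hB hxx' (by simp) (Or.inl rfl) (by simp) (Or.inr rfl)
  refine ⟨h2.mono ?_, ?_, ?_, h.zpos, hap.trans h.xpos, ?_, ?_⟩
  · rintro y ((rfl | rfl | rfl) | (hy | hy))
    · simp
    · simp
    · simp
    · exact Or.inr (Or.inl hy)
    · exact Or.inl (Or.inl (Or.inr hy))
  · rintro (h' | h')
    · exact hr ((hM.root x).1 h'.symm)
    · exact h.root h'
  · rintro c (rfl | hc)
    · rw [hv]; exact hM.name x (hv ▸ h.xpos)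
    · exact h.name c hc
  · rintro c (rfl | hc)
    · exact Or.inr (Or.inl rfl)
    · rcases h.ap_cov c hc with h' | h' | h'
      · exact Or.inl h'
      · exact Or.inr (Or.inr (Or.inl (by rw [h'])))
      · exact Or.inr (Or.inr (Or.inr h'))
  · rintro c (rfl | hc)
    · exact Or.inr le_rfl
    · rcases h.ap_low c hc with h' | h'
      · exact Or.inl h'
      · exact Or.inr (hap.le.trans h')

/-- A walker that enters a marked class can stop: the rest of its way is already covered, and the
earlier walker `z` remains the lower bound for all apices. -/
theorem WalkInv.halted {v z x : V} {K : Set V} (h : WalkInv G pos r v cl ap K z x)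
    (hlt : pos z < pos x) (hx : cl x ∈ K) : WalkInv G pos r v cl ap K z z := by
  refine ⟨h.cliq.mono (Set.union_subset_union_left _ ?_), h.root, h.name, h.zpos, h.zpos,
    fun c hc => ?_, fun c hc => ?_⟩
  · rintro y (rfl | rfl | rfl) <;> simp
  · rcases h.ap_cov c hc with h' | h' | h'
    · exact Or.inl h'
    · exact Or.inr (Or.inr (h' ▸ hx))
    · exact Or.inr (Or.inr h')
  · rcases h.ap_low c hc with h' | h' <;> left <;> omega

/-- A new edge from `v` to `w` puts `w` on a cycle with `v` and `z`: if `v` is deleted, `w` and `z`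
are joined through the root, and otherwise through `v`. -/
theorem WalkInv.start {k : ℕ} (hM : MergeInv G r pos k cl ap) {v z w : V} {K : Set V}
    (h : WalkInv G pos r v cl ap K z z) (hvw : G.Adj v w) (hw : pos w < pos v) :
    WalkInv G pos r v cl ap K z w := by
  have hvz : v ≠ z := by rintro rfl; have := h.zpos; omega
  have hvzu : Unsep G v z := h.cliq v (by simp) z (by simp)
  have htri : UnsepSet G {v, z, w} := by
    refine unsepSet_triple hvzu (unsep_of_adj hvw) fun s hs hs' => ?_
    by_cases hsv : s = v
    · subst hsv; exact hM.low h.zpos hw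
    · exact (hvzu.symm s hs hsv).trans (unsep_of_adj hvw s hsv hs')
  refine ⟨(h.cliq.union htri hvz (by simp) (by simp) (by simp) (by simp)).mono ?_, h.root, h.name,
    h.zpos, hw, fun c hc => ?_, fun c hc => ?_⟩
  · rintro y ((rfl | rfl | rfl) | hy)
    · simp
    · simp
    · simp
    · exact Or.inl (Or.inr hy)
  · have := h.ap_cov c hc; tauto
  · have := h.ap_low c hc; tauto

theorem MergeInv.walk_init {k : ℕ} (hM : MergeInv G r pos k cl ap) {v : V} (hv : pos v = k)
    (hvr : v ≠ r) : WalkInv G pos r v cl ap ∅ (ap v) (ap v) := by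
  have hcl := hM.fresh v hv.ge
  have h1 := hM.ap_lt v hvr
  have h2 := hM.clique_ap v hvr
  rw [hcl] at h1 h2
  refine ⟨?_, by simp, by simp, h1, h1, by simp, by simp⟩
  refine (unsepSet_triple h2 h2 (Unsep.refl _)).mono ?_
  simp

-- When all walks of `v` have met in `z`, the marked classes, `v` and `z` form an inseparable set.
-- The marked classes and `v` become one class with name `v` and apex `z`; every edge from `v` to an
-- earlier vertex then lies in it, by `hcov`.
open Classical in
theorem MergeInv.merge (hinj : Function.Injective pos) {k : ℕ} (hM : MergeInv G r pos k cl ap)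
    {v z : V} (hv : pos v = k) (hvr : v ≠ r) {K : Set V} (h : WalkInv G pos r v cl ap K z z)
    (hcov : ∀ w, G.Adj v w → pos w < pos v → w = z ∨ cl w ∈ K) :
    MergeInv G r pos (k + 1) (fun u => if cl u ∈ K then v else cl u) (Function.update ap v z) := by
  have hvK : v ∉ K := fun h' => by have := h.name v h'; omega
  have hclv := hM.fresh v hv.ge
  have hcl_eq_v : ∀ x, cl x = v → x = v := by
    intro x hx
    by_cases hxk : pos x < k
    · have := hM.name x hxk
      rw [hx] at this; omega
    · rw [← hM.fresh x (by omega), hx]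
  have hmem : ∀ x, (cl x ∈ K ∨ cl x = v) → x ∈ ({v, z, z} ∪ {y | cl y ∈ K} : Set V) := by
    rintro x (hx | hx)
    · exact Or.inr hx
    · rw [hcl_eq_v x hx]; simp
  have hcl' : ∀ x, (if cl x ∈ K then v else cl x) = v ↔ (cl x ∈ K ∨ cl x = v) := by
    intro x; by_cases hx : cl x ∈ K <;> simp [hx]
  have hz : z ∈ ({v, z, z} ∪ {y | cl y ∈ K} : Set V) := by simp
  refine ⟨fun x => ?_, fun x => ?_, fun x hx => ?_, fun x y hx hxy => ?_, fun x hx => ?_,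
    fun x y hxy hlt hk => ?_, fun x hx => ?_, fun x hx => ?_⟩
  · by_cases hxK : cl x ∈ K
    · simp only [hxK, if_true]
      refine ⟨fun h' => absurd h' hvr, ?_⟩
      rintro rfl
      rw [(hM.root x).2 rfl] at hxK
      exact absurd hxK h.root
    · simp only [hxK, if_false]; exact hM.root x
  · by_cases hxK : cl x ∈ K
    · simp [hxK, hclv, hvK]
    · simp [hxK, hM.cl_cl]
  · by_cases hxv : (if cl x ∈ K then v else cl x) = v
    · rw [hxv, Function.update_self]
      rcases (hcl' x).1 hxv with hx' | hx'
      · have h1 := hM.ap_lt x hx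
        rcases h.ap_low _ hx' with h2 | h2 <;> omega
      · rw [hcl_eq_v x hx']; exact h.zpos
    · rw [Function.update_of_ne hxv]
      have : cl x ∉ K := fun h' => hxv ((hcl' x).2 (Or.inl h'))
      simp only [this, if_false]
      exact hM.ap_lt x hx
  · by_cases hxv : (if cl x ∈ K then v else cl x) = v
    · have hyv := hxy.trans hxv
      exact h.cliq x (hmem x ((hcl' x).1 hxv)) y (hmem y ((hcl' y).1 hyv))
    · have h1 : cl x ∉ K := fun h' => hxv ((hcl' x).2 (Or.inl h'))
      have h2 : cl y ∉ K := fun h' => hxv (hxy ▸ (hcl' y).2 (Or.inl h'))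
      simp only [h1, h2, if_false] at hxy
      exact hM.clique x y hx hxy
  · by_cases hxv : (if cl x ∈ K then v else cl x) = v
    · rw [hxv, Function.update_self]
      exact h.cliq x (hmem x ((hcl' x).1 hxv)) z hz
    · rw [Function.update_of_ne hxv]
      have : cl x ∉ K := fun h' => hxv ((hcl' x).2 (Or.inl h'))
      simp only [this, if_false]
      exact hM.clique_ap x hx
  · by_cases hxk : pos x = k
    · obtain rfl : x = v := hinj (hxk.trans hv.symm)
      simp only [hclv, hvK, if_false, Function.update_self]
      rcases hcov y hxy hlt with h' | h'
      · exact Or.inr h'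
      · exact Or.inl (by simp [h'])
    · have hxv : x ≠ v := by rintro rfl; exact hxk hv
      rcases hM.edge x y hxy hlt (by omega) with h' | h'
      · exact Or.inl (by simp only [h'])
      -- An old edge leads to the apex of a class that is now merged. By `ap_cov` this apex is `z`
      -- or belongs to a merged class itself.
      · by_cases hxK : cl x ∈ K
        · simp only [hxK, if_true, Function.update_self]
          rcases h.ap_cov _ hxK with h1 | h1 | h1
          · exact Or.inr (h'.trans h1)
          · exact Or.inr (h'.trans h1)
          · exact Or.inl (by simp [h', h1])
        · have : cl x ≠ v := fun h' => hxv (hcl_eq_v x h')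
          simp only [hxK, if_false, Function.update_of_ne this]
          exact Or.inr h'
  · have h1 := hM.fresh x (by omega)
    have h2 : cl x ∉ K := fun h' => by have := h.name _ h'; rw [h1] at this; omega
    rw [if_neg h2, h1]
  · by_cases hxK : cl x ∈ K
    · simp only [hxK, if_true]; omega
    · simp only [hxK, if_false]
      by_cases hxk : pos x = k
      · obtain rfl : x = v := hinj (hxk.trans hv.symm)
        rw [hclv]; omega
      · have := hM.name x (by omega); omega

theorem MergeInv.cert (hinj : Function.Injective pos) {k : ℕ} (hM : MergeInv G r pos k cl ap)
    (hk : ∀ x, pos x < k) : BlockCert G r pos cl ap :=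
  ⟨hinj, hM.root, hM.cl_cl, hM.ap_lt, hM.clique, hM.clique_ap,
    fun x y hxy hlt => hM.edge x y hxy hlt (hk x)⟩

end Merge

end RMIS

namespace RMIS

/-! ### Arrays of vertices -/

/-- The array holds the values of `f`. -/
def Rep {n : ℕ} (a : ℕ → ℕ) (f : Fin n → Fin n) : Prop := ∀ u : Fin n, a u = f u

/-- The array marks the elements of `K`. -/
def RepSet {n : ℕ} (a : ℕ → ℕ) (K : Set (Fin n)) : Prop := ∀ u : Fin n, a u = bit (u ∈ K)

theorem update_fin {n : ℕ} {α : Type} (a : ℕ → α) (u v : Fin n) (x : α) :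
    Function.update a (u : ℕ) x (v : ℕ) = if v = u then x else a v := by
  by_cases h : v = u
  · subst h; simp
  · have : (v : ℕ) ≠ u := fun h' => h (Fin.ext h')
    simp [h, this]

theorem Rep.update {n : ℕ} {a : ℕ → ℕ} {f : Fin n → Fin n} (h : Rep a f) (u v : Fin n) :
    Rep (Function.update a u v) (Function.update f u v) := by
  intro w
  rw [update_fin]
  by_cases hw : w = u
  · subst hw; simp
  · simp [hw, h w]

theorem RepSet.insert {n : ℕ} {a : ℕ → ℕ} {K : Set (Fin n)} (h : RepSet a K) (u : Fin n) :
    RepSet (Function.update a u 1) (insert u K) := by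
  intro w
  rw [update_fin]
  by_cases hw : w = u
  · subst hw; simp [bit_true]
  · simp [hw, h w]

/-- The number of zeros among the first `n` entries. -/
def zeros (n : ℕ) (a : ℕ → ℕ) : ℕ := ((Finset.range n).filter fun u => a u = 0).card

theorem zeros_le (n : ℕ) (a : ℕ → ℕ) : zeros n a ≤ n := by
  simpa [zeros] using Finset.card_filter_le (Finset.range n) fun u => a u = 0

theorem zeros_update_le (n : ℕ) (a : ℕ → ℕ) (u x : ℕ) (hx : x ≠ 0) :
    zeros n (Function.update a u x) ≤ zeros n a := by
  refine Finset.card_le_card fun v hv => ?_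
  simp only [Finset.mem_filter, Finset.mem_range] at hv ⊢
  refine ⟨hv.1, ?_⟩
  by_cases h : v = u
  · subst h; simp [hx] at hv
  · simpa [h] using hv.2

theorem zeros_update (n : ℕ) (a : ℕ → ℕ) (u x : ℕ) (hu : u < n) (h0 : a u = 0) (hx : x ≠ 0) :
    zeros n (Function.update a u x) + 1 = zeros n a := by
  have : ((Finset.range n).filter fun v => Function.update a u x v = 0) =
      ((Finset.range n).filter fun v => a v = 0).erase u := by
    ext v
    by_cases h : v = u
    · subst h; simp [hx]
    · simp [h]
  unfold zeros
  rw [this, Finset.card_erase_add_one]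
  simp [hu, h0]

/-- The relation on numbers below `n` given by a relation on `Fin n`. -/
def natRel {n : ℕ} (A : Fin n → Fin n → Prop) (i j : ℕ) : Prop :=
  ∃ (hi : i < n) (hj : j < n), A ⟨i, hi⟩ ⟨j, hj⟩

theorem natRel_connected {n : ℕ} {T : SimpleGraph (Fin n)} (hT : T.Preconnected) (r : Fin n)
    (C : ℕ → Prop) (hr : C r) (hC : ∀ i j, i < n → j < n → C i → natRel T.Adj i j → C j) (i : ℕ)
    (hi : i < n) : C i := by
  have key : ∀ a b : Fin n, T.Reachable a b → C a → C b := by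
    rintro a b ⟨p⟩
    induction p with
    | nil => exact id
    | cons h p ih => exact fun ha => ih (hC _ _ (Fin.is_lt _) (Fin.is_lt _) ha ⟨Fin.is_lt _, Fin.is_lt _, h⟩)
  exact key r ⟨i, hi⟩ (hT r ⟨i, hi⟩) hr

/-! ### The merging program -/

section

variable {V : Type} {G : SimpleGraph V} {r : V} {pos : V → ℕ} {cl ap : V → V}

theorem MergeInv.zero {ap : V → V} (hap : ∀ x, x ≠ r → G.Adj (ap x) x ∧ pos (ap x) < pos x) :
    MergeInv G r pos 0 id ap := by
  refine ⟨fun _ => Iff.rfl, fun _ => rfl, fun x hx => (hap x hx).2, fun x y _ h => ?_,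
    fun x hx => unsep_of_adj (hap x hx).1.symm, fun x y _ _ h => by omega, fun _ _ => rfl,
    fun _ h => by omega⟩
  obtain rfl : y = x := h
  exact Unsep.refl _

/-- The root comes first and has no earlier neighbour, so the program skips it. -/
theorem MergeInv.one (hinj : Function.Injective pos) (h : MergeInv G r pos 0 cl ap)
    (hr : pos r = 0) : MergeInv G r pos 1 cl ap := by
  refine ⟨h.root, h.cl_cl, h.ap_lt, h.clique, h.clique_ap, fun x y _ _ _ => by omega,
    fun x _ => h.fresh x (by omega), fun x hx => ?_⟩
  obtain rfl : x = r := hinj (by omega)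
  rw [(h.root x).2 rfl]
  exact hx

end

/-- Walk from the vertices in registers 16 and 18 to where they meet, marking classes. -/
def mergeWalk : Prog :=
  .while ((♯18 =! ♯16) =! 0)
    (.ite ((11 ↗ ♯16) <! (11 ↗ ♯18))
      (.ite (16 ↗ (14 ↗ ♯18)) (18 ≔ ♯16)
        (.store 16 (14 ↗ ♯18) 1 ;; 18 ≔ 15 ↗ (14 ↗ ♯18)))
      (.store 16 (14 ↗ ♯16) 1 ;; 16 ≔ 15 ↗ (14 ↗ ♯16)))

section MergeProgram

variable {W M n : ℕ} {G : SimpleGraph (Fin n)} {r : Fin n} {pos : Fin n → ℕ}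
  {cl ap : Fin n → Fin n} {v : Fin n}

/-- The state of a walk in memory, where the vertices in `D` have to be covered. -/
def WalkState (G : SimpleGraph (Fin n)) (pos : Fin n → ℕ) (r v : Fin n) (cl ap : Fin n → Fin n)
    (D : Set (Fin n)) (s : State) (K : Set (Fin n)) (z x : Fin n) : Prop :=
  WalkInv G pos r v cl ap K z x ∧ RepSet (s.arr 16) K ∧ s.var 16 = z ∧
    ∀ w ∈ D, w = z ∨ w = x ∨ cl w ∈ K

/-- Every step marks a new class, lowers the position of `z`, or ends the walk. The number of
unmarked classes plus the position of `z` is therefore a potential, and it carries over to the next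
walk of the same `v`; each walk adds only a constant. -/
theorem mergeWalk_spec (hB : Big W M) (hM : MergeInv G r pos (pos v) cl ap)
    (hinj : Function.Injective pos) (hr : pos r = 0) (hn : n ≤ M) (hpos : ∀ u, pos u < n) {s : State}
    (h11 : ∀ u : Fin n, s.arr 11 u = pos u) (h14 : Rep (s.arr 14) cl) (h15 : Rep (s.arr 15) ap)
    {D K : Set (Fin n)} {z x : Fin n} (hs : WalkState G pos r v cl ap D s K z x)
    (hx : s.var 18 = x) :
    Runs W mergeWalk s fun t s' =>
      (∃ K' z', WalkState G pos r v cl ap D s' K' z' z') ∧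
      t + 100 * (zeros n (s'.arr 16) + s'.arr 11 (s'.var 16)) ≤
        100 * (zeros n (s.arr 16) + s.arr 11 (s.var 16)) + 200 := by
  have h32 := hB.two
  refine (runs_while (M := M) hB (of_decide_eq_true rfl)
    (fun s' => ∃ K' z' x', WalkState G pos r v cl ap D s' K' z' x' ∧ s'.var 18 = x')
    -- The additional 100 while the walkers are apart pay for the step that ends a walk in a marked
    -- class.
    (fun s' => 100 * (zeros n (s'.arr 16) + s'.arr 11 (s'.var 16)) +
      100 * (if s'.var 18 = s'.var 16 then 0 else 1)) ⟨K, z, x, hs, hx⟩ ?_ ?_).mono ?_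
  · rintro s' - ⟨K', z', x', h, hx'⟩
    have := h.2.2.1
    simp; omega
  · rintro s' hf ⟨K', z', x', ⟨hW, hK, hz, hD⟩, hx'⟩ hne
    have e11 : s'.arr 11 = s.arr 11 := hf.arr 11 (of_decide_eq_true rfl)
    have e14 : s'.arr 14 = s.arr 14 := hf.arr 14 (of_decide_eq_true rfl)
    have e15 : s'.arr 15 = s.arr 15 := hf.arr 15 (of_decide_eq_true rfl)
    have hxz : x' ≠ z' := by
      rintro rfl
      simp [hz, hx'] at hne
    have hxz' : (x' : ℕ) ≠ z' := fun h => hxz (Fin.ext h)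
    have hpne : pos x' ≠ pos z' := fun h => hxz (hinj h)
    have c1 := h14 x'
    have c2 := h14 z'
    have c3 := h15 (cl x')
    have c4 := h15 (cl z')
    have c5 := hK (cl x')
    have c6 := h11 x'
    have c7 := h11 z'
    have hb := bit_le_one (cl x' ∈ K')
    have b1 := hpos x'
    have b2 := hpos z'
    refine runs_run hB rfl ?_ fun t ht => ?_
    · simp [hz, hx', e11, e14, e15, c1, c2, c3, c4, c5, c6, c7]
      omega
    · have ht' : t ≤ 60 := ht.trans (of_decide_eq_true rfl)
      by_cases hlt : pos z' < pos x'
      · have hxr : x' ≠ r := by rintro rfl; omega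
        by_cases hmem : cl x' ∈ K'
        · refine ⟨⟨K', z', z', ⟨hW.halted hlt hmem, ?_, ?_, ?_⟩, ?_⟩, ?_⟩
          · simpa [hz, hx', e11, e14, e15, c1, c5, c6, c7, hlt, bit_true hmem] using hK
          · simp [hz, hx', e11, e14, c1, c5, c6, c7, hlt, bit_true hmem]
          · intro w hw
            rcases hD w hw with h' | h' | h'
            · exact Or.inl h'
            · exact Or.inr (Or.inr (h' ▸ hmem))
            · exact Or.inr (Or.inr h')
          · simp [hz, hx', e11, e14, c1, c5, c6, c7, hlt, bit_true hmem]
          · simp [hz, hx', e11, e14, c1, c5, c6, c7, hlt, bit_true hmem, hxz']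
            omega
        · have hz0 : s'.arr 16 (cl x') = 0 := by rw [c5, bit_false hmem]
          have hzz := zeros_update n (s'.arr 16) (cl x') 1 (cl x').2 hz0 one_ne_zero
          refine ⟨⟨_, z', ap (cl x'), ⟨hW.step hM rfl hlt hxr, ?_, ?_, ?_⟩, ?_⟩, ?_⟩
          · simpa [hz, hx', e11, e14, e15, c1, c3, c5, c6, c7, hlt, bit_false hmem] using
              hK.insert _
          · simp [hz, hx', e11, e14, e15, c1, c3, c5, c6, c7, hlt, bit_false hmem]
          · intro w hw
            rcases hD w hw with h' | h' | h'
            · exact Or.inl h'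
            · exact Or.inr (Or.inr (h' ▸ Or.inl rfl))
            · exact Or.inr (Or.inr (Or.inr h'))
          · simp [hz, hx', e11, e14, e15, c1, c3, c5, c6, c7, hlt, bit_false hmem]
          · simp [hz, hx', e11, e14, e15, c1, c3, c5, c6, c7, hlt, bit_false hmem, hxz']
            split_ifs <;> omega
      · have hlt' : pos x' < pos z' := by omega
        have hzr : z' ≠ r := by rintro rfl; omega
        -- The class of `z` may be marked already, so this step is paid for by the fall of `z`
        -- alone.
        have hzz := zeros_update_le n (s'.arr 16) (cl z') 1 one_ne_zero
        have hap := hM.ap_lt z' hzr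
        have c8 := h11 (ap (cl z'))
        refine ⟨⟨_, ap (cl z'), x', ⟨(hW.swap.step hM rfl hlt' hzr).swap, ?_, ?_, ?_⟩, ?_⟩, ?_⟩
        · simpa [hz, hx', e11, e14, e15, c2, c4, c6, c7, hlt] using hK.insert _
        · simp [hz, hx', e11, e14, e15, c2, c4, c6, c7, hlt]
        · intro w hw
          rcases hD w hw with h' | h' | h'
          · exact Or.inr (Or.inr (h' ▸ Or.inl rfl))
          · exact Or.inr (Or.inl h')
          · exact Or.inr (Or.inr (Or.inr h'))
        · simp [hz, hx', e11, e14, e15, c2, c4, c6, c7, hlt]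
        · simp [hz, hx', e11, e14, e15, c2, c4, c6, c7, c8, hlt, hxz']
          split_ifs <;> omega
  · rintro t s' hf ⟨⟨K', z', x', h, hx'⟩, h0, ht⟩
    have hxz : x' = z' := by
      by_contra hne
      have hne' : (x' : ℕ) ≠ z' := fun h => hne (Fin.ext h)
      simp [hx', h.2.2.1, hne'] at h0
    subst hxz
    refine ⟨⟨K', x', h⟩, ?_⟩
    simp only [Expr.cost] at ht
    split_ifs at ht <;> simp at ht <;> omega

end MergeProgram

end RMIS

namespace RMIS

/-- Process the vertex in register 15. -/
def mergeVertex : Prog :=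
  .for 19 0 (.store 16 ♯19 0) ;;
  16 ≔ 15 ↗ ♯15 ;;
  .for 17 0 (.ite ((0 ↗ (♯15 * ♯0 + ♯17)) * ((11 ↗ ♯17) <! (11 ↗ ♯15)))
    (18 ≔ ♯17 ;; mergeWalk) .skip) ;;
  .for 19 0 (.ite (16 ↗ (14 ↗ ♯19)) (.store 14 ♯19 ♯15) .skip) ;;
  .store 15 ♯15 ♯16

/-- Compute the blocks from a search order: the classes are written to array 14, the apices to
array 15. -/
def merge : Prog :=
  .for 19 0 (.store 14 ♯19 ♯19 ;; .store 15 ♯19 (13 ↗ ♯19)) ;;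
  .for 14 0 (.ite ♯14 (15 ≔ 10 ↗ ♯14 ;; mergeVertex) .skip)

section MergeProgram

variable {W M n : ℕ} {G : SimpleGraph (Fin n)} {r : Fin n} {pos : Fin n → ℕ}
  {cl ap : Fin n → Fin n} {v : Fin n}

theorem adj_cell (s : State) (h : HoldsGraph G s) (i j : Fin n) :
    s.arr 0 ((i : ℕ) * n + j) = bit (G.Adj i j) := h.2 i j

/-- The potential of the walks starts below `2 * n`, so all walks of one vertex together take linear
time. -/
theorem mergeVertex_spec (hB : Big W M) (hn : n ≤ M) {s : State} (hG : HoldsGraph G s)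
    (hM : MergeInv G r pos (pos v) cl ap)
    (hinj : Function.Injective pos) (hr : pos r = 0) (hpos : ∀ u, pos u < n) (hvr : v ≠ r)
    (h11 : ∀ u : Fin n, s.arr 11 u = pos u) (h14 : Rep (s.arr 14) cl) (h15 : Rep (s.arr 15) ap)
    (hv : s.var 15 = v) :
    HaltsWithin W (1000 * n) mergeVertex s fun s' => ∃ cl' ap',
      MergeInv G r pos (pos v + 1) cl' ap' ∧ Rep (s'.arr 14) cl' ∧ Rep (s'.arr 15) ap' := by
  have h32 := hB.two
  have hn1 : 1 ≤ n := by have := v.2; omega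
  -- clear the marks
  refine hw_seq (T₁ := n * 11 + 6) (T₂ := 964 * n + 19) (fun s' => ∀ u, u < n → s'.arr 16 u = 0)
    (hw_for hB (K := n) (of_decide_eq_true rfl) (of_decide_eq_true rfl) (by omega) hG.1 hn
      (fun j s' => ∀ u, u < j → s'.arr 16 u = 0) 3 (by simp) ?_ (fun s' _ _ h => h) (by omega)) ?_
    (by omega)
  · intro j s' hj hf hvj hI
    refine hw_run hB rfl (of_decide_eq_true rfl) (by simp [hvj]; omega) ?_
    intro u hu
    simp only [Prog.run, Expr.val, hvj]
    by_cases h : u = j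
    · subst h; simp
    · simp [Function.update_of_ne h, hI u (by omega)]
  intro s₁ f₁ h16
  have g1 : s₁.arr 11 = s.arr 11 := f₁.arr 11 (of_decide_eq_true rfl)
  have g2 : s₁.arr 14 = s.arr 14 := f₁.arr 14 (of_decide_eq_true rfl)
  have g3 : s₁.arr 15 = s.arr 15 := f₁.arr 15 (of_decide_eq_true rfl)
  have g4 : s₁.var 15 = v := (f₁.var 15 (of_decide_eq_true rfl)).trans hv
  have g5 : s₁.arr 0 = s.arr 0 := f₁.arr 0 (of_decide_eq_true rfl)
  have g6 : s₁.var 0 = n := (f₁.var 0 (of_decide_eq_true rfl)).trans hG.1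
  have c1 := h15 v
  refine hw_seq (T₁ := 3) (T₂ := 964 * n + 16) (fun s' => s' = s₁.setVar 16 (ap v))
    (hw_run hB rfl (of_decide_eq_true rfl) (by simp [g4, g3, c1]; omega) (by simp [g4, g3, c1])) ?_
    (by omega)
  rintro _ - rfl
  -- walks
  refine hw_seq (T₁ := 930 * n + 6) (T₂ := 34 * n + 10) (fun s' => ∃ K z,
    WalkState G pos r v cl ap {w | G.Adj v w ∧ pos w < pos v} s' K z z) ?_ ?_ (by omega)
  · refine (runs_for hB (K := n) (of_decide_eq_true rfl) (of_decide_eq_true rfl) (by omega)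
      (by simpa using g6) hn
      (fun j s' => ∃ K z, WalkState G pos r v cl ap {w | (w : ℕ) < j ∧ G.Adj v w ∧ pos w < pos v} s' K z z)
      (fun s' => 100 * (zeros n (s'.arr 16) + s'.arr 11 (s'.var 16))) 230 ?_ ?_).halts ?_
    · refine ⟨∅, ap v, hM.walk_init rfl hvr, fun u => ?_, by simp, by simp⟩
      simp [h16 u u.2, bit_false]
    · rintro j s' hj hf hvj ⟨K, z, hW, hK, hz, hD⟩
      have e1 : s'.arr 11 = s.arr 11 := (hf.arr 11 (of_decide_eq_true rfl)).trans g1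
      have e2 : s'.arr 14 = s.arr 14 := (hf.arr 14 (of_decide_eq_true rfl)).trans g2
      have e3 : s'.arr 15 = s.arr 15 := (hf.arr 15 (of_decide_eq_true rfl)).trans g3
      have e4 : s'.var 15 = v := (hf.var 15 (of_decide_eq_true rfl)).trans (by simpa using g4)
      have e5 : s'.arr 0 = s.arr 0 := (hf.arr 0 (of_decide_eq_true rfl)).trans g5
      have e6 : s'.var 0 = n := (hf.var 0 (of_decide_eq_true rfl)).trans (by simpa using g6)
      lift j to Fin n using hj with w
      have d1 := h11 w
      have d2 := h11 v
      have d3 := adj_cell s hG v w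
      have d4 := hpos w
      have d5 := hpos v
      have d6 := bit_le_one (G.Adj v w)
      have d7 := w.2
      have d8 := v.2
      refine runs_ite (M := M) hB (by simp [e1, e4, e5, e6, hvj, d1, d2, d3]; omega)
        (of_decide_eq_true rfl) (fun hb => ?_) (fun hb => ?_)
      · have hb' : G.Adj v w ∧ pos w < pos v := by
          simpa [e1, e4, e5, e6, hvj, d1, d2, d3, and_comm] using hb
        refine runs_seq (Q := fun t s'' => t ≤ 2 ∧ s'' = s'.setVar 18 w)
          (runs_run (M := M) hB rfl (by simp [hvj]; omega) fun t ht => ⟨ht, by simp [hvj]⟩) ?_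
        rintro t₀ _ - ⟨ht₀, rfl⟩
        have hWS : WalkState G pos r v cl ap {w' | (w' : ℕ) < w + 1 ∧ G.Adj v w' ∧ pos w' < pos v}
            (s'.setVar 18 w) K z w := by
          refine ⟨hW.start hM hb'.1 hb'.2, by simpa using hK, by simpa using hz, ?_⟩
          rintro w' ⟨hw', hw''⟩
          by_cases hww : w' = w
          · exact Or.inr (Or.inl hww)
          · have hne : (w' : ℕ) ≠ w := fun h => hww (Fin.ext h)
            have := hD w' ⟨by omega, hw''⟩
            tauto
        refine (mergeWalk_spec hB hM hinj hr hn hpos (by simpa [e1] using h11)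
          (by simpa [e2] using h14) (by simpa [e3] using h15) hWS (by simp)).mono ?_
        rintro t s'' hf'' ⟨⟨K', z', hW', hK', hz', hD'⟩, ht⟩
        simp at ht
        refine ⟨⟨K', z', hW', by simpa using hK', by simpa using hz', hD'⟩, ?_⟩
        simp; omega
      · have hb' : ¬ (G.Adj v w ∧ pos w < pos v) := by
          rintro ⟨h1, h2⟩
          simp [e1, e4, e5, e6, hvj, d1, d2, d3, h1, h2] at hb
        refine runs_run (M := M) hB rfl (by simp) fun t ht => ?_
        have ht' : t ≤ 1 := ht
        refine ⟨⟨K, z, hW, by simpa using hK, by simpa using hz, ?_⟩, by simp; omega⟩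
        rintro w' ⟨hw', hw''⟩
        by_cases hww : w' = w
        · exact absurd (hww ▸ hw'') hb'
        · have hne : (w' : ℕ) ≠ w := fun h => hww (Fin.ext h)
          exact hD w' ⟨by omega, hw''⟩
    · rintro t s' hf ⟨⟨K, z, hW, hK, hz, hD⟩, -, ht⟩
      refine ⟨?_, K, z, hW, hK, hz, fun w hw => hD w ⟨w.2, hw⟩⟩
      have z1 := zeros_le n (s₁.arr 16)
      have z2 : s₁.arr 11 (ap v) = pos (ap v) := by rw [g1, h11]
      have z3 := hpos (ap v)
      simp [z2] at ht
      omega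
  rintro s₂ f₂ ⟨K, z, hW, hK, hz, hD⟩
  have e2 : s₂.arr 14 = s.arr 14 := (f₂.arr 14 (of_decide_eq_true rfl)).trans g2
  have e3 : s₂.arr 15 = s.arr 15 := (f₂.arr 15 (of_decide_eq_true rfl)).trans g3
  have e4 : s₂.var 15 = v := (f₂.var 15 (of_decide_eq_true rfl)).trans (by simpa using g4)
  have e6 : s₂.var 0 = n := (f₂.var 0 (of_decide_eq_true rfl)).trans (by simpa using g6)
  classical
  refine hw_seq (T₁ := 34 * n + 6) (T₂ := 4)
    (fun s' => Rep (s'.arr 14) (fun u => if cl u ∈ K then v else cl u)) ?_ ?_ (by omega)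
  · refine hw_for hB (K := n) (of_decide_eq_true rfl) (of_decide_eq_true rfl) (by omega) e6 hn
      (fun j s' => ∀ u : Fin n, s'.arr 14 u =
        if (u : ℕ) < j then ((if cl u ∈ K then v else cl u : Fin n) : ℕ) else cl u) 20 ?_ ?_ ?_ (by omega)
    · intro u; simp [e2, h14 u]
    · intro j s' hj hf hvj hI
      have e4' : s'.var 15 = v := (hf.var 15 (of_decide_eq_true rfl)).trans e4
      have e16 : s'.arr 16 = s₂.arr 16 := hf.arr 16 (of_decide_eq_true rfl)
      lift j to Fin n using hj with w
      have d1 := hI w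
      simp only [lt_irrefl, if_false] at d1
      have d2 := hK (cl w)
      have d6 := bit_le_one (cl w ∈ K)
      have d7 := w.2
      have d8 := v.2
      refine hw_run hB rfl (of_decide_eq_true rfl) ?_ ?_
      · simp [e4', hvj, d1, e16, d2]; omega
      · intro u
        by_cases hu : u = w
        · subst hu
          by_cases hm : cl u ∈ K
          · simp [e4', hvj, d1, e16, d2, hm, bit_true]
          · simp [hvj, d1, e16, d2, hm, bit_false]
        · have hne : (u : ℕ) ≠ w := fun h => hu (Fin.ext h)
          have hlt : (u : ℕ) < w + 1 ↔ (u : ℕ) < w := by omega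
          by_cases hm : cl w ∈ K
          · simp [e4', hvj, d1, e16, d2, hm, bit_true, update_fin, hu, hI u, hlt]
          · simp [hvj, d1, e16, d2, hm, bit_false, hI u, hlt]
    · intro s' _ _ h u
      have := h u
      simpa using this
  · intro s₃ f₃ h3
    have k1 : s₃.var 15 = v := (f₃.var 15 (of_decide_eq_true rfl)).trans e4
    have k2 : s₃.var 16 = z := (f₃.var 16 (of_decide_eq_true rfl)).trans hz
    have k3 : s₃.arr 15 = s.arr 15 := (f₃.arr 15 (of_decide_eq_true rfl)).trans e3
    have d7 := z.2
    have d8 := v.2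
    refine hw_run hB rfl (of_decide_eq_true rfl) (by simp [k1, k2]; omega) ?_
    refine ⟨_, _, hM.merge hinj rfl hvr hW fun w hw hlt => ?_, ?_, ?_⟩
    · have := hD w ⟨hw, hlt⟩; tauto
    · simpa [k1, k2] using h3
    · have := h15.update v z
      simp only [Prog.run, Expr.val, k1, k2, State.setArr_arr, if_true, k3]
      convert this

/-- The block structure of the graph in memory. -/
def HoldsBlocks (G : SimpleGraph (Fin n)) (r : Fin n) (pos : Fin n → ℕ) (cl ap : Fin n → Fin n)
    (s : State) : Prop :=
  BlockCert G r pos cl ap ∧ Rep (s.arr 14) cl ∧ Rep (s.arr 15) ap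

theorem merge_spec (hB : Big W M) (hn : n ≤ M) {s : State} (hG : HoldsGraph G s)
    (hS : SearchPost n r (natRel G.Adj) (s.arr 10) (s.arr 11) (s.arr 13)) :
    HaltsWithin W (2000 * n ^ 2) merge s fun s' =>
      ∃ cl ap, HoldsBlocks G r (fun u => s.arr 11 u) cl ap s' := by
  have h32 := hB.two
  have hn1 : 1 ≤ n := by have := r.2; omega
  have hq : ∀ u : Fin n, s.arr 13 u < n := by
    intro u
    by_cases h : (u : ℕ) = r
    · rw [h]; exact hS.root.2.2
    · exact (hS.par u u.2 h).1
  set pos : Fin n → ℕ := fun u => s.arr 11 u with hposdef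
  have hpos : ∀ u, pos u < n := fun u => (hS.pos u u.2).1
  have hinj : Function.Injective pos := by
    intro u w huw
    refine Fin.ext ?_
    rw [← (hS.pos u u.2).2, ← (hS.pos w w.2).2]
    exact congrArg _ huw
  have hr : pos r = 0 := hS.root.2.1
  let par : Fin n → Fin n := fun u => ⟨s.arr 13 u, hq u⟩
  have h0 : MergeInv G r pos 0 id par := by
    refine MergeInv.zero fun x hx => ?_
    obtain ⟨-, ⟨h1, h2, h3⟩, h4⟩ := hS.par x x.2 fun h => hx (Fin.ext h)
    exact ⟨h3, h4⟩
  refine hw_seq (T₁ := 20 * n + 6) (T₂ := n * (1000 * n + 20) + 6)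
    (fun s' => Rep (s'.arr 14) id ∧ Rep (s'.arr 15) par)
    (hw_for hB (K := n) (of_decide_eq_true rfl) (of_decide_eq_true rfl) (by omega) hG.1 hn
      (fun j s' => ∀ u : Fin n, (u : ℕ) < j → s'.arr 14 u = u ∧ s'.arr 15 u = par u) 12 (by simp)
      ?_ (fun s' _ _ h => ⟨fun u => (h u u.2).1, fun u => (h u u.2).2⟩) (by omega)) ?_
    (by nlinarith)
  · intro j s' hj hf hvj hI
    have e13 : s'.arr 13 = s.arr 13 := hf.arr 13 (of_decide_eq_true rfl)
    lift j to Fin n using hj with w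
    have d1 := hq w
    refine hw_run hB rfl (of_decide_eq_true rfl) (by simp [hvj, e13]; omega) ?_
    intro u hu
    by_cases h : u = w
    · subst h; simp [hvj, e13, par]
    · have hne : (u : ℕ) ≠ w := fun h' => h (Fin.ext h')
      simpa [hvj, e13, hne] using hI u (by omega)
  · rintro s₁ f₁ ⟨h14, h15⟩
    refine hw_for hB (K := n) (of_decide_eq_true rfl) (of_decide_eq_true rfl) (by omega)
      ((f₁.var 0 (of_decide_eq_true rfl)).trans hG.1) hn
      (fun k s' => ∃ cl ap, MergeInv G r pos k cl ap ∧ Rep (s'.arr 14) cl ∧ Rep (s'.arr 15) ap)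
      (1000 * n + 10) ⟨id, par, h0, h14, h15⟩ ?_ ?_ (by nlinarith)
    · rintro k s' hk hf hvk ⟨cl, ap, hM, h14, h15⟩
      refine hw_ite (M := M) (T' := 1000 * n + 8) hB (by simp; omega) (of_decide_eq_true rfl)
        (fun hb => ?_) (fun hb => ?_) (by simp; omega)
      · have hk0 : k ≠ 0 := by simpa [hvk] using hb
        have e0 : s'.arr 0 = s.arr 0 :=
          (hf.arr 0 (of_decide_eq_true rfl)).trans (f₁.arr 0 (of_decide_eq_true rfl))
        have e1 : s'.var 0 = n :=
          ((hf.var 0 (of_decide_eq_true rfl)).trans (f₁.var 0 (of_decide_eq_true rfl))).trans hG.1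
        have e10 : s'.arr 10 = s.arr 10 :=
          (hf.arr 10 (of_decide_eq_true rfl)).trans (f₁.arr 10 (of_decide_eq_true rfl))
        have e11 : s'.arr 11 = s.arr 11 :=
          (hf.arr 11 (of_decide_eq_true rfl)).trans (f₁.arr 11 (of_decide_eq_true rfl))
        obtain ⟨o1, o2⟩ := hS.ord k hk
        refine hw_seq (T₁ := 3) (T₂ := 1000 * n) (fun s'' => s'' = s'.setVar 15 (s.arr 10 k))
          (hw_run hB rfl (of_decide_eq_true rfl) (by simp [hvk, e10]; omega)
            (by simp [hvk, e10])) ?_ (by omega)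
        rintro _ - rfl
        have hpv : pos ⟨s.arr 10 k, o1⟩ = k := o2
        refine (mergeVertex_spec (s := s'.setVar 15 (s.arr 10 k)) (v := ⟨s.arr 10 k, o1⟩) (cl := cl) (ap := ap) hB hn
          ⟨by simpa using e1, by simpa [e0] using hG.2⟩ (hpv ▸ hM) hinj hr hpos ?_
          (by simp [e11, hposdef]) h14 h15 rfl).mono le_rfl ?_
        · rintro h
          rw [h, hr] at hpv
          exact hk0 hpv.symm
        · rintro s'' - ⟨cl', ap', h1, h2, h3⟩
          exact ⟨cl', ap', hpv ▸ h1, h2, h3⟩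
      · have hk0 : k = 0 := by simpa [hvk] using hb
        subst hk0
        exact hw_run (M := M) hB rfl (by simp [Prog.tmax]) (by simp)
          ⟨cl, ap, hM.one hinj hr, h14, h15⟩
    · rintro s' - - ⟨cl, ap, hM, h14, h15⟩
      exact ⟨cl, ap, hM.cert hinj hpos, h14, h15⟩

end MergeProgram

end RMIS

namespace RMIS

/-! ### Counting and tabulating -/

/-- Count in register `c` the numbers `j` below register `r` for which `e` is not zero. -/
def Prog.count (c j r : ℕ) (e : Expr) : Prog :=
  c ≔ 0 ;; .for j r (.ite e (c ≔ ♯c + 1) .skip)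

/-- Tabulate the expression `e`, which depends on the registers `i` and `j`. -/
def Prog.fill (a i j rI rJ : ℕ) (e : Expr) : Prog :=
  .for i rI (.for j rJ (.store a (♯i * ♯rJ + ♯j) e))

section

variable {W M n : ℕ}

theorem ncard_lt_succ {n : ℕ} (P : Fin n → Prop) (w : Fin n) :
    {x : Fin n | (x : ℕ) < w + 1 ∧ P x}.ncard =
      {x : Fin n | (x : ℕ) < w ∧ P x}.ncard + bit (P w) := by
  by_cases h : P w
  · have : {x : Fin n | (x : ℕ) < w + 1 ∧ P x} = insert w {x : Fin n | (x : ℕ) < w ∧ P x} := by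
      ext x
      by_cases hx : x = w
      · subst hx; simp [h]
      · have : (x : ℕ) ≠ w := fun h' => hx (Fin.ext h')
        have : (x : ℕ) < w + 1 ↔ (x : ℕ) < w := by omega
        simp only [Set.mem_ofPred_eq, Set.mem_insert_iff, hx, this, false_or]
    rw [this, Set.ncard_insert_of_notMem (by simp), bit_true h]
  · have : {x : Fin n | (x : ℕ) < w + 1 ∧ P x} = {x : Fin n | (x : ℕ) < w ∧ P x} := by
      ext x
      by_cases hx : x = w
      · subst hx; simp [h]
      · have : (x : ℕ) ≠ w := fun h' => hx (Fin.ext h')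
        have : (x : ℕ) < w + 1 ↔ (x : ℕ) < w := by omega
        simp only [Set.mem_ofPred_eq, this]
    rw [this, bit_false h, add_zero]

theorem hw_count (hB : Big W M) {c j r : ℕ} {e : Expr} (hc : e.cost ≤ 64) (hcj : c ≠ j)
    (hrc : r ≠ c) (hrj : r ≠ j) {s : State} (hr : s.var r = n) (hn : n ≤ M) (P : Fin n → Prop)
    (he : ∀ s' (w : Fin n), (∀ i, i ≠ c → i ≠ j → s'.var i = s.var i) → s'.arr = s.arr →
      s'.var j = (w : ℕ) → e.Bdd M s' ∧ (e.val s' ≠ 0 ↔ P w)) :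
    HaltsWithin W (n * 80 + 8) (.count c j r e) s fun s' =>
      s'.var c = {x | P x}.ncard := by
  have h32 := hB.two
  refine hw_seq (T₁ := 2) (T₂ := n * 80 + 6) (fun s' => s' = s.setVar c 0)
    (hw_run hB rfl (of_decide_eq_true rfl) (by simp) (by simp)) ?_ (by omega)
  rintro _ - rfl
  refine hw_for hB (K := n) (by simp [Prog.wvars, hcj.symm]) (by simp [Prog.wvars, hrc]) hrj
    (by simp [hrc, hr]) hn
    (fun k s' => s'.var c = {x : Fin n | (x : ℕ) < k ∧ P x}.ncard) 72 (by simp [hcj]) ?_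
    (fun s' _ _ h => by simpa using h) (by omega)
  intro k s' hk hf hv hI
  lift k to Fin n using hk with w
  obtain ⟨h1, h2⟩ := he s' w (fun i h1 h2 => by
    rw [hf.var i (by simp [Prog.for, Prog.wvars, h1, h2])]; simp [h1])
    (by ext a; rw [hf.arr a (by simp [Prog.for, Prog.warrs])]; simp) hv
  have hle : {x : Fin n | (x : ℕ) < w ∧ P x}.ncard ≤ n := by
    have := Set.ncard_le_card {x : Fin n | (x : ℕ) < w ∧ P x}
    simpa using this
  have hs := ncard_lt_succ P w
  generalize {x : Fin n | (x : ℕ) < w + 1 ∧ P x}.ncard = A at hs ⊢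
  generalize {x : Fin n | (x : ℕ) < w ∧ P x}.ncard = B at hs hI hle
  refine hw_ite (M := M) (T' := 4) hB h1 hc (fun hb => ?_) (fun hb => ?_) (by omega)
  · refine hw_run hB rfl (of_decide_eq_true rfl) (by simp [hI]; omega) ?_
    simp [hI, hcj, hs, bit_true (h2.1 hb)]
  · refine hw_run (M := M) hB rfl (by simp [Prog.tmax]) (by simp) ?_
    simp [hI, hcj, hs, bit_false fun h => (h2.2 h) hb]

theorem hw_fill (hB : Big W M) {a i j rI rJ I J : ℕ} {e : Expr} (hc : e.cost ≤ 64) (hij : i ≠ j)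
    (h1 : rI ≠ i) (h2 : rI ≠ j) (h3 : rJ ≠ i) (h4 : rJ ≠ j) {s : State} (hI : s.var rI = I)
    (hJ : s.var rJ = J) (hIM : I ≤ M) (hJM : J ≤ M) (F : ℕ → ℕ → ℕ)
    (he : ∀ s' k l, k < I → l < J → (∀ x, x ≠ i → x ≠ j → s'.var x = s.var x) →
      (∀ b, b ≠ a → s'.arr b = s.arr b) → s'.var i = k → s'.var j = l →
        e.Bdd M s' ∧ e.val s' = F k l) :
    HaltsWithin W (I * (J * 80 + 14) + 6) (.fill a i j rI rJ e) s fun s' =>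
      ∀ k l, k < I → l < J → s'.arr a (k * J + l) = F k l := by
  have h32 := hB.two
  -- Quotient and remainder recover the cell, so filling a later cell does not destroy an earlier
  -- one.
  have key : ∀ k l k' l' : ℕ, l < J → l' < J → k * J + l = k' * J + l' → k = k' ∧ l = l' := by
    intro k l k' l' hl hl' h
    have e1 : (k * J + l) / J = k := by
      rw [Nat.add_comm, Nat.add_mul_div_right _ _ (by omega), Nat.div_eq_of_lt hl]; omega
    have e2 : (k' * J + l') / J = k' := by
      rw [Nat.add_comm, Nat.add_mul_div_right _ _ (by omega), Nat.div_eq_of_lt hl']; omega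
    have : k = k' := by rw [← e1, ← e2, h]
    subst this
    exact ⟨rfl, by omega⟩
  refine hw_for hB (K := I) (by simp [Prog.for, Prog.wvars, hij])
    (by simp [Prog.for, Prog.wvars, h2]) h1 hI hIM
    (fun k' s' => ∀ k l, k < k' → l < J → s'.arr a (k * J + l) = F k l) (J * 80 + 6)
    (by simp) ?_ (fun s' _ _ h => h) (by linarith)
  intro k₀ s' hk₀ hf hv hInv
  refine hw_for hB (K := J) (by simp [Prog.wvars])
    (by simp [Prog.wvars]) h4 (by rw [hf.var rJ (by simp [Prog.for, Prog.wvars, h3, h4]), hJ]) hJM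
    (fun l' s'' => ∀ k l, l < J → (k < k₀ ∨ (k = k₀ ∧ l < l')) → s''.arr a (k * J + l) = F k l) 72
    ?_ ?_ ?_ (by omega)
  · intro k l hl h
    have : k < k₀ := by omega
    simpa using hInv k l this hl
  · intro l₀ s'' hl₀ hf' hv' hInv'
    have hvi : s''.var i = k₀ := by
      rw [hf'.var i (by simp [Prog.for, Prog.wvars, hij]), hv]
    have hvJ : s''.var rJ = J := by
      rw [hf'.var rJ (by simp [Prog.for, Prog.wvars, h4]),
        hf.var rJ (by simp [Prog.for, Prog.wvars, h3, h4]), hJ]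
    obtain ⟨b1, b2⟩ := he s'' k₀ l₀ hk₀ hl₀ (fun x hx hx' => by
      rw [hf'.var x (by simp [Prog.for, Prog.wvars, hx']),
        hf.var x (by simp [Prog.for, Prog.wvars, hx, hx'])])
      (fun b hb => by
        rw [hf'.arr b (by simp [Prog.for, Prog.warrs, hb]),
        hf.arr b (by simp [Prog.for, Prog.warrs, hb])]) hvi hv'
    refine hw_run (M := M) hB (by simp only [Prog.small, hc, decide_true, Bool.and_true]; rfl) ?_ ?_ ?_
    · change _ + e.cost + 1 ≤ 72
      have : (♯i * ♯rJ + ♯j : Expr).cost = 5 := rfl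
      omega
    · simp [hvi, hvJ, hv', b1]; omega
    · intro k l hl h
      by_cases hkl : k = k₀ ∧ l = l₀
      · simp [hvi, hvJ, hv', b2, hkl.1, hkl.2]
      · have hne : k * J + l ≠ k₀ * J + l₀ := fun h' => hkl (key _ _ _ _ hl hl₀ h')
        simp only [Prog.run, State.setVar_arr, State.setArr_arr, if_true, Expr.val, Op.eval, hvi,
          hvJ, hv', Function.update_of_ne hne]
        exact hInv' k l hl (by omega)
  · intro s'' _ _ h k l hk hl
    exact h k l hl (by omega)

end

end RMIS

namespace RMIS

/-! ### Listing the nodes of the tree -/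

/-- Whether `x` belongs to the block named `c`. -/
def memE (c x : Expr) : Expr := 1 - (1 - ((14 ↗ x) =! c)) * (1 - ((15 ↗ c) =! x))

/-- Whether `c` is the name of a block. -/
def blkE (c : Expr) : Expr := ((14 ↗ c) =! c) * (1 - (c =! 0))

/-- Append `q` to the list in array 17 if `e` holds. -/
def pushIf (e q : Expr) : Prog := .ite e (.store 17 ♯1 q ;; 1 ≔ ♯1 + 1) .skip

/-- List the codes of all nodes in array 17. -/
def listCodes : Prog :=
  1 ≔ 0 ;;
  .for 20 0 (
    .count 23 21 0 (0 ↗ (♯20 * ♯0 + ♯21)) ;;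
    .count 24 21 0 (blkE ♯21 * memE ♯21 ♯20) ;;
    .count 25 21 0 (memE ♯20 ♯21) ;;
    pushIf (♯23 =! 1) (4 * ♯20) ;;
    pushIf (1 <! ♯24) (4 * ♯20 + 1) ;;
    pushIf (blkE ♯20 * (♯25 <! 3)) (4 * ♯20 + 2) ;;
    pushIf (blkE ♯20 * (2 <! ♯25)) (4 * ♯20 + 3))

/-- Write the tables that describe the tree. -/
def writeTree : Prog :=
  .for 20 1 (.store 1 ♯20 ((17 ↗ ♯20) % 4)) ;;
  .fill 2 20 21 1 0 (((1 ↗ ♯20) <! 2) * (♯21 =! (17 ↗ ♯20) / 4) +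
    (1 - ((1 ↗ ♯20) <! 2)) * memE ((17 ↗ ♯20) / 4) ♯21) ;;
  .fill 3 20 21 1 1 (
    ((1 ↗ ♯20) <! 2) * (1 - ((1 ↗ ♯21) <! 2)) * (2 ↗ (♯21 * ♯0 + (17 ↗ ♯20) / 4)) +
    ((1 ↗ ♯21) <! 2) * (1 - ((1 ↗ ♯20) <! 2)) * (2 ↗ (♯20 * ♯0 + (17 ↗ ♯21) / 4)))

/-- The array lists the valid codes below `b`. -/
structure CodeInv (Valid : ℕ → Prop) (b N : ℕ) (code : ℕ → ℕ) : Prop where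
  le : N ≤ b
  valid : ∀ k, k < N → code k < b ∧ Valid (code k)
  mono : ∀ k l, k < l → l < N → code k < code l
  surj : ∀ q, q < b → Valid q → ∃ k, k < N ∧ code k = q

theorem CodeInv.push {Valid : ℕ → Prop} {b N : ℕ} {code : ℕ → ℕ} (h : CodeInv Valid b N code)
    (hb : Valid b) : CodeInv Valid (b + 1) (N + 1) (Function.update code N b) := by
  have hlt : ∀ k, k < N → Function.update code N b k = code k := fun k hk =>
    Function.update_of_ne (by omega) _ _
  refine ⟨by have := h.le; omega, fun k hk => ?_, fun k l hkl hl => ?_, fun q hq hv => ?_⟩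
  · by_cases hkN : k = N
    · subst hkN; simp [hb]
    · rw [hlt k (by omega)]
      have := h.valid k (by omega)
      exact ⟨by omega, this.2⟩
  · rw [hlt k (by omega)]
    by_cases hlN : l = N
    · subst hlN; simpa using (h.valid k hkl).1
    · rw [hlt l (by omega)]; exact h.mono k l hkl (by omega)
  · by_cases hqb : q = b
    · exact ⟨N, by omega, by simp [hqb]⟩
    · obtain ⟨k, hk, hkq⟩ := h.surj q (by omega) hv
      exact ⟨k, by omega, by rw [hlt k hk, hkq]⟩

theorem CodeInv.pass {Valid : ℕ → Prop} {b N : ℕ} {code : ℕ → ℕ} (h : CodeInv Valid b N code)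
    (hb : ¬ Valid b) : CodeInv Valid (b + 1) N code := by
  refine ⟨by have := h.le; omega, fun k hk => ?_, h.mono, fun q hq hv => ?_⟩
  · have := h.valid k hk
    exact ⟨by omega, this.2⟩
  · have hqb : q ≠ b := by rintro rfl; exact hb hv
    exact h.surj q (by omega) hv

section

variable {W M n : ℕ}

theorem pushIf_spec (hB : Big W M) {Valid : ℕ → Prop} {b : ℕ} {e q : Expr} {s : State}
    (he : e.cost ≤ 40) (hq : q.cost ≤ 5) (hbM : b ≤ M)
    (h : CodeInv Valid b (s.var 1) (s.arr 17)) (hb : e.Bdd M s) (hv : e.val s ≠ 0 ↔ Valid b)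
    (hqb : q.Bdd M s) (hqv : q.val s = b) :
    HaltsWithin W 60 (pushIf e q) s fun s' => CodeInv Valid (b + 1) (s'.var 1) (s'.arr 17) := by
  have h32 := hB.two
  have := h.le
  refine hw_ite (T' := 15) hB hb (by omega) (fun hne => ?_) (fun h0 => ?_) (by omega)
  · refine hw_run (M := M) hB ?_ ?_ ?_ ?_
    · have : q.cost ≤ 64 := by omega
      simp only [Prog.small, this, decide_true, Bool.and_true]; rfl
    · change 1 + q.cost + 1 + 4 ≤ 15
      omega
    · simp [hqb]; omega
    · simpa [hqv] using h.push (hv.1 hne)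
  · exact hw_run (M := M) hB rfl (by simp [Prog.tmax]) (by simp)
      (h.pass fun hV => hv.2 hV h0)

variable {G : SimpleGraph (Fin n)} {r : Fin n} {pos : Fin n → ℕ} {cl ap : Fin n → Fin n}

theorem memE_val {s : State} (h14 : Rep (s.arr 14) cl) (h15 : Rep (s.arr 15) ap) {c x : Expr}
    {c' x' : Fin n} (hc : c.val s = c') (hx : x.val s = x') :
    (memE c x).val s = bit (x' ∈ blk cl ap c') := by
  have e1 : (cl x' : ℕ) = c' ↔ cl x' = c' := Fin.ext_iff.symm
  have e2 : (ap c' : ℕ) = x' ↔ x' = ap c' := by rw [eq_comm, Fin.ext_iff]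
  have d1 := h14 x'
  have d2 := h15 c'
  simp only [memE, Expr.val_sub, Expr.val, Op.eval, hc, hx, d1, d2,
    e1, e2]
  by_cases h1 : cl x' = c' <;> by_cases h2 : x' = ap c' <;> simp [h1, h2, blk, bit]

theorem memE_bdd {s : State} (h14 : Rep (s.arr 14) cl) (h15 : Rep (s.arr 15) ap) {c x : Expr}
    {c' x' : Fin n} (hc : c.val s = c') (hx : x.val s = x') (hcb : c.Bdd M s) (hxb : x.Bdd M s)
    (hn : n ≤ M) (hM : 1 ≤ M) : (memE c x).Bdd M s := by
  have d1 := h14 x'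
  have d2 := h15 c'
  have d3 := (cl x').2
  have d4 := (ap c').2
  simp [memE, hc, hx, d1, d2, hcb, hxb]
  omega

/-- The program recognises the root by its number, as the search starts at vertex 0. -/
theorem blkE_val {s : State} (h14 : Rep (s.arr 14) cl) {c : Expr} {c' : Fin n} (hr : (r : ℕ) = 0)
    (hc : c.val s = c') : (blkE c).val s = bit (IsBlk r cl c') := by
  have e1 : (cl c' : ℕ) = c' ↔ cl c' = c' := Fin.ext_iff.symm
  have e2 : (c' : ℕ) = 0 ↔ c' = r := by rw [← hr, Fin.ext_iff]
  have d1 := h14 c'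
  simp only [blkE, Expr.val_sub, Expr.val, Op.eval, hc, d1, e1, e2]
  by_cases h1 : cl c' = c' <;> by_cases h2 : c' = r <;> simp [h1, h2, IsBlk, bit]

theorem blkE_bdd {s : State} (h14 : Rep (s.arr 14) cl) {c : Expr} {c' : Fin n}
    (hc : c.val s = c') (hcb : c.Bdd M s) (hn : n ≤ M) (hM : 1 ≤ M) : (blkE c).Bdd M s := by
  have d1 := h14 c'
  have d3 := (cl c').2
  simp [blkE, hc, d1, hcb]
  omega

/-- The code `4 * v + k` stands for a node. -/
def ValidCode (h : BlockCert G r pos cl ap) (hG : G.Connected) (q : ℕ) : Prop :=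
  ∃ (k : Fin 4) (v : Fin n), q = 4 * v + k ∧ ∃ x, h.nodeOf hG k v = some x

theorem validCode_iff (h : BlockCert G r pos cl ap) (hG : G.Connected) (k : Fin 4) (v : Fin n) :
    ValidCode h hG (4 * v + k) ↔ ∃ x, h.nodeOf hG k v = some x := by
  constructor
  · rintro ⟨k', v', he, hx⟩
    have h1 : k = k' := Fin.ext (by omega)
    have h2 : v = v' := Fin.ext (by omega)
    rwa [h1, h2]
  · intro hx; exact ⟨k, v, rfl, hx⟩

theorem validCode_zero (h : BlockCert G r pos cl ap) (hG : G.Connected) (v : Fin n) :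
    ValidCode h hG (4 * v) ↔ {w | G.Adj v w}.ncard = 1 := by
  have := validCode_iff h hG 0 v
  simp only [Fin.val_zero, add_zero] at this
  rw [this]
  change _ ↔ IsPendant G v
  by_cases hv : IsPendant G v
  · simp [BlockCert.nodeOf, hv]
  · simp [BlockCert.nodeOf, hv]

theorem validCode_one (h : BlockCert G r pos cl ap) (hG : G.Connected) (v : Fin n) :
    ValidCode h hG (4 * v + 1) ↔ 1 < {c | IsBlk r cl c ∧ v ∈ blk cl ap c}.ncard := by
  have h1 : ValidCode h hG (4 * v + 1) ↔ IsArticulation G v := by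
    refine (validCode_iff h hG 1 v).trans ?_
    by_cases hv : IsArticulation G v
    · simp [BlockCert.nodeOf, hv]
    · simp [BlockCert.nodeOf, hv]
  rw [h1, h.isArticulation_iff hG, Set.one_lt_ncard_iff (Set.toFinite _)]
  constructor
  · rintro ⟨c, c', hne, hc, hc', hv, hv'⟩
    exact ⟨c, c', ⟨hc, hv⟩, ⟨hc', hv'⟩, hne⟩
  · rintro ⟨c, c', ⟨hc, hv⟩, ⟨hc', hv'⟩, hne⟩
    exact ⟨c, c', hne, hc, hc', hv, hv'⟩

theorem validCode_two (h : BlockCert G r pos cl ap) (hG : G.Connected) (v : Fin n) :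
    ValidCode h hG (4 * v + 2) ↔ IsBlk r cl v ∧ (blk cl ap v).ncard < 3 := by
  refine (validCode_iff h hG 2 v).trans ?_
  by_cases hv : IsBlk r cl v ∧ ¬ 3 ≤ (blk cl ap v).ncard
  · exact iff_of_true ⟨_, dif_pos hv⟩ ⟨hv.1, by omega⟩
  · refine iff_of_false ?_ fun h' => hv ⟨h'.1, by omega⟩
    rintro ⟨x, hx⟩
    rw [BlockCert.nodeOf, dif_neg hv] at hx
    cases hx

theorem validCode_three (h : BlockCert G r pos cl ap) (hG : G.Connected) (v : Fin n) :
    ValidCode h hG (4 * v + 3) ↔ IsBlk r cl v ∧ 2 < (blk cl ap v).ncard := by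
  refine (validCode_iff h hG 3 v).trans ?_
  by_cases hv : IsBlk r cl v ∧ 3 ≤ (blk cl ap v).ncard
  · exact iff_of_true ⟨_, dif_pos hv⟩ ⟨hv.1, by omega⟩
  · refine iff_of_false ?_ fun h' => hv ⟨h'.1, by omega⟩
    rintro ⟨x, hx⟩
    rw [BlockCert.nodeOf, dif_neg hv] at hx
    cases hx

/-- Three counts in linear time decide all four codes of a vertex: its degree, the number of blocks
that contain it, and the size of the block that it names. The codes come in increasing order, so
none is listed twice. -/
theorem listCodes_spec (hB : Big W M) (hn : 8 * n ≤ M) (hr : (r : ℕ) = 0) (hconn : G.Connected)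
    {s : State} (hG : HoldsGraph G s) (hb : HoldsBlocks G r pos cl ap s) :
    HaltsWithin W (1000 * n ^ 2) listCodes s fun s' =>
      CodeInv (ValidCode hb.1 hconn) (4 * n) (s'.var 1) (s'.arr 17) := by
  have h32 := hB.two
  have hn1 : 1 ≤ n := by have := r.2; omega
  obtain ⟨hC, h14, h15⟩ := hb
  refine hw_seq (T₁ := 2) (T₂ := n * (n * 240 + 272) + 6) (fun s' => s' = s.setVar 1 0)
    (hw_run hB rfl (of_decide_eq_true rfl) (by simp) (by simp)) ?_ (by nlinarith)
  rintro _ - rfl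
  refine hw_for hB (K := n) (of_decide_eq_true rfl) (of_decide_eq_true rfl) (by omega)
    (by simpa using hG.1) (by omega)
    (fun j s' => CodeInv (ValidCode hC hconn) (4 * j) (s'.var 1) (s'.arr 17)) (n * 240 + 264)
    ⟨by simp, by simp, by simp, by simp⟩ ?_ (fun s' _ _ h => h) (by linarith)
  intro j s₀ hj f₀ v₀ hI
  have hvar : ∀ i, i ∉ [1, 20, 21, 23, 24, 25] → s₀.var i = s.var i := by
    intro i hi
    rw [f₀.var i (by revert hi; simp [Prog.for, Prog.wvars, Prog.count, pushIf]; omega)]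
    revert hi; simp; omega
  have harr : ∀ i, i ≠ 17 → s₀.arr i = s.arr i := by
    intro i hi
    rw [f₀.arr i (by simp [Prog.for, Prog.warrs, Prog.count, pushIf, hi])]
    simp
  have g0 : s₀.var 0 = n := (hvar 0 (of_decide_eq_true rfl)).trans hG.1
  rw [← harr 14 (by omega)] at h14
  rw [← harr 15 (by omega)] at h15
  have hA : ∀ w w' : Fin n, s₀.arr 0 ((w : ℕ) * n + w') = bit (G.Adj w w') := by
    intro w w'
    rw [harr 0 (by omega)]; exact hG.2 w w'
  lift j to Fin n using hj with v
  have hv2 := v.2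
  -- the three counts
  refine hw_seq (T₁ := n * 80 + 8) (T₂ := n * 160 + 256) _
    (hw_count hB (of_decide_eq_true rfl) (by omega) (by omega) (by omega) g0 (by omega)
      (fun w => G.Adj v w) ?_) ?_ (by omega)
  · intro s' w hf ha hw
    have d1 := hA v w
    have d2 := bit_le_one (G.Adj v w)
    have d3 := w.2
    have e1 : s'.var 20 = v := (hf 20 (by omega) (by omega)).trans v₀
    have e0 : s'.var 0 = n := (hf 0 (by omega) (by omega)).trans g0
    simp [e1, e0, ha, hw, d1]; omega
  intro s₁ f₁ c₁
  have e1 : s₁.var 20 = v := (f₁.var 20 (of_decide_eq_true rfl)).trans v₀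
  have e0 : s₁.var 0 = n := (f₁.var 0 (of_decide_eq_true rfl)).trans g0
  have ha : s₁.arr = s₀.arr := by ext a; rw [f₁.arr a (by simp [Prog.for, Prog.warrs, Prog.count])]
  have en : s₁.var 1 = s₀.var 1 := f₁.var 1 (of_decide_eq_true rfl)
  clear f₁
  rw [← ha] at h14 h15 hI hA
  rw [← en] at hI
  clear hvar harr v₀ g0 ha f₀ en
  refine hw_seq (T₁ := n * 80 + 8) (T₂ := n * 80 + 248) _
    (hw_count hB (of_decide_eq_true rfl) (by omega) (by omega) (by omega) e0 (by omega)
      (fun c => IsBlk r cl c ∧ v ∈ blk cl ap c) ?_) ?_ (by omega)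
  · intro s' w hf ha hw
    have d3 := w.2
    have e1 : s'.var 20 = v := (hf 20 (by omega) (by omega)).trans e1
    rw [← ha] at h14 h15
    have a1 := memE_val h14 h15 (c := ♯21) (x := ♯20) hw e1
    have a2 := blkE_val (r := r) h14 (c := ♯21) hr hw
    have b1 := memE_bdd (M := M) h14 h15 (c := ♯21) (x := ♯20) hw e1 (by simp [hw]; omega) (by simp [e1]; omega)
      (by omega) (by omega)
    have b2 := blkE_bdd (M := M) h14 (c := ♯21) hw (by simp [hw]; omega) (by omega) (by omega)
    simp [a1, a2, b1, b2]
  intro s₂ f₂ c₂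
  replace e1 : s₂.var 20 = v := (f₂.var 20 (of_decide_eq_true rfl)).trans e1
  replace e0 : s₂.var 0 = n := (f₂.var 0 (of_decide_eq_true rfl)).trans e0
  replace c₁ := (f₂.var 23 (of_decide_eq_true rfl)).trans c₁
  have ha : s₂.arr = s₁.arr := by ext a; rw [f₂.arr a (by simp [Prog.for, Prog.warrs, Prog.count])]
  have en : s₂.var 1 = s₁.var 1 := f₂.var 1 (of_decide_eq_true rfl)
  clear f₂
  rw [← ha] at h14 h15 hI
  rw [← en] at hI
  clear hA ha en
  refine hw_seq (T₁ := n * 80 + 8) (T₂ := 240) _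
    (hw_count hB (of_decide_eq_true rfl) (by omega) (by omega) (by omega) e0 (by omega)
      (fun x => x ∈ blk cl ap v) ?_) ?_ (by omega)
  · intro s' w hf ha hw
    have d3 := w.2
    have e1 : s'.var 20 = v := (hf 20 (by omega) (by omega)).trans e1
    rw [← ha] at h14 h15
    have a1 := memE_val h14 h15 (c := ♯20) (x := ♯21) e1 hw
    have b1 := memE_bdd (M := M) h14 h15 (c := ♯20) (x := ♯21) e1 hw (by simp [e1]; omega) (by simp [hw]; omega)
      (by omega) (by omega)
    simp [a1, b1]
  intro s₃ f₃ c₃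
  replace e1 : s₃.var 20 = v := (f₃.var 20 (of_decide_eq_true rfl)).trans e1
  replace c₁ := (f₃.var 23 (of_decide_eq_true rfl)).trans c₁
  replace c₂ := (f₃.var 24 (of_decide_eq_true rfl)).trans c₂
  have ha : s₃.arr = s₂.arr := by ext a; rw [f₃.arr a (by simp [Prog.for, Prog.warrs, Prog.count])]
  have en : s₃.var 1 = s₂.var 1 := f₃.var 1 (of_decide_eq_true rfl)
  clear f₃
  rw [← ha] at h14 h15 hI
  rw [← en] at hI
  clear ha en e0
  have hle : ∀ K : Set (Fin n), K.ncard ≤ n := fun K => by simpa using Set.ncard_le_card K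
  have l1 := hle {w | G.Adj v w}
  have l2 := hle {c | IsBlk r cl c ∧ v ∈ blk cl ap c}
  have l3 := hle (blk cl ap v)
  have v0 := validCode_zero hC hconn v
  have v1 := validCode_one hC hconn v
  have v2 := validCode_two hC hconn v
  have v3 := validCode_three hC hconn v
  change s₃.var 25 = (blk cl ap v).ncard at c₃
  refine hw_seq (T₁ := 60) (T₂ := 180) _ (pushIf_spec hB (of_decide_eq_true rfl) (of_decide_eq_true rfl) (by omega) hI
    (by simp [c₁]; omega) (by simp [c₁, v0]) (by simp [e1]; omega) (by simp [e1])) ?_ (by omega)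
  intro s₄ f₄ hI
  replace e1 : s₄.var 20 = v := (f₄.var 20 (of_decide_eq_true rfl)).trans e1
  replace c₂ := (f₄.var 24 (of_decide_eq_true rfl)).trans c₂
  replace c₃ := (f₄.var 25 (of_decide_eq_true rfl)).trans c₃
  rw [← f₄.arr 14 (of_decide_eq_true rfl)] at h14
  refine hw_seq (T₁ := 60) (T₂ := 120) _ (pushIf_spec hB (of_decide_eq_true rfl) (of_decide_eq_true rfl) (by omega) hI
    (by simp [c₂]; omega) (by rw [v1, ← c₂]; by_cases h : 1 < s₄.var 24 <;> simp [h]) (by simp [e1]; omega) (by simp [e1])) ?_ (by omega)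
  intro s₅ f₅ hI
  replace e1 : s₅.var 20 = v := (f₅.var 20 (of_decide_eq_true rfl)).trans e1
  replace c₃ := (f₅.var 25 (of_decide_eq_true rfl)).trans c₃
  rw [← f₅.arr 14 (of_decide_eq_true rfl)] at h14
  have a2 := blkE_val (r := r) h14 (c := ♯20) hr e1
  have b2 := blkE_bdd (M := M) h14 (c := ♯20) e1 (by simp [e1]; omega) (by omega) (by omega)
  refine hw_seq (T₁ := 60) (T₂ := 60) _ (pushIf_spec hB (of_decide_eq_true rfl) (of_decide_eq_true rfl) (by omega) hI
    (by simp [c₃, b2]; omega) (by rw [show 4 * (v : ℕ) + 1 + 1 = 4 * v + 2 from rfl, v2]; simp [c₃, a2, and_comm]) (by simp [e1]; omega) (by simp [e1])) ?_ (by omega)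
  intro s₆ f₆ hI
  replace e1 : s₆.var 20 = v := (f₆.var 20 (of_decide_eq_true rfl)).trans e1
  replace c₃ := (f₆.var 25 (of_decide_eq_true rfl)).trans c₃
  rw [← f₆.arr 14 (of_decide_eq_true rfl)] at h14
  have a2 := blkE_val (r := r) h14 (c := ♯20) hr e1
  have b2 := blkE_bdd (M := M) h14 (c := ♯20) e1 (by simp [e1]; omega) (by omega) (by omega)
  refine (pushIf_spec hB (of_decide_eq_true rfl) (of_decide_eq_true rfl) (by omega) hI
    (by simp [c₃, b2]; omega) (by rw [show 4 * (v : ℕ) + 1 + 1 + 1 = 4 * v + 3 from rfl, v3]; simp [c₃, a2, and_comm]) (by simp [e1]; omega) (by simp [e1])).mono le_rfl ?_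
  intro s' _ h
  simpa [mul_add] using h

end

end RMIS

/-! ### Numbering the nodes and writing the tables of the tree -/

namespace RMIS

section

variable {W M n : ℕ} {G : SimpleGraph (Fin n)} {r : Fin n} {pos : Fin n → ℕ}
  {cl ap : Fin n → Fin n}

theorem bit_exists_fin {N n : ℕ} (P : Fin N → Fin n → Prop) (i : Fin N) (v : Fin n) :
    bit (∃ (hi : (i : ℕ) < N) (hv : (v : ℕ) < n), P ⟨i, hi⟩ ⟨v, hv⟩) = bit (P i v) :=
  bit_congr ⟨fun ⟨_, _, h⟩ => h, fun h => ⟨i.2, v.2, h⟩⟩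

theorem writeTree_spec (hB : Big W M) (hn : 8 * n ≤ M) (hr : (r : ℕ) = 0) (hconn : G.Connected)
    {s : State} (hG : HoldsGraph G s) (hb : HoldsBlocks G r pos cl ap s)
    (hcode : CodeInv (ValidCode hb.1 hconn) (4 * n) (s.var 1) (s.arr 17)) :
    HaltsWithin W (4000 * n ^ 2) writeTree s fun s' =>
      ∃ (N : ℕ) (ν : Fin N ≃ Node G), HoldsTree G ν s' := by
  have h32 := hB.two
  have hn1 : 1 ≤ n := by have := r.2; omega
  obtain ⟨hC, h14, h15⟩ := hb
  obtain ⟨N, hN⟩ : ∃ N, N = s.var 1 := ⟨_, rfl⟩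
  obtain ⟨code, hcd⟩ : ∃ code, code = s.arr 17 := ⟨_, rfl⟩
  rw [← hN, ← hcd] at hcode
  have hNle := hcode.le
  choose kk vv hkv f hf using fun i : Fin N => (hcode.valid i i.2).2
  have hspec := fun i => hC.nodeOf_spec hconn (hf i)
  -- Codes are determined by nodes and strictly increase along the list, hence injectivity;
  -- surjectivity holds because every valid code is listed.
  have hbij : Function.Bijective f := by
    constructor
    · intro i j hij
      have hj := hf j
      rw [← hij] at hj
      obtain ⟨h1, h2⟩ := hC.nodeOf_inj hconn (hf i) hj
      have hc : code i = code j := by rw [hkv i, hkv j, h1, h2]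
      rcases lt_trichotomy (i : ℕ) j with h | h | h
      · have := hcode.mono i j h j.2; omega
      · exact Fin.ext h
      · have := hcode.mono j i h i.2; omega
    · intro x
      obtain ⟨k, v, hx⟩ := hC.nodeOf_surj hconn x
      obtain ⟨i, hi, hiq⟩ := hcode.surj (4 * v + k) (by omega) ⟨k, v, rfl, x, hx⟩
      refine ⟨⟨i, hi⟩, ?_⟩
      have h1 := hkv ⟨i, hi⟩
      simp only at h1
      have h2 : kk ⟨i, hi⟩ = k := Fin.ext (by omega)
      have h3 : vv ⟨i, hi⟩ = v := Fin.ext (by omega)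
      have h4 := hf ⟨i, hi⟩
      rw [h2, h3, hx] at h4
      exact (Option.some.inj h4).symm
  have hvert : ∀ i, (kk i : ℕ) < 2 → (f i).IsVertex (vv i) := by
    intro i hi
    rcases (hspec i).2 with h | h | h | h
    · exact h.2.2
    · exact h.2.2
    · rw [h.1] at hi; exact absurd hi (by decide)
    · rw [h.1] at hi; exact absurd hi (by decide)
  have hblk : ∀ i, ¬ (kk i : ℕ) < 2 → (f i).IsBlock ∧ (f i).verts = blk cl ap (vv i) := by
    intro i hi
    rcases (hspec i).2 with h | h | h | h
    · rw [h.1] at hi; exact absurd (by decide) hi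
    · rw [h.1] at hi; exact absurd (by decide) hi
    · exact h.2.2.2
    · exact h.2.2.2
  have hkind := fun i => (hspec i).1
  have hmod : ∀ i : Fin N, code i % 4 = kk i := fun i => by rw [hkv]; omega
  have hdiv : ∀ i : Fin N, code i / 4 = vv i := fun i => by rw [hkv]; omega
  have hcl : ∀ i : Fin N, code i ≤ M := fun i => by have := (hcode.valid i i.2).1; omega
  -- kinds
  refine hw_seq (T₁ := N * 16 + 6) (T₂ := N * (n * 80 + 14) + N * (N * 80 + 14) + 12)
    (fun s' => ∀ i, i < N → s'.arr 1 i = code i % 4)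
    (hw_for hB (K := N) (of_decide_eq_true rfl) (of_decide_eq_true rfl) (by omega) hN.symm (by omega)
      (fun j s' => ∀ i, i < j → s'.arr 1 i = code i % 4) 8 (by simp) ?_ (fun s' _ _ h => h)
      (by omega)) ?_ (by nlinarith)
  · intro j s' hj hf hvj hI
    have e17 : s'.arr 17 = code := (hf.arr 17 (of_decide_eq_true rfl)).trans hcd.symm
    have := hcl ⟨j, hj⟩
    refine hw_run hB rfl (of_decide_eq_true rfl) (by simp [hvj, e17]; simp at this; omega) ?_
    intro i hi
    by_cases h : i = j
    · subst h; simp [hvj, e17]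
    · simpa [hvj, e17, h] using hI i (by omega)
  intro s₁ f₁ h1
  have g0 : s₁.var 0 = n := (f₁.var 0 (of_decide_eq_true rfl)).trans hG.1
  have g1 : s₁.var 1 = N := (f₁.var 1 (of_decide_eq_true rfl)).trans hN.symm
  have g17 : s₁.arr 17 = code := (f₁.arr 17 (of_decide_eq_true rfl)).trans hcd.symm
  rw [← f₁.arr 14 (of_decide_eq_true rfl)] at h14
  rw [← f₁.arr 15 (of_decide_eq_true rfl)] at h15
  have hG₁ : HoldsGraph G s₁ := ⟨g0, by rw [f₁.arr 0 (of_decide_eq_true rfl)]; exact hG.2⟩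
  -- vertices
  refine hw_seq (T₁ := N * (n * 80 + 14) + 6) (T₂ := N * (N * 80 + 14) + 6) _
    (hw_fill hB (I := N) (J := n) (of_decide_eq_true rfl) (by omega) (by omega) (by omega)
      (by omega) (by omega) g1 g0 (by omega) (by omega)
      (fun k l => bit (∃ (hk : k < N) (hl : l < n), (⟨l, hl⟩ : Fin n) ∈ (f ⟨k, hk⟩).verts)) ?_) ?_
      (by omega)
  · intro s' k l hk hl hv ha hvk hvl
    obtain ⟨i, rfl⟩ : ∃ i : Fin N, (i : ℕ) = k := ⟨⟨k, hk⟩, rfl⟩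
    obtain ⟨v, rfl⟩ : ∃ v : Fin n, (v : ℕ) = l := ⟨⟨l, hl⟩, rfl⟩
    have b14 := h14
    have b15 := h15
    rw [← ha 14 (by omega)] at b14
    rw [← ha 15 (by omega)] at b15
    have e1 : s'.arr 1 i = kk i := by rw [ha 1 (by omega), h1 i i.2, hmod]
    have e17 : s'.arr 17 i = code i := by rw [ha 17 (by omega), g17]
    have ec : ((17 ↗ ♯20 : Expr) / 4).val s' = vv i := by simp [hvk, e17, hdiv]
    have a1 := memE_val b14 b15 ec (x := ♯21) hvl
    have := hcl i
    have c1 := memE_bdd (M := M) b14 b15 ec (x := ♯21) hvl (by simp [hvk, e17]; omega)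
      (by simp [hvl]; omega) (by omega) (by omega)
    have := (kk i).2
    refine ⟨by simp [hvk, hvl, e1, e17, c1]; omega, ?_⟩
    rw [bit_exists_fin fun i v => v ∈ (f i).verts]
    simp only [Expr.val_sub, a1, ec, Expr.val, hvk,
      hvl, e1, Op.eval]
    by_cases h2 : (kk i : ℕ) < 2
    · have hv' : v ∈ (f i).verts ↔ (v : ℕ) = vv i := by
        rw [(hvert i h2).verts, Fin.ext_iff.symm]; rfl
      simp [h2, bit, hv']
    · simp [h2, (hblk i h2).2]
  intro s₂ f₂ h2
  replace h2 : ∀ (i : Fin N) (v : Fin n), s₂.arr 2 (i * n + v) = bit (v ∈ (f i).verts) := by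
    intro i v
    rw [h2 i v i.2 v.2, bit_exists_fin fun i v => v ∈ (f i).verts]
  replace g0 : s₂.var 0 = n := (f₂.var 0 (of_decide_eq_true rfl)).trans g0
  replace g1 : s₂.var 1 = N := (f₂.var 1 (of_decide_eq_true rfl)).trans g1
  replace g17 : s₂.arr 17 = code := (f₂.arr 17 (of_decide_eq_true rfl)).trans g17
  rw [← f₂.arr 1 (of_decide_eq_true rfl)] at h1
  have hG₂ : HoldsGraph G s₂ := ⟨g0, by rw [f₂.arr 0 (of_decide_eq_true rfl)]; exact hG₁.2⟩
  -- edges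
  refine (hw_fill hB (I := N) (J := N) (of_decide_eq_true rfl) (by omega) (by omega) (by omega)
      (by omega) (by omega) g1 g1 (by omega) (by omega)
      (fun k l => bit (∃ (hk : k < N) (hl : l < N), (abcTree G).Adj (f ⟨k, hk⟩) (f ⟨l, hl⟩))) ?_).mono
      le_rfl ?_
  · intro s' k l hk hl hv ha hvk hvl
    obtain ⟨i, rfl⟩ : ∃ i : Fin N, (i : ℕ) = k := ⟨⟨k, hk⟩, rfl⟩
    obtain ⟨j, rfl⟩ : ∃ j : Fin N, (j : ℕ) = l := ⟨⟨l, hl⟩, rfl⟩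
    have e0 : s'.var 0 = n := (hv 0 (by omega) (by omega)).trans g0
    have e1 : s'.arr 1 i = kk i := by rw [ha 1 (by omega), h1 i i.2, hmod]
    have e1' : s'.arr 1 j = kk j := by rw [ha 1 (by omega), h1 j j.2, hmod]
    have e17 : s'.arr 17 i = code i := by rw [ha 17 (by omega), g17]
    have e17' : s'.arr 17 j = code j := by rw [ha 17 (by omega), g17]
    have e2 : s'.arr 2 (j * n + vv i) = bit (vv i ∈ (f j).verts) := by rw [ha 2 (by omega), h2]
    have e2' : s'.arr 2 (i * n + vv j) = bit (vv j ∈ (f i).verts) := by rw [ha 2 (by omega), h2]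
    have d1 := hcl i
    have d2 := hcl j
    have d3 := (kk i).2
    have d4 := (kk j).2
    have d5 := bit_le_one (vv i ∈ (f j).verts)
    have d6 := bit_le_one (vv j ∈ (f i).verts)
    have d7 := i.2
    have d8 := j.2
    refine ⟨by simp [hvk, hvl, e0, e1, e1', e17, e17', hdiv, e2, e2']; omega, ?_⟩
    rw [bit_exists_fin fun i j => (abcTree G).Adj (f i) (f j), bit_congr (hC.tree_adj _ _)]
    have key : ∀ i j, (∃ v, (f i).IsVertex v ∧ (f j).IsBlock ∧ v ∈ (f j).verts) ↔
        (kk i : ℕ) < 2 ∧ ¬ (kk j : ℕ) < 2 ∧ vv i ∈ (f j).verts := by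
      intro i j
      constructor
      · rintro ⟨v, h3, h4, h5⟩
        have h6 : (kk i : ℕ) < 2 := by
          by_contra hc; exact h3.not_block (hblk i hc).1
        have h7 : ¬ (kk j : ℕ) < 2 := fun hc => (hvert j hc).not_block h4
        exact ⟨h6, h7, (h3.eq (hvert i h6)) ▸ h5⟩
      · rintro ⟨h3, h4, h5⟩
        exact ⟨_, hvert i h3, (hblk j h4).1, h5⟩
    rw [bit_congr (or_congr (key i j) (key j i))]
    simp only [Expr.val_sub, Expr.val_div, Expr.val,
      hvk, hvl, e0, e1, e1', e17, e17', hdiv, e2, e2', Op.eval]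
    by_cases h3 : (kk i : ℕ) < 2 <;> by_cases h4 : (kk j : ℕ) < 2 <;> simp [h3, h4, bit_false]
  · intro s₃ f₃ h3
    refine ⟨N, Equiv.ofBijective f hbij, ⟨(f₃.var 0 (of_decide_eq_true rfl)).trans g0, ?_⟩,
      (f₃.var 1 (of_decide_eq_true rfl)).trans g1, ?_, ?_, ?_⟩
    · rw [f₃.arr 0 (of_decide_eq_true rfl)]; exact hG₂.2
    · intro i
      rw [f₃.arr 1 (of_decide_eq_true rfl), h1 i i.2, hmod]
      exact (hkind i).symm
    · intro i v
      rw [f₃.arr 2 (of_decide_eq_true rfl), h2]; rfl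
    · intro i j
      rw [h3 i j i.2 j.2, bit_exists_fin fun i j => (abcTree G).Adj (f i) (f j)]; rfl

/-- Build the tree of a connected graph. -/
def buildTree : Prog := 6 ≔ 0 ;; search 0 0 6 ;; merge ;; listCodes ;; writeTree

/-- The block structure arises only as the output of the merging program; therefore `BlockFacts` is
part of the postcondition. -/
theorem buildTree_spec (hB : Big W M) (hn : 8 * n ≤ M) (hconn : G.Connected) {s : State}
    (hG : HoldsGraph G s) :
    HaltsWithin W (8000 * n ^ 2) buildTree s fun s' =>
      BlockFacts G ∧ ∃ (N : ℕ) (ν : Fin N ≃ Node G), HoldsTree G ν s' := by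
  have h32 := hB.two
  obtain ⟨v₀⟩ := hconn.nonempty
  have hn1 : 1 ≤ n := by have := v₀.2; omega
  let r : Fin n := ⟨0, by omega⟩
  refine hw_seq (T₁ := 2) (T₂ := 7200 * n ^ 2) (fun s' => s' = s.setVar 6 0)
    (hw_run hB rfl (of_decide_eq_true rfl) (by simp) (by simp)) ?_ (by nlinarith)
  rintro _ - rfl
  refine hw_seq (T₁ := 200 * n ^ 2) (T₂ := 7000 * n ^ 2) _
    (search_spec (r := r) (A := natRel G.Adj) hB (by omega) (by omega) (by omega) (by omega)
      (m := n) (by simpa using hG.1) (by simp [r]) r.2 ?_ (natRel_connected hconn.preconnected r)) ?_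
    (by nlinarith)
  · intro i j hi hj
    rw [State.setVar_arr]
    refine (hG.2 ⟨i, hi⟩ ⟨j, hj⟩).trans (bit_congr ⟨fun h => ⟨hi, hj, h⟩, fun ⟨_, _, h⟩ => h⟩)
  intro s₁ f₁ hS
  have hG₁ : HoldsGraph G s₁ := ⟨by rw [f₁.var 0 (of_decide_eq_true rfl)]; simpa using hG.1,
    by rw [f₁.arr 0 (of_decide_eq_true rfl)]; exact hG.2⟩
  refine hw_seq (T₁ := 2000 * n ^ 2) (T₂ := 5000 * n ^ 2) _ (merge_spec hB (by omega) hG₁ hS) ?_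
    (by nlinarith)
  rintro s₂ f₂ ⟨cl, ap, hb⟩
  have hG₂ : HoldsGraph G s₂ := ⟨by rw [f₂.var 0 (of_decide_eq_true rfl)]; exact hG₁.1,
    by rw [f₂.arr 0 (of_decide_eq_true rfl)]; exact hG₁.2⟩
  refine hw_seq (T₁ := 1000 * n ^ 2) (T₂ := 4000 * n ^ 2) _
    (listCodes_spec hB hn rfl hconn hG₂ hb) ?_ (by nlinarith)
  intro s₃ f₃ h₃
  have hG₃ : HoldsGraph G s₃ := ⟨by rw [f₃.var 0 (of_decide_eq_true rfl)]; exact hG₂.1,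
    by rw [f₃.arr 0 (of_decide_eq_true rfl)]; exact hG₂.2⟩
  have hb₃ : HoldsBlocks G r (fun u => s₁.arr 11 u) cl ap s₃ :=
    ⟨hb.1, by rw [f₃.arr 14 (of_decide_eq_true rfl)]; exact hb.2.1,
      by rw [f₃.arr 15 (of_decide_eq_true rfl)]; exact hb.2.2⟩
  exact (writeTree_spec hB hn rfl hconn hG₃ hb₃ h₃).mono le_rfl fun s' _ h =>
    ⟨hb.1.facts hconn, h⟩

end

end RMIS

namespace RMIS

/-! ### Two-satisfiability by propagation -/

/-- A system of constraints for a set `T` of vertices: an edge in `E` has exactly one end in `T`, or at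
most one if both ends are in `P`; moreover `T` contains `I` and is disjoint from `O`. -/
structure TwoSat (n : ℕ) where
  X : Set (Fin n)
  E : Fin n → Fin n → Prop
  P : Set (Fin n)
  I : Set (Fin n)
  O : Set (Fin n)
  symm : ∀ u w, E u w → E w u
  mem : ∀ u w, E u w → w ∈ X

variable {n : ℕ} {p : TwoSat n}

/-- If `u` has the value `x`, which is 2 inside of `T` and 1 outside, then `w` has the other value. -/
def TwoSat.Imp (p : TwoSat n) (u : Fin n) (x : ℕ) (w : Fin n) : Prop :=
  p.E u w ∧ ¬ (u ∈ p.P ∧ w ∈ p.P ∧ x = 1)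

/-- Contraposition: the constraint says that `u` and `w` do not both have the value `x`. -/
theorem TwoSat.Imp.symm {u w : Fin n} {x : ℕ} (h : p.Imp u x w) : p.Imp w x u :=
  ⟨p.symm _ _ h.1, fun ⟨h1, h2, h3⟩ => h.2 ⟨h2, h1, h3⟩⟩

/-- `T` solves the constraints. -/
structure TwoSat.Sol (p : TwoSat n) (T : Set (Fin n)) : Prop where
  xor : ∀ u w, p.E u w → ¬ (u ∈ p.P ∧ w ∈ p.P) → (u ∈ T ↔ w ∉ T)
  nand : ∀ u w, p.E u w → u ∈ p.P → w ∈ p.P → ¬ (u ∈ T ∧ w ∈ T)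
  pin : ∀ v ∈ p.I, v ∈ T
  pout : ∀ v ∈ p.O, v ∉ T

theorem TwoSat.Sol.imp {T : Set (Fin n)} (h : p.Sol T) {u w : Fin n} {x : ℕ} (hi : p.Imp u x w)
    (hx : x = 1 ∨ x = 2) (hu : x = 2 ↔ u ∈ T) : 3 - x = 2 ↔ w ∈ T := by
  by_cases hP : u ∈ p.P ∧ w ∈ p.P
  · have h1 := h.nand u w hi.1 hP.1 hP.2
    have h2 : x ≠ 1 := fun h' => hi.2 ⟨hP.1, hP.2, h'⟩
    obtain rfl : x = 2 := by tauto
    have h3 := hu.1 rfl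
    have : w ∉ T := fun h' => h1 ⟨h3, h'⟩
    simp [this]
  · have h1 := h.xor u w hi.1 hP
    rcases hx with rfl | rfl
    · have : u ∉ T := fun h' => by have := hu.2 h'; omega
      have : w ∈ T := by tauto
      simp [this]
    · have : u ∈ T := hu.1 rfl
      have : w ∉ T := by tauto
      simp [this]

/-- A partial assignment that is closed under the constraints. -/
structure TwoSat.Closed (p : TwoSat n) (σ : ℕ → ℕ) : Prop where
  le : ∀ w : Fin n, σ w ≤ 2
  imp : ∀ u w : Fin n, σ u ≠ 0 → p.Imp u (σ u) w → σ w = 3 - σ u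

/-- A run of the propagation that extends `v₀`: the first `h` of the `t` vertices in the queue `q` have
been processed; `c` tells whether a conflict has been found; the result is valid for all solutions that
satisfy `seed`. -/
structure RunInv (p : TwoSat n) (σ : ℕ → ℕ) (seed : Set (Fin n) → Prop) (v₀ : Fin n → ℕ)
    (val q : ℕ → ℕ) (h t c : ℕ) : Prop where
  le : ∀ w : Fin n, val w ≤ 2
  mem : ∀ w : Fin n, val w ≠ 0 → w ∈ p.X ∧ σ w = 0
  head : h ≤ t
  queue : ∀ k, k < t → ∃ u : Fin n, q k = u ∧ val u ≠ 0
  surj : ∀ u : Fin n, val u ≠ 0 → ∃ k, k < t ∧ q k = u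
  count : zeros n val + t = n
  conflict : c ≤ 1
  sound : ∀ T, p.Sol T → seed T → c = 0 ∧ ∀ w : Fin n, val w ≠ 0 → (val w = 2 ↔ w ∈ T)
  grow : c = 0 → ∀ w : Fin n, v₀ w ≠ 0 → val w = v₀ w
  closed : c = 0 → ∀ k, k < h → ∀ u w : Fin n, q k = u → p.Imp u (val u) w →
    σ w ≠ 0 ∨ val w = 3 - val u

section Run

variable {σ : ℕ → ℕ} {seed : Set (Fin n) → Prop} {v₀ : Fin n → ℕ} {val q : ℕ → ℕ} {h t c : ℕ}

theorem zeros_of_eq_zero {val : ℕ → ℕ} (hv : ∀ w, w < n → val w = 0) : zeros n val = n := by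
  rw [zeros, Finset.filter_true_of_mem (by simpa using hv), Finset.card_range]

theorem RunInv.empty (hv : ∀ w, w < n → val w = 0) : RunInv p σ seed (fun _ => 0) val q 0 0 0 := by
  have hv' : ∀ w : Fin n, val w = 0 := fun w => hv w w.2
  refine ⟨fun w => by simp [hv'], fun w hw => absurd (hv' w) hw, le_rfl, by simp,
    fun w hw => absurd (hv' w) hw, by simp [zeros_of_eq_zero hv], by simp,
    fun T _ _ => ⟨rfl, fun w hw => absurd (hv' w) hw⟩, by simp, by simp⟩

theorem RunInv.halted (hr : RunInv p σ seed v₀ val q h t c) (hc : ∀ T, p.Sol T → ¬ seed T) :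
    RunInv p σ seed v₀ val q h t 1 :=
  ⟨hr.le, hr.mem, hr.head, hr.queue, hr.surj, hr.count, le_rfl, fun T hT hs => absurd hs (hc T hT),
    by simp, by simp⟩

theorem RunInv.regrow (hr : RunInv p σ seed v₀ val q h t c) {v₁ : Fin n → ℕ}
    (hg : c = 0 → ∀ w : Fin n, v₁ w ≠ 0 → val w = v₁ w) : RunInv p σ seed v₁ val q h t c :=
  ⟨hr.le, hr.mem, hr.head, hr.queue, hr.surj, hr.count, hr.conflict, hr.sound, hg, hr.closed⟩

theorem RunInv.push (hr : RunInv p σ seed v₀ val q h t c) {w : Fin n} {x : ℕ} (hx : x = 1 ∨ x = 2)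
    (hw : val w = 0) (hσ : σ w = 0) (hX : w ∈ p.X)
    (hs : ∀ T, p.Sol T → seed T → (x = 2 ↔ w ∈ T)) :
    RunInv p σ seed v₀ (Function.update val w x) (Function.update q t w) h (t + 1) c := by
  have hx0 : x ≠ 0 := by omega
  have hne : ∀ u : Fin n, val u ≠ 0 → u ≠ w := by rintro u hu rfl; exact hu hw
  have hq : ∀ k, k < t → Function.update q t (w : ℕ) k = q k := fun k hk =>
    Function.update_of_ne (by omega) _ _
  refine ⟨fun u => ?_, fun u hu => ?_, by have := hr.head; omega, fun k hk => ?_, fun u hu => ?_, ?_,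
    hr.conflict, fun T hT hs' => ⟨(hr.sound T hT hs').1, fun u hu => ?_⟩, fun hc u hu => ?_,
    fun hc k hk u y hqu hi => ?_⟩
  · rw [update_fin]; split_ifs
    · omega
    · exact hr.le u
  · rw [update_fin] at hu; split_ifs at hu with he
    · subst he; exact ⟨hX, hσ⟩
    · exact hr.mem u hu
  · by_cases hkt : k = t
    · subst hkt; exact ⟨w, by simp, by simp [hx0]⟩
    · obtain ⟨u, h1, h2⟩ := hr.queue k (by omega)
      refine ⟨u, by rw [hq k (by omega), h1], ?_⟩
      rwa [update_fin, if_neg (hne u h2)]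
  · rw [update_fin] at hu; split_ifs at hu with he
    · subst he; exact ⟨t, by omega, by simp⟩
    · obtain ⟨k, h1, h2⟩ := hr.surj u hu
      exact ⟨k, by omega, by rw [hq k h1, h2]⟩
  · have := zeros_update n val w x w.2 hw hx0
    have := hr.count
    omega
  · rw [update_fin] at hu ⊢; split_ifs at hu ⊢ with he
    · subst he; exact hs T hT hs'
    · exact (hr.sound T hT hs').2 u hu
  · have h1 := hr.grow hc u hu
    rw [update_fin, if_neg (hne u (by omega)), h1]
  · have h1 := hr.head
    rw [hq k (by omega)] at hqu
    obtain ⟨u', h2, h3⟩ := hr.queue k (by omega)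
    obtain rfl : u = u' := Fin.ext (hqu.symm.trans h2)
    have hu : Function.update val w x u = val u := by rw [update_fin, if_neg (hne u h3)]
    rw [hu] at hi ⊢
    rcases hr.closed hc k hk u y hqu hi with h4 | h4
    · exact Or.inl h4
    · have := hr.le u
      rw [update_fin, if_neg (hne y (by omega))]
      exact Or.inr h4

/-- The values forced by a processed vertex `u`. -/
theorem RunInv.forced (hr : RunInv p σ seed v₀ val q h t c) {u w : Fin n} (hu : val u ≠ 0)
    (hi : p.Imp u (val u) w) {T : Set (Fin n)} (hT : p.Sol T) (hs : seed T) :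
    3 - val u = 2 ↔ w ∈ T := by
  have := hr.le u
  exact hT.imp hi (by omega) ((hr.sound T hT hs).2 u hu)

theorem RunInv.clash (hr : RunInv p σ seed v₀ val q h t c) {u w : Fin n} (hu : val u ≠ 0)
    (hi : p.Imp u (val u) w) (hw : val w = val u) (T : Set (Fin n)) (hT : p.Sol T) : ¬ seed T := by
  intro hs
  have h1 := hr.forced hu hi hT hs
  have h2 := (hr.sound T hT hs).2 w (by omega)
  have := hr.le u
  rw [← h1] at h2
  omega

/-- Adopt the result of a finished run. -/
theorem RunInv.commit (hr : RunInv p σ seed v₀ val q t t 0) (hσ : p.Closed σ) {σ' : ℕ → ℕ}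
    (hσ' : ∀ w : Fin n, σ' w = if val w = 0 then σ w else val w) :
    p.Closed σ' ∧ (∀ w : Fin n, σ w ≠ 0 → σ' w = σ w) ∧ (∀ w : Fin n, v₀ w ≠ 0 → σ' w = v₀ w) ∧
      zeros n σ' + t = zeros n σ := by
  have hkeep : ∀ w : Fin n, σ w ≠ 0 → val w = 0 := by
    intro w hw
    by_contra hv
    exact hw (hr.mem w hv).2
  refine ⟨⟨fun w => ?_, fun u w hu hi => ?_⟩, fun w hw => by rw [hσ', if_pos (hkeep w hw)],
    fun w hw => ?_, ?_⟩
  · rw [hσ']; split_ifs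
    · exact hσ.le w
    · exact hr.le w
  · have hu' := hσ' u
    by_cases hvu : val u = 0
    · rw [if_pos hvu] at hu'
      rw [hu'] at hu hi ⊢
      have h1 := hσ.imp u w hu hi
      have := hσ.le u
      rw [hσ', if_pos (hkeep w (by omega)), h1]
    · rw [if_neg hvu] at hu'
      rw [hu'] at hi ⊢
      obtain ⟨k, hk, hqk⟩ := hr.surj u hvu
      have h2 := hr.le u
      rcases hr.closed rfl k hk u w hqk hi with h1 | h1
      · rw [hσ', if_pos (hkeep w h1)]
        -- The critical edge leads from a new value to an old one. If they clashed, then by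
        -- contraposition the old assignment, being closed, would already have fixed `u`.
        have h3 := hσ.le w
        by_contra hne
        have h4 : σ w = val u := by omega
        rw [← h4] at hi
        have := hσ.imp w u h1 hi.symm
        have := (hr.mem u hvu).2
        omega
      · rw [hσ', if_neg (by omega), h1]
  · have := hr.grow rfl w hw
    rw [hσ', if_neg (by omega), this]
  · have hsplit : (Finset.range n).filter (fun w => σ w = 0) =
        (Finset.range n).filter (fun w => σ' w = 0) ∪
          (Finset.range n).filter (fun w => ¬ val w = 0) := by
      ext w
      simp only [Finset.mem_filter, Finset.mem_range, Finset.mem_union]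
      by_cases hw : w < n
      · have h1 := hσ' ⟨w, hw⟩
        have h2 := hr.mem ⟨w, hw⟩
        simp only at h1 h2
        by_cases hv : val w = 0
        · simp [hw, h1, hv]
        · simp [hw, hv, (h2 hv).2]
      · simp [hw]
    have hdisj : Disjoint ((Finset.range n).filter (fun w => σ' w = 0))
        ((Finset.range n).filter (fun w => ¬ val w = 0)) := by
      rw [Finset.disjoint_left]
      intro w hw hw'
      simp only [Finset.mem_filter, Finset.mem_range] at hw hw'
      have h1 := hσ' ⟨w, hw.1⟩
      simp only [hw'.2, if_false] at h1
      exact hw'.2 (h1.symm.trans hw.2)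
    have hcard := Finset.card_filter_add_card_filter_not (s := Finset.range n) (fun w => val w = 0)
    rw [Finset.card_range] at hcard
    have := hr.count
    unfold zeros at this ⊢
    rw [hsplit, Finset.card_union_of_disjoint hdisj]
    omega

end Run

end RMIS

namespace RMIS

/-! ### The propagation program -/

/-- Process the next vertex of the queue `qa`; the values are in array `va`, registers `hd` and `tl`
delimit the queue, register `cf` records conflicts. -/
def stepRun (va qa hd tl cf : ℕ) : Prog :=
  39 ≔ qa ↗ ♯hd ;; 40 ≔ va ↗ ♯39 ;; hd ≔ ♯hd + 1 ;;
  .for 38 0 (.ite ((0 ↗ (♯39 * ♯0 + ♯38)) * (20 ↗ ♯38) * ((26 ↗ ♯38) =! 0) *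
      (1 - (21 ↗ ♯39) * (21 ↗ ♯38) * (♯40 =! 1)))
    (.ite (va ↗ ♯38) (.ite ((va ↗ ♯38) =! ♯40) (cf ≔ 1) .skip)
      (.store va ♯38 (3 - ♯40) ;; .store qa ♯tl ♯38 ;; tl ≔ ♯tl + 1)) .skip)

variable {W M n : ℕ} {p : TwoSat n}

/-- The constraints in memory. -/
structure HoldsTwoSat (p : TwoSat n) (s : State) : Prop where
  size : s.var 0 = n
  adj : ∀ u w : Fin n, s.arr 0 (u * n + w) ≤ 1
  verts : ∀ w : Fin n, s.arr 20 w = bit (w ∈ p.X)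
  edge : ∀ u w : Fin n, u ∈ p.X →
    (p.E u w ↔ s.arr 0 (u * n + w) ≠ 0 ∧ s.arr 20 w ≠ 0)
  pair : ∀ w : Fin n, s.arr 21 w = bit (w ∈ p.P)
  pin : ∀ w : Fin n, s.arr 22 w = bit (w ∈ p.I)
  pout : ∀ w : Fin n, s.arr 23 w = bit (w ∈ p.O)
  sub : ∀ w, w ∈ p.I ∨ w ∈ p.O → w ∈ p.X

theorem HoldsTwoSat.congr {s s' : State} (h : HoldsTwoSat p s) (h0 : s'.var 0 = s.var 0)
    (ha : ∀ a ∈ [0, 20, 21, 22, 23], s'.arr a = s.arr a) : HoldsTwoSat p s' := by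
  simp only [List.mem_cons, List.not_mem_nil, or_false, forall_eq_or_imp, forall_eq] at ha
  obtain ⟨h1, h2, h3, h4, h5⟩ := ha
  exact ⟨h0.trans h.size, by rw [h1]; exact h.adj, by rw [h2]; exact h.verts,
    by rw [h1, h2]; exact h.edge, by rw [h3]; exact h.pair, by rw [h4]; exact h.pin,
    by rw [h5]; exact h.pout, h.sub⟩

/-- Neighbours fixed by earlier rounds are skipped, so a run never draws conclusions from them. This
is why its values, and its conflicts, are valid for all solutions with the given seed and not only
for those that extend the current assignment. -/
theorem stepRun_spec (hB : Big W M) (hn : n ≤ M) {va qa hd tl cf : ℕ}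
    (hreg : (va = 27 ∧ qa = 29 ∧ hd = 30 ∧ tl = 32 ∧ cf = 34) ∨
      (va = 28 ∧ qa = 30 ∧ hd = 31 ∧ tl = 33 ∧ cf = 35))
    {s : State} (hp : HoldsTwoSat p s) (hσ : ∀ w : Fin n, s.arr 26 w ≤ 2)
    {seed : Set (Fin n) → Prop} {v₀ : Fin n → ℕ}
    (hR : RunInv p (s.arr 26) seed v₀ (s.arr va) (s.arr qa) (s.var hd) (s.var tl) (s.var cf))
    (hlt : s.var hd < s.var tl) :
    HaltsWithin W (n * 100 + 30) (stepRun va qa hd tl cf) s fun s' =>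
      RunInv p (s.arr 26) seed v₀ (s'.arr va) (s'.arr qa) (s'.var hd) (s'.var tl) (s'.var cf) ∧
      s'.var hd = s.var hd + 1 := by
  have h32 := hB.two
  obtain ⟨u, hu, hvu⟩ := hR.queue _ hlt
  obtain ⟨h, hh⟩ : ∃ h, h = s.var hd := ⟨_, rfl⟩
  obtain ⟨x, hx⟩ : ∃ x, x = s.arr va u := ⟨_, rfl⟩
  have hx12 : x = 1 ∨ x = 2 := by have := hR.le u; omega
  have huX := (hR.mem u hvu).1
  have htl : s.var tl ≤ n := by have := hR.count; omega
  have hu2 := u.2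
  rw [← hh] at hu hR hlt
  -- Both instances of the program satisfy the same list of disequalities between cells; only these
  -- are used below.
  have hd1 : (va = 0) = False ∧ (va = 20) = False ∧ (va = 21) = False ∧ (va = 26) = False ∧
      (va = qa) = False ∧ (qa = 0) = False ∧ (qa = 20) = False ∧ (qa = 21) = False ∧
      (qa = 26) = False ∧ (qa = va) = False ∧ (0 = va) = False ∧ (20 = va) = False ∧
      (21 = va) = False ∧ (26 = va) = False ∧ (0 = qa) = False ∧ (20 = qa) = False ∧
      (21 = qa) = False ∧ (26 = qa) = False := by
    simp only [eq_iff_iff, iff_false]; omega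
  have hd2 : (hd = 0) = False ∧ (0 = hd) = False ∧ (hd = 38) = False ∧ (38 = hd) = False ∧
      (hd = 39) = False ∧ (39 = hd) = False ∧ (hd = 40) = False ∧ (40 = hd) = False ∧
      (hd = tl) = False ∧ (hd = cf) = False ∧ (tl = 0) = False ∧ (0 = tl) = False ∧
      (tl = 38) = False ∧ (38 = tl) = False ∧ (tl = 39) = False ∧ (39 = tl) = False ∧
      (tl = 40) = False ∧ (40 = tl) = False ∧ (tl = hd) = False ∧ (tl = cf) = False ∧
      (cf = 0) = False ∧ (0 = cf) = False ∧ (cf = 38) = False ∧ (38 = cf) = False ∧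
      (cf = 39) = False ∧ (39 = cf) = False ∧ (cf = 40) = False ∧ (40 = cf) = False ∧
      (cf = hd) = False ∧ (cf = tl) = False := by
    simp only [eq_iff_iff, iff_false]; omega
  clear hreg
  refine hw_seq (T₁ := 3) (T₂ := n * 100 + 21) (fun s' => s' = s.setVar 39 u)
    (hw_run hB rfl (of_decide_eq_true rfl) (by simp [← hh, hu]; omega) (by simp [← hh, hu])) ?_
    (by omega)
  rintro _ - rfl
  refine hw_seq (T₁ := 3) (T₂ := n * 100 + 18) (fun s' => s' = (s.setVar 39 u).setVar 40 x)
    (hw_run hB rfl (of_decide_eq_true rfl) (by simp [← hx]; omega) (by simp [← hx])) ?_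
    (by omega)
  rintro _ - rfl
  refine hw_seq (T₁ := 4) (T₂ := n * 100 + 14)
    (fun s' => s' = ((s.setVar 39 u).setVar 40 x).setVar hd (h + 1))
    (hw_run hB rfl (of_decide_eq_true rfl) (by simp [hd2, ← hh]; omega) (by simp [hd2, ← hh])) ?_
    (by omega)
  rintro s₁ - hs₁
  have f0 : s₁.var 0 = n := by simpa [hs₁, hd2] using hp.size
  have f1 : s₁.arr = s.arr := by simp [hs₁]
  have f2 : s₁.var 39 = u := by simp [hs₁, hd2]
  have f3 : s₁.var 40 = x := by simp [hs₁, hd2]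
  have f4 : s₁.var hd = h + 1 := by simp [hs₁]
  have f5 : s₁.var tl = s.var tl := by simp [hs₁, hd2]
  have f6 : s₁.var cf = s.var cf := by simp [hs₁, hd2]
  clear hs₁
  refine hw_for hB (K := n) (by simp [Prog.wvars, hd2]) (by simp [Prog.wvars, hd2]) (by omega) f0 hn
    (fun j s' => RunInv p (s.arr 26) seed v₀ (s'.arr va) (s'.arr qa) h (s'.var tl) (s'.var cf) ∧
      h < s'.var tl ∧ s'.arr qa h = u ∧ s'.arr va u = x ∧ (s'.var cf = 0 → ∀ w : Fin n,
        (w : ℕ) < j → p.Imp u x w → s.arr 26 w ≠ 0 ∨ s'.arr va w = 3 - x)) 80 ?_ ?_ ?_ (by omega)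
  · simp only [State.setVar_arr, State.setVar_var, hd2, if_false, f1, f5, f6]
    exact ⟨hR, hlt, hu, hx.symm, by simp⟩
  · rintro j s' hj hf hvj ⟨hR', hlt', hqu, hvx, hcl⟩
    obtain ⟨w, rfl⟩ : ∃ w : Fin n, (w : ℕ) = j := ⟨⟨j, hj⟩, rfl⟩
    have g0 : s'.var 0 = n := (hf.var 0 (by simp [Prog.for, Prog.wvars, hd2])).trans f0
    have g39 : s'.var 39 = u := (hf.var 39 (by simp [Prog.for, Prog.wvars, hd2])).trans f2
    have g40 : s'.var 40 = x := (hf.var 40 (by simp [Prog.for, Prog.wvars, hd2])).trans f3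
    have harr : ∀ a, a ≠ va → a ≠ qa → s'.arr a = s.arr a := fun a h1 h2 =>
      (hf.arr a (by simp [Prog.for, Prog.warrs, h1, h2])).trans (by rw [f1])
    have a0 := harr 0 (by simp [hd1]) (by simp [hd1])
    have a20 := harr 20 (by simp [hd1]) (by simp [hd1])
    have a21 := harr 21 (by simp [hd1]) (by simp [hd1])
    have a26 := harr 26 (by simp [hd1]) (by simp [hd1])
    have b1 := hp.adj u w
    have b2 := hp.verts w
    have b3 := bit_le_one (w ∈ p.X)
    have b4 := hp.pair w
    have b5 := hp.pair u
    have b6 := bit_le_one (w ∈ p.P)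
    have b7 := bit_le_one (u ∈ p.P)
    have b8 := hσ w
    have b9 := hR'.le w
    have b10 : s'.var tl ≤ n := by have := hR'.count; omega
    have b11 := w.2
    have hedge := hp.edge u w huX
    have hcond : p.Imp u x w ∧ s.arr 26 w = 0 ↔ s.arr 0 (u * n + w) *
        bit (w ∈ p.X) * (if s.arr 26 w = 0 then 1 else 0) *
        (1 - bit (u ∈ p.P) * bit (w ∈ p.P) * (if x = 1 then 1 else 0)) ≠ 0 := by
      have h1 : (1 - bit (u ∈ p.P) * bit (w ∈ p.P) * (if x = 1 then 1 else 0)) ≠ 0 ↔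
          ¬ (u ∈ p.P ∧ w ∈ p.P ∧ x = 1) := by
        by_cases c1 : u ∈ p.P <;> by_cases c2 : w ∈ p.P <;> by_cases c3 : x = 1 <;>
          simp [c1, c2, c3, bit]
      rw [mul_ne_zero_iff, mul_ne_zero_iff, mul_ne_zero_iff, h1, TwoSat.Imp, hedge, b2]
      by_cases c4 : s.arr 26 w = 0
      · simp [c4]
      · simp [c4]
    have hnext : ∀ (w' : Fin n), (w' : ℕ) < w + 1 → w' = w ∨ (w' : ℕ) < w := by
      intro w' hw'
      by_cases hww : w' = w
      · exact Or.inl hww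
      · have : (w' : ℕ) ≠ w := fun h => hww (Fin.ext h)
        exact Or.inr (by omega)
    refine hw_ite (M := M) (T' := 30) hB (by simp [g0, g39, g40, hvj, a0, a20, a21, a26, b2, b4, b5]; omega)
      (of_decide_eq_true rfl) (fun hb => ?_) (fun hb => ?_) (of_decide_eq_true rfl)
    · have hb' := hcond.2 (by simpa [g0, g39, g40, hvj, a0, a20, a21, a26, b2, b4, b5] using hb)
      have hi : p.Imp u (s'.arr va u) w := by rw [hvx]; exact hb'.1
      have hwX : w ∈ p.X := p.mem _ _ hb'.1.1
      have hu0 : s'.arr va u ≠ 0 := by rw [hvx]; omega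
      refine hw_run (M := M) hB rfl (of_decide_eq_true rfl) (by simp [hvj, g40]; omega) ?_
      by_cases h0 : s'.arr va w = 0
      · have hne : (u : ℕ) ≠ w := by rintro he; rw [he] at hu0; exact hu0 h0
        have hpush := hR'.push (w := w) (x := 3 - x) (by omega) h0 hb'.2 hwX
          (fun T hT hs => by have := hR'.forced hu0 hi hT hs; rwa [hvx] at this)
        simp only [Prog.run, Expr.val, hvj, h0, g40, State.setArr_arr, State.setVar_arr,
          State.setArr_var, State.setVar_var, hd1, hd2, if_true, if_false, Expr.val_sub,
          Op.eval]
        refine ⟨hpush, by omega, ?_, ?_, fun hc w' hw' hi' => ?_⟩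
        · rwa [Function.update_of_ne (by omega)]
        · rwa [Function.update_of_ne hne]
        · rw [update_fin]
          rcases hnext w' hw' with rfl | hlt
          · simp
          · split_ifs
            · exact Or.inr rfl
            · exact hcl hc w' hlt hi'
      · by_cases h1 : s'.arr va w = x
        · have hclash := hR'.halted (hR'.clash hu0 hi (by rw [h1, hvx]))
          simp [hvj, h1, g40, hd2, show x ≠ 0 by omega, hclash, hlt', hqu, hvx]
        · simp [hvj, h0, h1, g40, hd2, hR', hlt', hqu, hvx]
          intro hc w' hw' hi'
          rcases hnext w' (by omega) with rfl | hlt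
          · exact Or.inr (by omega)
          · have := hcl hc w' hlt hi'
            tauto
    · have hb' : ¬ (p.Imp u x w ∧ s.arr 26 w = 0) := fun h' => hcond.1 h'
        (by simpa [g0, g39, g40, hvj, a0, a20, a21, a26, b2, b4, b5] using hb)
      refine hw_run (M := M) hB rfl (of_decide_eq_true rfl) (by simp) ?_
      simp only [Prog.run, State.setVar_arr, State.setVar_var, hd2, if_false]
      refine ⟨hR', hlt', hqu, hvx, fun hc w' hw' hi' => ?_⟩
      rcases hnext w' (by omega) with rfl | hlt
      · exact Or.inl fun h' => hb' ⟨hi', h'⟩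
      · exact hcl hc w' hlt hi'
  · rintro s' hf - ⟨hR', hlt', hqu, hvx, hcl⟩
    have hhd : s'.var hd = h + 1 := (hf.var hd (by simp [Prog.for, Prog.wvars, hd2])).trans f4
    refine ⟨?_, by rw [hhd, ← hh]⟩
    rw [hhd]
    refine ⟨hR'.le, hR'.mem, by omega, hR'.queue, hR'.surj, hR'.count, hR'.conflict, hR'.sound,
      hR'.grow, fun hc k hk u' w hu' hi => ?_⟩
    by_cases hkh : k = h
    · subst hkh
      obtain rfl : u' = u := Fin.ext (hu'.symm.trans hqu)
      rw [hvx] at hi ⊢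
      exact hcl hc w w.2 hi
    · exact hR'.closed hc k (by omega) u' w hu' hi

end RMIS

/-! ### Two propagations in lockstep -/

namespace RMIS

/-- Whether a run has ended without conflict. -/
def doneE (hd tl cf : ℕ) : Expr := (1 - ♯cf) * (♯hd =! ♯tl)

/-- Perform two runs in lockstep until one of them has ended without conflict. -/
def lockstep : Prog :=
  36 ≔ 0 ;;
  .while ((1 - doneE 30 32 34) * (1 - doneE 31 33 35) * (1 - ♯34 * ♯35))
    (.ite ♯34 .skip (stepRun 27 29 30 32 34) ;;
     .ite ♯35 .skip (stepRun 28 30 31 33 35) ;;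
     36 ≔ ♯36 + 1)

/-- Adopt the values in array `va`. -/
def commitRun (va : ℕ) : Prog :=
  .for 38 0 (.ite (va ↗ ♯38) (.store 26 ♯38 (va ↗ ♯38)) .skip)

/-- Perform two runs, adopt the result of one and reset them; register 5 becomes zero if both fail. -/
def round : Prog :=
  lockstep ;;
  .ite (doneE 30 32 34) (commitRun 27) (.ite (doneE 31 33 35) (commitRun 28) (5 ≔ 0)) ;;
  .for 38 0 (.store 27 ♯38 0 ;; .store 28 ♯38 0)

section

variable {W M n : ℕ} {p : TwoSat n} {seed₀ seed₁ : Set (Fin n) → Prop} {v₀ v₁ : Fin n → ℕ}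

/-- The two runs in memory. -/
structure HoldsRuns (p : TwoSat n) (σ : ℕ → ℕ) (seed₀ seed₁ : Set (Fin n) → Prop)
    (v₀ v₁ : Fin n → ℕ) (i : ℕ) (s : State) : Prop where
  run₀ : RunInv p σ seed₀ v₀ (s.arr 27) (s.arr 29) (s.var 30) (s.var 32) (s.var 34)
  run₁ : RunInv p σ seed₁ v₁ (s.arr 28) (s.arr 30) (s.var 31) (s.var 33) (s.var 35)
  head₀ : s.var 34 = 0 → s.var 30 = i
  head₁ : s.var 35 = 0 → s.var 31 = i

theorem doneE_ne {s : State} {hd tl cf : ℕ} (hc : s.var cf ≤ 1) :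
    (doneE hd tl cf).val s ≠ 0 ↔ s.var cf = 0 ∧ s.var hd = s.var tl := by
  have : s.var cf = 0 ∨ s.var cf = 1 := by omega
  rcases this with h | h <;> by_cases h' : s.var hd = s.var tl <;> simp [doneE, h, h']

theorem RunInv.le_size {σ : ℕ → ℕ} {seed : Set (Fin n) → Prop} {v : Fin n → ℕ} {val q : ℕ → ℕ}
    {h t c : ℕ} (hr : RunInv p σ seed v val q h t c) : h ≤ n ∧ t ≤ n := by
  have h1 := hr.count
  have h2 := hr.head
  omega

/-- Here `i` counts the common steps, each of which scans at most two rows. A run without conflict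
has processed exactly `i` vertices, so a long futile run cannot outlast a short successful one. -/
theorem lockstep_spec (hB : Big W M) (hn : n ≤ M) (hn1 : 1 ≤ n) {s : State} (hp : HoldsTwoSat p s)
    (hσ : ∀ w : Fin n, s.arr 26 w ≤ 2) (hr : HoldsRuns p (s.arr 26) seed₀ seed₁ v₀ v₁ 0 s) :
    Runs W lockstep s fun t s' => ∃ i, HoldsRuns p (s.arr 26) seed₀ seed₁ v₀ v₁ i s' ∧ i ≤ n ∧
      ((s'.var 34 = 0 ∧ s'.var 30 = s'.var 32) ∨ (s'.var 35 = 0 ∧ s'.var 31 = s'.var 33) ∨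
        (s'.var 34 = 1 ∧ s'.var 35 = 1)) ∧ t ≤ 400 * n * i + 40 := by
  have h32 := hB.two
  refine runs_seq (Q := fun t s' => t ≤ 2 ∧ s' = s.setVar 36 0)
    (runs_run (M := M) hB rfl (by simp) fun t ht => ⟨ht, by simp⟩) ?_
  rintro t₀ _ - ⟨ht₀, rfl⟩
  refine (runs_while (M := M) hB (of_decide_eq_true rfl)
    (fun s' => HoldsRuns p (s.arr 26) seed₀ seed₁ v₀ v₁ (s'.var 36) s' ∧ s'.var 36 ≤ n)
    (fun s' => 400 * n * (n - s'.var 36)) ?_ ?_ ?_).mono ?_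
  · exact ⟨⟨hr.run₀, hr.run₁, hr.head₀, hr.head₁⟩, by simp⟩
  · rintro s' hf ⟨h, hi⟩
    have := h.run₀.le_size
    have := h.run₁.le_size
    have := h.run₀.conflict
    have := h.run₁.conflict
    simp [doneE]; omega
  · rintro s' hf ⟨h, hi⟩ hne
    have e26 : s'.arr 26 = s.arr 26 := hf.arr 26 (of_decide_eq_true rfl)
    have hp' : HoldsTwoSat p s' := hp.congr (hf.var 0 (of_decide_eq_true rfl))
      (by
        simp only [List.mem_cons, List.not_mem_nil, or_false, forall_eq_or_imp, forall_eq]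
        refine ⟨?_, ?_, ?_, ?_, ?_⟩ <;> exact hf.arr _ (of_decide_eq_true rfl))
    have c0 := h.run₀.conflict
    have c1 := h.run₁.conflict
    have l0 := h.run₀.le_size
    have l1 := h.run₁.le_size
    have k0 := h.run₀.head
    have k1 := h.run₁.head
    have d0 := doneE_ne (hd := 30) (tl := 32) c0
    have d1 := doneE_ne (hd := 31) (tl := 33) c1
    have hn0 : ¬ (s'.var 34 = 0 ∧ s'.var 30 = s'.var 32) := by
      rw [← d0]; intro h'; apply hne
      simp [show 1 - (doneE 30 32 34).val s' = 0 by omega]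
    have hn1' : ¬ (s'.var 35 = 0 ∧ s'.var 31 = s'.var 33) := by
      rw [← d1]; intro h'; apply hne
      simp [show 1 - (doneE 31 33 35).val s' = 0 by omega]
    have hn2 : ¬ (s'.var 34 = 1 ∧ s'.var 35 = 1) := by
      rintro ⟨h1, h2⟩
      apply hne
      simp [h1, h2]
    -- A run without conflict that is not finished has its head, which is the counter, strictly
    -- before the tail of its queue, and the queue holds at most `n` vertices.
    have hlt : s'.var 36 < n := by
      have h1 := h.head₀
      have h2 := h.head₁
      omega
    obtain ⟨i, hieq⟩ : ∃ i, i = s'.var 36 := ⟨_, rfl⟩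
    rw [← hieq] at h hlt hi ⊢
    -- first run
    refine HaltsWithin.runs (T := 200 * n + 70) (post := fun s'' =>
      HoldsRuns p (s.arr 26) seed₀ seed₁ v₀ v₁ (i + 1) s'' ∧ s''.var 36 = i + 1) ?_ |>.mono ?_
    · refine hw_seq (T₁ := n * 100 + 32) (T₂ := n * 100 + 36) (fun s'' =>
        RunInv p (s.arr 26) seed₀ v₀ (s''.arr 27) (s''.arr 29) (s''.var 30) (s''.var 32)
          (s''.var 34) ∧ (s''.var 34 = 0 → s''.var 30 = i + 1)) ?_ ?_ (by omega)
      · refine hw_ite (M := M) (T' := n * 100 + 30) hB (by simp; omega) (of_decide_eq_true rfl)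
          (fun hb => ?_) (fun hb => ?_) (by simp; omega)
        · refine hw_run (M := M) hB rfl (by simp [Prog.tmax]) (by simp) ?_
          exact ⟨h.run₀, fun h' => absurd h' (by simpa using hb)⟩
        · have hc : s'.var 34 = 0 := by simpa using hb
          have := h.head₀ hc
          refine (stepRun_spec hB hn (Or.inl ⟨rfl, rfl, rfl, rfl, rfl⟩) hp' (by rw [e26]; exact hσ)
            (by rw [e26]; exact h.run₀) (by omega)).mono le_rfl ?_
          rintro s'' - ⟨h1, h2⟩
          rw [e26] at h1
          exact ⟨h1, fun _ => by omega⟩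
      rintro s₂ f₂ ⟨hr₂, hh₂⟩
      have e26' : s₂.arr 26 = s.arr 26 := (f₂.arr 26 (of_decide_eq_true rfl)).trans e26
      have hp₂ : HoldsTwoSat p s₂ := hp'.congr (f₂.var 0 (of_decide_eq_true rfl))
        (by
          simp only [List.mem_cons, List.not_mem_nil, or_false, forall_eq_or_imp, forall_eq]
          refine ⟨?_, ?_, ?_, ?_, ?_⟩ <;> exact f₂.arr _ (of_decide_eq_true rfl))
      have q1 : s₂.var 31 = s'.var 31 := f₂.var 31 (of_decide_eq_true rfl)
      have q2 : s₂.var 33 = s'.var 33 := f₂.var 33 (of_decide_eq_true rfl)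
      have q3 : s₂.var 35 = s'.var 35 := f₂.var 35 (of_decide_eq_true rfl)
      have q4 : s₂.arr 28 = s'.arr 28 := f₂.arr 28 (of_decide_eq_true rfl)
      have q5 : s₂.arr 30 = s'.arr 30 := f₂.arr 30 (of_decide_eq_true rfl)
      have q6 : s₂.var 36 = i := (f₂.var 36 (of_decide_eq_true rfl)).trans hieq.symm
      have hr₁ := h.run₁
      have hh₁ := h.head₁
      rw [← q1, ← q2, ← q3, ← q4, ← q5] at hr₁
      rw [← q3, ← q1] at hh₁
      rw [← q1, ← q2, ← q3] at hn1'
      refine hw_seq (T₁ := n * 100 + 32) (T₂ := 4) (fun s'' =>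
        RunInv p (s.arr 26) seed₁ v₁ (s''.arr 28) (s''.arr 30) (s''.var 31) (s''.var 33)
          (s''.var 35) ∧ (s''.var 35 = 0 → s''.var 31 = i + 1)) ?_ ?_ (by omega)
      · refine hw_ite (M := M) (T' := n * 100 + 30) hB (by simp; omega) (of_decide_eq_true rfl)
          (fun hb => ?_) (fun hb => ?_) (by simp; omega)
        · refine hw_run (M := M) hB rfl (by simp [Prog.tmax]) (by simp) ?_
          exact ⟨hr₁, fun h' => absurd h' (by simpa using hb)⟩
        · have hc : s₂.var 35 = 0 := by simpa using hb
          have := hh₁ hc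
          have := hr₁.head
          refine (stepRun_spec hB hn (Or.inr ⟨rfl, rfl, rfl, rfl, rfl⟩) hp₂ (by rw [e26']; exact hσ)
            (by rw [e26']; exact hr₁) (by omega)).mono le_rfl ?_
          rintro s'' - ⟨h1, h2⟩
          rw [e26'] at h1
          exact ⟨h1, fun _ => by omega⟩
      rintro s₃ f₃ ⟨hr₃, hh₃⟩
      have w1 : s₃.var 30 = s₂.var 30 := f₃.var 30 (of_decide_eq_true rfl)
      have w2 : s₃.var 32 = s₂.var 32 := f₃.var 32 (of_decide_eq_true rfl)
      have w3 : s₃.var 34 = s₂.var 34 := f₃.var 34 (of_decide_eq_true rfl)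
      have w4 : s₃.arr 27 = s₂.arr 27 := f₃.arr 27 (of_decide_eq_true rfl)
      have w5 : s₃.arr 29 = s₂.arr 29 := f₃.arr 29 (of_decide_eq_true rfl)
      have w6 : s₃.var 36 = i := (f₃.var 36 (of_decide_eq_true rfl)).trans q6
      rw [← w1, ← w2, ← w3, ← w4, ← w5] at hr₂
      rw [← w1, ← w3] at hh₂
      refine hw_run (M := M) hB rfl (of_decide_eq_true rfl) (by simp [w6]; omega) ?_
      exact ⟨⟨by simpa using hr₂, by simpa using hr₃, by simpa using hh₂, by simpa using hh₃⟩,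
        by simp [w6]⟩
    · rintro t s'' - ⟨ht, -, h1, h2⟩
      refine ⟨⟨by rw [h2]; exact h1, by omega⟩, ?_⟩
      rw [h2, show n - i = n - (i + 1) + 1 by omega, Nat.mul_add]
      have hcost : ((1 - doneE 30 32 34) * (1 - doneE 31 33 35) * (1 - ♯34 * ♯35) : Expr).cost = 25 :=
        rfl
      rw [hcost]
      omega
  · rintro t s' - ⟨⟨h, hi⟩, h0, ht⟩
    refine ⟨s'.var 36, h, hi, ?_, ?_⟩
    · have c0 := h.run₀.conflict
      have c1 := h.run₁.conflict
      have d0 := doneE_ne (hd := 30) (tl := 32) c0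
      have d1 := doneE_ne (hd := 31) (tl := 33) c1
      by_contra hcon
      push Not at hcon
      have e0 : (doneE 30 32 34).val s' = 0 := by
        by_contra hc; exact hcon.1 (d0.1 hc).1 (d0.1 hc).2
      have e1 : (doneE 31 33 35).val s' = 0 := by
        by_contra hc; exact hcon.2.1 (d1.1 hc).1 (d1.1 hc).2
      have e2 : 1 - s'.var 34 * s'.var 35 ≠ 0 := by
        have := hcon.2.2
        rcases (show s'.var 34 = 0 ∨ s'.var 34 = 1 by omega) with h | h <;>
          rcases (show s'.var 35 = 0 ∨ s'.var 35 = 1 by omega) with h' | h' <;> simp_all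
      apply e2
      simpa [e0, e1] using h0
    · have hcost : ((1 - doneE 30 32 34) * (1 - doneE 31 33 35) * (1 - ♯34 * ♯35) : Expr).cost = 25 :=
        rfl
      rw [hcost] at ht
      simp only [State.setVar_var, if_true, Nat.sub_zero] at ht
      have : 400 * n * n = 400 * n * (n - s'.var 36) + 400 * n * s'.var 36 := by
        rw [← Nat.mul_add]; congr 1; omega
      omega

end

end RMIS

/-! ### One round and its amortised cost -/

namespace RMIS

section

variable {W M n : ℕ} {p : TwoSat n} {seed₀ seed₁ : Set (Fin n) → Prop} {v₀ v₁ : Fin n → ℕ}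

theorem commitRun_spec (hB : Big W M) (hn : n ≤ M) {va : ℕ} (hva : va ≠ 26) {s : State}
    (h0 : s.var 0 = n) (hv : ∀ w : Fin n, s.arr va w ≤ 2) :
    HaltsWithin W (n * 20 + 6) (commitRun va) s fun s' =>
      ∀ w : Fin n, s'.arr 26 w = if s.arr va w = 0 then s.arr 26 w else s.arr va w := by
  have h32 := hB.two
  refine hw_for hB (K := n) (of_decide_eq_true rfl) (of_decide_eq_true rfl) (by omega) h0 hn
    (fun j s' => s'.arr va = s.arr va ∧ ∀ w : Fin n, s'.arr 26 w =
      if (w : ℕ) < j ∧ s.arr va w ≠ 0 then s.arr va w else s.arr 26 w) 12 ⟨by simp, by simp⟩ ?_ ?_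
    (by omega)
  · rintro j s' hj hf hvj ⟨hI1, hI⟩
    lift j to Fin n using hj with u
    have d1 := hv u
    have d2 := u.2
    refine hw_run hB rfl (of_decide_eq_true rfl) (by simp [hvj, hI1]; omega) ?_
    have hne : ∀ w : Fin n, w ≠ u → ((w : ℕ) < u + 1 ↔ (w : ℕ) < u) := by
      intro w hw
      have : (w : ℕ) ≠ u := fun h => hw (Fin.ext h)
      omega
    by_cases h0 : s.arr va u = 0
    · refine ⟨by simp [hvj, hI1, h0], fun w => ?_⟩
      simp only [Prog.run, Expr.val, hvj, hI1, h0, if_true, State.setVar_arr]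
      rw [hI w]
      by_cases hw : w = u
      · subst hw; simp [h0]
      · simp only [hne w hw]
    · refine ⟨by simp [hvj, hI1, h0, hva], fun w => ?_⟩
      simp only [Prog.run, Expr.val, hvj, hI1, h0, if_true, if_false, State.setVar_arr,
        State.setArr_arr, update_fin]
      by_cases hw : w = u
      · subst hw; simp [h0]
      · simp only [hw, if_false, hI w, hne w hw]
  · rintro s' - - ⟨-, h⟩ w
    rw [h w]
    by_cases h0 : s.arr va w = 0 <;> simp [h0]

/-- The outcome of a round: either none of the two seeds is part of a solution, or the assignment has
been extended by one of them. -/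
def RoundPost (p : TwoSat n) (seed₀ seed₁ : Set (Fin n) → Prop) (v₀ v₁ : Fin n → ℕ) (σ σ' : ℕ → ℕ)
    (ok : ℕ) : Prop :=
  (ok = 0 ∧ ∀ T, p.Sol T → ¬ seed₀ T ∧ ¬ seed₁ T) ∨
    (ok = 1 ∧ p.Closed σ' ∧ (∀ w : Fin n, σ w ≠ 0 → σ' w = σ w) ∧
      ((∀ w : Fin n, v₀ w ≠ 0 → σ' w = v₀ w) ∨ ∀ w : Fin n, v₁ w ≠ 0 → σ' w = v₁ w))

/-- The potential that pays for the rounds. -/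
def roundPot (n : ℕ) (s : State) : ℕ := 400 * n * (zeros n (s.arr 26) + n * s.var 5)

/-- A round of `i` steps costs `400 * n * i` up to a linear term. If a run succeeds, it has decided
`i` new vertices, and these pay. If both fail, then `i ≤ n`, and the term `n * s.var 5` of the
potential pays, as register 5 drops to zero. -/
theorem round_spec (hB : Big W M) (hn : n ≤ M) (hn1 : 1 ≤ n) {s : State} (hp : HoldsTwoSat p s)
    (hσ : p.Closed (s.arr 26)) (hr : HoldsRuns p (s.arr 26) seed₀ seed₁ v₀ v₁ 0 s)
    (hok : s.var 5 = 1) :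
    Runs W round s fun t s' =>
      RoundPost p seed₀ seed₁ v₀ v₁ (s.arr 26) (s'.arr 26) (s'.var 5) ∧
      (∀ w, w < n → s'.arr 27 w = 0 ∧ s'.arr 28 w = 0) ∧
      t + roundPot n s' ≤ 200 * n + roundPot n s := by
  have h32 := hB.two
  refine runs_seq (lockstep_spec hB hn hn1 hp hσ.le hr) ?_
  rintro t s₁ f₁ ⟨i, hR, hi, hdone, ht⟩
  have e0 : s₁.var 0 = n := (f₁.var 0 (of_decide_eq_true rfl)).trans hp.size
  have e5 : s₁.var 5 = 1 := (f₁.var 5 (of_decide_eq_true rfl)).trans hok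
  have e26 : s₁.arr 26 = s.arr 26 := f₁.arr 26 (of_decide_eq_true rfl)
  have c0 := hR.run₀.conflict
  have c1 := hR.run₁.conflict
  have l0 := hR.run₀.le_size
  have l1 := hR.run₁.le_size
  have d0 := doneE_ne (hd := 30) (tl := 32) c0
  have d1 := doneE_ne (hd := 31) (tl := 33) c1
  have k0 : (doneE 30 32 34).cost = 7 := rfl
  have k1 : (doneE 31 33 35).cost = 7 := rfl
  refine HaltsWithin.runs (T := 50 * n + 60) (post := fun s' =>
      RoundPost p seed₀ seed₁ v₀ v₁ (s.arr 26) (s'.arr 26) (s'.var 5) ∧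
      (∀ w, w < n → s'.arr 27 w = 0 ∧ s'.arr 28 w = 0) ∧
      400 * n * i + roundPot n s' ≤ roundPot n s) ?_ |>.mono ?_
  swap
  · rintro t' s' - ⟨ht', -, h1, h2, h3⟩
    exact ⟨h1, h2, by omega⟩
  have commit : ∀ {seed v va q h tl c} (_ : RunInv p (s.arr 26) seed v va q h tl c) (_ : c = 0)
      (_ : h = tl) (_ : h = i) {s' : State}
      (_ : ∀ w : Fin n, s'.arr 26 w = if va w = 0 then s.arr 26 w else va w) (_ : s'.var 5 = 1),
      p.Closed (s'.arr 26) ∧ (∀ w : Fin n, s.arr 26 w ≠ 0 → s'.arr 26 w = s.arr 26 w) ∧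
        (∀ w : Fin n, v w ≠ 0 → s'.arr 26 w = v w) ∧
        400 * n * i + roundPot n s' ≤ roundPot n s := by
    intro seed v va q h tl c hr hc hht hhi s' hs' h5
    subst hc hht hhi
    obtain ⟨h1, h2, h3, h4⟩ := hr.commit hσ hs'
    refine ⟨h1, h2, h3, ?_⟩
    rw [roundPot, roundPot, h5, hok, ← h4, ← Nat.mul_add]
    exact Nat.mul_le_mul_left _ (by omega)
  refine hw_seq (T₁ := 20 * n + 34) (T₂ := 20 * n + 6) (fun s' =>
      RoundPost p seed₀ seed₁ v₀ v₁ (s.arr 26) (s'.arr 26) (s'.var 5) ∧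
      400 * n * i + roundPot n s' ≤ roundPot n s) ?_ ?_ (by omega)
  · refine hw_ite (M := M) (T' := 20 * n + 24) hB (by simp [doneE]; omega) (of_decide_eq_true rfl)
      (fun hb => ?_) (fun hb => ?_) (by rw [k0]; omega)
    · obtain ⟨b1, b2⟩ := d0.1 hb
      refine (commitRun_spec hB hn (by omega) e0 hR.run₀.le).mono (by omega) ?_
      intro s' f' h'
      rw [e26] at h'
      have h5 : s'.var 5 = 1 := (f'.var 5 (of_decide_eq_true rfl)).trans e5
      obtain ⟨h1, h2, h3, h4⟩ := commit hR.run₀ b1 b2 (hR.head₀ b1) h' h5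
      exact ⟨Or.inr ⟨h5, h1, h2, Or.inl h3⟩, h4⟩
    · refine hw_ite (M := M) (T' := 20 * n + 6) hB (by simp [doneE]; omega) (of_decide_eq_true rfl)
        (fun hb' => ?_) (fun hb' => ?_) (by rw [k1]; omega)
      · obtain ⟨b1, b2⟩ := d1.1 hb'
        refine (commitRun_spec hB hn (by omega) e0 hR.run₁.le).mono (by omega) ?_
        intro s' f' h'
        rw [e26] at h'
        have h5 : s'.var 5 = 1 := (f'.var 5 (of_decide_eq_true rfl)).trans e5
        obtain ⟨h1, h2, h3, h4⟩ := commit hR.run₁ b1 b2 (hR.head₁ b1) h' h5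
        exact ⟨Or.inr ⟨h5, h1, h2, Or.inr h3⟩, h4⟩
      · have hn0 : ¬ (s₁.var 34 = 0 ∧ s₁.var 30 = s₁.var 32) := by rw [← d0]; simpa using hb
        have hn1' : ¬ (s₁.var 35 = 0 ∧ s₁.var 31 = s₁.var 33) := by rw [← d1]; simpa using hb'
        obtain ⟨b1, b2⟩ : s₁.var 34 = 1 ∧ s₁.var 35 = 1 := by tauto
        refine hw_run (M := M) hB rfl (by simp [Prog.tmax]) (by simp) ⟨Or.inl ⟨by simp, ?_⟩, ?_⟩
        · intro T hT
          refine ⟨fun hs => ?_, fun hs => ?_⟩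
          · have := (hR.run₀.sound T hT hs).1; omega
          · have := (hR.run₁.sound T hT hs).1; omega
        · simp only [Prog.run, roundPot, State.setVar_var, State.setVar_arr, if_true, Expr.val, e26,
            hok, Nat.mul_zero, Nat.add_zero]
          rw [← Nat.mul_add]
          exact Nat.mul_le_mul_left _ (by omega)
  · rintro s₂ f₂ ⟨h1, h2⟩
    have e0' : s₂.var 0 = n := (f₂.var 0 (of_decide_eq_true rfl)).trans e0
    refine hw_for hB (K := n) (of_decide_eq_true rfl) (of_decide_eq_true rfl) (by omega) e0' hn
      (fun j s' => ∀ w, w < j → s'.arr 27 w = 0 ∧ s'.arr 28 w = 0) 12 (by simp) ?_ ?_ (by omega)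
    · rintro j s' hj hf hvj hI
      refine hw_run (M := M) hB rfl (of_decide_eq_true rfl) (by simp [hvj]; omega) ?_
      intro w hw
      by_cases h : w = j
      · subst h; simp [hvj]
      · have := hI w (by omega)
        simp [hvj, h, this]
    · intro s' f' _ h'
      have g5 : s'.var 5 = s₂.var 5 := f'.var 5 (of_decide_eq_true rfl)
      have g26 : s'.arr 26 = s₂.arr 26 := f'.arr 26 (of_decide_eq_true rfl)
      refine ⟨by rw [g5, g26]; exact h1, h', ?_⟩
      rw [roundPot, g5, g26]; exact h2

end

end RMIS

/-! ### The solver -/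

namespace RMIS

/-- Start a run with the value `x` of the vertex in register 37. -/
def pushSeed (x : Expr) : Prog := .store 27 ♯37 x ;; .store 29 ♯32 ♯37 ;; 32 ≔ ♯32 + 1

/-- Start runs with both values of the vertex in register 37. -/
def startBoth : Prog :=
  .store 27 ♯37 2 ;; .store 28 ♯37 1 ;; .store 29 0 ♯37 ;; .store 30 0 ♯37 ;; 30 ≔ 0 ;;
    31 ≔ 0 ;; 32 ≔ 1 ;; 33 ≔ 1 ;; 34 ≔ 0 ;; 35 ≔ 0

/-- Decide the constraints described by arrays 0 and 20 to 23. -/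
def solve : Prog :=
  5 ≔ 1 ;;
  .for 38 0 (.store 26 ♯38 0 ;; .store 27 ♯38 0 ;; .store 28 ♯38 0) ;;
  (30 ≔ 0 ;; 31 ≔ 0 ;; 32 ≔ 0 ;; 33 ≔ 0 ;; 34 ≔ 0 ;; 35 ≔ 1) ;;
  .for 37 0 (.ite (22 ↗ ♯37) (.ite (23 ↗ ♯37) (34 ≔ 1) (pushSeed 2))
    (.ite (23 ↗ ♯37) (pushSeed 1) .skip)) ;;
  round ;;
  .for 37 0 (.ite ♯5 (.ite ((20 ↗ ♯37) * ((26 ↗ ♯37) =! 0)) (startBoth ;; round) .skip) .skip)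

section

variable {W M n : ℕ} {p : TwoSat n}

open Classical in
/-- The values forced by the unit constraints; 3 stands for a contradiction. -/
noncomputable def TwoSat.unit (p : TwoSat n) (w : Fin n) : ℕ :=
  if w ∈ p.I then (if w ∈ p.O then 3 else 2) else if w ∈ p.O then 1 else 0

/-- The state of the solver after the first `j` vertices. -/
structure SolveInv (p : TwoSat n) (j : ℕ) (s : State) : Prop where
  clean : ∀ w, w < n → s.arr 27 w = 0 ∧ s.arr 28 w = 0
  state : (s.var 5 = 0 ∧ ∀ T, ¬ p.Sol T) ∨ (s.var 5 = 1 ∧ p.Closed (s.arr 26) ∧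
    (∀ v ∈ p.I, s.arr 26 v = 2) ∧ (∀ v ∈ p.O, s.arr 26 v = 1) ∧
    ∀ w : Fin n, (w : ℕ) < j → w ∈ p.X → s.arr 26 w ≠ 0)

/-- Once all vertices of the component are decided, closedness under the constraints makes the set
of vertices with value 2 a solution. -/
theorem SolveInv.returns {s : State} (h : SolveInv p n s) : Returns (∃ T, p.Sol T) s := by
  rcases h.state with ⟨h5, h⟩ | ⟨h5, hC, hI, hO, hX⟩
  · rw [Returns, h5, bit_false (by simpa using h)]
  · rw [Returns, h5, bit_true]
    have key : ∀ u w, p.E u w → (u ∈ p.P ∧ w ∈ p.P → s.arr 26 u ≠ 1) →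
        s.arr 26 w = 3 - s.arr 26 u := by
      intro u w hE hP
      exact hC.imp u w (hX u u.2 (p.mem _ _ (p.symm _ _ hE))) ⟨hE, fun h' => hP ⟨h'.1, h'.2.1⟩ h'.2.2⟩
    refine ⟨{w | s.arr 26 w = 2}, fun u w hE hP => ?_, fun u w hE hu hw => ?_, hI, fun v hv => ?_⟩
    · have h1 := key u w hE fun h' => absurd h' hP
      have h2 := hC.le u
      have h3 := hX u u.2 (p.mem _ _ (p.symm _ _ hE))
      change s.arr 26 u = 2 ↔ ¬ s.arr 26 w = 2
      omega
    · rintro ⟨h1, h2⟩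
      change s.arr 26 u = 2 at h1
      change s.arr 26 w = 2 at h2
      have := key u w hE fun _ => by omega
      omega
    · have := hO v hv
      change ¬ s.arr 26 v = 2
      omega

/-- All unit constraints seed one run; a vertex forced both ways is recorded as a conflict at once.
The second run starts in the failed state, with the impossible seed `False` and the impossible value
3, so that the program for a round can be reused. -/
theorem unitSeeds_spec (hB : Big W M) (hn : n ≤ M) {s : State} (hp : HoldsTwoSat p s)
    (hσ : ∀ w, w < n → s.arr 26 w = 0) (hv : ∀ w, w < n → s.arr 27 w = 0 ∧ s.arr 28 w = 0)
    (h30 : s.var 30 = 0) (h32' : s.var 32 = 0) (h33 : s.var 33 = 0) (h34 : s.var 34 = 0)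
    (h31 : s.var 31 = 0) (h35 : s.var 35 = 1) :
    HaltsWithin W (n * 40 + 6) (.for 37 0 (.ite (22 ↗ ♯37) (.ite (23 ↗ ♯37) (34 ≔ 1) (pushSeed 2))
      (.ite (23 ↗ ♯37) (pushSeed 1) .skip))) s fun s' =>
        HoldsRuns p (s.arr 26) (fun _ => True) (fun _ => False) p.unit (fun _ => 3) 0 s' := by
  have h32 := hB.two
  classical
  refine hw_for hB (K := n) (of_decide_eq_true rfl) (of_decide_eq_true rfl) (by omega) hp.size hn
    (fun j s' => RunInv p (s.arr 26) (fun _ => True) (fun w => if (w : ℕ) < j then p.unit w else 0)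
      (s'.arr 27) (s'.arr 29) 0 (s'.var 32) (s'.var 34) ∧ ∀ w : Fin n, j ≤ w → s'.arr 27 w = 0)
    32 ?_ ?_ ?_ (by omega)
  · have : (fun w : Fin n => if (w : ℕ) < 0 then p.unit w else 0) = fun _ => 0 := by simp
    rw [this]
    simp only [State.setVar_var, State.setVar_arr, h32', h34]
    exact ⟨RunInv.empty fun w hw => (hv w hw).1, fun w _ => (hv w w.2).1⟩
  · rintro j s' hj hf hvj ⟨hR, hz⟩
    obtain ⟨w, rfl⟩ : ∃ w : Fin n, (w : ℕ) = j := ⟨⟨j, hj⟩, rfl⟩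
    have a22 : s'.arr 22 w = bit (w ∈ p.I) := by
      rw [hf.arr 22 (of_decide_eq_true rfl), hp.pin]
    have a23 : s'.arr 23 w = bit (w ∈ p.O) := by
      rw [hf.arr 23 (of_decide_eq_true rfl), hp.pout]
    have b1 := bit_le_one (w ∈ p.I)
    have b2 := bit_le_one (w ∈ p.O)
    have b3 := hR.le_size
    have hz0 := hz w le_rfl
    have hnext : ∀ (w' : Fin n), (w' : ℕ) < w + 1 → w' = w ∨ (w' : ℕ) < w := by
      intro w' hw'
      by_cases hww : w' = w
      · exact Or.inl hww
      · have : (w' : ℕ) ≠ w := fun h => hww (Fin.ext h)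
        exact Or.inr (by omega)
    refine hw_run (M := M) hB rfl (of_decide_eq_true rfl) ?_ ?_
    · simp [pushSeed, hvj, a22, a23]; omega
    have hpush : ∀ x, (x = 1 ∨ x = 2) → p.unit w = x → w ∈ p.X →
        (∀ T, p.Sol T → (x = 2 ↔ w ∈ T)) →
        RunInv p (s.arr 26) (fun _ => True) (fun w' => if (w' : ℕ) < w + 1 then p.unit w' else 0)
          (Function.update (s'.arr 27) w x) (Function.update (s'.arr 29) (s'.var 32) w) 0
          (s'.var 32 + 1) (s'.var 34) ∧
        ∀ w' : Fin n, (w : ℕ) + 1 ≤ w' → Function.update (s'.arr 27) (w : ℕ) x w' = 0 := by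
      intro x hx hux hX hs
      have h1 := hR.push hx hz0 (hσ w w.2) hX fun T hT _ => hs T hT
      refine ⟨h1.regrow fun hc w' hw' => ?_, fun w' hw' => ?_⟩
      · by_cases hlt : (w' : ℕ) < w + 1
        · rw [if_pos hlt] at hw' ⊢
          rcases hnext w' hlt with rfl | hlt'
          · simp [hux]
          · have := h1.grow hc w'
            rw [if_pos hlt'] at this
            exact this hw'
        · rw [if_neg hlt] at hw'; exact absurd rfl hw'
      · rw [Function.update_of_ne (by omega)]; exact hz w' (by omega)
    by_cases hI : w ∈ p.I <;> by_cases hO : w ∈ p.O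
    · simp only [Prog.run, Expr.val, hvj, a22, a23, bit_true hI, bit_true hO, one_ne_zero, if_false,
        State.setVar_var, State.setVar_arr]
      have hno : ∀ T, p.Sol T → ¬ True := fun T hT => absurd (hT.pin w hI) (hT.pout w hO)
      exact ⟨(hR.halted hno).regrow fun hc => absurd hc one_ne_zero, fun w' hw' => hz w' (by omega)⟩
    · have := hpush 2 (Or.inr rfl) (by simp [TwoSat.unit, hI, hO]) (hp.sub w (Or.inl hI))
        fun T hT => by simp [hT.pin w hI]
      simpa [pushSeed, hvj, a22, a23, bit_true hI, bit_false hO] using this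
    · have := hpush 1 (Or.inl rfl) (by simp [TwoSat.unit, hI, hO]) (hp.sub w (Or.inr hO))
        fun T hT => by simp [hT.pout w hO]
      simpa [pushSeed, hvj, a22, a23, bit_false hI, bit_true hO] using this
    · simp only [Prog.run, Expr.val, hvj, a22, a23, bit_false hI, bit_false hO, if_true,
        State.setVar_var, State.setVar_arr]
      refine ⟨hR.regrow fun hc w' hw' => ?_, fun w' hw' => hz w' (by omega)⟩
      by_cases hlt : (w' : ℕ) < w + 1
      · rw [if_pos hlt] at hw' ⊢
        rcases hnext w' hlt with rfl | hlt'
        · simp [TwoSat.unit, hI, hO] at hw'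
        · have := hR.grow hc w'
          rw [if_pos hlt'] at this
          exact this hw'
      · rw [if_neg hlt] at hw'; exact absurd rfl hw'
  · rintro s' hf - ⟨hR, -⟩
    have e30 : s'.var 30 = 0 := (hf.var 30 (of_decide_eq_true rfl)).trans h30
    have e31 : s'.var 31 = 0 := (hf.var 31 (of_decide_eq_true rfl)).trans h31
    have e33 : s'.var 33 = 0 := (hf.var 33 (of_decide_eq_true rfl)).trans h33
    have e35 : s'.var 35 = 1 := (hf.var 35 (of_decide_eq_true rfl)).trans h35
    have e28 : s'.arr 28 = s.arr 28 := hf.arr 28 (of_decide_eq_true rfl)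
    refine ⟨?_, ?_, fun _ => e30, fun _ => e31⟩
    · rw [e30]
      simpa using hR
    · rw [e31, e33, e35, e28]
      exact ((RunInv.empty fun w hw => (hv w hw).2).halted fun _ _ => id).regrow
        fun h => absurd h one_ne_zero

theorem roundPot_le {s : State} (h : s.var 5 ≤ 1) : roundPot n s ≤ 800 * n ^ 2 := by
  have h1 := zeros_le n (s.arr 26)
  have h2 : n * s.var 5 ≤ n * 1 := Nat.mul_le_mul_left _ h
  calc 400 * n * (zeros n (s.arr 26) + n * s.var 5) ≤ 400 * n * (n + n) :=
        Nat.mul_le_mul_left _ (by omega)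
    _ = 800 * n ^ 2 := by ring

/-- A solution contains `v` or not, so two failing runs refute every solution. A run that succeeds
is kept without backtracking: the assignment stays closed, and a later failure still refutes all
solutions. -/
theorem tryVertex_spec (hB : Big W M) (hn : n ≤ M) (hn1 : 1 ≤ n) {s : State} (hp : HoldsTwoSat p s)
    (v : Fin n) (hv : s.var 37 = v) (hI : SolveInv p v s) :
    Runs W (.ite ♯5 (.ite ((20 ↗ ♯37) * ((26 ↗ ♯37) =! 0)) (startBoth ;; round) .skip) .skip) s fun t s' =>
      SolveInv p (v + 1) s' ∧ t + roundPot n s' ≤ 200 * n + 60 + roundPot n s := by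
  have h32 := hB.two
  have hlt : ∀ (w : Fin n), (w : ℕ) < v + 1 → w = v ∨ (w : ℕ) < v := by
    intro w hw
    by_cases hww : w = v
    · exact Or.inl hww
    · have : (w : ℕ) ≠ v := fun h => hww (Fin.ext h)
      exact Or.inr (by omega)
  have h5 : s.var 5 ≤ 1 := by rcases hI.state with h | h <;> omega
  have h20 := hp.verts v
  have b20 := bit_le_one (v ∈ p.X)
  have h26 : s.var 5 = 1 → s.arr 26 v ≤ 2 := by
    intro h
    rcases hI.state with h' | h'
    · omega
    · exact h'.2.1.le v
  have hk : ((20 ↗ ♯37) * ((26 ↗ ♯37) =! 0)).cost = 7 := rfl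
  have hk' : (♯5).cost = 1 := rfl
  have hskip : (s.var 5 = 0 ∨ v ∉ p.X ∨ s.arr 26 v ≠ 0) →
      Runs W .skip s fun t s' => SolveInv p (v + 1) s' ∧ t + roundPot n s' ≤ 1 + roundPot n s := by
    intro h
    refine ⟨1, s, .skip s, ⟨hI.clean, ?_⟩, le_rfl⟩
    rcases hI.state with h' | ⟨h1, h2, h3, h4, h6⟩
    · exact Or.inl h'
    · refine Or.inr ⟨h1, h2, h3, h4, fun w hw hX => ?_⟩
      rcases hlt w hw with rfl | hw
      · rcases h with h | h | h
        · omega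
        · exact absurd hX h
        · exact h
      · exact h6 w hw hX
  refine runs_ite (M := M) hB (by simp; omega) (of_decide_eq_true rfl) (fun hb => ?_) fun hb => ?_
  swap
  · exact (hskip (Or.inl hb)).mono fun t s' _ h => ⟨h.1, by omega⟩
  obtain ⟨g5, hC, hPI, hPO, hX⟩ := hI.state.resolve_left fun h => hb h.1
  have g26 := hC.le v
  refine runs_ite (M := M) hB (by simp [hv, h20]; omega) (of_decide_eq_true rfl) (fun hb' => ?_)
    fun hb' => ?_
  swap
  · refine (hskip (Or.inr ?_)).mono fun t s' _ h => ⟨h.1, by omega⟩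
    by_contra! hcon
    simp [hv, h20, hcon] at hb'
  have hvX : v ∈ p.X := by
    by_contra h
    simp [hv, h20, bit_false h] at hb'
  have hv0 : s.arr 26 v = 0 := by
    by_contra h
    simp [hv, h] at hb'
  refine runs_seq (Q := fun t s' => t ≤ 40 ∧ s' = startBoth.run s)
    (runs_run (M := M) hB rfl (by simp [startBoth, hv]; omega) fun t ht => ⟨ht.trans
      (of_decide_eq_true rfl), rfl⟩) ?_
  rintro t₁ s₁ hf ⟨ht₁, rfl⟩
  have e26 : (startBoth.run s).arr 26 = s.arr 26 := hf.arr 26 (of_decide_eq_true rfl)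
  have e5 : (startBoth.run s).var 5 = 1 := (hf.var 5 (of_decide_eq_true rfl)).trans g5
  have e37 : (startBoth.run s).var 37 = v := (hf.var 37 (of_decide_eq_true rfl)).trans hv
  have hruns : HoldsRuns p ((startBoth.run s).arr 26) (fun T => v ∈ T) (fun T => v ∉ T)
      (fun w => if w = v then 2 else 0) (fun w => if w = v then 1 else 0) 0 (startBoth.run s) := by
    have r0 := RunInv.push (q := s.arr 29) (RunInv.empty (p := p) (σ := s.arr 26)
      (seed := fun T => v ∈ T) fun w hw => (hI.clean w hw).1)
      (w := v) (Or.inr rfl) (hI.clean v v.2).1 hv0 hvX (by simp)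
    have r1 := RunInv.push (q := s.arr 30) (RunInv.empty (p := p) (σ := s.arr 26)
      (seed := fun T => v ∉ T) fun w hw => (hI.clean w hw).2)
      (w := v) (Or.inl rfl) (hI.clean v v.2).2 hv0 hvX (by simp)
    rw [e26]
    refine ⟨?_, ?_, fun _ => by simp [startBoth], fun _ => by simp [startBoth]⟩
    · have := r0.regrow (v₁ := fun w => if w = v then 2 else 0) fun _ w hw => by
        rw [update_fin]
        by_cases h : w = v <;> simp [h] at hw ⊢
      simpa [startBoth, hv] using this
    · have := r1.regrow (v₁ := fun w => if w = v then 1 else 0) fun _ w hw => by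
        rw [update_fin]
        by_cases h : w = v <;> simp [h] at hw ⊢
      simpa [startBoth, hv] using this
  refine (round_spec hB hn hn1 (hp.congr (hf.var 0 (of_decide_eq_true rfl)) ?_) (e26 ▸ hC) hruns
    e5).mono ?_
  · simp only [List.mem_cons, List.not_mem_nil, or_false, forall_eq_or_imp, forall_eq]
    refine ⟨?_, ?_, ?_, ?_, ?_⟩ <;> exact hf.arr _ (of_decide_eq_true rfl)
  · rintro t s' - ⟨hpost, hcl, ht⟩
    have hpot : roundPot n (startBoth.run s) = roundPot n s := by
      rw [roundPot, roundPot, e26, e5, g5]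
    refine ⟨⟨hcl, ?_⟩, by omega⟩
    rcases hpost with ⟨h0, hno⟩ | ⟨h1, hC', hkeep, hset⟩
    · exact Or.inl ⟨h0, fun T hT => (hno T hT).2 (hno T hT).1⟩
    · rw [e26] at hkeep
      refine Or.inr ⟨h1, hC', fun u hu => ?_, fun u hu => ?_, fun w hw hwX => ?_⟩
      · have := hPI u hu
        rw [hkeep u (by omega), this]
      · have := hPO u hu
        rw [hkeep u (by omega), this]
      · rcases hlt w hw with rfl | hw
        · rcases hset with h | h <;> have := h w (by simp) <;> rw [this] <;> simp
        · have := hX w hw hwX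
          rwa [hkeep w this]

/-- The potential never exceeds `800 * n ^ 2`; besides it, each vertex costs only linear time for
resetting its round. -/
theorem solve_spec (hB : Big W M) (hn : n ≤ M) (hn1 : 1 ≤ n) {s : State} (hp : HoldsTwoSat p s) :
    HaltsWithin W (5000 * n ^ 2) solve s (Returns (∃ T, p.Sol T)) := by
  have h32 := hB.two
  have hnn : n ≤ n ^ 2 := by nlinarith
  refine hw_seq (T₁ := 2) (T₂ := 4998 * n ^ 2) (fun s' => s' = s.setVar 5 1)
    (hw_run (M := M) hB rfl (of_decide_eq_true rfl) (by simp; omega) (by simp)) ?_ (by omega)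
  rintro s₁ f₁ rfl
  have hsame : ∀ {s' : State}, HoldsTwoSat p s' → ∀ {q : Prog} {s'' : State}, Frame q s' s'' →
      (0 ∉ q.wvars ∧ ∀ a ∈ [0, 20, 21, 22, 23], a ∉ q.warrs) → HoldsTwoSat p s'' := by
    intro s' h q s'' f hq
    exact h.congr (f.var 0 hq.1) fun a ha => f.arr a (hq.2 a ha)
  have p₁ := hsame hp f₁ (of_decide_eq_true rfl)
  refine hw_seq (T₁ := n * 20 + 6) (T₂ := 4970 * n ^ 2) (fun s' => ∀ w, w < n →
      s'.arr 26 w = 0 ∧ s'.arr 27 w = 0 ∧ s'.arr 28 w = 0) ?_ ?_ (by omega)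
  · refine hw_for hB (K := n) (of_decide_eq_true rfl) (of_decide_eq_true rfl) (by omega) p₁.size hn
      (fun j s' => ∀ w, w < j → s'.arr 26 w = 0 ∧ s'.arr 27 w = 0 ∧ s'.arr 28 w = 0) 12 (by simp)
      ?_ (fun s' _ _ h => h) (by omega)
    rintro j s' hj hf hvj hI
    refine hw_run (M := M) hB rfl (of_decide_eq_true rfl) (by simp [hvj]; omega) ?_
    intro w hw
    by_cases h : w = j
    · subst h; simp [hvj]
    · have := hI w (by omega)
      simp [hvj, h, this]
  rintro s₂ f₂ hz
  have p₂ := hsame p₁ f₂ (of_decide_eq_true rfl)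
  have g₂ : s₂.var 5 = 1 := (f₂.var 5 (of_decide_eq_true rfl)).trans (by simp)
  refine hw_seq (T₁ := 12) (T₂ := 4950 * n ^ 2)
    (fun s' => s' = Prog.run (30 ≔ 0 ;; 31 ≔ 0 ;; 32 ≔ 0 ;; 33 ≔ 0 ;; 34 ≔ 0 ;; 35 ≔ 1) s₂)
    (hw_run (M := M) hB rfl (of_decide_eq_true rfl) (by simp; omega) rfl) ?_ (by omega)
  rintro s₃ f₃ e₃
  have p₃ := hsame p₂ f₃ (of_decide_eq_true rfl)
  have g₃ : s₃.var 5 = 1 := (f₃.var 5 (of_decide_eq_true rfl)).trans g₂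
  have a26 : s₃.arr 26 = s₂.arr 26 := f₃.arr 26 (of_decide_eq_true rfl)
  have a27 : s₃.arr 27 = s₂.arr 27 := f₃.arr 27 (of_decide_eq_true rfl)
  have a28 : s₃.arr 28 = s₂.arr 28 := f₃.arr 28 (of_decide_eq_true rfl)
  refine hw_seq (T₁ := n * 40 + 6) (T₂ := 4900 * n ^ 2) _ (unitSeeds_spec hB hn p₃
    (fun w hw => by rw [a26, (hz w hw).1]) (fun w hw => by
      rw [a27, a28, (hz w hw).2.1, (hz w hw).2.2]; exact ⟨rfl, rfl⟩) (by simp [e₃]) (by simp [e₃])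
    (by simp [e₃]) (by simp [e₃]) (by simp [e₃]) (by simp [e₃])) ?_ (by omega)
  rintro s₄ f₄ hr
  have p₄ := hsame p₃ f₄ (of_decide_eq_true rfl)
  have g₄ : s₄.var 5 = 1 := (f₄.var 5 (of_decide_eq_true rfl)).trans g₃
  have b26 : s₄.arr 26 = s₃.arr 26 := f₄.arr 26 (of_decide_eq_true rfl)
  rw [← b26] at hr
  have hz4 : ∀ w : Fin n, s₄.arr 26 w = 0 := fun w => by rw [b26, a26, (hz w w.2).1]
  have hC4 : p.Closed (s₄.arr 26) := ⟨fun w => by simp [hz4], fun u w hu => absurd (hz4 u) hu⟩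
  have pot4 := roundPot_le (n := n) (s := s₄) (by omega)
  refine hw_seq (T₁ := 1000 * n ^ 2) (T₂ := 3900 * n ^ 2) (SolveInv p 0)
    ((round_spec hB hn hn1 p₄ hC4 hr g₄).halts ?_) ?_ (by omega)
  · rintro t s' - ⟨hpost, hcl, ht⟩
    refine ⟨by omega, hcl, ?_⟩
    rcases hpost with ⟨h0, hno⟩ | ⟨h1, hC', -, hset⟩
    · exact Or.inl ⟨h0, fun T hT => (hno T hT).1 trivial⟩
    · have hset : ∀ w : Fin n, p.unit w ≠ 0 → s'.arr 26 w = p.unit w := by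
        rcases hset with h | h
        · exact h
        -- The dummy second run cannot have won, since a closed assignment has no value 3.
        · intro w _
          have : s'.arr 26 w = 3 := h w (by simp)
          have := hC'.le w
          omega
      refine Or.inr ⟨h1, hC', fun v hv => ?_, fun v hv => ?_, by simp⟩
      · have h2 := hC'.le v
        have := hset v
        by_cases hO : v ∈ p.O <;> simp [TwoSat.unit, hv, hO] at this <;> omega
      · have h2 := hC'.le v
        have := hset v
        by_cases hO : v ∈ p.I <;> simp [TwoSat.unit, hv, hO] at this <;> omega
  rintro s₅ f₅ hI
  have p₅ := hsame p₄ f₅ (of_decide_eq_true rfl)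
  have pot5 := roundPot_le (n := n) (s := s₅) (by rcases hI.state with h | h <;> omega)
  have hvar : ∀ {j x} {s : State}, SolveInv p j s → SolveInv p j (s.setVar 37 x) := fun h =>
    ⟨h.clean, by simpa using h.state⟩
  refine (runs_for (M := M) hB (K := n) (of_decide_eq_true rfl) (of_decide_eq_true rfl) (by omega)
    p₅.size hn (fun j s' => SolveInv p j s') (roundPot n) (200 * n + 60)
    (hvar hI) ?_).halts ?_
  · rintro j s' hj hf hvj hI'
    refine (tryVertex_spec hB hn hn1 (hsame p₅ hf (of_decide_eq_true rfl)) ⟨j, hj⟩ hvj hI').mono ?_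
    rintro t s'' - h
    exact ⟨hvar h.1, by simpa [roundPot] using h.2⟩
  · rintro t s' - ⟨h, -, ht⟩
    refine ⟨?_, h.returns⟩
    have pot5' : roundPot n (s₅.setVar 37 0) = roundPot n s₅ := by simp [roundPot]
    have : n * (200 * n + 60 + 8) = 200 * n ^ 2 + 68 * n := by ring
    omega

end

end RMIS

namespace RMIS

/-! ### Testing satisfiability -/

section

variable {n : ℕ} (G : SimpleGraph (Fin n))

/-- The constraints of `LocalSol`. -/
def localSat (lab : Fin n → Set Label) (X att : Set (Fin n)) (flag : Flag) : TwoSat n where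
  X := X
  E u w := u ∈ X ∧ w ∈ X ∧ G.Adj u w
  P := {v | Label.PO ∈ lab v}
  I := {v | v ∈ X ∧ (lab v = {Label.PI} ∨ flag = .inside ∧ v ∈ att)}
  O := {v | v ∈ X ∧ ((lab v = {Label.PO} ∨ lab v = {Label.PE}) ∨ flag = .outside ∧ v ∈ att)}
  symm _ _ h := ⟨h.2.1, h.1, h.2.2.symm⟩
  mem _ _ h := h.2.1

theorem localSat_sol_iff {lab : Fin n → Set Label} {X att : Set (Fin n)} {flag : Flag}
    {T : Set (Fin n)} : (localSat G lab X att flag).Sol T ↔ LocalSol G lab X att flag T := by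
  constructor
  · intro h
    refine ⟨fun u hu w hw hA hP => h.xor u w ⟨hu, hw, hA⟩ fun h' => hP h'.1,
      fun u hu w hw hA hPu hPw => h.nand u w ⟨hu, hw, hA⟩ hPu hPw,
      fun v hv hl => h.pin v ⟨hv, Or.inl hl⟩, fun v hv hl => h.pout v ⟨hv, Or.inl hl⟩,
      fun hf v hv ha => h.pin v ⟨hv, Or.inr ⟨hf, ha⟩⟩,
      fun hf v hv ha => h.pout v ⟨hv, Or.inr ⟨hf, ha⟩⟩⟩
  · intro h
    refine ⟨?_, fun u w hE hu hw => h.nand u hE.1 w hE.2.1 hE.2.2 hu hw, ?_, ?_⟩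
    · rintro u w ⟨hu, hw, hA⟩ hP
      by_cases hPu : Label.PO ∈ lab u
      · have := h.xor w hw u hu hA.symm fun h' => hP ⟨hPu, h'⟩
        tauto
      · exact h.xor u hu w hw hA hPu
    · rintro v ⟨hv, hl | ⟨hf, ha⟩⟩
      · exact h.pin v hv hl
      · exact h.fin hf v hv ha
    · rintro v ⟨hv, hl | ⟨hf, ha⟩⟩
      · exact h.pout v hv hl
      · exact h.fout hf v hv ha

end

/-- The number that encodes a set of labels. -/
noncomputable def labelCode (S : Set Label) : ℕ :=
  bit (Label.PI ∈ S) + 2 * bit (Label.PO ∈ S) + 4 * bit (Label.PE ∈ S)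

theorem labelCode_facts (S : Set Label) :
    labelCode S ≤ 7 ∧ labelCode S / 2 % 2 = bit (Label.PO ∈ S) ∧ (labelCode S = 1 ↔ S = {Label.PI}) ∧
      (labelCode S = 2 ↔ S = {Label.PO}) ∧ (labelCode S = 4 ↔ S = {Label.PE}) := by
  have key : ∀ l, S = {l} ↔ ∀ k, k ∈ S ↔ k = l := fun l => by simp [Set.ext_iff]
  have all : ∀ P : Label → Prop, (∀ k, P k) ↔ P .PI ∧ P .PO ∧ P .PE :=
    fun P => ⟨fun h => ⟨h _, h _, h _⟩, fun ⟨h1, h2, h3⟩ k => by cases k <;> assumption⟩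
  simp only [key, all, labelCode]
  by_cases h1 : Label.PI ∈ S <;> by_cases h2 : Label.PO ∈ S <;> by_cases h3 : Label.PE ∈ S <;>
    simp [h1, h2, h3, bit]

@[simp] theorem labelCode_empty : labelCode ∅ = 0 := by simp [labelCode, bit]

/-- Write the set of attachment vertices to array 25, and clear array 24. -/
def readAttach : Prog :=
  .for 31 0 (.store 24 ♯31 0 ;;
    .ite ♯4 (.store 25 ♯31 (2 ↗ ((4 ↗ ♯3) * ♯0 + ♯31))) (.store 25 ♯31 0))

/-- Write the labels of the vertices to array 24. -/
def readLabels : Prog :=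
  .for 30 1 (.ite ((1 ↗ ♯30) =! 1)
    (.for 31 0 (.ite (2 ↗ (♯30 * ♯0 + ♯31))
      (.store 24 ♯31 ((5 ↗ (3 * ♯30)) + 2 * (5 ↗ (3 * ♯30 + 1)) + 4 * (5 ↗ (3 * ♯30 + 2))))
      .skip)) .skip)

/-- Write the constraints of a component to arrays 20 to 23. -/
def writeSat : Prog :=
  .for 31 0 (.store 20 ♯31 (2 ↗ (♯3 * ♯0 + ♯31)) ;;
    .store 21 ♯31 ((24 ↗ ♯31) / 2 % 2) ;;
    .store 22 ♯31 ((20 ↗ ♯31) * (1 - (1 - ((24 ↗ ♯31) =! 1)) * (1 - (♯4 =! 1) * (25 ↗ ♯31)))) ;;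
    .store 23 ♯31 ((20 ↗ ♯31) * (1 - (1 - ((24 ↗ ♯31) =! 2)) * ((1 - ((24 ↗ ♯31) =! 4)) *
      (1 - (♯4 =! 2) * (25 ↗ ♯31))))))

/-- The program for `isSatisfiable`. -/
def isSat : Prog := readAttach ;; readLabels ;; writeSat ;; solve

section

variable {W M n N : ℕ} {G : SimpleGraph (Fin n)} {ν : Fin N ≃ Node G} {R : Node G}
  {L : Labelling G}

theorem cell_lt {i j a b : ℕ} (hi : i < a) (hj : j < b) : i * b + j < a * b := by
  have : (i + 1) * b ≤ a * b := Nat.mul_le_mul_right _ hi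
  have : (i + 1) * b = i * b + b := by ring
  omega

theorem readAttach_spec (hB : Big W M) (hN : N * n ≤ M) (hn : n ≤ M) (hNM : N ≤ M)
    (F : BlockFacts G) {s : State} (hT : HoldsRootedTree G ν R s) {x : Node G} (hx : x.IsBlock)
    {flag : Flag} (hC : HoldsCall ν x flag s) (hxR : flag ≠ .none → x ≠ R) :
    HaltsWithin W (n * 40 + 6) readAttach s fun s' => ∀ v : Fin n, s'.arr 24 v = 0 ∧
      (s'.arr 25 v ≤ 1) ∧ (flag ≠ .none → s'.arr 25 v = bit (IsAttachment R v x)) := by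
  have h32 := hB.two
  obtain ⟨⟨⟨h0, hA⟩, h1, hk, hv, ht⟩, hr, hp⟩ := hT
  have h3 : s.var 3 < N := by rw [hC.1]; exact (ν.symm x).2
  have h4 : s.var 4 ≤ 2 ∧ (s.var 4 ≠ 0 ↔ flag ≠ .none) := by
    rw [hC.2]; cases flag <;> simp
  have hpar : flag ≠ .none → ∃ k : Fin N, s.arr 4 (s.var 3) = k ∧
      ∀ v, v ∈ (ν k).verts ↔ IsAttachment R v x := by
    intro hf
    obtain ⟨p, hpx⟩ := F.exists_parent (hxR hf)
    refine ⟨ν.symm p, ?_, fun v => ?_⟩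
    · rw [hC.1]; exact hp _ _ (by simpa using hpx)
    · rw [isAttachment_block hx, Equiv.apply_symm_apply]
      exact ⟨fun h => ⟨p, hpx, h⟩, fun ⟨q, hq, h⟩ => F.parent_unique hq hpx ▸ h⟩
  refine hw_for hB (K := n) (of_decide_eq_true rfl) (of_decide_eq_true rfl) (by omega) h0 hn
    (fun j s' => ∀ v : Fin n, (v : ℕ) < j → s'.arr 24 v = 0 ∧
      (s'.arr 25 v ≤ 1) ∧ (flag ≠ .none → s'.arr 25 v = bit (IsAttachment R v x))) 32 (by simp)
    ?_ (fun s' _ _ h v => h v v.2) (by omega)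
  intro j s' hj hf hvj hI
  lift j to Fin n using hj with u
  have e0 : s'.var 0 = n := (hf.var 0 (of_decide_eq_true rfl)).trans h0
  have e3 : s'.var 3 = s.var 3 := hf.var 3 (of_decide_eq_true rfl)
  have e4 : s'.var 4 = s.var 4 := hf.var 4 (of_decide_eq_true rfl)
  have a2 : s'.arr 2 = s.arr 2 := hf.arr 2 (of_decide_eq_true rfl)
  have a4 : s'.arr 4 = s.arr 4 := hf.arr 4 (of_decide_eq_true rfl)
  have hu := u.2
  have hne : ∀ v : Fin n, v ≠ u → (v : ℕ) < u + 1 → (v : ℕ) < u := by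
    intro v hv h
    have : (v : ℕ) ≠ u := fun h => hv (Fin.ext h)
    omega
  -- Without a flag the parent entry is not read: at the root it may hold anything.
  by_cases hfl : flag = .none
  · have h40 : s.var 4 = 0 := by by_contra h; exact h4.2.1 h hfl
    refine hw_run (M := M) hB rfl (of_decide_eq_true rfl) (by simp [hvj, e4, h40]; omega) ?_
    intro v hv
    by_cases h : v = u
    · subst h; simp [hvj, e4, h40, hfl]
    · have := hI v (hne v h hv)
      simpa [hvj, e4, h40, update_fin, h] using this
  · have h40 : s.var 4 ≠ 0 := h4.2.2 hfl
    obtain ⟨k, hk4, hka⟩ := hpar hfl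
    have hcell := hv k u
    have hb := bit_le_one (u ∈ (ν k).verts)
    have hlt := cell_lt k.2 hu
    have hk2 := k.2
    have hkn : (k : ℕ) * n ≤ M := by omega
    refine hw_run (M := M) hB rfl (of_decide_eq_true rfl) ?_ ?_
    · simp [hvj, e4, h40, e3, e0, a4, a2, hk4, hcell]; omega
    · intro v hv
      by_cases h : v = u
      · subst h
        simp [hvj, e4, h40, e3, e0, a4, a2, hk4, hcell, hb, ← hka]
      · have := hI v (hne v h hv)
        simpa [hvj, e4, h40, update_fin, h, e3, e0, a4, a2, hk4] using this

theorem readLabels_spec (hB : Big W M) (hN : N * n ≤ M) (hn : n ≤ M) (hNM : 3 * N ≤ M)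
    {s : State} (hT : HoldsTree G ν s) (hL : HoldsLabels ν L s)
    (h24 : ∀ v : Fin n, s.arr 24 v = 0) :
    HaltsWithin W (N * (n * 60 + 30) + 6) readLabels s fun s' =>
      ∀ v : Fin n, s'.arr 24 v = labelCode (vertexLabels L v) := by
  have h32 := hB.two
  obtain ⟨⟨h0, hA⟩, h1, hk, hv, ht⟩ := hT
  have hcode : ∀ i : Fin N, s.arr 5 (3 * i) + 2 * s.arr 5 (3 * i + 1) + 4 * s.arr 5 (3 * i + 2) =
      labelCode (L (ν i)) := fun i => by
    obtain ⟨l1, l2, l3⟩ := hL i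
    rw [l1, l2, l3, labelCode]
  refine hw_for hB (K := N) (of_decide_eq_true rfl) (of_decide_eq_true rfl) (by omega) h1 (by omega)
    (fun j s' => (∀ (i : Fin N) v h, (i : ℕ) < j → ν i = .artic v h →
      s'.arr 24 v = labelCode (vertexLabels L v)) ∧
      ∀ v : Fin n, ¬ IsArticulation G v → s'.arr 24 v = 0) (n * 60 + 20) (by simp [h24]) ?_
    ?_ (by linarith)
  · rintro j s' hj hf hvj ⟨hI, hI'⟩
    lift j to Fin N using hj with i
    have hi := i.2
    have e0 : s'.var 0 = n := (hf.var 0 (of_decide_eq_true rfl)).trans h0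
    have a1 : s'.arr 1 = s.arr 1 := hf.arr 1 (of_decide_eq_true rfl)
    have a2 : s'.arr 2 = s.arr 2 := hf.arr 2 (of_decide_eq_true rfl)
    have a5 : s'.arr 5 = s.arr 5 := hf.arr 5 (of_decide_eq_true rfl)
    have hk1 := hk i
    have hk3 : (ν i).kind ≤ 3 := by cases ν i <;> simp [Node.kind]
    have hcost : ((1 ↗ ♯30) =! 1 : Expr).cost = 4 := rfl
    have hnext : ∀ i' : Fin N, (i' : ℕ) < i + 1 → i' = i ∨ (i' : ℕ) < i := by
      intro i' h'
      by_cases hii : i' = i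
      · exact Or.inl hii
      · have : (i' : ℕ) ≠ i := fun h => hii (Fin.ext h)
        exact Or.inr (by omega)
    refine hw_ite (M := M) (T' := n * 60 + 6) hB (by simp [hvj, a1, hk1]; omega)
      (of_decide_eq_true rfl) (fun hb => ?_) (fun hb => ?_) (by omega)
    · have hkind : (ν i).kind = 1 := by
        by_contra h
        simp [hvj, a1, hk1, h] at hb
      obtain ⟨a, ha, hνi⟩ : ∃ a ha, ν i = .artic a ha := by
        cases hc : ν i <;> simp [hc, Node.kind] at hkind
        exact ⟨_, _, rfl⟩
      refine hw_for hB (K := n) (of_decide_eq_true rfl) (of_decide_eq_true rfl) (by omega) e0 hn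
        (fun l s'' => (∀ (i' : Fin N) v h, (i' : ℕ) < i → ν i' = .artic v h →
          s''.arr 24 v = labelCode (vertexLabels L v)) ∧
          (∀ v : Fin n, ¬ IsArticulation G v → s''.arr 24 v = 0) ∧
          ((a : ℕ) < l → s''.arr 24 a = labelCode (vertexLabels L a))) 50
        ⟨by simpa using hI, by simpa using hI', by simp⟩ ?_ ?_ (by omega)
      · rintro l s'' hl hf' hvl ⟨hJ, hJ', hJ''⟩
        lift l to Fin n using hl with u
        have hu := u.2
        have g0 : s''.var 0 = n := (hf'.var 0 (of_decide_eq_true rfl)).trans e0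
        have g30 : s''.var 30 = i := (hf'.var 30 (of_decide_eq_true rfl)).trans hvj
        have b2 : s''.arr 2 = s.arr 2 := (hf'.arr 2 (of_decide_eq_true rfl)).trans a2
        have b5 : s''.arr 5 = s.arr 5 := (hf'.arr 5 (of_decide_eq_true rfl)).trans a5
        have hcell := hv i u
        have hb2 := bit_le_one (u ∈ (ν i).verts)
        have hlt := cell_lt hi hu
        obtain ⟨l1, l2, l3⟩ := hL i
        have hb3 := bit_le_one (Label.PI ∈ L (ν i))
        have hb4 := bit_le_one (Label.PO ∈ L (ν i))
        have hb5 := bit_le_one (Label.PE ∈ L (ν i))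
        have hc := hcode i
        refine hw_run (M := M) hB rfl (of_decide_eq_true rfl) ?_ ?_
        · simp [g0, g30, b2, b5, hvl, hcell, l1, l2, l3]; omega
        · by_cases hua : u = a
          · subst hua
            have hmem : u ∈ (ν i).verts := by rw [hνi]; rfl
            have hlab : labelCode (L (ν i)) = labelCode (vertexLabels L u) := by
              rw [hνi, vertexLabels_artic]
            simp only [Prog.run, Expr.val, Op.eval, g0, g30, b2, b5, hvl, hcell, bit_true hmem]
            refine ⟨fun i' v h hi' hv' => ?_, fun v hv' => ?_, fun _ => ?_⟩
            · have := hJ i' v h hi' hv'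
              by_cases hvu : v = u
              · subst hvu
                simp [hc, hlab]
              · simpa [update_fin, hvu] using this
            · have hvu : v ≠ u := by rintro rfl; exact hv' ha
              simpa [update_fin, hvu] using hJ' v hv'
            · simp [hc, hlab]
          · have hmem : u ∉ (ν i).verts := by rw [hνi]; exact hua
            have : (a : ℕ) < u + 1 → (a : ℕ) < u := by
              have : (u : ℕ) ≠ a := fun h => hua (Fin.ext h)
              omega
            simp only [Prog.run, Expr.val, Op.eval, g0, g30, b2, b5, hvl, hcell, bit_false hmem]
            exact ⟨hJ, hJ', fun h => hJ'' (this h)⟩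
      · rintro s'' - - ⟨hJ, hJ', hJ''⟩
        refine ⟨fun i' v h hi' hv' => ?_, by simpa using hJ'⟩
        rcases hnext i' hi' with rfl | hlt
        · rw [hνi] at hv'
          obtain rfl : a = v := by simpa using hv'
          simpa using hJ'' a.2
        · simpa using hJ i' v h hlt hv'
    · have hkind : (ν i).kind ≠ 1 := by
        intro h
        simp [hvj, a1, hk1, h] at hb
      refine hw_run (M := M) hB rfl (by simp [Prog.tmax]) (by simp) ⟨fun i' v h hi' hv' => ?_, by simpa using hI'⟩
      rcases hnext i' hi' with rfl | hlt
      · rw [hv'] at hkind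
        exact absurd rfl hkind
      · simpa using hI i' v h hlt hv'
  · rintro s' - - ⟨hI, hI'⟩ v
    by_cases ha : IsArticulation G v
    · exact hI (ν.symm (.artic v ha)) v ha (ν.symm _).2 (by simp)
    · rw [hI' v ha, vertexLabels_of_not _ ha, labelCode_empty]

theorem writeSat_spec (hB : Big W M) (hN : N * n ≤ M) (hn : n ≤ M) (hNM : N ≤ M) {s : State}
    (hT : HoldsTree G ν s) {H : G.Subgraph} {hH : IsBiconnectedComponent H} {flag : Flag}
    (hC : HoldsCall ν (.comp H hH) flag s)
    (h24 : ∀ v : Fin n, s.arr 24 v = labelCode (vertexLabels L v))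
    (h25 : ∀ v : Fin n, s.arr 25 v ≤ 1 ∧
      (flag ≠ .none → s.arr 25 v = bit (IsAttachment R v (.comp H hH)))) :
    HaltsWithin W (n * 100 + 6) writeSat s fun s' => HoldsTwoSat
      (localSat G (vertexLabels L) H.verts {v | IsAttachment R v (.comp H hH)} flag) s' := by
  have h32 := hB.two
  obtain ⟨⟨h0, hA⟩, h1, hk, hv, ht⟩ := hT
  obtain ⟨p, hp⟩ : ∃ p, p = localSat G (vertexLabels L) H.verts
    {v | IsAttachment R v (.comp H hH)} flag := ⟨_, rfl⟩
  rw [← hp]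
  refine hw_for hB (K := n) (of_decide_eq_true rfl) (of_decide_eq_true rfl) (by omega) h0 hn
    (fun j s' => ∀ v : Fin n, (v : ℕ) < j → s'.arr 20 v = bit (v ∈ p.X) ∧
      s'.arr 21 v = bit (v ∈ p.P) ∧ s'.arr 22 v = bit (v ∈ p.I) ∧ s'.arr 23 v = bit (v ∈ p.O)) 90
    (by simp) ?_ ?_ (by omega)
  · intro j s' hj hf hvj hI
    lift j to Fin n using hj with u
    have hu := u.2
    have e0 : s'.var 0 = n := (hf.var 0 (of_decide_eq_true rfl)).trans h0
    have e3 : s'.var 3 = ν.symm (.comp H hH) := (hf.var 3 (of_decide_eq_true rfl)).trans hC.1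
    have e4 : s'.var 4 = s.var 4 := hf.var 4 (of_decide_eq_true rfl)
    have a2 : s'.arr 2 = s.arr 2 := hf.arr 2 (of_decide_eq_true rfl)
    have a24 : s'.arr 24 u = labelCode (vertexLabels L u) := by
      rw [hf.arr 24 (of_decide_eq_true rfl), h24]
    have a25 : s'.arr 25 u = s.arr 25 u := by rw [hf.arr 25 (of_decide_eq_true rfl)]
    have hcell := hv (ν.symm (.comp H hH)) u
    rw [Equiv.apply_symm_apply] at hcell
    have hk2 := (ν.symm (.comp H hH)).2
    have hlt := cell_lt hk2 hu
    generalize hX : bit (u ∈ (Node.comp H hH).verts) = bX at hcell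
    have hb : bX ≤ 1 := hX ▸ bit_le_one _
    have hX1 : bX = 1 ↔ u ∈ H.verts := by rw [← hX, bit_eq_one_iff]; rfl
    obtain ⟨c1, c2, c3, c4, c5⟩ := labelCode_facts (vertexLabels L u)
    obtain ⟨d1, d2⟩ := h25 u
    have hf4 : s.var 4 ≤ 2 ∧ (s.var 4 = 1 ↔ flag = .inside) ∧ (s.var 4 = 2 ↔ flag = .outside) := by
      rw [hC.2]; cases flag <;> simp
    have hin : flag = .inside → (s.arr 25 u = 1 ↔ IsAttachment R u (.comp H hH)) := by
      rintro rfl; rw [d2 (by simp), bit_eq_one_iff]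
    have hout : flag = .outside → (s.arr 25 u = 1 ↔ IsAttachment R u (.comp H hH)) := by
      rintro rfl; rw [d2 (by simp), bit_eq_one_iff]
    have iX : u ∈ p.X ↔ bX = 1 := by rw [hX1, hp]; rfl
    have iP : u ∈ p.P ↔ Label.PO ∈ vertexLabels L u := by rw [hp]; rfl
    have iI : u ∈ p.I ↔ bX = 1 ∧ (labelCode (vertexLabels L u) = 1 ∨
        s.var 4 = 1 ∧ s.arr 25 u = 1) := by
      rw [hX1, c3, hf4.2.1, and_congr_right hin, hp]; rfl
    have iO : u ∈ p.O ↔ bX = 1 ∧ ((labelCode (vertexLabels L u) = 2 ∨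
        labelCode (vertexLabels L u) = 4) ∨ s.var 4 = 2 ∧ s.arr 25 u = 1) := by
      rw [hX1, c4, c5, hf4.2.2, and_congr_right hout, hp]; rfl
    obtain ⟨hf4, -⟩ := hf4
    -- What remains is arithmetic in the code of the label set, two bits and the flag; it is settled
    -- by a finite case distinction.
    clear hin hout d2 c3 c4 c5 hX1 hX
    generalize labelCode (vertexLabels L u) = code at *
    generalize s.arr 25 u = at' at *
    generalize s.var 4 = fl at *
    refine hw_run (M := M) hB rfl (of_decide_eq_true rfl) ?_ ?_
    · simp [hvj, e0, e3, e4, a2, a24, a25, hcell]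
      omega
    · intro v hv'
      by_cases hvu : v = u
      · subst hvu
        rw [bit_congr iX, bit_congr iP, bit_congr iI, bit_congr iO, ← c2]
        simp only [Prog.run, Expr.val, Op.eval]
        simp [hvj, e0, e3, e4, a2, a24, a25, hcell]
        have : bX = 0 ∨ bX = 1 := by omega
        have : at' = 0 ∨ at' = 1 := by omega
        rcases this with rfl | rfl <;> rcases ‹bX = 0 ∨ bX = 1› with rfl | rfl <;>
          interval_cases fl <;> by_cases k1 : code = 1 <;> by_cases k2 : code = 2 <;>
          by_cases k3 : code = 4 <;> simp [k1, k2, k3, bit]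
      · have := hI v (by
          have : (v : ℕ) ≠ u := fun h => hvu (Fin.ext h)
          omega)
        simpa [hvj, update_fin, hvu] using this
  · rintro s' hf - h
    have e0 : s'.var 0 = n := (hf.var 0 (of_decide_eq_true rfl)).trans h0
    have a0 : s'.arr 0 = s.arr 0 := hf.arr 0 (of_decide_eq_true rfl)
    refine ⟨e0, fun u w => ?_, fun w => (h w w.2).1, fun u w hu => ?_, fun w => (h w w.2).2.1,
      fun w => (h w w.2).2.2.1, fun w => (h w w.2).2.2.2, ?_⟩
    · rw [a0, hA]; exact bit_le_one _
    · rw [a0, hA, (h w w.2).1]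
      subst hp
      change u ∈ H.verts ∧ w ∈ H.verts ∧ G.Adj u w ↔ _
      change u ∈ H.verts at hu
      simp only [ne_eq, bit_eq_zero_iff, not_not, hu, true_and]
      exact and_comm
    · subst hp
      rintro w (hw | hw) <;> exact hw.1

/-- The dominant costs are reading at most `4 * n` rows of the membership matrix and the solver.
Arrays 0 to 5 are never written, so tree and labelling survive the call. -/
theorem isSat_spec (hB : Big W M) (hn1 : 1 ≤ n) (hN4 : N ≤ 4 * n) (hM : 4 * n * n ≤ M)
    (hM' : 12 * n ≤ M) (F : BlockFacts G) {s : State} (hT : HoldsRootedTree G ν R s)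
    (hL : HoldsLabels ν L s) {x : Node G} {flag : Flag} (hx : x.IsComp) (hC : HoldsCall ν x flag s)
    (hxR : flag ≠ .none → x ≠ R) :
    HaltsWithin W (6000 * n ^ 2) isSat s (Returns (isSatisfiable R L x flag)) := by
  have h32 := hB.two
  have hN : N * n ≤ M := (Nat.mul_le_mul_right n hN4).trans hM
  have hnn : n ≤ n ^ 2 := by nlinarith
  have hNn : N * (n * 60 + 30) ≤ 400 * n ^ 2 := by nlinarith
  obtain ⟨H, hH, rfl⟩ := hx
  refine hw_seq (T₁ := n * 40 + 6) (T₂ := 5900 * n ^ 2) _ (readAttach_spec hB hN (by omega)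
    (by omega) F hT
    (show Node.IsBlock (.comp H hH) from trivial) hC hxR) ?_ (by omega)
  intro s₁ f₁ h₁
  have same : ∀ {s' s'' : State} {q : Prog}, HoldsTree G ν s' → HoldsLabels ν L s' →
      HoldsCall ν (.comp H hH) flag s' → Frame q s' s'' →
      ((∀ i ∈ [0, 1, 3, 4], i ∉ q.wvars) ∧ ∀ a ∈ [0, 1, 2, 3, 5], a ∉ q.warrs) →
      HoldsTree G ν s'' ∧ HoldsLabels ν L s'' ∧ HoldsCall ν (.comp H hH) flag s'' := by
    intro s' s'' q hT hL hC f ⟨hv, ha⟩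
    simp only [List.mem_cons, List.not_mem_nil, or_false, forall_eq_or_imp, forall_eq] at hv ha
    unfold HoldsTree HoldsGraph HoldsLabels HoldsCall
    rw [f.var 0 hv.1, f.var 1 hv.2.1, f.var 3 hv.2.2.1, f.var 4 hv.2.2.2, f.arr 0 ha.1,
      f.arr 1 ha.2.1, f.arr 2 ha.2.2.1, f.arr 3 ha.2.2.2.1, f.arr 5 ha.2.2.2.2]
    exact ⟨hT, hL, hC⟩
  obtain ⟨hT₁, hL₁, hC₁⟩ := same hT.1 hL hC f₁ (of_decide_eq_true rfl)
  refine hw_seq (T₁ := N * (n * 60 + 30) + 6) (T₂ := 5400 * n ^ 2) _ (readLabels_spec hB hN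
    (by omega) (by omega) hT₁ hL₁ fun v => (h₁ v).1) ?_ (by omega)
  intro s₂ f₂ h₂
  obtain ⟨hT₂, hL₂, hC₂⟩ := same hT₁ hL₁ hC₁ f₂ (of_decide_eq_true rfl)
  refine hw_seq (T₁ := n * 100 + 6) (T₂ := 5000 * n ^ 2) _ (writeSat_spec (R := R) hB hN (by omega)
    (by omega) hT₂ hC₂ h₂ ?_) ?_ (by omega)
  · intro v
    rw [f₂.arr 25 (of_decide_eq_true rfl)]
    exact (h₁ v).2
  · intro s₃ f₃ h₃
    refine (solve_spec hB (by omega) hn1 h₃).mono le_rfl fun s' _ h => ?_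
    rw [Returns] at h ⊢
    rw [h, F.isSatisfiable_iff]
    exact bit_congr (exists_congr fun T => localSat_sol_iff G)

end

end RMIS

namespace RMIS

/-! ### Labelling a single node -/

section Congr

variable {V : Type} {G : SimpleGraph V} {R : Node G} (F : BlockFacts G)
include F

theorem BlockFacts.isSatisfiable_congr {L L' : Labelling G} {H : G.Subgraph}
    {hH : IsBiconnectedComponent H} (flag : Flag)
    (h : ∀ v ∈ H.verts, vertexLabels L v = vertexLabels L' v) :
    isSatisfiable R L (.comp H hH) flag ↔ isSatisfiable R L' (.comp H hH) flag := by
  rw [F.isSatisfiable_iff, F.isSatisfiable_iff]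
  exact exists_congr fun T => ⟨fun h' => h'.congr h, fun h' => h'.congr fun v hv => (h v hv).symm⟩

/-- Every articulation point of a block is its parent, whose labels are overwritten, or one of its
children. -/
theorem BlockFacts.setParent_congr {L L' : Labelling G} {X : Node G} (hX : X.IsBlock)
    (h : ∀ c, IsParent R X c → L c = L' c) (Z : Set Label) {v : V} (hv : v ∈ X.verts) :
    vertexLabels (setParent R L X Z) v = vertexLabels (setParent R L' X Z) v := by
  by_cases ha : IsArticulation G v
  · rw [vertexLabels_artic _ ha, vertexLabels_artic _ ha, setParent, setParent]
    by_cases hp : IsParent R (.artic v ha) X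
    · simp [hp]
    · simp [hp, h _ ((F.artic_cases (R := R) hX hv ha).resolve_left hp)]
  · rw [vertexLabels_of_not _ ha, vertexLabels_of_not _ ha]

theorem BlockFacts.labelNode_congr {L L' : Labelling G} {x : Node G}
    (h : ∀ c, IsParent R x c → L c = L' c) : labelNode R L x = labelNode R L' x := by
  cases x with
  | pendant => rfl
  | artic v hv =>
    ext l
    have h1 : ∀ P : Set Label → Prop, (∀ c, IsParent R (.artic v hv) c → P (L c)) ↔
        ∀ c, IsParent R (.artic v hv) c → P (L' c) := fun P =>
      forall₂_congr fun c hc => by rw [h c hc]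
    have h2 : ∀ P : Set Label → Prop, (∃ c, IsParent R (.artic v hv) c ∧ P (L c)) ↔
        ∃ c, IsParent R (.artic v hv) c ∧ P (L' c) := fun P =>
      exists_congr fun c => and_congr_right fun hc => by rw [h c hc]
    have h3 := h1 fun S => Label.PI ∈ S
    have h4 := h1 fun S => Label.PO ∈ S ∨ Label.PE ∈ S
    have h5 := h2 fun S => Label.PO ∈ S
    simp only [labelNode, articLabels, Set.mem_ofPred_eq, h3, h4, h5]
  | bridge e he =>
    ext l
    exact exists_congr fun c => and_congr_right fun hc => by rw [h c hc]
  | comp H hH =>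
    have key := fun Z flag => F.isSatisfiable_congr (R := R) (hH := hH) flag
      fun v (hv : v ∈ (Node.comp H hH).verts) => F.setParent_congr (R := R) (X := .comp H hH)
        trivial h Z hv
    ext l
    simp only [labelNode, compLabels, Set.mem_ofPred_eq, key]

theorem BlockFacts.runLabelling_unique {L L' : Labelling G} (h : IsRunLabelling R L)
    (h' : IsRunLabelling R L') : L = L' := by
  funext x
  refine F.bottom_up (R := R) (P := fun x => L x = L' x) (fun x ih => ?_) x
  by_cases hx : x = R
  · rw [hx, h.1, h'.1]
  · rw [h.2 x hx, h'.2 x hx, F.labelNode_congr ih]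

end Congr

/-- While `x` is being labelled its parent has no label. -/
theorem setParent_self {V : Type} {G : SimpleGraph V} {R : Node G} {L : Labelling G} {x : Node G}
    (h : ∀ p, IsParent R p x → L p = ∅) : setParent R L x ∅ = L := by
  funext z
  by_cases hz : IsParent R z x
  · simp [setParent, hz, h]
  · simp [setParent, hz]

theorem BlockFacts.setParent_eq {V : Type} {G : SimpleGraph V} (F : BlockFacts G) {R : Node G}
    (L : Labelling G) {p x : Node G} (h : IsParent R p x) (S : Set Label) [DecidableEq (Node G)] :
    setParent R L x S = Function.update L p S := by
  funext z
  by_cases hz : z = p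
  · subst hz; simp [setParent, h]
  · have : ¬ IsParent R z x := fun h' => hz (F.parent_unique h' h)
    simp [setParent, this, hz]

/-- Set register `t` if some child of the node in register 15 has labels with `e`. -/
def anyChild (t : ℕ) (e : Expr) : Prog :=
  t ≔ 0 ;; .for 16 1 (.ite (♯16 =! ♯2) .skip (.ite ((4 ↗ ♯16) =! ♯15) (.ite e (t ≔ 1) .skip) .skip))

/-- The label bits of the node in register 16. -/
def bitE (k : Expr) : Expr := 5 ↗ (3 * ♯16 + k)

/-- Write the label bits in registers 20 to 22 to the node in register 15. -/
def writeLabel : Prog :=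
  .store 5 (3 * ♯15) ♯20 ;; .store 5 (3 * ♯15 + 1) ♯21 ;; .store 5 (3 * ♯15 + 2) ♯22

/-- Set registers 20 to 22 according to the children of the node in register 15. -/
def anyChildren (e₁ e₂ e₃ : Expr) : Prog := anyChild 20 e₁ ;; anyChild 21 e₂ ;; anyChild 22 e₃

/-- Compute the label bits of the articulation point in register 15. -/
def articLabel : Prog :=
  anyChildren (1 - bitE 0) ((1 - bitE 1) * (1 - bitE 2)) (bitE 1) ;;
  (20 ≔ 1 - ♯20 ;; 23 ≔ 1 - ♯21 ;; 21 ≔ ♯23 * ♯22 ;; 22 ≔ ♯23 * (1 - ♯22))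

/-- Compute the label bits of the bridge in register 15. -/
def bridgeLabel : Prog := anyChildren (bitE 1 + bitE 2) (bitE 0) (bitE 1 * (1 - bitE 0))

/-- Compute the label bits of the component in register 15. -/
def compLabel : Prog :=
  (3 ≔ ♯15 ;; 4 ≔ 1) ;; isSat ;; (20 ≔ ♯5 ;; 4 ≔ 2) ;; isSat ;;
  (21 ≔ ♯5 ;; .store 5 (3 * (4 ↗ ♯15) + 1) 1) ;; isSat ;;
  (22 ≔ ♯5 * (1 - ♯21) ;; .store 5 (3 * (4 ↗ ♯15) + 1) 0)

/-- Label the node in register 15. -/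
def labelStep : Prog :=
  .ite ((1 ↗ ♯15) =! 3) compLabel
    (.ite ((1 ↗ ♯15) =! 2) bridgeLabel
      (.ite ((1 ↗ ♯15) =! 1) articLabel (20 ≔ 1 ;; 21 ≔ 0 ;; 22 ≔ 1))) ;;
  writeLabel

section

variable {W M n N : ℕ} {G : SimpleGraph (Fin n)} {ν : Fin N ≃ Node G} {R : Node G}
  {L : Labelling G}

/-- The memory during the labelling of node `x`. -/
def HoldsNode (ν : Fin N ≃ Node G) (R : Node G) (L : Labelling G) (x : Node G) (s : State) : Prop :=
  HoldsRootedTree G ν R s ∧ HoldsLabels ν L s ∧ s.var 15 = ν.symm x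

/-- The truth values in registers 20 to 22 describe `S`. -/
def HoldsBits (S : Set Label) (s : State) : Prop :=
  s.var 20 = bit (Label.PI ∈ S) ∧ s.var 21 = bit (Label.PO ∈ S) ∧ s.var 22 = bit (Label.PE ∈ S)

theorem HoldsRootedTree.frame {p : Prog} {s s' : State} (h : HoldsRootedTree G ν R s)
    (f : Frame p s s') (hp : (∀ i ∈ [0, 1, 2], i ∉ p.wvars) ∧ ∀ a ∈ [0, 1, 2, 3, 4], a ∉ p.warrs) :
    HoldsRootedTree G ν R s' := by
  obtain ⟨hv, ha⟩ := hp
  simp only [List.mem_cons, List.not_mem_nil, or_false, forall_eq_or_imp, forall_eq] at hv ha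
  unfold HoldsRootedTree HoldsTree HoldsGraph
  rw [f.var 0 hv.1, f.var 1 hv.2.1, f.var 2 hv.2.2, f.arr 0 ha.1, f.arr 1 ha.2.1, f.arr 2 ha.2.2.1,
    f.arr 3 ha.2.2.2.1, f.arr 4 ha.2.2.2.2]
  exact h

theorem HoldsNode.frame {p : Prog} {s s' : State} {x : Node G} (h : HoldsNode ν R L x s)
    (f : Frame p s s')
    (hp : (∀ i ∈ [0, 1, 2], i ∉ p.wvars) ∧ ∀ a ∈ [0, 1, 2, 3, 4], a ∉ p.warrs)
    (h5 : 5 ∉ p.warrs) (h15 : 15 ∉ p.wvars) : HoldsNode ν R L x s' := by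
  refine ⟨h.1.frame f hp, ?_, ?_⟩
  · unfold HoldsLabels; rw [f.arr 5 h5]; exact h.2.1
  · rw [f.var 15 h15]; exact h.2.2

/-- Children are found by comparing parent entries. The root is skipped explicitly, because its
entry is unspecified and could mimic a child. -/
theorem anyChild_spec (hB : Big W M) (hN : 3 * N ≤ M) (F : BlockFacts G) {t : ℕ}
    (ht : t = 20 ∨ t = 21 ∨ t = 22) {e : Expr} (he : e.cost ≤ 24) (P : Set Label → Prop)
    {x : Node G} {s : State} (hs : HoldsNode ν R L x s)
    (hP : ∀ (s' : State) (j : Fin N), s'.var 16 = (j : ℕ) → HoldsLabels ν L s' →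
      e.Bdd M s' ∧ (e.val s' ≠ 0 ↔ P (L (ν j)))) :
    HaltsWithin W (N * 70 + 8) (anyChild t e) s fun s' =>
      s'.var t = bit (∃ c, IsParent R x c ∧ P (L c)) := by
  have h32 := hB.two
  have hd : (t = 1) = False ∧ (1 = t) = False ∧ (t = 2) = False ∧ (2 = t) = False ∧
      (t = 15) = False ∧ (15 = t) = False ∧ (t = 16) = False ∧ (16 = t) = False ∧
      (t = 0) = False ∧ (0 = t) = False := by
    simp only [eq_iff_iff, iff_false]; omega
  obtain ⟨⟨⟨⟨h0, hA⟩, h1, hk, hv, htr⟩, hr, hp⟩, hL, h15⟩ := hs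
  refine hw_seq (T₁ := 2) (T₂ := N * 70 + 6) (fun s' => s' = s.setVar t 0)
    (hw_run hB rfl (of_decide_eq_true rfl) (by simp) (by simp)) ?_ (by omega)
  rintro _ - rfl
  refine hw_for hB (K := N) (by simp [Prog.wvars, hd]) (by simp [Prog.wvars, hd]) (by omega)
    (by simp [hd, h1]) (by omega)
    (fun j s' => s'.var t = bit (∃ c, ((ν.symm c : Fin N) : ℕ) < j ∧ IsParent R x c ∧ P (L c))) 50
    (by simp [hd, bit]) ?_ (fun s' _ _ h => by simpa using h) (by omega)
  intro j s' hj hf hvj hI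
  lift j to Fin N using hj with i
  have hi := i.2
  have e2 : s'.var 2 = ν.symm R := by
    rw [hf.var 2 (by simp [Prog.for, Prog.wvars, hd])]; simpa [hd] using hr
  have e15 : s'.var 15 = ν.symm x := by
    rw [hf.var 15 (by simp [Prog.for, Prog.wvars, hd])]; simpa [hd] using h15
  have harr : s'.arr = s.arr := by
    ext a; rw [hf.arr a (by simp [Prog.for, Prog.warrs])]; simp
  obtain ⟨b1, b2⟩ := hP s' i hvj (by unfold HoldsLabels; rw [harr]; exact hL)
  have hstep : (∃ c, ((ν.symm c : Fin N) : ℕ) < i + 1 ∧ IsParent R x c ∧ P (L c)) ↔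
      (∃ c, ((ν.symm c : Fin N) : ℕ) < i ∧ IsParent R x c ∧ P (L c)) ∨
        IsParent R x (ν i) ∧ P (L (ν i)) := by
    constructor
    · rintro ⟨c, hc, h⟩
      by_cases hci : ν.symm c = i
      · subst hci; right; simpa using h
      · have : ((ν.symm c : Fin N) : ℕ) ≠ i := fun h => hci (Fin.ext h)
        exact Or.inl ⟨c, by omega, h⟩
    · rintro (⟨c, hc, h⟩ | h)
      · exact ⟨c, by omega, h⟩
      · exact ⟨ν i, by simp, h⟩
  have hbit : ∀ Q : Prop, (IsParent R x (ν i) ∧ P (L (ν i)) ↔ Q) → ∀ k : ℕ,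
      (Q → k = 1) → (¬ Q → k = s'.var t) →
      k = bit (∃ c, ((ν.symm c : Fin N) : ℕ) < i + 1 ∧ IsParent R x c ∧ P (L c)) := by
    intro Q hQ k h1 h2
    rw [hQ] at hstep
    by_cases h : Q
    · rw [h1 h, bit_true (hstep.2 (Or.inr h))]
    · rw [h2 h, hI]
      exact bit_congr (by rw [hstep]; simp [h])
  have hpar : ν i ≠ R → ∃ k : Fin N, s.arr 4 i = k ∧ (IsParent R x (ν i) ↔ k = ν.symm x) := by
    intro hne
    obtain ⟨p, hpp⟩ := F.exists_parent hne
    refine ⟨ν.symm p, hp _ _ (by simpa using hpp), ?_⟩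
    rw [EmbeddingLike.apply_eq_iff_eq]
    exact ⟨fun h => F.parent_unique hpp h, fun h => h ▸ hpp⟩
  have hk1 : (♯16 =! ♯2 : Expr).cost = 3 := rfl
  have hk2 : ((4 ↗ ♯16) =! ♯15 : Expr).cost = 4 := rfl
  refine hw_ite (M := M) (T' := 40) hB (by simp [hvj, e2]; omega) (of_decide_eq_true rfl)
    (fun hb => ?_) (fun hb => ?_) (by omega)
  · have hi2 : (i : ℕ) = ν.symm R := by by_contra h; simp [hvj, e2, h] at hb
    have hiR : ν i = R := by rw [Fin.ext hi2]; simp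
    refine hw_run (M := M) hB rfl (by simp [Prog.tmax]) (by simp) ?_
    simp only [State.setVar_var, Prog.run, hd, if_false]
    exact hbit False (by rw [hiR]; exact ⟨fun h => h.1.ne_root rfl, False.elim⟩) _ False.elim
      fun _ => rfl
  · have hi2 : (i : ℕ) ≠ ν.symm R := by intro h; simp [hvj, e2, h] at hb
    have hiR : ν i ≠ R := fun h => hi2 (by rw [← h]; simp)
    obtain ⟨k, hk4, hkx⟩ := hpar hiR
    have hk2' := k.2
    have hx2 := (ν.symm x).2
    refine hw_ite (M := M) (T' := 35) hB (by simp [hvj, e15, harr, hk4]; omega)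
      (of_decide_eq_true rfl) (fun hb' => ?_) (fun hb' => ?_) (by omega)
    · have hkx' : k = ν.symm x := by
        by_contra h
        have : (k : ℕ) ≠ ν.symm x := fun h' => h (Fin.ext h')
        simp [hvj, e15, harr, hk4, this] at hb'
      have hix := hkx.2 hkx'
      refine hw_ite (M := M) (T' := 3) hB b1 (by omega) (fun hc => ?_) (fun hc => ?_) (by omega)
      · refine hw_run (M := M) hB rfl (of_decide_eq_true rfl) (by simp; omega) ?_
        simp only [State.setVar_var, Prog.run, hd, if_false, if_true, Expr.val]
        exact hbit True ⟨fun _ => trivial, fun _ => ⟨hix, b2.1 hc⟩⟩ _ (fun _ => rfl) (by simp)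
      · refine hw_run (M := M) hB rfl (by simp [Prog.tmax]) (by simp) ?_
        simp only [State.setVar_var, Prog.run, hd, if_false]
        exact hbit False ⟨fun h => b2.2 h.2 hc, False.elim⟩ _ False.elim fun _ => rfl
    · have hkx' : k ≠ ν.symm x := by
        intro h
        simp [hvj, e15, harr, hk4, h] at hb'
      refine hw_run (M := M) hB rfl (by simp [Prog.tmax]) (by simp) ?_
      simp only [State.setVar_var, Prog.run, hd, if_false]
      exact hbit False ⟨fun h => hkx' (hkx.1 h.1), False.elim⟩ _ False.elim fun _ => rfl

end

end RMIS

/-! ### Labels of the four types of nodes -/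

namespace RMIS

section

variable {W M n N : ℕ} {G : SimpleGraph (Fin n)} {ν : Fin N ≃ Node G} {R : Node G}
  {L : Labelling G}

theorem anyChildren_spec (hB : Big W M) (hN : 3 * N ≤ M) (F : BlockFacts G) {e₁ e₂ e₃ : Expr}
    (he : e₁.cost ≤ 24 ∧ e₂.cost ≤ 24 ∧ e₃.cost ≤ 24) (P₁ P₂ P₃ : Set Label → Prop)
    {x : Node G} {s : State} (hs : HoldsNode ν R L x s)
    (hP : ∀ (s' : State) (j : Fin N), s'.var 16 = (j : ℕ) → HoldsLabels ν L s' →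
      (e₁.Bdd M s' ∧ (e₁.val s' ≠ 0 ↔ P₁ (L (ν j)))) ∧
      (e₂.Bdd M s' ∧ (e₂.val s' ≠ 0 ↔ P₂ (L (ν j)))) ∧
      (e₃.Bdd M s' ∧ (e₃.val s' ≠ 0 ↔ P₃ (L (ν j))))) :
    HaltsWithin W (N * 210 + 24) (anyChildren e₁ e₂ e₃) s fun s' =>
      s'.var 20 = bit (∃ c, IsParent R x c ∧ P₁ (L c)) ∧
      s'.var 21 = bit (∃ c, IsParent R x c ∧ P₂ (L c)) ∧
      s'.var 22 = bit (∃ c, IsParent R x c ∧ P₃ (L c)) := by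
  refine hw_seq (T₁ := N * 70 + 8) (T₂ := N * 140 + 16) _ (anyChild_spec hB hN F (Or.inl rfl) he.1
    P₁ hs fun s' j h1 h2 => (hP s' j h1 h2).1) ?_ (by omega)
  intro s₁ f₁ h₁
  have hs₁ := hs.frame f₁ (by simp [anyChild, Prog.wvars, Prog.warrs, Prog.for])
    (by simp [anyChild, Prog.warrs, Prog.for]) (by simp [anyChild, Prog.wvars, Prog.for])
  refine hw_seq (T₁ := N * 70 + 8) (T₂ := N * 70 + 8) _ (anyChild_spec hB hN F (Or.inr (Or.inl rfl))
    he.2.1 P₂ hs₁ fun s' j h1 h2 => (hP s' j h1 h2).2.1) ?_ (by omega)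
  intro s₂ f₂ h₂
  have hs₂ := hs₁.frame f₂ (by simp [anyChild, Prog.wvars, Prog.warrs, Prog.for])
    (by simp [anyChild, Prog.warrs, Prog.for]) (by simp [anyChild, Prog.wvars, Prog.for])
  refine (anyChild_spec hB hN F (Or.inr (Or.inr rfl)) he.2.2 P₃ hs₂
    fun s' j h1 h2 => (hP s' j h1 h2).2.2).mono le_rfl fun s₃ f₃ h₃ => ⟨?_, ?_, h₃⟩
  · rw [f₃.var 20 (by simp [anyChild, Prog.wvars, Prog.for]),
      f₂.var 20 (by simp [anyChild, Prog.wvars, Prog.for]), h₁]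
  · rw [f₃.var 21 (by simp [anyChild, Prog.wvars, Prog.for]), h₂]

/-- The values of the label bits of the node in register 16. -/
theorem bitE_facts (hB : Big W M) (hN : 3 * N ≤ M) {s : State} {j : Fin N} (h16 : s.var 16 = (j : ℕ))
    (hL : HoldsLabels ν L s) :
    ((bitE 0).Bdd M s ∧ (bitE 0).val s = bit (Label.PI ∈ L (ν j))) ∧
    ((bitE 1).Bdd M s ∧ (bitE 1).val s = bit (Label.PO ∈ L (ν j))) ∧
    ((bitE 2).Bdd M s ∧ (bitE 2).val s = bit (Label.PE ∈ L (ν j))) := by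
  have h32 := hB.two
  obtain ⟨l1, l2, l3⟩ := hL j
  have b1 := bit_le_one (Label.PI ∈ L (ν j))
  have b2 := bit_le_one (Label.PO ∈ L (ν j))
  have b3 := bit_le_one (Label.PE ∈ L (ν j))
  have hj := j.2
  refine ⟨⟨?_, ?_⟩, ⟨?_, ?_⟩, ⟨?_, ?_⟩⟩ <;> simp [bitE, h16, l1, l2, l3] <;> omega

/-- The conditions on all children are tested as the absence of a bad child. -/
theorem articLabel_spec (hB : Big W M) (hN : 3 * N ≤ M) (F : BlockFacts G) {x : Node G} {s : State}
    (hs : HoldsNode ν R L x s) :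
    HaltsWithin W (N * 210 + 50) articLabel s (HoldsBits (articLabels R L x)) := by
  have h32 := hB.two
  refine hw_seq (T₁ := N * 210 + 24) (T₂ := 26) _ (anyChildren_spec hB hN F
    ⟨of_decide_eq_true rfl, of_decide_eq_true rfl, of_decide_eq_true rfl⟩ (fun S => Label.PI ∉ S)
    (fun S => Label.PO ∉ S ∧ Label.PE ∉ S) (fun S => Label.PO ∈ S) hs fun s' j h1 h2 => ?_) ?_
    (by omega)
  · obtain ⟨⟨b0, v0⟩, ⟨b1, v1⟩, ⟨b2, v2⟩⟩ := bitE_facts hB hN h1 h2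
    refine ⟨⟨by simp [b0]; omega, ?_⟩, ⟨by simp [b1, b2]; omega, ?_⟩, b1, ?_⟩
    · simp only [Expr.val_sub, v0]
      by_cases h : Label.PI ∈ L (ν j) <;> simp [h, bit]
    · simp only [Expr.val_sub, Expr.val_mul, v1, v2]
      by_cases h : Label.PO ∈ L (ν j) <;> by_cases h' : Label.PE ∈ L (ν j) <;> simp [h, h', bit]
    · simp [v1]
  · rintro s₁ - ⟨h20, h21, h22⟩
    have b20 := bit_le_one (∃ c, IsParent R x c ∧ Label.PI ∉ L c)
    have b21 := bit_le_one (∃ c, IsParent R x c ∧ Label.PO ∉ L c ∧ Label.PE ∉ L c)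
    have b22 := bit_le_one (∃ c, IsParent R x c ∧ Label.PO ∈ L c)
    refine hw_run (M := M) hB rfl (of_decide_eq_true rfl) (by simp [h20, h21, h22]; omega) ?_
    have i1 : Label.PI ∈ articLabels R L x ↔ ¬ ∃ c, IsParent R x c ∧ Label.PI ∉ L c := by
      simp [articLabels]
    have i4 : (∀ c, IsParent R x c → Label.PO ∈ L c ∨ Label.PE ∈ L c) ↔
        ¬ ∃ c, IsParent R x c ∧ Label.PO ∉ L c ∧ Label.PE ∉ L c := by
      push Not
      exact forall₂_congr fun c _ => by tauto
    have i2 : Label.PO ∈ articLabels R L x ↔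
        (¬ ∃ c, IsParent R x c ∧ Label.PO ∉ L c ∧ Label.PE ∉ L c) ∧
        ∃ c, IsParent R x c ∧ Label.PO ∈ L c := by
      rw [← i4]; simp [articLabels]
    have i3 : Label.PE ∈ articLabels R L x ↔
        (¬ ∃ c, IsParent R x c ∧ Label.PO ∉ L c ∧ Label.PE ∉ L c) ∧
        ¬ ∃ c, IsParent R x c ∧ Label.PO ∈ L c := by
      rw [← i4]; simp [articLabels]
    rw [HoldsBits, bit_congr i1, bit_congr i2, bit_congr i3]
    simp only [Prog.run, State.setVar_var, Expr.val_sub, Expr.val,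
      h20, h21, h22]
    generalize (∃ c, IsParent R x c ∧ Label.PI ∉ L c) = A
    generalize (∃ c, IsParent R x c ∧ Label.PO ∉ L c ∧ Label.PE ∉ L c) = B
    generalize (∃ c, IsParent R x c ∧ Label.PO ∈ L c) = C
    by_cases hA : A <;> by_cases hB : B <;> by_cases hC : C <;> simp [bit, hA, hB, hC]

theorem bridgeLabel_spec (hB : Big W M) (hN : 3 * N ≤ M) (F : BlockFacts G) {x : Node G} {s : State}
    (hs : HoldsNode ν R L x s) :
    HaltsWithin W (N * 210 + 24) bridgeLabel s (HoldsBits (bridgeLabels R L x)) := by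
  have h32 := hB.two
  refine (anyChildren_spec hB hN F
    ⟨of_decide_eq_true rfl, of_decide_eq_true rfl, of_decide_eq_true rfl⟩
    (fun S => Label.PE ∈ S ∨ Label.PO ∈ S) (fun S => Label.PI ∈ S)
    (fun S => Label.PO ∈ S ∧ Label.PI ∉ S) hs fun s' j h1 h2 => ?_).mono le_rfl ?_
  · obtain ⟨⟨b0, v0⟩, ⟨b1, v1⟩, ⟨b2, v2⟩⟩ := bitE_facts hB hN h1 h2
    refine ⟨⟨by simp [b1, b2], ?_⟩, ⟨b0, by simp [v0]⟩, by simp [b0, b1]; omega, ?_⟩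
    · simp only [Expr.val_add, v1, v2]
      by_cases h : Label.PO ∈ L (ν j) <;> by_cases h' : Label.PE ∈ L (ν j) <;> simp [h, h', bit]
    · simp only [Expr.val_sub, Expr.val_mul, v1, v0]
      by_cases h : Label.PO ∈ L (ν j) <;> by_cases h' : Label.PI ∈ L (ν j) <;> simp [h, h', bit]
  · rintro s' - ⟨h20, h21, h22⟩
    refine ⟨h20.trans (bit_congr ?_), h21.trans (bit_congr ?_), h22.trans (bit_congr ?_)⟩ <;>
      exact exists_congr fun c => and_congr_right fun hc => by simp

theorem HoldsLabels.update [DecidableEq (Node G)] {s s' : State} (h : HoldsLabels ν L s) (i : Fin N)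
    {S : Set Label} (h0 : s'.arr 5 (3 * i) = bit (Label.PI ∈ S))
    (h1 : s'.arr 5 (3 * i + 1) = bit (Label.PO ∈ S))
    (h2 : s'.arr 5 (3 * i + 2) = bit (Label.PE ∈ S))
    (hne : ∀ k, k ≠ 3 * (i : ℕ) → k ≠ 3 * i + 1 → k ≠ 3 * i + 2 → s'.arr 5 k = s.arr 5 k) :
    HoldsLabels ν (Function.update L (ν i) S) s' := by
  intro j
  by_cases hj : j = i
  · subst hj; simp [h0, h1, h2]
  · have hj' : (j : ℕ) ≠ i := fun h => hj (Fin.ext h)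
    rw [Function.update_of_ne (by simpa using hj), hne _ (by omega) (by omega) (by omega),
      hne _ (by omega) (by omega) (by omega), hne _ (by omega) (by omega) (by omega)]
    exact h j

theorem writeLabel_spec [DecidableEq (Node G)] (hB : Big W M) (hN : 3 * N ≤ M) {x : Node G}
    {s : State} (hs : HoldsNode ν R L x s) {S : Set Label} (hS : HoldsBits S s) :
    HaltsWithin W 20 writeLabel s (HoldsLabels ν (Function.update L x S)) := by
  have h32 := hB.two
  obtain ⟨h20, h21, h22⟩ := hS
  have b1 := bit_le_one (Label.PI ∈ S)
  have b2 := bit_le_one (Label.PO ∈ S)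
  have b3 := bit_le_one (Label.PE ∈ S)
  have hx := (ν.symm x).2
  refine hw_run (M := M) hB rfl (of_decide_eq_true rfl) (by simp [writeLabel, hs.2.2, h20, h21, h22]; omega) ?_
  have := hs.2.1.update (s' := writeLabel.run s) (ν.symm x) (S := S)
    (by simp [writeLabel, hs.2.2, h20])
    (by simp [writeLabel, hs.2.2, h21])
    (by simp [writeLabel, hs.2.2, h22])
    (fun k h1 h2 h3 => by simp [writeLabel, hs.2.2, h1, h2, h3])
  simpa using this

/-- As the parent has no label yet, the first two tests run on the stored labelling itself. For the
third one, the PO bit of the parent is set and afterwards cleared, which restores the labelling. -/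
theorem compLabel_spec (hB : Big W M) (hn1 : 1 ≤ n) (hN4 : N ≤ 4 * n) (hM : 4 * n * n ≤ M)
    (hM' : 12 * n ≤ M) (F : BlockFacts G) {x : Node G} (hx : x.IsComp) (hxR : x ≠ R)
    (hpar : ∀ p, IsParent R p x → L p = ∅) {s : State} (hs : HoldsNode ν R L x s) :
    HaltsWithin W (18100 * n ^ 2) compLabel s fun s' =>
      HoldsBits (compLabels R L x) s' ∧ HoldsNode ν R L x s' := by
  classical
  have h32 := hB.two
  have hnn : 1 ≤ n ^ 2 := Nat.one_le_pow _ _ hn1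
  obtain ⟨p, hp⟩ := F.exists_parent hxR
  have hLp := hpar p hp
  have hsat : ∀ {L' : Labelling G} {flag : Flag} {s' : State}, HoldsNode ν R L' x s' →
      s'.var 3 = ν.symm x → s'.var 4 = (match flag with | .none => 0 | .inside => 1 | .outside => 2) →
      HaltsWithin W (6000 * n ^ 2) isSat s' (Returns (isSatisfiable R L' x flag)) :=
    fun h h3 h4 => isSat_spec hB hn1 hN4 hM hM' F h.1 h.2.1 hx ⟨h3, h4⟩ fun _ => hxR
  have hfr : ∀ {L' : Labelling G} {s' s'' : State}, HoldsNode ν R L' x s' → Frame isSat s' s'' →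
      HoldsNode ν R L' x s'' := fun h f =>
    h.frame f (of_decide_eq_true rfl) (of_decide_eq_true rfl) (of_decide_eq_true rfl)
  have hix := (ν.symm x).2
  have hip := (ν.symm p).2
  have e4 : s.arr 4 (ν.symm x) = ν.symm p := hs.1.2.2 _ _ (by simpa using hp)
  refine hw_seq (T₁ := 4) (T₂ := 18090 * n ^ 2)
    (fun s' => s' = Prog.run (3 ≔ ♯15 ;; 4 ≔ 1) s)
    (hw_run (M := M) hB rfl (of_decide_eq_true rfl) (by simp [hs.2.2]; omega) rfl) ?_ (by omega)
  rintro s₁ f₁ e₁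
  have hs₁ := hs.frame f₁ (of_decide_eq_true rfl) (of_decide_eq_true rfl) (of_decide_eq_true rfl)
  refine hw_seq (T₁ := 6000 * n ^ 2) (T₂ := 12090 * n ^ 2) _ (hsat (flag := .inside) hs₁
    (by simp [e₁, hs.2.2]) (by simp [e₁])) ?_ (by omega)
  rintro s₂ f₂ r₂
  have hs₂ := hfr hs₁ f₂
  have b2 := bit_le_one (isSatisfiable R L x .inside)
  rw [Returns] at r₂
  refine hw_seq (T₁ := 4) (T₂ := 12080 * n ^ 2)
    (fun s' => s' = Prog.run (20 ≔ ♯5 ;; 4 ≔ 2) s₂)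
    (hw_run (M := M) hB rfl (of_decide_eq_true rfl) (by simp [r₂]; omega) rfl) ?_ (by omega)
  rintro s₃ f₃ e₃
  have hs₃ := hs₂.frame f₃ (of_decide_eq_true rfl) (of_decide_eq_true rfl) (of_decide_eq_true rfl)
  have g3 : s₃.var 3 = ν.symm x := by
    rw [f₃.var 3 (of_decide_eq_true rfl), f₂.var 3 (of_decide_eq_true rfl)]
    simp [e₁, hs.2.2]
  refine hw_seq (T₁ := 6000 * n ^ 2) (T₂ := 6080 * n ^ 2) _ (hsat (flag := .outside) hs₃
    g3 (by simp [e₃])) ?_ (by omega)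
  rintro s₄ f₄ r₄
  have hs₄ := hfr hs₃ f₄
  have b4 := bit_le_one (isSatisfiable R L x .outside)
  rw [Returns] at r₄
  have e4' : s₄.arr 4 (ν.symm x) = ν.symm p := hs₄.1.2.2 _ _ (by simpa using hp)
  refine hw_seq (T₁ := 10) (T₂ := 6070 * n ^ 2)
    (fun s' => s' = Prog.run (21 ≔ ♯5 ;; .store 5 (3 * (4 ↗ ♯15) + 1) 1) s₄)
    (hw_run (M := M) hB rfl (of_decide_eq_true rfl) (by simp [r₄, hs₄.2.2, e4']; omega) rfl) ?_
    (by omega)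
  rintro s₅ f₅ e₅
  obtain ⟨l0, l1, l2⟩ := hs₄.2.1 (ν.symm p)
  have hs₅ : HoldsNode ν R (setParent R L x {Label.PO}) x s₅ := by
    refine ⟨hs₄.1.frame f₅ (of_decide_eq_true rfl), ?_, ?_⟩
    · rw [F.setParent_eq L hp]
      have := hs₄.2.1.update (s' := s₅) (ν.symm p) (S := {Label.PO})
        (by simp [e₅, hs₄.2.2, e4', l0, hLp])
        (by simp [e₅, hs₄.2.2, e4']; simp [bit])
        (by simp [e₅, hs₄.2.2, e4', l2, hLp])
        (fun k h1 h2 h3 => by simp [e₅, hs₄.2.2, e4', h2])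
      simpa using this
    · rw [f₅.var 15 (of_decide_eq_true rfl), hs₄.2.2]
  have g3' : s₅.var 3 = ν.symm x := by
    rw [f₅.var 3 (of_decide_eq_true rfl), f₄.var 3 (of_decide_eq_true rfl), g3]
  have g4' : s₅.var 4 = 2 := by
    rw [f₅.var 4 (of_decide_eq_true rfl), f₄.var 4 (of_decide_eq_true rfl)]
    simp [e₃]
  refine hw_seq (T₁ := 6000 * n ^ 2) (T₂ := 60 * n ^ 2) _ (hsat (flag := .outside) hs₅
    g3' g4') ?_ (by omega)
  rintro s₆ f₆ r₆
  have hs₆ := hfr hs₅ f₆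
  have b6 := bit_le_one (isSatisfiable R (setParent R L x {Label.PO}) x .outside)
  rw [Returns] at r₆
  have e4'' : s₆.arr 4 (ν.symm x) = ν.symm p := hs₆.1.2.2 _ _ (by simpa using hp)
  have v21 : s₆.var 21 = bit (isSatisfiable R L x .outside) := by
    rw [f₆.var 21 (of_decide_eq_true rfl)]
    simp [e₅, r₄]
  have v20 : s₆.var 20 = bit (isSatisfiable R L x .inside) := by
    rw [f₆.var 20 (of_decide_eq_true rfl), f₅.var 20 (of_decide_eq_true rfl),
      f₄.var 20 (of_decide_eq_true rfl)]
    simp [e₃, r₂]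
  obtain ⟨k0, k1, k2⟩ := hs₆.2.1 (ν.symm p)
  refine (hw_run (M := M) (T := 14) hB rfl (of_decide_eq_true rfl)
    (by simp [r₆, v21, hs₆.2.2, e4'']; omega) (post := fun s' => s' = Prog.run
      (22 ≔ ♯5 * (1 - ♯21) ;; .store 5 (3 * (4 ↗ ♯15) + 1) 0) s₆) rfl).mono (by omega) ?_
  rintro s₇ f₇ e₇
  refine ⟨⟨?_, ?_, ?_⟩, hs₆.1.frame f₇ (of_decide_eq_true rfl), ?_, ?_⟩
  · rw [f₇.var 20 (of_decide_eq_true rfl), v20]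
    exact bit_congr (by simp [compLabels, setParent_self hpar])
  · rw [f₇.var 21 (of_decide_eq_true rfl), v21]
    exact bit_congr (by simp [compLabels, setParent_self hpar])
  · simp only [e₇, Prog.run, State.setArr_var, State.setVar_var, if_true, Expr.val_sub,
      Expr.val, v21, r₆]
    have : Label.PE ∈ compLabels R L x ↔ ¬ isSatisfiable R L x .outside ∧
        isSatisfiable R (setParent R L x {Label.PO}) x .outside := by
      simp [compLabels, setParent_self hpar]
    rw [bit_congr this]
    by_cases h1 : isSatisfiable R L x .outside <;>
      by_cases h2 : isSatisfiable R (setParent R L x {Label.PO}) x .outside <;> simp [bit, h1, h2]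
  · have hLL : L = Function.update (setParent R L x {Label.PO}) (ν (ν.symm p)) ∅ := by
      rw [Equiv.apply_symm_apply, F.setParent_eq L hp, Function.update_idem, ← hLp,
        Function.update_eq_self]
    have hpo : setParent R L x {Label.PO} p = {Label.PO} := by simp [setParent, hp]
    rw [Equiv.apply_symm_apply, hpo] at k0 k2
    rw [hLL]
    exact hs₆.2.1.update (s' := s₇) (ν.symm p) (S := ∅)
      (by simp [e₇, hs₆.2.2, e4'', k0])
      (by simp [e₇, hs₆.2.2, e4'']; simp [bit])
      (by simp [e₇, hs₆.2.2, e4'', k2])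
      (fun k h1 h2 h3 => by simp [e₇, hs₆.2.2, e4'', h2])
  · rw [f₇.var 15 (of_decide_eq_true rfl), hs₆.2.2]

theorem labelStep_spec [DecidableEq (Node G)] (hB : Big W M) (hn1 : 1 ≤ n) (hN4 : N ≤ 4 * n)
    (hM : 4 * n * n ≤ M) (hM' : 12 * n ≤ M) (F : BlockFacts G) {x : Node G} (hxR : x ≠ R)
    (hpar : ∀ p, IsParent R p x → L p = ∅) {s : State} (hs : HoldsNode ν R L x s) :
    HaltsWithin W (19000 * n ^ 2) labelStep s
      (HoldsLabels ν (Function.update L x (labelNode R L x))) := by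
  have h32 := hB.two
  have hnn : n ≤ n ^ 2 := by nlinarith
  have hN : 3 * N ≤ M := by omega
  have h1 : s.arr 1 (ν.symm x) = x.kind := by simpa using hs.1.1.2.2.1 (ν.symm x)
  have hx := (ν.symm x).2
  have hc : ∀ k : ℕ, k ≤ 3 → ((1 ↗ ♯15) =! Expr.lit k).Bdd M s ∧
      (((1 ↗ ♯15) =! Expr.lit k).val s ≠ 0 ↔ x.kind = k) ∧ ((1 ↗ ♯15) =! Expr.lit k).cost = 4 := by
    intro k hk
    have : x.kind ≤ 3 := by cases x <;> simp [Node.kind]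
    refine ⟨?_, ?_, rfl⟩
    · simp [hs.2.2, h1]; omega
    · simp [hs.2.2, h1]
  obtain ⟨c3, d3, k3⟩ := hc 3 (by omega)
  obtain ⟨c2, d2, k2⟩ := hc 2 (by omega)
  obtain ⟨c1, d1, k1⟩ := hc 1 (by omega)
  refine hw_seq (T₁ := 18200 * n ^ 2) (T₂ := 20) (fun s' => HoldsBits (labelNode R L x) s' ∧
    HoldsNode ν R L x s') ?_ (fun s' _ h => writeLabel_spec hB hN h.2 h.1) (by omega)
  refine hw_ite (M := M) (T' := 18100 * n ^ 2) hB c3 (of_decide_eq_true rfl) (fun hb => ?_)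
    (fun hb => ?_) (by change 4 + 1 + _ ≤ _; omega)
  · have hk := d3.1 hb
    cases x <;> simp [Node.kind] at hk
    exact compLabel_spec hB hn1 hN4 hM hM' F ⟨_, _, rfl⟩ hxR hpar hs
  have n3 : x.kind ≠ 3 := fun h => d3.2 h hb
  refine hw_ite (M := M) (T' := 18000 * n ^ 2) hB c2 (of_decide_eq_true rfl) (fun hb => ?_)
    (fun hb => ?_) (by change 4 + 1 + _ ≤ _; omega)
  · have hk := d2.1 hb
    cases x <;> simp [Node.kind] at hk
    exact (bridgeLabel_spec hB hN F hs).mono (by omega) fun s' f h => ⟨h, hs.frame f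
      (of_decide_eq_true rfl) (of_decide_eq_true rfl) (of_decide_eq_true rfl)⟩
  have n2 : x.kind ≠ 2 := fun h => d2.2 h hb
  refine hw_ite (M := M) (T' := 17000 * n ^ 2) hB c1 (of_decide_eq_true rfl) (fun hb => ?_)
    (fun hb => ?_) (by change 4 + 1 + _ ≤ _; omega)
  · have hk := d1.1 hb
    cases x <;> simp [Node.kind] at hk
    exact (articLabel_spec hB hN F hs).mono (by omega) fun s' f h => ⟨h, hs.frame f
      (of_decide_eq_true rfl) (of_decide_eq_true rfl) (of_decide_eq_true rfl)⟩
  · have n1 : x.kind ≠ 1 := fun h => d1.2 h hb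
    refine (hw_run (M := M) (T := 6) hB rfl (of_decide_eq_true rfl) (by simp; omega)
      (post := HoldsBits (labelNode R L x)) ?_).mono (by omega) fun s' f h => ⟨h, hs.frame f
      (of_decide_eq_true rfl) (of_decide_eq_true rfl) (of_decide_eq_true rfl)⟩
    cases x <;> simp [Node.kind] at n1 n2 n3
    simp [HoldsBits, labelNode]
    simp [bit]

end

end RMIS

namespace RMIS

/-! ### The decision algorithm -/

/-- The existence of a block structure is extracted from the verified program: it is run on an
artificial memory that holds the adjacency matrix of `G`. -/
theorem BlockFacts.of_connected {n : ℕ} {G : SimpleGraph (Fin n)} (hG : G.Connected) :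
    BlockFacts G := by
  have hB : Big ((32 + 8 * n) ^ 64) (32 + 8 * n) := ⟨by omega, le_rfl⟩
  have hs : HoldsGraph G ⟨fun _ => n, fun _ k => bit (natRel G.Adj (k / n) (k % n))⟩ := by
    refine ⟨rfl, fun i j => ?_⟩
    have hn : 0 < n := by have := i.2; omega
    have h1 : ((i : ℕ) * n + j) / n = i := by
      rw [Nat.add_comm, Nat.add_mul_div_right _ _ hn, Nat.div_eq_of_lt j.2, Nat.zero_add]
    have h2 : ((i : ℕ) * n + j) % n = j := by
      rw [Nat.add_comm, Nat.add_mul_mod_self_right, Nat.mod_eq_of_lt j.2]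
    simp only [h1, h2]
    exact bit_congr ⟨fun ⟨_, _, h⟩ => h, fun h => ⟨i.2, j.2, h⟩⟩
  obtain ⟨_, _, _, _, h, _⟩ := buildTree_spec hB (by omega) hG hs
  exact h

/-- Clear the labels. -/
def clearLabels : Prog :=
  .for 14 1 (.store 5 (3 * ♯14) 0 ;; .store 5 (3 * ♯14 + 1) 0 ;; .store 5 (3 * ♯14 + 2) 0)

/-- Label the nodes in the reverse of the order in array 10. -/
def labelAll : Prog :=
  .for 14 1 (15 ≔ 10 ↗ (♯1 - 1 - ♯14) ;; .ite (♯15 =! ♯2) .skip labelStep)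

/-- Test in register 17 whether all nodes except for the root have labels. -/
def checkLabels : Prog :=
  17 ≔ 1 ;; .for 14 1 (.ite (♯14 =! ♯2) .skip
    (.ite ((5 ↗ (3 * ♯14)) + (5 ↗ (3 * ♯14 + 1)) + (5 ↗ (3 * ♯14 + 2))) .skip (17 ≔ 0)))

/-- The decision algorithm, given the order in array 10. -/
def decideOrdered : Prog :=
  clearLabels ;; labelAll ;; checkLabels ;; (3 ≔ ♯2 ;; 4 ≔ 0) ;; isSat ;; 5 ≔ ♯5 * ♯17

/-- The decision algorithm. -/
def mainAlg : Prog := search 3 1 2 ;; decideOrdered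

section

variable {W M n N : ℕ} {G : SimpleGraph (Fin n)} {ν : Fin N ≃ Node G} {R : Node G}

/-- The search visits the nodes of the tree from the root downwards. -/
structure TreeOrder (ν : Fin N ≃ Node G) (R : Node G) (O P Q : ℕ → ℕ) : Prop where
  ord : ∀ k, k < N → O k < N ∧ P (O k) = k
  pos : ∀ x, P (ν.symm x) < N ∧ O (P (ν.symm x)) = ν.symm x
  lt : ∀ p x, IsParent R p x → P (ν.symm p) < P (ν.symm x)
  pred_lt : ∀ i, i < N → Q i < N
  pred : ∀ i j : Fin N, IsParent R (ν j) (ν i) → Q i = j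

/-- Predecessors in the search are neighbours with smaller position, so by uniqueness they are the
parents, and positions grow from parent to child. -/
theorem searchTree_spec (hB : Big W M) (hN : N ≤ M) (F : BlockFacts G) {s : State}
    (hT : HoldsTree G ν s) (h2 : s.var 2 = ν.symm R) :
    HaltsWithin W (200 * N ^ 2) (search 3 1 2) s fun s' =>
      TreeOrder ν R (s'.arr 10) (s'.arr 11) (s'.arr 13) := by
  classical
  have hpre : ((abcTree G).comap ν).Preconnected := by
    intro i j
    have h := F.preconnected (ν i) (ν j)
    have := (SimpleGraph.Iso.reachable_iff (φ := SimpleGraph.Iso.comap ν (abcTree G))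
      (u := i) (v := j))
    exact this.1 h
  refine (search_spec (r := ν.symm R) (A := natRel ((abcTree G).comap ν).Adj) hB (by omega)
    (by omega) (by omega) hN hT.2.1 h2 (Fin.is_lt _) ?_ (natRel_connected hpre (ν.symm R))).mono
    le_rfl ?_
  · intro i j hi hj
    exact (hT.2.2.2.2 ⟨i, hi⟩ ⟨j, hj⟩).trans (bit_congr ⟨fun h => ⟨hi, hj, h⟩, fun ⟨_, _, h⟩ => h⟩)
  · intro s' _ h
    let q : Node G → Node G := fun x =>
      if hx : s'.arr 13 (ν.symm x) < N then ν ⟨s'.arr 13 (ν.symm x), hx⟩ else x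
    have hq : ∀ x, x ≠ R → ∃ hx : s'.arr 13 (ν.symm x) < N, q x = ν ⟨_, hx⟩ ∧
        (abcTree G).Adj x (q x) ∧ s'.arr 11 (ν.symm (q x)) < s'.arr 11 (ν.symm x) := by
      intro x hx
      have hne : ((ν.symm x : Fin N) : ℕ) ≠ ν.symm R := fun h => hx (by simpa using Fin.ext h)
      obtain ⟨h1, ⟨_, _, h2⟩, h3⟩ := h.par _ (ν.symm x).2 hne
      have hqx : q x = ν ⟨_, h1⟩ := by simp [q, h1]
      refine ⟨h1, hqx, ?_, ?_⟩
      · rw [hqx]; simpa using h2.symm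
      · rw [hqx]; simpa using h3
    have hpar : ∀ p x, IsParent R p x → x ≠ R ∧ p = q x := fun p x =>
      (F.isParent_iff (f := fun x => s'.arr 11 (ν.symm x)) fun x hx => (hq x hx).choose_spec.2).1
    refine ⟨h.ord, fun x => h.pos _ (ν.symm x).2, fun p x hp => ?_, fun i hi => ?_,
      fun i j hp => ?_⟩
    · obtain ⟨hx, rfl⟩ := hpar p x hp
      exact (hq x hx).choose_spec.2.2
    · by_cases hir : i = ν.symm R
      · rw [hir]; exact h.root.2.2
      · exact (h.par i hi hir).1
    · obtain ⟨hx, hj⟩ := hpar _ _ hp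
      obtain ⟨h1, h2, -⟩ := hq _ hx
      rw [h2] at hj
      have := congrArg Fin.val (ν.injective hj)
      simpa using this.symm

theorem clearLabels_spec (hB : Big W M) (hN : 3 * N ≤ M) {s : State} (h1 : s.var 1 = N) :
    HaltsWithin W (N * 40 + 6) clearLabels s (HoldsLabels ν fun _ => ∅) := by
  have h32 := hB.two
  refine hw_for hB (K := N) (of_decide_eq_true rfl) (of_decide_eq_true rfl) (by omega) h1 (by omega)
    (fun j s' => ∀ k, k < 3 * j → s'.arr 5 k = 0) 30 (by simp) ?_ ?_ (by omega)
  · intro j s' hj hf hvj hI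
    refine hw_run (M := M) hB rfl (of_decide_eq_true rfl) (by simp [hvj]; omega) fun k hk => ?_
    by_cases h : k < 3 * j
    · simp [hvj, Function.update_apply, hI k h]
    · have : k = 3 * j ∨ k = 3 * j + 1 ∨ k = 3 * j + 2 := by omega
      rcases this with rfl | rfl | rfl <;> simp [hvj]
  · intro s' _ _ h i
    have := i.2
    rw [h _ (by omega), h _ (by omega), h _ (by omega)]
    simp [bit]

/-- The state of the labelling when `k` nodes have been processed. -/
def LabelInv (ν : Fin N ≃ Node G) (R : Node G) (P : ℕ → ℕ) (k : ℕ) (L : Labelling G) : Prop :=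
  L R = ∅ ∧ (∀ x, P (ν.symm x) + k < N → L x = ∅) ∧
    ∀ x, x ≠ R → N ≤ P (ν.symm x) + k → L x = labelNode R L x

theorem TreeOrder.inj {O P Q : ℕ → ℕ} (h : TreeOrder ν R O P Q) {x y : Node G}
    (hxy : P (ν.symm x) = P (ν.symm y)) : x = y := by
  have : ((ν.symm x : Fin N) : ℕ) = ν.symm y := by rw [← (h.pos x).2, hxy, (h.pos y).2]
  simpa using Fin.ext this

/-- In the reverse search order children come before their parents. The labels of a processed node
depend on later positions only, so writing to `x` does not invalidate them, and the children of `x`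
are already final. -/
theorem LabelInv.step [DecidableEq (Node G)] (F : BlockFacts G) {O P Q : ℕ → ℕ}
    (h : TreeOrder ν R O P Q) {k : ℕ} {L : Labelling G} (hL : LabelInv ν R P k L) {x : Node G}
    (hx : P (ν.symm x) + k + 1 = N) :
    LabelInv ν R P (k + 1) (if x = R then L else Function.update L x (labelNode R L x)) := by
  obtain ⟨hL1, hL2, hL3⟩ := hL
  split_ifs with hxR
  · refine ⟨hL1, fun y hy => hL2 y (by omega), fun y hy hky => ?_⟩
    have : P (ν.symm y) ≠ P (ν.symm x) := fun h' => hy ((h.inj h').trans hxR)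
    exact hL3 y hy (by omega)
  · have hcong : ∀ y, P (ν.symm x) ≤ P (ν.symm y) →
        labelNode R (Function.update L x (labelNode R L x)) y = labelNode R L y := by
      intro y hy
      refine F.labelNode_congr fun c hc => Function.update_of_ne ?_ _ _
      rintro rfl
      have := h.lt _ _ hc
      omega
    refine ⟨?_, fun y hy => ?_, fun y hy hky => ?_⟩
    · rw [Function.update_of_ne (Ne.symm hxR), hL1]
    · have : y ≠ x := by rintro rfl; omega
      rw [Function.update_of_ne this, hL2 y (by omega)]
    · rw [hcong y (by omega)]
      by_cases hyx : y = x
      · subst hyx; simp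
      · have : P (ν.symm y) ≠ P (ν.symm x) := fun h' => hyx (h.inj h')
        rw [Function.update_of_ne hyx, hL3 y hy (by omega)]

theorem labelAll_spec (hB : Big W M) (hn1 : 1 ≤ n) (hN4 : N ≤ 4 * n)
    (hM : 4 * n * n ≤ M) (hM' : 12 * n ≤ M) (F : BlockFacts G) {s : State}
    (hT : HoldsRootedTree G ν R s) (hL : HoldsLabels ν (fun _ => ∅) s) {P Q : ℕ → ℕ}
    (hO : TreeOrder ν R (s.arr 10) P Q) :
    HaltsWithin W (80000 * n ^ 3) labelAll s fun s' =>
      ∃ L, IsRunLabelling R L ∧ HoldsLabels ν L s' := by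
  classical
  have h32 := hB.two
  have hnn : 1 ≤ n ^ 2 := Nat.one_le_pow _ _ hn1
  have hn3 : 1 ≤ n ^ 3 := Nat.one_le_pow _ _ hn1
  refine hw_for hB (K := N) (of_decide_eq_true rfl) (of_decide_eq_true rfl) (by omega) hT.1.2.1
    (by omega) (fun k s' => ∃ L, LabelInv ν R P k L ∧ HoldsLabels ν L s') (19020 * n ^ 2) ?_ ?_ ?_ ?_
  · refine ⟨fun _ => ∅, ⟨rfl, fun _ _ => rfl, fun x _ h => ?_⟩, hL⟩
    have := (hO.pos x).1
    omega
  · rintro k s' hk hf hvk ⟨L, hI, hLs⟩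
    have hT' := hT.frame hf (of_decide_eq_true rfl)
    have e10 : s'.arr 10 = s.arr 10 := hf.arr 10 (of_decide_eq_true rfl)
    have e1 : s'.var 1 = N := hT'.1.2.1
    obtain ⟨o1, o2⟩ := hO.ord (N - 1 - k) (by omega)
    obtain ⟨x, hx⟩ : ∃ x, ((ν.symm x : Fin N) : ℕ) = s.arr 10 (N - 1 - k) :=
      ⟨ν ⟨_, o1⟩, by simp⟩
    rw [← hx] at o1 o2
    have hstep := hI.step F hO (x := x) (by omega)
    refine hw_seq (T₁ := 7) (T₂ := 19010 * n ^ 2) (fun s'' => s'' = s'.setVar 15 (ν.symm x))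
      (hw_run (M := M) hB rfl (of_decide_eq_true rfl) (by simp [e1, hvk, e10, ← hx]; omega)
      (by simp [e1, hvk, e10, ← hx])) ?_ (by omega)
    rintro s₁ f₁ hs₁
    have hN₁ : HoldsNode ν R L x s₁ := ⟨hT'.frame f₁ (of_decide_eq_true rfl), by
      unfold HoldsLabels; rw [f₁.arr 5 (of_decide_eq_true rfl)]; exact hLs, by simp [hs₁]⟩
    have e2 : s₁.var 2 = ν.symm R := hN₁.1.2.1
    have hr := (ν.symm R).2
    refine hw_ite (M := M) (T' := 19000 * n ^ 2) hB (by simp [hN₁.2.2, e2]; omega)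
      (of_decide_eq_true rfl) (fun hb => ?_) (fun hb => ?_) (by change 3 + 1 + _ ≤ _; omega)
    · have hxR : x = R := by
        by_contra h
        have : ((ν.symm x : Fin N) : ℕ) ≠ ν.symm R := fun h' => h (by simpa using Fin.ext h')
        simp [hN₁.2.2, e2, this] at hb
      rw [if_pos hxR] at hstep
      exact hw_run (M := M) hB rfl (by simp only [Prog.tmax]; omega) (by simp)
        ⟨L, hstep, hN₁.2.1⟩
    · have hxR : x ≠ R := by
        rintro rfl
        simp [hN₁.2.2, e2] at hb
      rw [if_neg hxR] at hstep
      refine (labelStep_spec hB hn1 hN4 hM hM' F hxR (fun p hp => ?_) hN₁).mono le_rfl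
        fun s₂ f₂ h₂ => ⟨_, hstep, h₂⟩
      have := hO.lt p x hp
      exact hI.2.1 p (by omega)
  · rintro s' - - ⟨L, hI, hLs⟩
    exact ⟨L, ⟨hI.1, fun x hx => hI.2.2 x hx (by omega)⟩, hLs⟩
  -- At most `4 * n` nodes, each labelled in quadratic time.
  · calc N * (19020 * n ^ 2 + 8) + 6 ≤ 4 * n * (19028 * n ^ 2) + 6 := by gcongr; omega
      _ ≤ 80000 * n ^ 3 := by ring_nf; omega

theorem checkLabels_spec (hB : Big W M) (hN : 3 * N ≤ M) {s : State}
    (hT : HoldsRootedTree G ν R s) {L : Labelling G} (hL : HoldsLabels ν L s) :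
    HaltsWithin W (N * 50 + 8) checkLabels s fun s' =>
      s'.var 17 = bit (∀ x, x ≠ R → L x ≠ ∅) := by
  have h32 := hB.two
  refine hw_seq (T₁ := 2) (T₂ := N * 50 + 6) (fun s' => s' = s.setVar 17 1)
    (hw_run (M := M) hB rfl (of_decide_eq_true rfl) (by simp; omega) (by simp)) ?_ (by omega)
  rintro _ - rfl
  refine hw_for hB (K := N) (of_decide_eq_true rfl) (of_decide_eq_true rfl) (by omega)
    (by simpa using hT.1.2.1) (by omega)
    (fun k s' => s'.var 17 = bit (∀ i : Fin N, (i : ℕ) < k → ν i ≠ R → L (ν i) ≠ ∅)) 40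
    (by simp [bit]) ?_ ?_ (by omega)
  · intro k s' hk hf hvk hI
    lift k to Fin N using hk with i
    have hi := i.2
    have hr := (ν.symm R).2
    have e2 : s'.var 2 = ν.symm R := (hf.var 2 (of_decide_eq_true rfl)).trans (by simpa using hT.2.1)
    have e5 : s'.arr 5 = s.arr 5 := hf.arr 5 (of_decide_eq_true rfl)
    obtain ⟨l0, l1, l2⟩ := hL i
    have b0 := bit_le_one (Label.PI ∈ L (ν i))
    have b1 := bit_le_one (Label.PO ∈ L (ν i))
    have b2 := bit_le_one (Label.PE ∈ L (ν i))
    have hsucc : (∀ i' : Fin N, (i' : ℕ) < i + 1 → ν i' ≠ R → L (ν i') ≠ ∅) ↔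
        (∀ i' : Fin N, (i' : ℕ) < i → ν i' ≠ R → L (ν i') ≠ ∅) ∧ (ν i ≠ R → L (ν i) ≠ ∅) := by
      refine ⟨fun h => ⟨fun i' hi' => h i' (by omega), h i (by omega)⟩, fun ⟨h, h'⟩ i' hi' => ?_⟩
      by_cases hii : i' = i
      · subst hii; exact h'
      · have : (i' : ℕ) ≠ i := fun h => hii (Fin.ext h)
        exact h i' (by omega)
    refine hw_run (M := M) hB rfl (of_decide_eq_true rfl)
      (by simp [hvk, e2, e5, l0, l1, l2]; omega) ?_
    rw [bit_congr hsucc]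
    by_cases hiR : ν i = R
    · have : (i : ℕ) = ν.symm R := by rw [← hiR]; simp
      simp [hvk, e2, this, hiR]
      simpa [this] using hI
    · have hne : (i : ℕ) ≠ ν.symm R := fun h => hiR (by rw [Fin.ext h]; simp)
      have hemp : L (ν i) = ∅ ↔ Label.PI ∉ L (ν i) ∧ Label.PO ∉ L (ν i) ∧ Label.PE ∉ L (ν i) := by
        refine ⟨fun h => by simp [h], fun ⟨h1, h2, h3⟩ => ?_⟩
        ext l
        cases l <;> simp [h1, h2, h3]
      by_cases he : L (ν i) = ∅
      · simp [hvk, e2, e5, hne, l0, l1, l2, he, hiR]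
        simp [bit]
      · have hsum : bit (Label.PI ∈ L (ν i)) + bit (Label.PO ∈ L (ν i)) +
            bit (Label.PE ∈ L (ν i)) ≠ 0 := by
          intro h
          refine he (hemp.2 ⟨?_, ?_, ?_⟩) <;> refine bit_eq_zero_iff.1 (by omega)
        simp only [Prog.run, Expr.val, Op.eval, hvk, e2, e5, hne, if_false, State.setVar_var,
          l0, l1, l2, hsum, if_true]
        simpa [he] using hI
  · rintro s' - - h
    rw [h]
    refine bit_congr ⟨fun h x hx => ?_, fun h i _ => h (ν i)⟩
    have := h (ν.symm x) (Fin.is_lt _)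
    simp only [Equiv.apply_symm_apply] at this
    exact this hx

theorem decideOrdered_spec (hB : Big W M) (hn1 : 1 ≤ n) (hN4 : N ≤ 4 * n)
    (hM : 4 * n * n ≤ M) (hM' : 12 * n ≤ M) (F : BlockFacts G) (hR : R.IsComp) {s : State}
    (hT : HoldsRootedTree G ν R s) {P Q : ℕ → ℕ} (hO : TreeOrder ν R (s.arr 10) P Q) :
    HaltsWithin W (90000 * n ^ 3) decideOrdered s fun s' =>
      HoldsRootedTree G ν R s' ∧ HoldsVerdict ν R s' ∧ ∃ L, IsRunLabelling R L := by
  have h32 := hB.two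
  have hn3 : n ≤ n ^ 3 := Nat.le_self_pow (by omega) n
  have hn2 : n ^ 2 ≤ n ^ 3 := Nat.pow_le_pow_right hn1 (by omega)
  refine hw_seq (T₁ := N * 40 + 6) (T₂ := 89800 * n ^ 3) _
    (clearLabels_spec (ν := ν) hB (by omega) hT.1.2.1) ?_ (by omega)
  intro s₁ f₁ hL₁
  have hT₁ := hT.frame f₁ (of_decide_eq_true rfl)
  refine hw_seq (T₁ := 80000 * n ^ 3) (T₂ := 9800 * n ^ 3) _ (labelAll_spec hB hn1 hN4 hM hM' F hT₁
    hL₁ (P := P) (Q := Q) (by rwa [f₁.arr 10 (of_decide_eq_true rfl)])) ?_ (by omega)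
  rintro s₂ f₂ ⟨L, hrun, hL₂⟩
  have hT₂ := hT₁.frame f₂ (of_decide_eq_true rfl)
  refine hw_seq (T₁ := N * 50 + 8) (T₂ := 9500 * n ^ 3) _ (checkLabels_spec hB (by omega) hT₂ hL₂) ?_
    (by omega)
  intro s₃ f₃ h₃
  have hT₃ := hT₂.frame f₃ (of_decide_eq_true rfl)
  have e₃ : s₃.var 2 = ν.symm R := hT₃.2.1
  have hr := (ν.symm R).2
  refine hw_seq (T₁ := 4) (T₂ := 9490 * n ^ 3) (fun s' => s' = Prog.run (3 ≔ ♯2 ;; 4 ≔ 0) s₃)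
    (hw_run (M := M) hB rfl (of_decide_eq_true rfl) (by simp [e₃]; omega) rfl) ?_ (by omega)
  intro s₄ f₄ h₄
  have hT₄ := hT₃.frame f₄ (of_decide_eq_true rfl)
  have hlab : ∀ {p : Prog} {s' s'' : State}, HoldsLabels ν L s' → Frame p s' s'' → 5 ∉ p.warrs →
      HoldsLabels ν L s'' := by
    intro p s' s'' h f h5
    unfold HoldsLabels
    rw [f.arr 5 h5]
    exact h
  have hL₄ := hlab (hlab hL₂ f₃ (of_decide_eq_true rfl)) f₄ (of_decide_eq_true rfl)
  have v17 : s₄.var 17 = bit (∀ x, x ≠ R → L x ≠ ∅) := by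
    rw [f₄.var 17 (of_decide_eq_true rfl), h₃]
  refine hw_seq (T₁ := 6000 * n ^ 2) (T₂ := 5) _ (isSat_spec hB hn1 hN4 hM hM' F hT₄ hL₄ hR
    (flag := .none) ⟨by simp [h₄, e₃], by simp [h₄]⟩ (by simp)) ?_ (by omega)
  intro s₅ f₅ h₅
  have hT₅ := hT₄.frame f₅ (of_decide_eq_true rfl)
  have hL₅ := hlab hL₄ f₅ (of_decide_eq_true rfl)
  have b1 := bit_le_one (∀ x, x ≠ R → L x ≠ ∅)
  have b2 := bit_le_one (isSatisfiable R L R .none)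
  rw [Returns] at h₅
  have v17' : s₅.var 17 = bit (∀ x, x ≠ R → L x ≠ ∅) := by
    rw [f₅.var 17 (of_decide_eq_true rfl), v17]
  refine (hw_run (M := M) (T := 5) hB rfl (of_decide_eq_true rfl) (by
      simp only [Prog.Safe, Expr.Bdd, h₅, v17']; omega) (post := fun s' => s'.var 5 = s₅.var 5 * s₅.var 17) (by simp)).mono le_rfl ?_
  intro s₆ f₆ h₆
  refine ⟨hT₅.frame f₆ (of_decide_eq_true rfl), ⟨?_, fun L' hL' => ?_⟩, L, hrun⟩
  -- The verdict quantifies over labellings, but the labelling produced bottom-up is unique, so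
  -- testing the computed one suffices.
  · have : (∃ L, AcceptsWith R L) ↔ isSatisfiable R L R .none ∧ ∀ x, x ≠ R → L x ≠ ∅ := by
      constructor
      · rintro ⟨L', h1, h2, h3⟩
        rw [← F.runLabelling_unique h1 hrun]
        exact ⟨h3, h2⟩
      · exact fun h => ⟨L, hrun, h.2, h.1⟩
    rw [Returns, h₆, h₅, v17', bit_congr this]
    generalize isSatisfiable R L R .none = A
    generalize (∀ x, x ≠ R → L x ≠ ∅) = B
    by_cases hA : A <;> by_cases hB : B <;> simp [bit, hA, hB]
  · rw [F.runLabelling_unique hL'.1 hrun]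
    exact hlab hL₅ f₆ (of_decide_eq_true rfl)

theorem mainAlg_spec (hB : Big W M) (hn1 : 1 ≤ n) (hN4 : N ≤ 4 * n)
    (hM : 4 * n * n ≤ M) (hM' : 12 * n ≤ M) (F : BlockFacts G) (hR : R.IsComp) {s : State}
    (hT : HoldsRootedTree G ν R s) :
    HaltsWithin W (100000 * n ^ 3) mainAlg s fun s' =>
      HoldsRootedTree G ν R s' ∧ HoldsVerdict ν R s' := by
  have hn2 : n ^ 2 ≤ n ^ 3 := Nat.pow_le_pow_right hn1 (by omega)
  have hNN : N ^ 2 ≤ 16 * n ^ 2 := by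
    calc N ^ 2 ≤ (4 * n) ^ 2 := by gcongr
      _ = 16 * n ^ 2 := by ring
  refine hw_seq (T₁ := 200 * N ^ 2) (T₂ := 90000 * n ^ 3) _ (searchTree_spec hB (by omega) F hT.1
    hT.2.1) ?_ (by omega)
  intro s₁ f₁ hO
  exact (decideOrdered_spec hB hn1 hN4 hM hM' F hR (hT.frame f₁ (of_decide_eq_true rfl)) hO).mono
    le_rfl fun s' _ h => ⟨h.1, h.2.1⟩

end

end RMIS

/-! ### From the graph to the verdict -/

namespace RMIS

/-- Search for a component, leaving its number, or the number of nodes, in register 6. -/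
def findRoot : Prog := 6 ≔ ♯1 ;; .for 7 1 (.ite ((1 ↗ ♯7) =! 3) (6 ≔ ♯7) .skip)

/-- Decide whether there is a robust MIS. -/
def decideRobust : Prog :=
  buildTree ;; findRoot ;; .ite (♯6 <! ♯1)
    (2 ≔ ♯6 ;; search 3 1 2 ;; .for 14 1 (.store 4 ♯14 (13 ↗ ♯14)) ;; decideOrdered) (5 ≔ 1)

section

variable {W M n N : ℕ} {G : SimpleGraph (Fin n)} {ν : Fin N ≃ Node G}

theorem HoldsTree.frame {p : Prog} {s s' : State} (h : HoldsTree G ν s)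
    (f : Frame p s s') (hp : (∀ i ∈ [0, 1], i ∉ p.wvars) ∧ ∀ a ∈ [0, 1, 2, 3], a ∉ p.warrs) :
    HoldsTree G ν s' := by
  obtain ⟨hv, ha⟩ := hp
  simp only [List.mem_cons, List.not_mem_nil, or_false, forall_eq_or_imp, forall_eq] at hv ha
  unfold HoldsTree HoldsGraph
  rw [f.var 0 hv.1, f.var 1 hv.2, f.arr 0 ha.1, f.arr 1 ha.2.1, f.arr 2 ha.2.2.1, f.arr 3 ha.2.2.2]
  exact h

theorem Node.isComp_iff {V : Type} {G : SimpleGraph V} {x : Node G} : x.IsComp ↔ x.kind = 3 := by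
  cases x <;> simp [Node.IsComp, Node.kind]
  assumption

theorem findRoot_spec (hB : Big W M) (hN : N ≤ M) {s : State} (hT : HoldsTree G ν s) :
    HaltsWithin W (N * 20 + 8) findRoot s fun s' =>
      (s'.var 6 = N ∧ ¬ ∃ x : Node G, x.IsComp) ∨ ∃ i : Fin N, s'.var 6 = i ∧ (ν i).IsComp := by
  have h32 := hB.two
  have h1 : s.var 1 = N := hT.2.1
  refine hw_seq (T₁ := 2) (T₂ := N * 20 + 6) (fun s' => s' = s.setVar 6 N)
    (hw_run (M := M) hB rfl (of_decide_eq_true rfl) (by simp [h1]; omega) (by simp [h1])) ?_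
    (by omega)
  rintro _ - rfl
  refine hw_for hB (K := N) (of_decide_eq_true rfl) (of_decide_eq_true rfl) (by omega)
    (by simpa using h1) hN
    (fun k s' => (s'.var 6 = N ∧ ∀ i : Fin N, (i : ℕ) < k → ¬ (ν i).IsComp) ∨
      ∃ i : Fin N, s'.var 6 = i ∧ (ν i).IsComp) 12 (by simp) ?_ ?_ (by omega)
  · intro k s' hk hf hvk hI
    lift k to Fin N using hk with i
    have hi := i.2
    have e1 : s'.arr 1 i = (ν i).kind := by
      rw [hf.arr 1 (of_decide_eq_true rfl)]; exact hT.2.2.1 i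
    have hk3 : (ν i).kind ≤ 3 := by cases ν i <;> simp [Node.kind]
    refine hw_run (M := M) hB rfl (of_decide_eq_true rfl) (by simp [hvk, e1]; omega) ?_
    by_cases h : (ν i).kind = 3
    · right
      exact ⟨i, by simp [hvk, e1, h], Node.isComp_iff.2 h⟩
    · have : s'.var 6 = ((Prog.ite ((1 ↗ ♯7) =! 3) (6 ≔ ♯7) .skip).run s').var 6 := by
        simp [hvk, e1, h]
      simp only [State.setVar_var, show (6 : ℕ) ≠ 7 by omega, if_false, ← this]
      refine hI.imp_left fun ⟨h1, h2⟩ => ⟨h1, fun i' hi' => ?_⟩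
      by_cases hii : i' = i
      · subst hii; rwa [Node.isComp_iff]
      · have : (i' : ℕ) ≠ i := fun h => hii (Fin.ext h)
        exact h2 i' (by omega)
  · rintro s' - - h
    refine h.imp_left fun ⟨h1, h2⟩ => ⟨h1, ?_⟩
    rintro ⟨x, hx⟩
    exact h2 (ν.symm x) (Fin.is_lt _) (by simpa using hx)

theorem BlockFacts.card_nodes (F : BlockFacts G) (ν : Fin N ≃ Node G) : N ≤ 4 * n := by
  have := F.card_le
  rwa [← Nat.card_congr ν, Nat.card_fin, Nat.card_fin] at this

theorem decideRobust_spec (hB : Big W M) (hM : 4 * n * n ≤ M) (hM' : 12 * n ≤ M)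
    (hconn : G.Connected) {s : State} (hG : HoldsGraph G s) :
    HaltsWithin W (110000 * n ^ 3) decideRobust s fun s' =>
      Returns (∃ S, IsRobustMIS G S) s' ∧ ((∃ x : Node G, x.IsComp) →
        ∃ (N : ℕ) (ν : Fin N ≃ Node G) (R : Node G), R.IsComp ∧ HoldsRootedTree G ν R s' ∧
          HoldsVerdict ν R s') := by
  have h32 := hB.two
  obtain ⟨v₀⟩ := hconn.nonempty
  have hn1 : 1 ≤ n := by have := v₀.2; omega
  have hn3 : n ≤ n ^ 3 := Nat.le_self_pow (by omega) n
  have hn2 : n ^ 2 ≤ n ^ 3 := Nat.pow_le_pow_right hn1 (by omega)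
  refine hw_seq (T₁ := 8000 * n ^ 2) (T₂ := 100000 * n ^ 3) _ (buildTree_spec hB (by omega) hconn hG)
    ?_ (by omega)
  rintro s₁ f₁ ⟨F, N, ν, hT₁⟩
  have hN4 := F.card_nodes ν
  have hNN : N ^ 2 ≤ 16 * n ^ 2 := by
    calc N ^ 2 ≤ (4 * n) ^ 2 := by gcongr
      _ = 16 * n ^ 2 := by ring
  refine hw_seq (T₁ := N * 20 + 8) (T₂ := 99000 * n ^ 3) _ (findRoot_spec hB (by omega) hT₁) ?_
    (by omega)
  rintro s₂ f₂ h₂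
  have hT₂ := hT₁.frame f₂ (of_decide_eq_true rfl)
  have e1 : s₂.var 1 = N := hT₂.2.1
  have e6 : s₂.var 6 ≤ N := by
    rcases h₂ with h | ⟨i, h, -⟩
    · omega
    · have := i.2; omega
  refine hw_ite (M := M) (T' := 98000 * n ^ 3) hB (by simp [e1]; omega) (of_decide_eq_true rfl)
    (fun hb => ?_) (fun hb => ?_) (by change 3 + 1 + _ ≤ _; omega)
  · obtain ⟨i, hi, hR⟩ := h₂.resolve_left fun h => by simp [e1, h.1] at hb
    have hi2 := i.2
    refine hw_seq (T₁ := 2) (T₂ := 97000 * n ^ 3) (fun s' => s' = s₂.setVar 2 i)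
      (hw_run (M := M) hB rfl (of_decide_eq_true rfl) (by simp [hi]; omega) (by simp [hi])) ?_
      (by omega)
    rintro s₃ f₃ e₃
    have hT₃ := hT₂.frame f₃ (of_decide_eq_true rfl)
    refine hw_seq (T₁ := 200 * N ^ 2) (T₂ := 93000 * n ^ 3) _ (searchTree_spec (R := ν i) hB
      (by omega) F hT₃ (by simp [e₃])) ?_ (by omega)
    intro s₄ f₄ hO
    have hT₄ := hT₃.frame f₄ (of_decide_eq_true rfl)
    have e2 : s₄.var 2 = i := (f₄.var 2 (of_decide_eq_true rfl)).trans (by simp [e₃])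
    refine hw_seq (T₁ := N * 20 + 6) (T₂ := 90000 * n ^ 3) (fun s' => ∀ k, k < N →
      s'.arr 4 k = s₄.arr 13 k) ?_ ?_ (by omega)
    · refine hw_for hB (K := N) (of_decide_eq_true rfl) (of_decide_eq_true rfl) (by omega)
        hT₄.2.1 (by omega) (fun j s' => ∀ k, k < j → s'.arr 4 k = s₄.arr 13 k) 12 (by simp) ?_
        (fun s' _ _ h => h) (by omega)
      intro j s' hj hf hvj hI
      have e13 : s'.arr 13 = s₄.arr 13 := hf.arr 13 (of_decide_eq_true rfl)
      have := hO.pred_lt j hj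
      refine hw_run (M := M) hB rfl (of_decide_eq_true rfl) (by simp [hvj, e13]; omega)
        fun k hk => ?_
      by_cases h : k = j
      · subst h; simp [hvj, e13]
      · simp [hvj, h, hI k (by omega)]
    · intro s₅ f₅ h₅
      have hT₅ := hT₄.frame f₅ (of_decide_eq_true rfl)
      have hR₅ : HoldsRootedTree G ν (ν i) s₅ := by
        refine ⟨hT₅, ?_, fun k j hp => ?_⟩
        · rw [f₅.var 2 (of_decide_eq_true rfl), e2, Equiv.symm_apply_apply]
        · rw [h₅ k k.2, hO.pred k j hp]
      refine (decideOrdered_spec hB hn1 hN4 hM hM' F hR hR₅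
        (by rw [f₅.arr 10 (of_decide_eq_true rfl)]; exact hO)).mono le_rfl ?_
      rintro s₆ - ⟨hR₆, hV, L, hL⟩
      refine ⟨hV.1.trans (bit_congr ⟨?_, ?_⟩), fun _ => ⟨N, ν, ν i, hR, hR₆, hV⟩⟩
      · rintro ⟨L', hL'⟩
        exact F.robust_of_accepts hconn hR hL'
      · rintro ⟨S, hS⟩
        exact ⟨L, F.accepts_of_robust hR hS hL⟩
  -- Register 6 equals the number of nodes only if no component was found; then the answer is always
  -- yes.
  · have hno : ¬ ∃ x : Node G, x.IsComp := by
      rcases h₂ with h | ⟨i, h, -⟩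
      · exact h.2
      · have := i.2
        simp [e1, h] at hb
    refine hw_run (M := M) hB rfl (by change 2 ≤ _; omega) (by simp; omega) ⟨?_, fun h => absurd h hno⟩
    rw [Returns, bit_true (F.robust_of_no_comp hno)]
    simp

end

/-- The words are large enough. -/
theorem big_maxWord {n : ℕ} (hn : 1 ≤ n) : Big (maxWord 320 n) ((n + 2) ^ 5) ∧
    4 * n * n ≤ (n + 2) ^ 5 ∧ 12 * n ≤ (n + 2) ^ 5 := by
  have h : (n + 2) ^ 5 = n ^ 5 + 10 * n ^ 4 + 40 * n ^ 3 + 80 * n ^ 2 + 80 * n + 32 := by ring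
  -- The exponents fit because `320 = 5 * 64`; the fifth power of `n + 2` exceeds 32 and all sizes
  -- of tables.
  refine ⟨⟨by omega, by rw [maxWord, ← pow_mul]⟩, ?_, by omega⟩
  have : 4 * n * n = 4 * n ^ 2 := by ring
  omega

end RMIS

/-! ### The four claims -/

theorem mainTheorem5 :
    -- the ABC-tree can be built in `O(n ^ 2)` steps
    (∃ (buildTree : RMIS.Prog) (C c : ℕ), ∀ (n : ℕ) (G : SimpleGraph (Fin n)), G.Connected →
      ∀ s : RMIS.State, RMIS.HoldsGraph G s →
        RMIS.HaltsWithin (RMIS.maxWord c n) (C * n ^ 2) buildTree s fun s' =>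
          ∃ (N : ℕ) (ν : Fin N ≃ RMIS.Node G), RMIS.HoldsTree G ν s') ∧
    -- every call of `isSatisfiable` takes `O(n ^ 2)` steps
    (∃ (isSat : RMIS.Prog) (C c : ℕ), ∀ (n : ℕ) (G : SimpleGraph (Fin n)), G.Connected →
      ∀ (N : ℕ) (ν : Fin N ≃ RMIS.Node G) (R : RMIS.Node G) (L : RMIS.Labelling G)
        (x : RMIS.Node G) (flag : RMIS.Flag),
        R.IsComp → x.IsComp → (flag ≠ RMIS.Flag.none → x ≠ R) →
        ∀ s : RMIS.State, RMIS.HoldsRootedTree G ν R s → RMIS.HoldsLabels ν L s →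
          RMIS.HoldsCall ν x flag s →
          RMIS.HaltsWithin (RMIS.maxWord c n) (C * n ^ 2) isSat s fun s' =>
            RMIS.Returns (RMIS.isSatisfiable R L x flag) s' ∧
              RMIS.HoldsRootedTree G ν R s' ∧ RMIS.HoldsLabels ν L s') ∧
    -- the main algorithm, on the ABC-tree rooted in any component, takes `O(n ^ 3)` steps
    (∃ (mainAlg : RMIS.Prog) (C c : ℕ), ∀ (n : ℕ) (G : SimpleGraph (Fin n)), G.Connected →
      ∀ (N : ℕ) (ν : Fin N ≃ RMIS.Node G) (R : RMIS.Node G), R.IsComp →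
        ∀ s : RMIS.State, RMIS.HoldsRootedTree G ν R s →
          RMIS.HaltsWithin (RMIS.maxWord c n) (C * n ^ 3) mainAlg s fun s' =>
            RMIS.HoldsRootedTree G ν R s' ∧ RMIS.HoldsVerdict ν R s') ∧
    -- the whole algorithm, from the graph to the verdict, takes `O(n ^ 3)` steps
    (∃ (decide : RMIS.Prog) (C c : ℕ), ∀ (n : ℕ) (G : SimpleGraph (Fin n)), G.Connected →
      ∀ s : RMIS.State, RMIS.HoldsGraph G s →
        RMIS.HaltsWithin (RMIS.maxWord c n) (C * n ^ 3) decide s fun s' =>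
          RMIS.Returns (∃ S, RMIS.IsRobustMIS G S) s' ∧
            ((∃ x : RMIS.Node G, x.IsComp) →
              ∃ (N : ℕ) (ν : Fin N ≃ RMIS.Node G) (R : RMIS.Node G), R.IsComp ∧
                RMIS.HoldsRootedTree G ν R s' ∧ RMIS.HoldsVerdict ν R s')) := by
  have pos : ∀ {n : ℕ} {G : SimpleGraph (Fin n)}, G.Connected → 1 ≤ n := by
    intro n G h
    obtain ⟨v⟩ := h.nonempty
    have := v.2
    omega
  refine ⟨⟨RMIS.buildTree, 8000, 320, fun n G hG s hs => ?_⟩,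
    ⟨RMIS.isSat, 6000, 320, fun n G hG N ν R L x flag hR hx hxR s hT hL hC => ?_⟩,
    ⟨RMIS.mainAlg, 100000, 320, fun n G hG N ν R hR s hT => ?_⟩,
    ⟨RMIS.decideRobust, 110000, 320, fun n G hG s hs => ?_⟩⟩ <;>
    obtain ⟨hB, h1, h2⟩ := RMIS.big_maxWord (pos hG)
  · exact (RMIS.buildTree_spec hB (by omega) hG hs).mono le_rfl fun s' _ h => h.2
  · have F := RMIS.BlockFacts.of_connected hG
    refine (RMIS.isSat_spec hB (pos hG) (F.card_nodes ν) h1 h2 F hT hL hx hC hxR).mono le_rfl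
      fun s' f h => ⟨h, hT.frame f (of_decide_eq_true rfl), ?_⟩
    unfold RMIS.HoldsLabels
    rw [f.arr 5 (of_decide_eq_true rfl)]
    exact hL
  · have F := RMIS.BlockFacts.of_connected hG
    exact RMIS.mainAlg_spec hB (pos hG) (F.card_nodes ν) h1 h2 F hR hT
  · exact RMIS.decideRobust_spec hB h1 h2 hG hs
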